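/- Let $\Omega/K$ be a quadratic extension of number fields with rings of integers $\Lambda=\mathfrak o_\Omega$ and $\mathfrak o_K$, such that $\mathfrak o_K$ is a principal ideal domain and $\Lambda$ has class number $2$. Let $\overline{\,\cdot\,}$ be the nontrivial automorphism of $\Omega/K$, $M^*=\overline M^{\mathrm{tr}}$, $J=\begin{pmatrix}0&I_2\\-I_2&0\end{pmatrix}$. Let $\Delta=\Delta_2(\Lambda)$ be the monoid of all $M\in\mathrm{Mat}_4(\Lambda)$ with $M^*JM=mJ$ for some $m\in\mathfrak o_K\setminus\{0\}$ (the similitude of $M$), let $\Gamma=\mathrm{Sp}_2(\Lambda)$ be the group of those $M$ with $m\in\mathfrak o_K^\times$, and let $\mathcal H=\mathcal H(\Gamma,\Delta)$ be the integral Hecke algebra: the free $\mathbb Z$-module on the double cosets $\Gamma M\Gamma$, $M\in\Delta$, in which, for $\Gamma M\Gamma=\dot\bigcup_i\Gamma h_i$ and $\Gamma N\Gamma=\dot\bigcup_j\Gamma\tilde h_j$, the coefficient of $\Gamma X\Gamma$ in $\Gamma M\Gamma\cdot\Gamma N\Gamma$ is $\#\{(i,j):\Gamma h_i\tilde h_j=\Gamma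 X\}$. For a double coset $C=\Gamma M\Gamma$ let $\hat e(C)$ be the family, indexed by all nonzero prime ideals $\mathfrak P$ of $\Lambda$, of the pairs $(\hat e_{\mathfrak P}(M),l_{\mathfrak P})$, where $\hat e_{\mathfrak P}(M)=(\hat e_1\le\dots\le\hat e_4)$ are the valuations of the elementary divisors of $M$ over the completion $\Lambda_{\mathfrak P}$ and $l_{\mathfrak P}$ is the $\mathfrak P$-adic valuation of the similitude. A double coset $C\neq\Gamma$ is called indecomposable if $\hat e(C)=\hat e(N_1)+\hat e(N_2)$ with double cosets $N_1,N_2$ of $\Delta$ implies $N_1=\Gamma$ or $N_2=\Gamma$. 1. The map $C\mapsto\hat e(C)$ is a bijection from the set of indecomposable double cosets onto the following list. (Valuations at places not mentioned are $0$; $p$ is a prime element of $\mathfrak o_K$. If $p\Lambda=\mathfrak P\mathfrak P'$ splits, the tuple $(a_1,\dots,a_4)$ at $\mathfrak P$ with similitude $p^l$ means that the data are $((a_1,\dots,a_4),l)$ at $\mathfrak P$ and $((l-a_4,\dots,l-a_1),l)$ at $\mathfrak P'$; either prime may be called $\mathfrak P$.) * $p$ inert: $(0,0,1,1)$ with similitude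 $p$; $(0,1,1,2)$ and $(1,1,1,1)$ with similitude $p^2$. * $p\Lambda=\mathfrak P^2$ ramified: $(1,1,1,1)$ and $(0,0,2,2)$ with similitude $p$; moreover $(0,1,1,2)$ with similitude $p$ if $\mathfrak P$ is principal, and $(0,2,2,4)$ with similitude $p^2$ if $\mathfrak P$ is not principal. * $p\Lambda=\mathfrak P\mathfrak P'$ split into principal ideals: $(0,0,0,0),(0,0,0,1),(0,0,1,1),(0,1,1,1),(1,1,1,1)$ with similitude $p$. * $p\Lambda=\mathfrak P\mathfrak P'$ split into non-principal ideals: $(0,0,0,0),(0,0,1,1),(1,1,1,1)$ with similitude $p$, and $(0,1,1,2),(0,2,2,2),(0,0,0,2)$ with similitude $p^2$. * For non-associated primes $p_1,p_2$ of $\mathfrak o_K$, each of which is ramified or split with non-principal primes above it: the sums of one datum at $p_1$ and one datum at $p_2$ (similitude $p_1p_2$), where the datum at $p_i$ is $(0,1,1,2)$ with similitude $p_i$ if $p_i$ ramifies, and $(0,0,0,1)$ or $(0,1,1,1)$ with similitude $p_i$ if $p_i$ splits. 2. The indecomposable double cosets generate $\mathcal H$ as a (unital) $\mathbb Z$-algebra,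 and no proper subset of them generates $\mathcal H$. 3. $\mathcal H$ has no decomposition into primary components: if $\mathcal H_p$ denotes the subalgebra generated by the double cosets whose similitude is a power of $p$ up to units, then the subalgebras $\mathcal H_p$, $p$ running through all primes of $\mathfrak o_K$, do not generate $\mathcal H$. -/

import Mathlib

namespace HeckeAlgebra

open scoped Pointwise

/-- The set `H \ G` of right cosets `H g`. -/
abbrev RightCoset {G : Type*} [Group G] (H : Subgroup G) : Type _ :=
  Quotient (QuotientGroup.rightRel H)

/-- The right coset `H g`. -/
abbrev RightCoset.mk {G : Type*} [Group G] (H : Subgroup G) (g : G) : RightCoset H :=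
  Quotient.mk (QuotientGroup.rightRel H) g

theorem RightCoset.mk_eq {G : Type*} [Group G] {H : Subgroup G} {a b : G} :
    RightCoset.mk H a = RightCoset.mk H b ↔ b * a⁻¹ ∈ H := by
  unfold RightCoset.mk
  rw [Quotient.eq]
  exact QuotientGroup.rightRel_apply

/-- Right translation `(H x, g) ↦ H x g`. -/
def RightCoset.trans {G : Type*} [Group G] {H : Subgroup G} (q : RightCoset H) (g : G) :
    RightCoset H :=
  Quotient.lift (fun x => RightCoset.mk H (x * g)) (fun a b h => by
    have h' := QuotientGroup.rightRel_apply.1 h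
    rw [RightCoset.mk_eq]
    simpa [mul_assoc] using h') q

theorem RightCoset.trans_mk {G : Type*} [Group G] {H : Subgroup G} (x g : G) :
    (RightCoset.mk H x).trans g = RightCoset.mk H (x * g) := rfl

theorem RightCoset.trans_trans {G : Type*} [Group G] {H : Subgroup G} (q : RightCoset H)
    (g k : G) : (q.trans g).trans k = q.trans (g * k) := by
  induction q using Quotient.inductionOn with
  | h x => simp [RightCoset.trans, mul_assoc]

theorem RightCoset.trans_one {G : Type*} [Group G] {H : Subgroup G} (q : RightCoset H) :
    q.trans 1 = q := by
  induction q using Quotient.inductionOn with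
  | h x => simp [RightCoset.trans, RightCoset.mk]

theorem RightCoset.mk_out {G : Type*} [Group G] {H : Subgroup G} (q : RightCoset H) :
    RightCoset.mk H (Quotient.out q) = q := Quotient.out_eq q

/-- The set of right cosets `H g` contained in the double coset `C`. -/
def rightCosets {G : Type*} [Group G] {Δ : Submonoid G} {H : Subgroup G}
    (C : HeckeCoset Δ H H) : Set (RightCoset H) :=
  {q | ∃ g : Δ, HeckeCoset.mk H H g = C ∧ RightCoset.mk H (g : G) = q}

theorem mk_eq_mk_iff {G : Type*} [Group G] {Δ : Submonoid G} {H : Subgroup G} (a b : Δ) :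
    HeckeCoset.mk H H a = HeckeCoset.mk H H b ↔
      ∃ h ∈ H, ∃ k ∈ H, (b : G) = h * a * k := by
  exact (Quotient.eq (r := HeckeCoset.setoid Δ H H)).trans DoubleCoset.rel_iff

theorem mem_rightCosets_mk {G : Type*} [Group G] {Δ : Submonoid G} {H : Subgroup G}
    [IsHeckeTriple Δ H H] (a : Δ) (q : RightCoset H) :
    q ∈ rightCosets (HeckeCoset.mk H H a) ↔ ∃ k ∈ H, RightCoset.mk H ((a : G) * k) = q := by
  constructor
  · rintro ⟨g, hg, rfl⟩
    obtain ⟨h, hh, k, hk, e⟩ := (mk_eq_mk_iff a g).1 hg.symm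
    refine ⟨k, hk, ?_⟩
    rw [RightCoset.mk_eq, e]
    simpa [mul_assoc] using hh
  · rintro ⟨k, hk, rfl⟩
    refine ⟨⟨(a : G) * k, Δ.mul_mem a.2 (IsHeckeTriple.mem_of_mem_right (Δ := Δ) H hk)⟩, ?_, rfl⟩
    exact ((mk_eq_mk_iff _ _).2 ⟨1, H.one_mem, k, hk, by simp⟩).symm

theorem finite_rightCosets {G : Type*} [Group G] {Δ : Submonoid G} {H : Subgroup G}
    [IsHeckeTriple Δ H H] (C : HeckeCoset Δ H H) : (rightCosets C).Finite := by
  induction C using Quotient.inductionOn with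
  | h a =>
    change (rightCosets (HeckeCoset.mk H H a)).Finite
    have hc : (a : G)⁻¹ ∈ Subgroup.Commensurable.commensurator H :=
      inv_mem (IsHeckeTriple.mem_commensurator_right H a)
    rw [Subgroup.Commensurable.commensurator_mem_iff] at hc
    have hidx : ((ConjAct.toConjAct (a : G)⁻¹ • H).subgroupOf H).FiniteIndex := ⟨hc.1⟩
    have hfin : Finite (H ⧸ (ConjAct.toConjAct (a : G)⁻¹ • H).subgroupOf H) :=
      Subgroup.finite_quotient_of_finiteIndex
    let f : (H ⧸ (ConjAct.toConjAct (a : G)⁻¹ • H).subgroupOf H) → RightCoset H :=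
      Quotient.lift (fun h : H => RightCoset.mk H ((a : G) * (h : G)⁻¹)) (fun h k hk => by
        have h1 := QuotientGroup.leftRel_apply.1 hk
        rw [Subgroup.mem_subgroupOf, Subgroup.mem_pointwise_smul_iff_inv_smul_mem,
          ← ConjAct.toConjAct_inv, ConjAct.toConjAct_smul] at h1
        rw [RightCoset.mk_eq]
        have h2 := H.inv_mem h1
        simpa [mul_assoc] using h2)
    refine (Set.finite_range f).subset ?_
    intro q hq
    obtain ⟨k, hk, rfl⟩ := (mem_rightCosets_mk a q).1 hq
    refine ⟨Quotient.mk _ ⟨k⁻¹, H.inv_mem hk⟩, ?_⟩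
    change RightCoset.mk H ((a : G) * (k⁻¹)⁻¹) = _
    rw [inv_inv]

theorem trans_mem_rightCosets {G : Type*} [Group G] {Δ : Submonoid G} {H : Subgroup G}
    [IsHeckeTriple Δ H H] {C : HeckeCoset Δ H H} {q : RightCoset H} (hq : q ∈ rightCosets C)
    {h : G} (hh : h ∈ H) : q.trans h ∈ rightCosets C := by
  induction C using Quotient.inductionOn with
  | h a =>
    change q ∈ rightCosets (HeckeCoset.mk H H a) at hq
    change _ ∈ rightCosets (HeckeCoset.mk H H a)
    obtain ⟨k, hk, rfl⟩ := (mem_rightCosets_mk a q).1 hq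
    rw [mem_rightCosets_mk]
    exact ⟨k * h, H.mul_mem hk hh, by rw [RightCoset.trans_mk, mul_assoc]⟩

theorem mem_rightCosets_out {G : Type*} [Group G] {Δ : Submonoid G} {H : Subgroup G}
    (C : HeckeCoset Δ H H) : RightCoset.mk H ((Quotient.out C : Δ) : G) ∈ rightCosets C :=
  ⟨Quotient.out C, Quotient.out_eq C, rfl⟩

theorem out_mem_of_mem_rightCosets {G : Type*} [Group G] {Δ : Submonoid G} {H : Subgroup G}
    [IsHeckeTriple Δ H H] {C : HeckeCoset Δ H H} {q : RightCoset H} (hq : q ∈ rightCosets C) :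
    Quotient.out q ∈ Δ := by
  obtain ⟨g, -, hg⟩ := hq
  have h1 : RightCoset.mk H (g : G) = RightCoset.mk H (Quotient.out q) := by
    rw [RightCoset.mk_out, hg]
  rw [RightCoset.mk_eq] at h1
  have := Δ.mul_mem (IsHeckeTriple.mem_of_mem_right (Δ := Δ) H h1) g.2
  simpa using this

/-- The multiplicity of `E = H x H` in the product of the double cosets `C = ⨆ H cᵢ` and
`D = ⨆ H dⱼ`: the number of pairs `(i, j)` with `H cᵢ dⱼ = H x`. -/
noncomputable def structureConstant {G : Type*} [Group G] {Δ : Submonoid G} {H : Subgroup G}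
    (C D E : HeckeCoset Δ H H) : ℕ :=
  Set.ncard {x : RightCoset H × RightCoset H | x.1 ∈ rightCosets C ∧ x.2 ∈ rightCosets D ∧
    RightCoset.mk H (Quotient.out x.1 * Quotient.out x.2) =
      RightCoset.mk H ((Quotient.out E : Δ) : G)}

theorem finite_support_structureConstant {G : Type*} [Group G] {Δ : Submonoid G} {H : Subgroup G}
    [IsHeckeTriple Δ H H] (C D : HeckeCoset Δ H H) :
    (Function.support fun E : HeckeCoset Δ H H => (structureConstant C D E : ℤ)).Finite := by
  refine Set.Finite.of_finite_image (f := fun E : HeckeCoset Δ H H =>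
    RightCoset.mk H ((Quotient.out E : Δ) : G)) ?_ ?_
  · refine (((finite_rightCosets C).prod (finite_rightCosets D)).image
      (fun x : RightCoset H × RightCoset H => RightCoset.mk H
        (Quotient.out x.1 * Quotient.out x.2))).subset ?_
    rintro _ ⟨E, hE, rfl⟩
    have hE' : structureConstant C D E ≠ 0 := by simpa using hE
    obtain ⟨x, h1, h2, h3⟩ := Set.nonempty_of_ncard_ne_zero hE'
    exact ⟨x, ⟨h1, h2⟩, h3⟩
  · intro E _ F _ h
    have h' := RightCoset.mk_eq.1 h
    rw [← Quotient.out_eq E, ← Quotient.out_eq F]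
    exact (mk_eq_mk_iff _ _).2 ⟨_, h', 1, H.one_mem, by simp⟩

/-- The product of two double cosets. -/
noncomputable def cosetMul {G : Type*} [Group G] {Δ : Submonoid G} {H : Subgroup G}
    [IsHeckeTriple Δ H H] (C D : HeckeCoset Δ H H) : HeckeCoset Δ H H →₀ ℤ :=
  Finsupp.ofSupportFinite (fun E => (structureConstant C D E : ℤ))
    (finite_support_structureConstant C D)

/-- The bilinear extension of the product of double cosets. -/
noncomputable def heckeMul {G : Type*} [Group G] {Δ : Submonoid G} {H : Subgroup G}
    [IsHeckeTriple Δ H H] (f g : HeckeCoset Δ H H →₀ ℤ) : HeckeCoset Δ H H →₀ ℤ :=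
  f.sum fun C a => g.sum fun D b => (a * b) • cosetMul C D

/-! The ring axioms are transported from the faithful action on `ℤ[H \ G]`. -/

/-- Sum of the translates by `x` of the right cosets in `C`. -/
noncomputable def transSum {G : Type*} [Group G] {Δ : Submonoid G} {H : Subgroup G}
    [IsHeckeTriple Δ H H] (C : HeckeCoset Δ H H) (x : G) : RightCoset H →₀ ℤ :=
  ∑ p ∈ (finite_rightCosets C).toFinset, Finsupp.single (p.trans x) 1

theorem transSum_mul_left {G : Type*} [Group G] {Δ : Submonoid G} {H : Subgroup G}
    [IsHeckeTriple Δ H H] (C : HeckeCoset Δ H H) {h : G} (hh : h ∈ H) (x : G) :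
    transSum C (h * x) = transSum C x := by
  unfold transSum
  refine Finset.sum_bij' (fun p _ => p.trans h) (fun p _ => p.trans h⁻¹) ?_ ?_ ?_ ?_ ?_
  · intro p hp
    rw [Set.Finite.mem_toFinset] at hp ⊢
    exact trans_mem_rightCosets hp hh
  · intro p hp
    rw [Set.Finite.mem_toFinset] at hp ⊢
    exact trans_mem_rightCosets hp (H.inv_mem hh)
  · intro p _; rw [RightCoset.trans_trans, mul_inv_cancel, RightCoset.trans_one]
  · intro p _; rw [RightCoset.trans_trans, inv_mul_cancel, RightCoset.trans_one]
  · intro p _; rw [RightCoset.trans_trans]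

/-- The action of a double coset on `ℤ[H \ G]`. -/
noncomputable def cosetAct {G : Type*} [Group G] {Δ : Submonoid G} {H : Subgroup G}
    [IsHeckeTriple Δ H H] (C : HeckeCoset Δ H H) : Module.End ℤ (RightCoset H →₀ ℤ) :=
  Finsupp.linearCombination ℤ fun q : RightCoset H => transSum C (Quotient.out q)

theorem cosetAct_single_mk {G : Type*} [Group G] {Δ : Submonoid G} {H : Subgroup G}
    [IsHeckeTriple Δ H H] (C : HeckeCoset Δ H H) (x : G) :
    cosetAct C (Finsupp.single (RightCoset.mk H x) 1) = transSum C x := by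
  unfold cosetAct
  rw [Finsupp.linearCombination_single, one_smul]
  have h1 : RightCoset.mk H x = RightCoset.mk H (Quotient.out (RightCoset.mk H x)) := by
    rw [RightCoset.mk_out]
  rw [RightCoset.mk_eq] at h1
  have h2 := transSum_mul_left C h1 x
  rw [← h2]
  simp

/-- Right translation on `ℤ[H \ G]`. -/
noncomputable def transEnd {G : Type*} [Group G] (H : Subgroup G) (g : G) :
    Module.End ℤ (RightCoset H →₀ ℤ) :=
  Finsupp.lmapDomain ℤ ℤ fun q : RightCoset H => q.trans g

theorem transEnd_single {G : Type*} [Group G] (H : Subgroup G) (g : G) (q : RightCoset H) (a : ℤ) :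
    transEnd H g (Finsupp.single q a) = Finsupp.single (q.trans g) a := by
  simp [transEnd, Finsupp.mapDomain_single]

theorem cosetAct_transEnd {G : Type*} [Group G] {Δ : Submonoid G} {H : Subgroup G}
    [IsHeckeTriple Δ H H] (C : HeckeCoset Δ H H) (g : G) :
    cosetAct C * transEnd H g = transEnd H g * cosetAct C := by
  refine Finsupp.lhom_ext' fun q => LinearMap.ext_ring ?_
  rw [← RightCoset.mk_out q]
  simp only [LinearMap.comp_apply, Finsupp.lsingle_apply, Module.End.mul_apply, transEnd_single,
    RightCoset.trans_mk, cosetAct_single_mk]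
  simp only [transSum, map_sum, transEnd_single, RightCoset.trans_trans]

theorem transSum_one_apply {G : Type*} [Group G] {Δ : Submonoid G} {H : Subgroup G}
    [IsHeckeTriple Δ H H] [DecidableEq (HeckeCoset Δ H H)] (C : HeckeCoset Δ H H) (a : Δ) :
    transSum C 1 (RightCoset.mk H (a : G)) = if HeckeCoset.mk H H a = C then 1 else 0 := by
  classical
  unfold transSum
  simp only [RightCoset.trans_one, Finsupp.finsetSum_apply, Finsupp.single_apply,
    Finset.sum_ite_eq', Set.Finite.mem_toFinset]
  congr 1
  refine propext ⟨?_, fun h => ⟨a, h, rfl⟩⟩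
  rintro ⟨g, rfl, hg⟩
  exact (mk_eq_mk_iff _ _).2 ⟨_, RightCoset.mk_eq.1 hg.symm, 1, H.one_mem, by simp⟩

theorem transSum_one_apply_of_notMem {G : Type*} [Group G] {Δ : Submonoid G} {H : Subgroup G}
    [IsHeckeTriple Δ H H] (C : HeckeCoset Δ H H) {a : G} (ha : a ∉ Δ) :
    transSum C 1 (RightCoset.mk H a) = 0 := by
  classical
  unfold transSum
  simp only [RightCoset.trans_one, Finsupp.finsetSum_apply, Finsupp.single_apply,
    Finset.sum_ite_eq', Set.Finite.mem_toFinset]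
  rw [if_neg]
  rintro ⟨g, -, hg⟩
  have := Δ.mul_mem (IsHeckeTriple.mem_of_mem_right (Δ := Δ) H (RightCoset.mk_eq.1 hg)) g.2
  exact ha (by simpa using this)

/-- The linear action of the Hecke algebra on `ℤ[H \ G]`. -/
noncomputable def heckeAct {G : Type*} [Group G] (Δ : Submonoid G) (H : Subgroup G)
    [IsHeckeTriple Δ H H] :
    (HeckeCoset Δ H H →₀ ℤ) →ₗ[ℤ] Module.End ℤ (RightCoset H →₀ ℤ) :=
  Finsupp.linearCombination ℤ cosetAct

theorem heckeAct_apply_one {G : Type*} [Group G] {Δ : Submonoid G} {H : Subgroup G}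
    [IsHeckeTriple Δ H H] (f : HeckeCoset Δ H H →₀ ℤ) (a : Δ) :
    heckeAct Δ H f (Finsupp.single (RightCoset.mk H 1) 1) (RightCoset.mk H (a : G)) =
      f (HeckeCoset.mk H H a) := by
  classical
  induction f using Finsupp.induction_linear with
  | zero => simp
  | add f g hf hg => simp [hf, hg]
  | single C b =>
    simp only [heckeAct, Finsupp.linearCombination_single, LinearMap.smul_apply,
      cosetAct_single_mk, Finsupp.smul_apply, transSum_one_apply, Finsupp.single_apply,
      smul_eq_mul, mul_ite, mul_one, mul_zero, eq_comm]

theorem heckeAct_injective {G : Type*} [Group G] (Δ : Submonoid G) (H : Subgroup G)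
    [IsHeckeTriple Δ H H] : Function.Injective (heckeAct Δ H) := by
  intro f g hfg
  ext E
  induction E using Quotient.inductionOn with
  | h a =>
    change f (HeckeCoset.mk H H a) = g (HeckeCoset.mk H H a)
    rw [← heckeAct_apply_one, ← heckeAct_apply_one, hfg]

theorem structureConstant_eq {G : Type*} [Group G] {Δ : Submonoid G} {H : Subgroup G}
    [IsHeckeTriple Δ H H] (C D E : HeckeCoset Δ H H) :
    (structureConstant C D E : ℤ) =
      cosetAct C (transSum D 1) (RightCoset.mk H ((Quotient.out E : Δ) : G)) := by
  classical
  have h1 : cosetAct C (transSum D 1) = ∑ q ∈ (finite_rightCosets D).toFinset,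
      ∑ p ∈ (finite_rightCosets C).toFinset, Finsupp.single (p.trans (Quotient.out q)) (1 : ℤ) := by
    rw [transSum, map_sum]
    refine Finset.sum_congr rfl fun q _ => ?_
    have h := cosetAct_single_mk C (Quotient.out q)
    rw [RightCoset.mk_out] at h
    rw [RightCoset.trans_one, h, transSum]
  have h2 : ∀ p q : RightCoset H, p.trans (Quotient.out q) =
      RightCoset.mk H (Quotient.out p * Quotient.out q) := by
    intro p q
    rw [← RightCoset.trans_mk, RightCoset.mk_out]
  have h3 : {x : RightCoset H × RightCoset H | x.1 ∈ rightCosets C ∧ x.2 ∈ rightCosets D ∧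
      RightCoset.mk H (Quotient.out x.1 * Quotient.out x.2) =
        RightCoset.mk H ((Quotient.out E : Δ) : G)} =
      ((((finite_rightCosets C).toFinset ×ˢ (finite_rightCosets D).toFinset).filter fun x =>
        RightCoset.mk H (Quotient.out x.1 * Quotient.out x.2) =
          RightCoset.mk H ((Quotient.out E : Δ) : G) : Finset _) : Set _) := by
    ext x
    simp [and_assoc]
  rw [h1, structureConstant, h3, Set.ncard_coe_finset, Finset.card_filter, Finset.sum_product_right]
  simp only [Finsupp.finsetSum_apply, Finsupp.single_apply, h2]
  push_cast
  rfl

theorem structureConstant_eq_zero {G : Type*} [Group G] {Δ : Submonoid G} {H : Subgroup G}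
    [IsHeckeTriple Δ H H] (C D : HeckeCoset Δ H H) {x : G} (hx : x ∉ Δ) :
    cosetAct C (transSum D 1) (RightCoset.mk H x) = 0 := by
  classical
  have h1 : cosetAct C (transSum D 1) = ∑ q ∈ (finite_rightCosets D).toFinset,
      ∑ p ∈ (finite_rightCosets C).toFinset, Finsupp.single (p.trans (Quotient.out q)) (1 : ℤ) := by
    rw [transSum, map_sum]
    refine Finset.sum_congr rfl fun q _ => ?_
    have h := cosetAct_single_mk C (Quotient.out q)
    rw [RightCoset.mk_out] at h
    rw [RightCoset.trans_one, h, transSum]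
  rw [h1]
  simp only [Finsupp.finsetSum_apply]
  refine Finset.sum_eq_zero fun q hq => Finset.sum_eq_zero fun p hp => ?_
  rw [Finsupp.single_apply, if_neg]
  intro h
  rw [Set.Finite.mem_toFinset] at hp hq
  have h4 : RightCoset.mk H (Quotient.out p * Quotient.out q) = RightCoset.mk H x := by
    rw [← RightCoset.trans_mk, RightCoset.mk_out, h]
  have h5 := Δ.mul_mem (IsHeckeTriple.mem_of_mem_right (Δ := Δ) H (RightCoset.mk_eq.1 h4))
    (Δ.mul_mem (out_mem_of_mem_rightCosets hp) (out_mem_of_mem_rightCosets hq))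
  exact hx (by rwa [inv_mul_cancel_right] at h5)

theorem transEnd_cosetAct_transSum {G : Type*} [Group G] {Δ : Submonoid G} {H : Subgroup G}
    [IsHeckeTriple Δ H H] (C D : HeckeCoset Δ H H) (x : G) :
    transEnd H x (cosetAct C (transSum D 1)) = cosetAct C (transSum D x) := by
  have h := LinearMap.congr_fun (cosetAct_transEnd C x) (transSum D 1)
  simp only [Module.End.mul_apply] at h
  rw [← h]
  congr 1
  simp [transSum, transEnd_single, RightCoset.trans_one]

theorem heckeAct_cosetMul_one {G : Type*} [Group G] {Δ : Submonoid G} {H : Subgroup G}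
    [IsHeckeTriple Δ H H] (C D : HeckeCoset Δ H H) :
    heckeAct Δ H (cosetMul C D) (Finsupp.single (RightCoset.mk H 1) 1) =
      cosetAct C (transSum D 1) := by
  ext q
  rw [← RightCoset.mk_out q]
  by_cases hx : Quotient.out q ∈ Δ
  · have h1 := heckeAct_apply_one (cosetMul C D) ⟨Quotient.out q, hx⟩
    refine h1.trans ?_
    change (structureConstant C D _ : ℤ) = _
    rw [structureConstant_eq]
    set E := HeckeCoset.mk H H (⟨Quotient.out q, hx⟩ : Δ) with hE
    obtain ⟨h, hh, k, hk, e⟩ := (mk_eq_mk_iff (⟨Quotient.out q, hx⟩ : Δ) (Quotient.out E)).1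
      (Quotient.out_eq E).symm
    have h2 : RightCoset.mk H ((Quotient.out E : Δ) : G) =
        (RightCoset.mk H (Quotient.out q)).trans k := by
      rw [RightCoset.trans_mk, RightCoset.mk_eq, e]
      simpa [mul_assoc] using hh
    have h3 : cosetAct C (transSum D 1) = transEnd H k (cosetAct C (transSum D 1)) := by
      rw [transEnd_cosetAct_transSum]
      congr 1
      have := transSum_mul_left D hk 1
      rw [mul_one] at this
      exact this.symm
    rw [h2, h3, transEnd, Finsupp.lmapDomain_apply, Finsupp.mapDomain_apply]
    · rw [← Finsupp.lmapDomain_apply ℤ ℤ]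
      exact congrArg (fun f => f (RightCoset.mk H (Quotient.out q))) h3
    · intro p p' hp
      have := congrArg (fun r => RightCoset.trans r k⁻¹) hp
      simpa [RightCoset.trans_trans, RightCoset.trans_one] using this
  · rw [structureConstant_eq_zero C D hx]
    generalize cosetMul C D = f
    induction f using Finsupp.induction_linear with
    | zero => simp
    | add f g hf hg => rw [map_add, LinearMap.add_apply, Finsupp.add_apply, hf, hg, add_zero]
    | single C b =>
      rw [heckeAct, Finsupp.linearCombination_single, LinearMap.smul_apply, cosetAct_single_mk,
        Finsupp.smul_apply, transSum_one_apply_of_notMem C hx, smul_zero]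

theorem heckeAct_transEnd {G : Type*} [Group G] {Δ : Submonoid G} {H : Subgroup G}
    [IsHeckeTriple Δ H H] (f : HeckeCoset Δ H H →₀ ℤ) (g : G) :
    heckeAct Δ H f * transEnd H g = transEnd H g * heckeAct Δ H f := by
  induction f using Finsupp.induction_linear with
  | zero => simp
  | add f g hf hg => simp [add_mul, mul_add, hf, hg]
  | single C b =>
    rw [heckeAct, Finsupp.linearCombination_single, smul_mul_assoc, mul_smul_comm,
      cosetAct_transEnd]

theorem heckeAct_cosetMul {G : Type*} [Group G] {Δ : Submonoid G} {H : Subgroup G}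
    [IsHeckeTriple Δ H H] (C D : HeckeCoset Δ H H) :
    heckeAct Δ H (cosetMul C D) = cosetAct C * cosetAct D := by
  refine Finsupp.lhom_ext' fun q => LinearMap.ext_ring ?_
  rw [← RightCoset.mk_out q]
  set x := Quotient.out q
  simp only [LinearMap.comp_apply, Finsupp.lsingle_apply, Module.End.mul_apply]
  have h1 : (Finsupp.single (RightCoset.mk H x) 1 : RightCoset H →₀ ℤ) =
      transEnd H x (Finsupp.single (RightCoset.mk H 1) 1) := by
    rw [transEnd_single, RightCoset.trans_mk, one_mul]
  have h2 := LinearMap.congr_fun (heckeAct_transEnd (cosetMul C D) x)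
    (Finsupp.single (RightCoset.mk H 1) 1)
  simp only [Module.End.mul_apply] at h2
  rw [cosetAct_single_mk, h1, h2, heckeAct_cosetMul_one, transEnd_cosetAct_transSum]

theorem heckeAct_mul {G : Type*} [Group G] {Δ : Submonoid G} {H : Subgroup G}
    [IsHeckeTriple Δ H H] (f g : HeckeCoset Δ H H →₀ ℤ) :
    heckeAct Δ H (heckeMul f g) = heckeAct Δ H f * heckeAct Δ H g := by
  have h : heckeAct Δ H (heckeMul f g) =
      f.sum fun C a => g.sum fun D b => (a • cosetAct C) * (b • cosetAct D) := by
    simp only [heckeMul, Finsupp.sum, map_sum, map_smul, heckeAct_cosetMul]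
    refine Finset.sum_congr rfl fun C _ => Finset.sum_congr rfl fun D _ => ?_
    rw [smul_mul_assoc, mul_smul_comm, smul_smul]
  rw [h, heckeAct, Finsupp.linearCombination_apply, Finsupp.linearCombination_apply]
  simp only [Finsupp.sum, Finset.sum_mul, Finset.mul_sum]
  exact Finset.sum_comm

theorem heckeAct_one {G : Type*} [Group G] (Δ : Submonoid G) (H : Subgroup G)
    [IsHeckeTriple Δ H H] :
    heckeAct Δ H (Finsupp.single 1 1) = 1 := by
  refine Finsupp.lhom_ext' fun q => LinearMap.ext_ring ?_
  rw [← RightCoset.mk_out q]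
  set x := Quotient.out q
  simp only [LinearMap.comp_apply, Finsupp.lsingle_apply, Module.End.one_apply, heckeAct,
    Finsupp.linearCombination_single, one_smul, cosetAct_single_mk]
  have h : (finite_rightCosets (1 : HeckeCoset Δ H H)).toFinset = {RightCoset.mk H 1} := by
    ext q
    rw [Set.Finite.mem_toFinset, HeckeCoset.one_def, mem_rightCosets_mk, Finset.mem_singleton]
    constructor
    · rintro ⟨k, hk, rfl⟩
      rw [RightCoset.mk_eq]
      simpa using hk
    · rintro rfl
      exact ⟨1, H.one_mem, by simp⟩
  rw [transSum, h, Finset.sum_singleton, RightCoset.trans_mk, one_mul]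

theorem heckeMul_assoc {G : Type*} [Group G] {Δ : Submonoid G} {H : Subgroup G}
    [IsHeckeTriple Δ H H] (f g k : HeckeCoset Δ H H →₀ ℤ) :
    heckeMul (heckeMul f g) k = heckeMul f (heckeMul g k) := by
  apply heckeAct_injective Δ H
  simp only [heckeAct_mul, mul_assoc]

theorem heckeMul_add {G : Type*} [Group G] {Δ : Submonoid G} {H : Subgroup G}
    [IsHeckeTriple Δ H H] (f g k : HeckeCoset Δ H H →₀ ℤ) :
    heckeMul f (g + k) = heckeMul f g + heckeMul f k := by
  apply heckeAct_injective Δ H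
  simp only [heckeAct_mul, map_add, mul_add]

theorem add_heckeMul {G : Type*} [Group G] {Δ : Submonoid G} {H : Subgroup G}
    [IsHeckeTriple Δ H H] (f g k : HeckeCoset Δ H H →₀ ℤ) :
    heckeMul (f + g) k = heckeMul f k + heckeMul g k := by
  apply heckeAct_injective Δ H
  simp only [heckeAct_mul, map_add, add_mul]

theorem heckeMul_zero {G : Type*} [Group G] {Δ : Submonoid G} {H : Subgroup G}
    [IsHeckeTriple Δ H H] (f : HeckeCoset Δ H H →₀ ℤ) :
    heckeMul f 0 = 0 := by
  apply heckeAct_injective Δ H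
  simp only [heckeAct_mul, map_zero, mul_zero]

theorem zero_heckeMul {G : Type*} [Group G] {Δ : Submonoid G} {H : Subgroup G}
    [IsHeckeTriple Δ H H] (f : HeckeCoset Δ H H →₀ ℤ) :
    heckeMul 0 f = 0 := by
  apply heckeAct_injective Δ H
  simp only [heckeAct_mul, map_zero, zero_mul]

theorem heckeMul_one {G : Type*} [Group G] {Δ : Submonoid G} {H : Subgroup G}
    [IsHeckeTriple Δ H H] (f : HeckeCoset Δ H H →₀ ℤ) :
    heckeMul f (Finsupp.single 1 1) = f := by
  apply heckeAct_injective Δ H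
  rw [heckeAct_mul, heckeAct_one, mul_one]

theorem one_heckeMul {G : Type*} [Group G] {Δ : Submonoid G} {H : Subgroup G}
    [IsHeckeTriple Δ H H] (f : HeckeCoset Δ H H →₀ ℤ) :
    heckeMul (Finsupp.single 1 1) f = f := by
  apply heckeAct_injective Δ H
  rw [heckeAct_mul, heckeAct_one, one_mul]

noncomputable instance instMulHeckeRing {G : Type*} [Group G] {Δ : Submonoid G} {H : Subgroup G}
    [IsHeckeTriple Δ H H] : Mul (HeckeRing Δ H ℤ) :=
  ⟨fun f g => HeckeCosetModule.of
    (heckeMul (HeckeCosetModule.of.symm f) (HeckeCosetModule.of.symm g))⟩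

noncomputable instance instOneHeckeRing {G : Type*} [Group G] {Δ : Submonoid G} {H : Subgroup G}
    [IsHeckeTriple Δ H H] : One (HeckeRing Δ H ℤ) :=
  ⟨HeckeCosetModule.of (Finsupp.single 1 1)⟩

/-- The Hecke algebra `𝓗(H, Δ)`: the free `ℤ`-module on the double cosets `H g H`, `g ∈ Δ`, with
the product of double cosets extended bilinearly. -/
noncomputable instance instRingHeckeRing {G : Type*} [Group G] {Δ : Submonoid G} {H : Subgroup G}
    [IsHeckeTriple Δ H H] : Ring (HeckeRing Δ H ℤ) :=
  { (inferInstance : AddCommGroup (HeckeRing Δ H ℤ)), instMulHeckeRing, instOneHeckeRing with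
    left_distrib := heckeMul_add
    right_distrib := add_heckeMul
    zero_mul := zero_heckeMul
    mul_zero := heckeMul_zero
    mul_assoc := heckeMul_assoc
    one_mul := one_heckeMul
    mul_one := heckeMul_one }

/-- The double coset `C` as an element of the Hecke algebra. -/
noncomputable def basisElement {G : Type*} [Group G] {Δ : Submonoid G} {H : Subgroup G}
    (C : HeckeCoset Δ H H) : HeckeRing Δ H ℤ :=
  HeckeCosetModule.of (Finsupp.single C 1)

/-! ### The hermitian modular group -/

open Matrix NumberField IsDedekindDomain

/-- The matrix `J`. -/
def symplecticJ (n : ℕ) (R : Type*) [CommRing R] : Matrix (Fin n ⊕ Fin n) (Fin n ⊕ Fin n) R :=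
  Matrix.fromBlocks 0 1 (-1) 0

/-- `M* = (σ M)ᵗʳ`, where `σ` is the Galois conjugation of `Ω` over `K`. -/
def conjTr {K Ω : Type*} [Field K] [Field Ω] [Algebra K Ω] (σ : Ω ≃ₐ[K] Ω) {n : ℕ}
    (M : Matrix (Fin n ⊕ Fin n) (Fin n ⊕ Fin n) Ω) : Matrix (Fin n ⊕ Fin n) (Fin n ⊕ Fin n) Ω :=
  (M.map σ)ᵀ

/-- `M` has similitude `m`: `M* J M = m J`. -/
def HasSimilitude {K Ω : Type*} [Field K] [Field Ω] [Algebra K Ω] (σ : Ω ≃ₐ[K] Ω) {n : ℕ}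
    (M : Matrix (Fin n ⊕ Fin n) (Fin n ⊕ Fin n) Ω) (m : K) : Prop :=
  conjTr σ M * symplecticJ n Ω * M = m • symplecticJ n Ω

/-- The entries of `M` lie in the ring of integers. -/
def IsIntegralMatrix {Ω : Type*} [Field Ω] {n : ℕ}
    (M : Matrix (Fin n ⊕ Fin n) (Fin n ⊕ Fin n) Ω) : Prop :=
  ∀ i j, IsIntegral ℤ (M i j)

theorem conjTr_mul {K Ω : Type*} [Field K] [Field Ω] [Algebra K Ω] (σ : Ω ≃ₐ[K] Ω) {n : ℕ}
    (M N : Matrix (Fin n ⊕ Fin n) (Fin n ⊕ Fin n) Ω) :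
    conjTr σ (M * N) = conjTr σ N * conjTr σ M := by
  unfold conjTr
  rw [← Matrix.transpose_mul]
  congr 1
  exact Matrix.map_mul (f := (σ : Ω →+* Ω))

theorem conjTr_one {K Ω : Type*} [Field K] [Field Ω] [Algebra K Ω] (σ : Ω ≃ₐ[K] Ω) {n : ℕ} :
    conjTr σ (1 : Matrix (Fin n ⊕ Fin n) (Fin n ⊕ Fin n) Ω) = 1 := by
  unfold conjTr
  rw [Matrix.map_one _ (map_zero σ) (map_one σ), Matrix.transpose_one]

theorem HasSimilitude.one {K Ω : Type*} [Field K] [Field Ω] [Algebra K Ω] (σ : Ω ≃ₐ[K] Ω)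
    (n : ℕ) : HasSimilitude σ (1 : Matrix (Fin n ⊕ Fin n) (Fin n ⊕ Fin n) Ω) (1 : K) := by
  simp [HasSimilitude, conjTr_one]

theorem HasSimilitude.mul {K Ω : Type*} [Field K] [Field Ω] [Algebra K Ω] {σ : Ω ≃ₐ[K] Ω}
    {n : ℕ} {M N : Matrix (Fin n ⊕ Fin n) (Fin n ⊕ Fin n) Ω} {m k : K}
    (hM : HasSimilitude σ M m) (hN : HasSimilitude σ N k) : HasSimilitude σ (M * N) (m * k) := by
  unfold HasSimilitude at *
  calc conjTr σ (M * N) * symplecticJ n Ω * (M * N)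
      = conjTr σ N * (conjTr σ M * symplecticJ n Ω * M) * N := by
        rw [conjTr_mul]; simp only [Matrix.mul_assoc]
    _ = (m * k) • symplecticJ n Ω := by
        rw [hM, Matrix.mul_smul, Matrix.smul_mul, hN, smul_smul]

theorem symplecticJ_mul_neg (n : ℕ) (R : Type*) [CommRing R] :
    -symplecticJ n R * symplecticJ n R = 1 := by
  simp [symplecticJ, Matrix.fromBlocks_multiply, Matrix.fromBlocks_neg]

theorem HasSimilitude.inv {K Ω : Type*} [Field K] [Field Ω] [Algebra K Ω] {σ : Ω ≃ₐ[K] Ω}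
    {n : ℕ} {g : GL (Fin n ⊕ Fin n) Ω} {m : K} (hm : m ≠ 0)
    (hg : HasSimilitude σ (g : Matrix (Fin n ⊕ Fin n) (Fin n ⊕ Fin n) Ω) m) :
    HasSimilitude σ ((g⁻¹ : GL (Fin n ⊕ Fin n) Ω) : Matrix (Fin n ⊕ Fin n) (Fin n ⊕ Fin n) Ω)
      m⁻¹ := by
  have h1 : (g : Matrix (Fin n ⊕ Fin n) (Fin n ⊕ Fin n) Ω) *
      ((g⁻¹ : GL (Fin n ⊕ Fin n) Ω) : Matrix (Fin n ⊕ Fin n) (Fin n ⊕ Fin n) Ω) = 1 := by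
    rw [← Units.val_mul, mul_inv_cancel, Units.val_one]
  set A : Matrix (Fin n ⊕ Fin n) (Fin n ⊕ Fin n) Ω := g.1
  set B : Matrix (Fin n ⊕ Fin n) (Fin n ⊕ Fin n) Ω :=
    (g⁻¹ : GL (Fin n ⊕ Fin n) Ω).1
  unfold HasSimilitude at *
  have h2 : conjTr σ B * conjTr σ A = 1 := by rw [← conjTr_mul, h1, conjTr_one]
  have h3 : conjTr σ B * (conjTr σ A * symplecticJ n Ω * A) * B = symplecticJ n Ω := by
    calc _ = (conjTr σ B * conjTr σ A) * symplecticJ n Ω * (A * B) := by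
            simp only [Matrix.mul_assoc]
      _ = _ := by rw [h1, h2, Matrix.one_mul, Matrix.mul_one]
  rw [hg, Matrix.mul_smul, Matrix.smul_mul] at h3
  rw [← h3, smul_smul, inv_mul_cancel₀ hm, one_smul, h3]

theorem HasSimilitude.inv_eq {K Ω : Type*} [Field K] [Field Ω] [Algebra K Ω] {σ : Ω ≃ₐ[K] Ω}
    {n : ℕ} {g : GL (Fin n ⊕ Fin n) Ω} {m : K} (hm : m ≠ 0)
    (hg : HasSimilitude σ (g : Matrix (Fin n ⊕ Fin n) (Fin n ⊕ Fin n) Ω) m) :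
    ((g⁻¹ : GL (Fin n ⊕ Fin n) Ω) : Matrix (Fin n ⊕ Fin n) (Fin n ⊕ Fin n) Ω) =
      m⁻¹ • (-symplecticJ n Ω * conjTr σ (g : Matrix (Fin n ⊕ Fin n) (Fin n ⊕ Fin n) Ω) *
        symplecticJ n Ω) := by
  rw [Matrix.coe_units_inv]
  refine Matrix.inv_eq_left_inv ?_
  unfold HasSimilitude at hg
  rw [Matrix.smul_mul, Matrix.mul_assoc, Matrix.mul_assoc, ← Matrix.mul_assoc (conjTr σ _), hg,
    Matrix.mul_smul, symplecticJ_mul_neg, smul_smul, inv_mul_cancel₀ hm, one_smul]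

theorem IsIntegralMatrix.mul {Ω : Type*} [Field Ω] {n : ℕ}
    {M N : Matrix (Fin n ⊕ Fin n) (Fin n ⊕ Fin n) Ω} (hM : IsIntegralMatrix M)
    (hN : IsIntegralMatrix N) : IsIntegralMatrix (M * N) := fun i j => by
  rw [Matrix.mul_apply]
  exact IsIntegral.sum _ fun k _ => (hM i k).mul (hN k j)

theorem IsIntegralMatrix.one {Ω : Type*} [Field Ω] {n : ℕ} :
    IsIntegralMatrix (1 : Matrix (Fin n ⊕ Fin n) (Fin n ⊕ Fin n) Ω) := fun i j => by
  rw [Matrix.one_apply]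
  split_ifs
  · exact isIntegral_one
  · exact isIntegral_zero

theorem IsIntegralMatrix.neg {Ω : Type*} [Field Ω] {n : ℕ}
    {M : Matrix (Fin n ⊕ Fin n) (Fin n ⊕ Fin n) Ω} (hM : IsIntegralMatrix M) :
    IsIntegralMatrix (-M) := fun i j => (hM i j).neg

theorem isIntegralMatrix_symplecticJ (n : ℕ) (Ω : Type*) [Field Ω] :
    IsIntegralMatrix (symplecticJ n Ω) := by
  rintro (i | i) (j | j) <;> simp only [symplecticJ, Matrix.fromBlocks_apply₁₁,
    Matrix.fromBlocks_apply₁₂, Matrix.fromBlocks_apply₂₁, Matrix.fromBlocks_apply₂₂,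
    Matrix.zero_apply, Matrix.neg_apply, Matrix.one_apply] <;> (try split_ifs) <;>
    simp [isIntegral_zero, isIntegral_one]

theorem IsIntegralMatrix.conjTr {K Ω : Type*} [Field K] [Field Ω] [Algebra K Ω] (σ : Ω ≃ₐ[K] Ω)
    {n : ℕ} {M : Matrix (Fin n ⊕ Fin n) (Fin n ⊕ Fin n) Ω} (hM : IsIntegralMatrix M) :
    IsIntegralMatrix (conjTr σ M) := fun i j =>
  (hM j i).map (σ : Ω →+* Ω).toIntAlgHom

/-- The monoid `Δₙ(Λ)`, `Λ` the ring of integers of `Ω`: integral matrices whose similitude is a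
nonzero integer of `K`. -/
def similitudeMonoid {K Ω : Type*} [Field K] [Field Ω] [Algebra K Ω] (n : ℕ) (σ : Ω ≃ₐ[K] Ω) :
    Submonoid (GL (Fin n ⊕ Fin n) Ω) where
  carrier := {g | IsIntegralMatrix (g : Matrix (Fin n ⊕ Fin n) (Fin n ⊕ Fin n) Ω) ∧
    ∃ m : 𝓞 K, m ≠ 0 ∧
      HasSimilitude σ (g : Matrix (Fin n ⊕ Fin n) (Fin n ⊕ Fin n) Ω) (m : K)}
  one_mem' := ⟨IsIntegralMatrix.one, 1, one_ne_zero, HasSimilitude.one σ n⟩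
  mul_mem' := by
    rintro g h ⟨hg, m, hm, hgm⟩ ⟨hh, k, hk, hhk⟩
    exact ⟨hg.mul hh, m * k, mul_ne_zero hm hk, by simpa using hgm.mul hhk⟩

/-- The modular group `Spₙ(Λ)`: integral matrices whose similitude is a unit of the ring of
integers of `K`. -/
def modularGroup {K Ω : Type*} [Field K] [Field Ω] [Algebra K Ω] (n : ℕ) (σ : Ω ≃ₐ[K] Ω) :
    Subgroup (GL (Fin n ⊕ Fin n) Ω) where
  carrier := {g | IsIntegralMatrix (g : Matrix (Fin n ⊕ Fin n) (Fin n ⊕ Fin n) Ω) ∧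
    ∃ u : (𝓞 K)ˣ,
      HasSimilitude σ (g : Matrix (Fin n ⊕ Fin n) (Fin n ⊕ Fin n) Ω) ((u : 𝓞 K) : K)}
  one_mem' := ⟨IsIntegralMatrix.one, 1, by simpa using HasSimilitude.one σ n⟩
  mul_mem' := by
    rintro g h ⟨hg, m, hgm⟩ ⟨hh, k, hhk⟩
    exact ⟨hg.mul hh, m * k, by simpa using hgm.mul hhk⟩
  inv_mem' := by
    rintro g ⟨hg, u, hu⟩
    have hne : ((u : 𝓞 K) : K) ≠ 0 := by simp
    have hinv : (((u : 𝓞 K) : K))⁻¹ = ((↑u⁻¹ : 𝓞 K) : K) := by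
      refine inv_eq_of_mul_eq_one_right ?_
      rw [← map_mul, Units.mul_inv, map_one]
    refine ⟨?_, u⁻¹, ?_⟩
    · rw [hu.inv_eq hne, hinv]
      intro i j
      rw [Matrix.smul_apply, Algebra.smul_def]
      refine IsIntegral.mul ?_ ((((isIntegralMatrix_symplecticJ n Ω).neg.mul
        (hg.conjTr σ)).mul (isIntegralMatrix_symplecticJ n Ω)) i j)
      exact (RingOfIntegers.isIntegral_coe _).map ((algebraMap K Ω).toIntAlgHom)
    · rw [← hinv]
      exact hu.inv hne

theorem exists_denominator {Ω : Type*} [Field Ω] [NumberField Ω] {n : ℕ}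
    (M : Matrix (Fin n ⊕ Fin n) (Fin n ⊕ Fin n) Ω) :
    ∃ a : 𝓞 Ω, a ≠ 0 ∧ IsIntegralMatrix ((a : Ω) • M) := by
  obtain ⟨b, hb⟩ := IsLocalization.exist_integer_multiples_of_finite (nonZeroDivisors (𝓞 Ω))
    (fun x : (Fin n ⊕ Fin n) × (Fin n ⊕ Fin n) => M x.1 x.2)
  refine ⟨b, nonZeroDivisors.coe_ne_zero b, fun i j => ?_⟩
  obtain ⟨c, hc⟩ := hb (i, j)
  rw [Matrix.smul_apply, smul_eq_mul]
  have h : ((b : 𝓞 Ω) : Ω) * M i j = (c : Ω) :=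
    (hc.trans (Algebra.smul_def (b : 𝓞 Ω) (M i j))).symm
  rw [h]
  exact RingOfIntegers.isIntegral_coe c

theorem relIndex_modularGroup_ne_zero {K Ω : Type*} [Field K] [Field Ω] [NumberField Ω]
    [Algebra K Ω] {n : ℕ} (σ : Ω ≃ₐ[K] Ω) (g : GL (Fin n ⊕ Fin n) Ω) {m : K} (hm : m ≠ 0)
    (hg : HasSimilitude σ (g : Matrix (Fin n ⊕ Fin n) (Fin n ⊕ Fin n) Ω) m) :
    (ConjAct.toConjAct g • modularGroup n σ).relIndex (modularGroup n σ) ≠ 0 := by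
  obtain ⟨a, ha, hag⟩ := exists_denominator
    (g : Matrix (Fin n ⊕ Fin n) (Fin n ⊕ Fin n) Ω)
  obtain ⟨b, hb, hbg⟩ := exists_denominator
    ((g⁻¹ : GL (Fin n ⊕ Fin n) Ω) : Matrix (Fin n ⊕ Fin n) (Fin n ⊕ Fin n) Ω)
  have hne : Ideal.span {b * a} ≠ (⊥ : Ideal (𝓞 Ω)) := by
    rw [Ne, Ideal.span_singleton_eq_bot]
    exact mul_ne_zero hb ha
  have hfin : Finite (𝓞 Ω ⧸ Ideal.span {b * a}) := Ideal.finiteQuotientOfFreeOfNeBot _ hne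
  let Y : modularGroup n σ → (Fin n ⊕ Fin n) → (Fin n ⊕ Fin n) → 𝓞 Ω := fun γ i j =>
    ⟨(γ : GL (Fin n ⊕ Fin n) Ω).1 i j, γ.2.1 i j⟩
  have hY : ∀ γ i j, algebraMap (𝓞 Ω) Ω (Y γ i j) = (γ : GL (Fin n ⊕ Fin n) Ω).1 i j :=
    fun _ _ _ => rfl
  let f : modularGroup n σ → Matrix (Fin n ⊕ Fin n) (Fin n ⊕ Fin n)
      (𝓞 Ω ⧸ Ideal.span {b * a}) := fun γ => Matrix.of fun i j =>
    Ideal.Quotient.mk _ (Y γ i j)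
  have key : ∀ x y : modularGroup n σ, f x = f y →
      x⁻¹ * y ∈ (ConjAct.toConjAct g • modularGroup n σ).subgroupOf (modularGroup n σ) := by
    intro x y hxy
    rw [Subgroup.mem_subgroupOf, Subgroup.mem_pointwise_smul_iff_inv_smul_mem,
      ← ConjAct.toConjAct_inv, ConjAct.toConjAct_smul, inv_inv]
    have hX : ∃ X : Matrix (Fin n ⊕ Fin n) (Fin n ⊕ Fin n) Ω, IsIntegralMatrix X ∧
        (y : GL (Fin n ⊕ Fin n) Ω).1 = (x : GL (Fin n ⊕ Fin n) Ω).1 +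
          ((b : Ω) * (a : Ω)) • X := by
      have h : ∀ i j, ∃ c : 𝓞 Ω, (y : GL (Fin n ⊕ Fin n) Ω).1 i j =
          (x : GL (Fin n ⊕ Fin n) Ω).1 i j + ((b : Ω) * (a : Ω)) * (c : Ω) := by
        intro i j
        have h1 := congrFun (congrFun hxy.symm i) j
        simp only [f, Matrix.of_apply] at h1
        rw [Ideal.Quotient.eq, Ideal.mem_span_singleton] at h1
        obtain ⟨c, hc⟩ := h1
        refine ⟨c, ?_⟩
        have h2 := congrArg (algebraMap (𝓞 Ω) Ω) hc
        rw [map_sub, map_mul, map_mul, hY, hY] at h2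
        rw [← h2]
        ring
      choose c hc using h
      exact ⟨Matrix.of fun i j => (c i j : Ω), fun i j => RingOfIntegers.isIntegral_coe _,
        Matrix.ext fun i j => by simp [hc i j]⟩
    obtain ⟨X, hX, hy⟩ := hX
    refine ⟨?_, ?_⟩
    · have hx : (x⁻¹ : modularGroup n σ).1.1 * x.1.1 = 1 := by
        rw [← Units.val_mul, ← Subgroup.coe_mul, inv_mul_cancel]
        rfl
      have hgg : (g⁻¹ : GL (Fin n ⊕ Fin n) Ω).1 * g.1 = 1 := by
        rw [← Units.val_mul, inv_mul_cancel, Units.val_one]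
      have h1 : (g⁻¹ * ((x⁻¹ * y : modularGroup n σ) : GL (Fin n ⊕ Fin n) Ω) * g).1 =
          1 + ((b : Ω) • (g⁻¹ : GL (Fin n ⊕ Fin n) Ω).1) * (x⁻¹ : modularGroup n σ).1.1 * X *
            ((a : Ω) • g.1) := by
        rw [Subgroup.coe_mul, Units.val_mul, Units.val_mul, Units.val_mul, hy, Matrix.mul_add, hx,
          Matrix.mul_add, Matrix.add_mul, Matrix.mul_one, hgg]
        simp only [Matrix.mul_smul, Matrix.smul_mul, smul_smul, Matrix.mul_assoc]
        rw [mul_comm (b : Ω)]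
      have h2 := ((hbg.mul (x⁻¹).2.1).mul hX).mul hag
      rw [h1]
      intro i j
      exact (IsIntegralMatrix.one i j).add (h2 i j)
    · obtain ⟨u, hu⟩ := (x⁻¹ * y).2.2
      refine ⟨u, ?_⟩
      have h := ((hg.inv hm).mul hu).mul hg
      rw [mul_comm (m⁻¹), inv_mul_cancel_right₀ hm] at h
      exact h
  have hq : Finite (modularGroup n σ ⧸
      (ConjAct.toConjAct g • modularGroup n σ).subgroupOf (modularGroup n σ)) := by
    refine Finite.of_injective (fun q => f (Quotient.out q)) ?_
    intro p q hpq
    rw [← Quotient.out_eq p, ← Quotient.out_eq q]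
    exact Quotient.sound (QuotientGroup.leftRel_apply.2 (key _ _ hpq))
  exact (Subgroup.finiteIndex_of_finite_quotient (H := (ConjAct.toConjAct g •
    modularGroup n σ).subgroupOf (modularGroup n σ))).index_ne_zero

instance instIsHeckeTriple {K Ω : Type*} [Field K] [Field Ω] [NumberField Ω] [Algebra K Ω]
    (n : ℕ) (σ : Ω ≃ₐ[K] Ω) :
    IsHeckeTriple (similitudeMonoid n σ) (modularGroup n σ) (modularGroup n σ) := by
  refine IsHeckeTriple.of_diagonal ?_ ?_
  · rintro g ⟨hg, u, hu⟩
    exact ⟨hg, u, u.ne_zero, hu⟩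
  · rintro g ⟨-, m, hm, hgm⟩
    have hm' : (m : K) ≠ 0 := by simpa using hm
    change Subgroup.Commensurable _ _
    refine ⟨relIndex_modularGroup_ne_zero σ g hm' hgm, ?_⟩
    have h := relIndex_modularGroup_ne_zero σ g⁻¹ (inv_ne_zero hm') (hgm.inv hm')
    rw [← Subgroup.relIndex_pointwise_smul (ConjAct.toConjAct g), smul_smul,
      ConjAct.toConjAct_inv, mul_inv_cancel, one_smul] at h
    exact h

/-- The Hecke algebra `𝓗(Spₙ(Λ), Δₙ(Λ))`. -/
abbrev HermitianHecke {K Ω : Type*} [Field K] [Field Ω] [Algebra K Ω] (n : ℕ) (σ : Ω ≃ₐ[K] Ω) :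
    Type _ :=
  HeckeRing (similitudeMonoid n σ) (modularGroup n σ) ℤ

/-- The double cosets of `Spₙ(Λ)` in `Δₙ(Λ)`. -/
abbrev HermitianCoset {K Ω : Type*} [Field K] [Field Ω] [Algebra K Ω] (n : ℕ) (σ : Ω ≃ₐ[K] Ω) :
    Type _ :=
  HeckeCoset (similitudeMonoid n σ) (modularGroup n σ) (modularGroup n σ)

/-! ### Elementary divisors and indecomposable double cosets -/

/-- The elementary divisors of `M` over the completion `Λ_P` have the valuations
`e 0 ≤ e 1 ≤ ⋯`: up to multiplication by invertible matrices over `Λ_P` on both sides, `M` is the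
diagonal matrix with entries `ϖ ^ e i`, where `ϖ` is a uniformizer of `Λ_P`. -/
def HasElementaryDivisors {Ω : Type*} [Field Ω] [NumberField Ω] (P : HeightOneSpectrum (𝓞 Ω))
    {n : ℕ} (M : Matrix (Fin n ⊕ Fin n) (Fin n ⊕ Fin n) Ω) (e : Fin (n + n) → ℕ) : Prop :=
  Monotone e ∧
    ∃ (ϖ : P.adicCompletionIntegers Ω) (U V : GL (Fin n ⊕ Fin n) (P.adicCompletionIntegers Ω)),
      Irreducible ϖ ∧
      M.map (algebraMap Ω (P.adicCompletion Ω)) =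
        ((U : Matrix (Fin n ⊕ Fin n) (Fin n ⊕ Fin n) (P.adicCompletionIntegers Ω)) *
          Matrix.diagonal (fun i => ϖ ^ e (finSumFinEquiv i)) *
          (V : Matrix (Fin n ⊕ Fin n) (Fin n ⊕ Fin n) (P.adicCompletionIntegers Ω))).map
            (algebraMap (P.adicCompletionIntegers Ω) (P.adicCompletion Ω))

open Classical in
/-- The valuations `ê_P(M)` of the elementary divisors of `M` over `Λ_P`. (They exist and are unique
for `M` integral and invertible over `Ω`.) -/
noncomputable def elementaryDivisors {Ω : Type*} [Field Ω] [NumberField Ω]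
    (P : HeightOneSpectrum (𝓞 Ω)) {n : ℕ} (M : Matrix (Fin n ⊕ Fin n) (Fin n ⊕ Fin n) Ω) :
    Fin (n + n) → ℕ :=
  if h : ∃ e, HasElementaryDivisors P M e then h.choose else 0

/-- The similitude of an element of `Δₙ(Λ)`. -/
noncomputable def similitude {K Ω : Type*} [Field K] [Field Ω] [Algebra K Ω] {n : ℕ}
    {σ : Ω ≃ₐ[K] Ω} (g : similitudeMonoid n σ) : 𝓞 K :=
  g.2.2.choose

/-- For every finite place of `Ω`, a tuple of valuations of elementary divisors and the valuation of
a similitude. -/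
abbrev DivisorData (n : ℕ) (Ω : Type*) [Field Ω] : Type _ :=
  HeightOneSpectrum (𝓞 Ω) → (Fin (n + n) → ℕ) × ℕ

/-- The data `ê(C)` of a double coset `C`, computed on a representative: for every finite place `P`
of `Ω` the valuations at `P` of the elementary divisors and of the similitude. -/
noncomputable def divisorData {K Ω : Type*} [Field K] [Field Ω] [NumberField Ω] [Algebra K Ω]
    {n : ℕ} {σ : Ω ≃ₐ[K] Ω} (C : HermitianCoset n σ) : DivisorData n Ω := fun P =>
  (elementaryDivisors P ((Quotient.out C : similitudeMonoid n σ) : GL (Fin n ⊕ Fin n) Ω).1,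
    multiplicity P.asIdeal
      (Ideal.span {algebraMap (𝓞 K) (𝓞 Ω) (similitude (Quotient.out C))}))

/-- A nontrivial double coset `C` is indecomposable if `ê(C) = ê(N₁) + ê(N₂)` for double cosets
`N₁`, `N₂` over `Λ` only if one of them is trivial. -/
def Indecomposable {K Ω : Type*} [Field K] [Field Ω] [NumberField Ω] [Algebra K Ω]
    {n : ℕ} {σ : Ω ≃ₐ[K] Ω} (C : HermitianCoset n σ) : Prop :=
  C ≠ 1 ∧ ∀ N₁ N₂ : HermitianCoset n σ,
    divisorData C = divisorData N₁ + divisorData N₂ → N₁ = 1 ∨ N₂ = 1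

/-- The primary component at the prime `p` of `K`: the subalgebra generated by the double cosets
whose similitude is, up to units, a power of `p`. -/
noncomputable def primaryComponent {K Ω : Type*} [Field K] [Field Ω] [NumberField Ω] [Algebra K Ω]
    (n : ℕ) (σ : Ω ≃ₐ[K] Ω) (p : HeightOneSpectrum (𝓞 K)) : Subalgebra ℤ (HermitianHecke n σ) :=
  Algebra.adjoin ℤ (basisElement '' {C : HermitianCoset n σ |
    ∃ k : ℕ, Ideal.span {similitude (Quotient.out C)} = p.asIdeal ^ k})

/-! ### The explicit list for `n = 2` -/

/-- `p` is inert in `Ω`, and `P` is the prime above it. -/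
def IsInert {K Ω : Type*} [Field K] [Field Ω] [Algebra K Ω] (p : HeightOneSpectrum (𝓞 K))
    (P : HeightOneSpectrum (𝓞 Ω)) : Prop :=
  p.asIdeal.map (algebraMap (𝓞 K) (𝓞 Ω)) = P.asIdeal

/-- `p` is ramified in `Ω`, and `P` is the prime above it. -/
def IsRamified {K Ω : Type*} [Field K] [Field Ω] [Algebra K Ω] (p : HeightOneSpectrum (𝓞 K))
    (P : HeightOneSpectrum (𝓞 Ω)) : Prop :=
  p.asIdeal.map (algebraMap (𝓞 K) (𝓞 Ω)) = P.asIdeal ^ 2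

/-- `p` splits in `Ω` into the distinct primes `P` and `P'`. -/
def IsSplit {K Ω : Type*} [Field K] [Field Ω] [Algebra K Ω] (p : HeightOneSpectrum (𝓞 K))
    (P P' : HeightOneSpectrum (𝓞 Ω)) : Prop :=
  P ≠ P' ∧ p.asIdeal.map (algebraMap (𝓞 K) (𝓞 Ω)) = P.asIdeal * P'.asIdeal

open Classical in
/-- The data with the tuple `a` and the similitude valuation `l` at `P` and trivial elsewhere. -/
noncomputable def dataAt {Ω : Type*} [Field Ω] (P : HeightOneSpectrum (𝓞 Ω)) (a : Fin 4 → ℕ)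
    (l : ℕ) : DivisorData 2 Ω :=
  Pi.single P (a, l)

/-- The data at a pair `P`, `P'` of conjugate places with the tuple `a` at `P` and similitude
valuation `l`; the elementary divisors at `P'` are determined by `M_{P'} = m J⁻¹ (M_P⁻¹)* J`. -/
noncomputable def splitDataAt {Ω : Type*} [Field Ω] (P P' : HeightOneSpectrum (𝓞 Ω))
    (a : Fin 4 → ℕ) (l : ℕ) : DivisorData 2 Ω :=
  dataAt P a l + dataAt P' (fun i => l - a i.rev) l

/-- The local factors at `p` of the indecomposable double cosets with similitude `p₁ p₂`. -/
inductive NonprincipalFactor {K Ω : Type*} [Field K] [Field Ω] [Algebra K Ω]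
    (p : HeightOneSpectrum (𝓞 K)) : DivisorData 2 Ω → Prop
  | ramified (P : HeightOneSpectrum (𝓞 Ω)) (h : IsRamified p P)
      (hP : ¬ P.asIdeal.IsPrincipal) : NonprincipalFactor p (dataAt P ![0, 1, 1, 2] 2)
  | split_one (P P' : HeightOneSpectrum (𝓞 Ω)) (h : IsSplit p P P')
      (hP : ¬ P.asIdeal.IsPrincipal) : NonprincipalFactor p (splitDataAt P P' ![0, 0, 0, 1] 1)
  | split_three (P P' : HeightOneSpectrum (𝓞 Ω)) (h : IsSplit p P P')
      (hP : ¬ P.asIdeal.IsPrincipal) : NonprincipalFactor p (splitDataAt P P' ![0, 1, 1, 1] 1)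

/-- The list of the data of the indecomposable double cosets. -/
inductive Listed (K : Type*) {Ω : Type*} [Field K] [Field Ω] [Algebra K Ω] :
    DivisorData 2 Ω → Prop
  | inert (p : HeightOneSpectrum (𝓞 K)) (P : HeightOneSpectrum (𝓞 Ω)) (h : IsInert p P)
      (a : Fin 4 → ℕ) (l : ℕ)
      (ha : (a, l) = (![0, 0, 1, 1], 1) ∨ (a, l) = (![0, 1, 1, 2], 2) ∨
        (a, l) = (![1, 1, 1, 1], 2)) :
      Listed K (dataAt P a l)
  | ramified (p : HeightOneSpectrum (𝓞 K)) (P : HeightOneSpectrum (𝓞 Ω)) (h : IsRamified p P)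
      (a : Fin 4 → ℕ) (ha : a = ![1, 1, 1, 1] ∨ a = ![0, 0, 2, 2]) :
      Listed K (dataAt P a 2)
  | ramified_principal (p : HeightOneSpectrum (𝓞 K)) (P : HeightOneSpectrum (𝓞 Ω))
      (h : IsRamified p P) (hP : P.asIdeal.IsPrincipal) :
      Listed K (dataAt P ![0, 1, 1, 2] 2)
  | ramified_nonprincipal (p : HeightOneSpectrum (𝓞 K)) (P : HeightOneSpectrum (𝓞 Ω))
      (h : IsRamified p P) (hP : ¬ P.asIdeal.IsPrincipal) :
      Listed K (dataAt P ![0, 2, 2, 4] 4)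
  | split_principal (p : HeightOneSpectrum (𝓞 K)) (P P' : HeightOneSpectrum (𝓞 Ω))
      (h : IsSplit p P P') (hP : P.asIdeal.IsPrincipal) (a : Fin 4 → ℕ)
      (ha : a = ![0, 0, 0, 0] ∨ a = ![0, 0, 0, 1] ∨ a = ![0, 0, 1, 1] ∨ a = ![0, 1, 1, 1] ∨
        a = ![1, 1, 1, 1]) :
      Listed K (splitDataAt P P' a 1)
  | split_nonprincipal (p : HeightOneSpectrum (𝓞 K)) (P P' : HeightOneSpectrum (𝓞 Ω))
      (h : IsSplit p P P') (hP : ¬ P.asIdeal.IsPrincipal) (a : Fin 4 → ℕ)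
      (ha : a = ![0, 0, 0, 0] ∨ a = ![0, 0, 1, 1] ∨ a = ![1, 1, 1, 1]) :
      Listed K (splitDataAt P P' a 1)
  | split_nonprincipal_sq (p : HeightOneSpectrum (𝓞 K)) (P P' : HeightOneSpectrum (𝓞 Ω))
      (h : IsSplit p P P') (hP : ¬ P.asIdeal.IsPrincipal) (a : Fin 4 → ℕ)
      (ha : a = ![0, 1, 1, 2] ∨ a = ![0, 2, 2, 2] ∨ a = ![0, 0, 0, 2]) :
      Listed K (splitDataAt P P' a 2)
  | product (p₁ p₂ : HeightOneSpectrum (𝓞 K)) (hp : p₁ ≠ p₂) (d₁ d₂ : DivisorData 2 Ω)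
      (h₁ : NonprincipalFactor p₁ d₁) (h₂ : NonprincipalFactor p₂ d₂) :
      Listed K (d₁ + d₂)

end HeckeAlgebra

/-!
# Indecomposable elements of a Hecke algebra for class number two

The double cosets are classified by triples of ideals. To `C = Γ M Γ` belong the ideal `A` of the
entries of `M`, the ideal `A² B` of its minors of order two, and an ideal `D` of `𝓞 K` such that the
similitude generates `D · N(A B)`, where `N` is the relative norm. The map `C ↦ (A, B, D)` is a
bijection onto the triples of nonzero ideals whose second component is principal.

*Injectivity* (`coset_ext`). Localizing at `1 + c 𝓞 K` for a multiple `c` of the similitude gives a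
semilocal ring, over which an elementary divisor theorem holds for similitudes (`exists_simDiag`):
`M` is brought to a diagonal matrix by products of elementary matrices, and these can be
approximated modulo `c` by elements of `Γ`. Two matrices with the same ideals and the same
similitude thus differ by a diagonal matrix of semilocal units. The upper left block of this matrix
has determinant a global unit times an element of `K`, because the ideal of minors is principal
(`exists_minorIdeal_eq_span`: a semilocal generator generates the ideal of minors up to an ideal
prime to `c`; comparison with its conjugate by means of the determinant shows that this factor is
fixed by the conjugation, and it therefore comes from `K`). Such a diagonal matrix is again
congruent to an element of `Γ`, and congruence modulo the similitude is enough to return to `Γ`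
itself (`mem_modularGroup_of_congr`).

*Surjectivity* (`IsValid.exists_coset`). A normal form is written down explicitly; since the class
number is two, `A²` is principal. As the ideal of minors is principal, so is `B` for every double
coset.

The data of elementary divisors at all primes are additive functions of the triple and determine it
(`divisorData_eq`, `dataOf_mul`, `dataOf_injective`). Hence a double coset is indecomposable if and
only if its triple is an atom (`indecomposable_iff`). The atoms are `(P, 1, 1)`, `(1, 1, p)`,
`(1, P, 1)` with `P` principal and `(1, P Q, 1)` with `P` and `Q` not principal; their data, sorted
by the decomposition of the primes below, are the list in question.

For the algebra, the product of two double cosets has a leading term: the double coset whose triple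
is the product of the triples occurs with coefficient one (`structureConstant_leading`), and the
ideals of entries and of minors of all others are contained in those of the leading one, not both
being equal (`cosetSize_leading_lt`).
Factorization of triples into atoms and induction then show that the indecomposable double cosets
generate (`adjoin_eq_top_of_leading`). The algebra is commutative, by transposition. None of the
generators can be omitted (`notMem_adjoin_of_leading`): the similitude of an indecomposable double
coset divides a product of two primes, and in such degrees a product of two nontrivial double cosets
is determined by its leading term, which is decomposable, so that no combination of products cancels
down to indecomposable double cosets. The same argument applies to `(1, P Q, 1)` with nonprincipal
`P` and `Q` over different primes of `K`: no double coset with a prime power as similitude has the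
same degree, so it does not lie in the algebra generated by the primary components.
-/

set_option linter.unusedSectionVars false

namespace HeckeAlgebra

/-! ### Structure constants and commutativity of a Hecke algebra -/

section Abstract

variable {G : Type*} [Group G] {Δ : Submonoid G} {H : Subgroup G}

/-- The right cosets `H k` of right factors in the factorizations `x = g k` with `g` in the double
coset `C` and `k` in the double coset `D`. -/
def factorSet (C D : HeckeCoset Δ H H) (x : G) : Set (RightCoset H) :=
  {q | ∃ g k : Δ, HeckeCoset.mk H H g = C ∧ HeckeCoset.mk H H k = D ∧
    RightCoset.mk H (k : G) = q ∧ x = g * k}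

theorem heckeCoset_mk_eq_of_mul {g : Δ} {x : Δ} {h k : G} (hh : h ∈ H) (hk : k ∈ H)
    (e : (x : G) = h * g * k) : HeckeCoset.mk H H x = HeckeCoset.mk H H g :=
  ((mk_eq_mk_iff _ _).2 ⟨h, hh, k, hk, e⟩).symm

/-- The coefficient at a double coset. -/
noncomputable def coeff (E : HeckeCoset Δ H H) : HeckeRing Δ H ℤ →ₗ[ℤ] ℤ :=
  AddMonoidHom.toIntLinearMap
    { toFun := fun f => f E
      map_zero' := rfl
      map_add' := fun _ _ => rfl }

theorem coeff_basisElement [DecidableEq (HeckeCoset Δ H H)] (C E : HeckeCoset Δ H H) :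
    coeff E (basisElement C) = if C = E then 1 else 0 :=
  Finsupp.single_apply

theorem hecke_ext {f g : HeckeRing Δ H ℤ} (h : ∀ E, coeff E f = coeff E g) : f = g :=
  HeckeCosetModule.ext h

theorem coeff_eq_zero_of_mem_span {T : Set (HeckeCoset Δ H H)} {E : HeckeCoset Δ H H} (hE : E ∉ T)
    {t : HeckeRing Δ H ℤ} (ht : t ∈ Submodule.span ℤ (basisElement '' T)) : coeff E t = 0 := by
  classical
  have : Submodule.span ℤ (basisElement '' T) ≤ LinearMap.ker (coeff E) := by
    rw [Submodule.span_le]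
    rintro _ ⟨C, hC, rfl⟩
    rw [SetLike.mem_coe, LinearMap.mem_ker, coeff_basisElement, if_neg]
    rintro rfl
    exact hE hC
  exact this ht

variable [IsHeckeTriple Δ H H]

theorem finite_factorSet (C D : HeckeCoset Δ H H) (x : G) : (factorSet C D x).Finite := by
  refine (finite_rightCosets D).subset ?_
  rintro q ⟨g, k, -, hk, hq, -⟩
  exact ⟨k, hk, hq⟩

theorem ncard_factorSet_le (C D : HeckeCoset Δ H H) (x : G) {h k : G} (hh : h ∈ H) (hk : k ∈ H) :
    (factorSet C D x).ncard ≤ (factorSet C D (h * x * k)).ncard := by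
  refine Set.ncard_le_ncard_of_injOn (fun q => q.trans k) ?_ ?_ (finite_factorSet _ _ _)
  · rintro q ⟨a, b, ha, hb, rfl, rfl⟩
    refine ⟨⟨h * a, Δ.mul_mem (IsHeckeTriple.mem_of_mem_right (Δ := Δ) H hh) a.2⟩,
      ⟨b * k, Δ.mul_mem b.2 (IsHeckeTriple.mem_of_mem_right (Δ := Δ) H hk)⟩, ?_, ?_, rfl, ?_⟩
    · rw [← ha]; exact heckeCoset_mk_eq_of_mul hh H.one_mem (by simp)
    · rw [← hb]; exact heckeCoset_mk_eq_of_mul H.one_mem hk (by simp)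
    · simp [mul_assoc]
  · intro p _ q _ hpq
    have := congrArg (fun r => RightCoset.trans r k⁻¹) hpq
    simpa [RightCoset.trans_trans, RightCoset.trans_one] using this

/-- A structure constant counts factorizations up to `(g, k) ↦ (g h⁻¹, h k)`: the left factor is
determined by the right coset of the right factor. -/
theorem structureConstant_eq_ncard (C D : HeckeCoset Δ H H) (x : Δ) :
    structureConstant C D (HeckeCoset.mk H H x) = (factorSet C D (x : G)).ncard := by
  have key : ∀ y : Δ, Set.ncard {z : RightCoset H × RightCoset H | z.1 ∈ rightCosets C ∧
      z.2 ∈ rightCosets D ∧ RightCoset.mk H (Quotient.out z.1 * Quotient.out z.2) =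
      RightCoset.mk H (y : G)} = (factorSet C D (y : G)).ncard := by
    intro y
    refine Set.ncard_congr (fun z _ => z.2) ?_ ?_ ?_
    · rintro ⟨p, q⟩ ⟨hp, hq, e⟩
      have hk := out_mem_of_mem_rightCosets hq
      obtain ⟨g, hg, rfl⟩ := hp
      obtain ⟨k', hk', rfl⟩ := hq
      have e1 : RightCoset.mk H ((g : G) * Quotient.out (RightCoset.mk H (k' : G))) =
          RightCoset.mk H (y : G) := by
        rw [← RightCoset.trans_mk, ← RightCoset.mk_out (RightCoset.mk H (g : G)),
          RightCoset.trans_mk]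
        exact e
      have e2 := RightCoset.mk_eq.1 e1
      have e3 := RightCoset.mk_eq.1 (RightCoset.mk_out (RightCoset.mk H (k' : G)))
      refine ⟨⟨_, Δ.mul_mem (IsHeckeTriple.mem_of_mem_right (Δ := Δ) H e2) g.2⟩, ⟨_, hk⟩, ?_, ?_,
        RightCoset.mk_out _, ?_⟩
      · rw [← hg]; exact heckeCoset_mk_eq_of_mul e2 H.one_mem (by simp)
      · rw [← hk']; exact (heckeCoset_mk_eq_of_mul e3 H.one_mem (by simp)).symm
      · simp [mul_assoc]
    · rintro ⟨p, q⟩ ⟨p', q'⟩ ⟨-, -, e⟩ ⟨-, -, e'⟩ hqq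
      obtain rfl : q = q' := hqq
      have h1 : p.trans (Quotient.out q) = p'.trans (Quotient.out q) := by
        rw [← RightCoset.mk_out p, ← RightCoset.mk_out p', RightCoset.trans_mk,
          RightCoset.trans_mk]
        exact e.trans e'.symm
      have := congrArg (fun r => RightCoset.trans r (Quotient.out q)⁻¹) h1
      simp only [RightCoset.trans_trans, mul_inv_cancel, RightCoset.trans_one] at this
      rw [this]
    · rintro q ⟨g, k, hg, hk, hq, e⟩
      have hq' := RightCoset.mk_eq.1 (hq.trans (RightCoset.mk_out q).symm)
      refine ⟨(RightCoset.mk H ((y : G) * (Quotient.out q)⁻¹), q), ⟨?_, ⟨k, hk, hq⟩, ?_⟩, rfl⟩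
      · rw [e]
        have hq2 : (k : G) * (Quotient.out q)⁻¹ ∈ H := by simpa using H.inv_mem hq'
        refine ⟨⟨g * (k * (Quotient.out q)⁻¹),
          Δ.mul_mem g.2 (IsHeckeTriple.mem_of_mem_right (Δ := Δ) H hq2)⟩, ?_, ?_⟩
        · rw [← hg]; exact heckeCoset_mk_eq_of_mul H.one_mem hq2 (by simp)
        · simp [mul_assoc]
      · rw [← RightCoset.trans_mk, RightCoset.mk_out, RightCoset.trans_mk]
        simp
  -- the representative of the double coset of `x` may be replaced by `x`
  have h1 := key (Quotient.out (HeckeCoset.mk H H x))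
  obtain ⟨h, hh, k, hk, e⟩ := (mk_eq_mk_iff x (Quotient.out (HeckeCoset.mk H H x))).1
    (Quotient.out_eq _).symm
  refine h1.trans (le_antisymm ?_ ?_)
  · have e' : (x : G) = h⁻¹ * (Quotient.out (HeckeCoset.mk H H x) : Δ) * k⁻¹ := by
      rw [e]; group
    conv_rhs => rw [e']
    exact ncard_factorSet_le C D _ (H.inv_mem hh) (H.inv_mem hk)
  · rw [e]
    exact ncard_factorSet_le C D _ hh hk

/-- An anti-involution `ι` maps the factorization `x = g k` to `ι x = ι k · ι g`. -/
theorem ncard_factorSet_le_swap (ι : G → G) (hmul : ∀ a b, ι (a * b) = ι b * ι a)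
    (hH : ∀ a ∈ H, ι a ∈ H) (hinv : ∀ a, ι (ι a) = a)
    (hΔ : ∀ a : Δ, ∃ b : Δ, (b : G) = ι a ∧ HeckeCoset.mk H H b = HeckeCoset.mk H H a)
    (C D : HeckeCoset Δ H H) (x : G) :
    (factorSet C D x).ncard ≤ (factorSet D C (ι x)).ncard := by
  classical
  have hex : ∀ q : RightCoset H, q ∈ factorSet C D x → ∃ g k : Δ, HeckeCoset.mk H H g = C ∧
      HeckeCoset.mk H H k = D ∧ RightCoset.mk H (k : G) = q ∧ x = g * k := fun q hq => hq
  choose! g k h1 h2 h3 h4 using hex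
  refine Set.ncard_le_ncard_of_injOn (fun q => RightCoset.mk H (ι (g q))) ?_ ?_
    (finite_factorSet _ _ _)
  · intro q hq
    obtain ⟨b, hb, hb'⟩ := hΔ (g q)
    obtain ⟨c, hc, hc'⟩ := hΔ (k q)
    refine ⟨c, b, hc'.trans (h2 q hq), hb'.trans (h1 q hq), by rw [hb], ?_⟩
    rw [hb, hc, ← hmul, ← h4 q hq]
  · intro p hp q hq hpq
    have e := hH _ (RightCoset.mk_eq.1 hpq)
    have hι1 : ι 1 = 1 := by
      have := hmul (ι 1) 1
      rw [mul_one, hinv, mul_one] at this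
      exact this.symm
    have hιinv : ∀ a, ι a⁻¹ = (ι a)⁻¹ := fun a => by
      refine eq_inv_of_mul_eq_one_left ?_
      rw [← hmul, mul_inv_cancel, hι1]
    rw [hmul, hιinv, hinv, hinv] at e
    rw [← h3 p hp, ← h3 q hq, RightCoset.mk_eq]
    have e1 : (k p : G) = (g p : G)⁻¹ * x := by rw [h4 p hp]; group
    have e2 : (k q : G) = (g q : G)⁻¹ * x := by
      conv_rhs => rw [h4 q hq]
      group
    rw [e1, e2]
    have := H.inv_mem e
    simpa [mul_assoc] using this

/-- An anti-involution fixing all double cosets makes the structure constants symmetric. -/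
theorem structureConstant_comm (ι : G → G) (hmul : ∀ a b, ι (a * b) = ι b * ι a)
    (hH : ∀ a ∈ H, ι a ∈ H) (hinv : ∀ a, ι (ι a) = a)
    (hΔ : ∀ a : Δ, ∃ b : Δ, (b : G) = ι a ∧ HeckeCoset.mk H H b = HeckeCoset.mk H H a)
    (C D E : HeckeCoset Δ H H) : structureConstant C D E = structureConstant D C E := by
  have key : ∀ C D : HeckeCoset Δ H H, structureConstant C D E ≤ structureConstant D C E := by
    intro C D
    induction E using Quotient.inductionOn with
    | h x =>
      change structureConstant C D (HeckeCoset.mk H H x) ≤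
        structureConstant D C (HeckeCoset.mk H H x)
      obtain ⟨b, hb, hb'⟩ := hΔ x
      conv_rhs => rw [← hb']
      rw [structureConstant_eq_ncard, structureConstant_eq_ncard, hb]
      exact ncard_factorSet_le_swap ι hmul hH hinv hΔ C D x
  exact le_antisymm (key C D) (key D C)

theorem structureConstant_ne_zero_iff (C D : HeckeCoset Δ H H) (x : Δ) :
    structureConstant C D (HeckeCoset.mk H H x) ≠ 0 ↔
      ∃ g k : Δ, HeckeCoset.mk H H g = C ∧ HeckeCoset.mk H H k = D ∧ (x : G) = g * k := by
  rw [structureConstant_eq_ncard, ← Nat.pos_iff_ne_zero, Set.ncard_pos (finite_factorSet C D _)]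
  constructor
  · rintro ⟨q, g, k, hg, hk, -, e⟩
    exact ⟨g, k, hg, hk, e⟩
  · rintro ⟨g, k, hg, hk, e⟩
    exact ⟨_, g, k, hg, hk, rfl, e⟩

theorem structureConstant_le_one (C D : HeckeCoset Δ H H) (x : Δ)
    (hu : ∀ g k g' k' : Δ, HeckeCoset.mk H H g = C → HeckeCoset.mk H H k = D →
      HeckeCoset.mk H H g' = C → HeckeCoset.mk H H k' = D → (x : G) = g * k → (x : G) = g' * k' →
      (k' : G) * (k : G)⁻¹ ∈ H) :
    structureConstant C D (HeckeCoset.mk H H x) ≤ 1 := by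
  rw [structureConstant_eq_ncard, Set.ncard_le_one (finite_factorSet C D _)]
  rintro _ ⟨g, k, hg, hk, rfl, e⟩ _ ⟨g', k', hg', hk', rfl, e'⟩
  exact RightCoset.mk_eq.2 (hu g k g' k' hg hk hg' hk' e e')

/-! ### Generating sets of a Hecke algebra with leading terms -/

theorem basisElement_one : basisElement (1 : HeckeCoset Δ H H) = 1 := rfl

theorem coeff_mul (C D E : HeckeCoset Δ H H) :
    coeff E (basisElement C * basisElement D) = structureConstant C D E := by
  have h : basisElement C * basisElement D = HeckeCosetModule.of (cosetMul C D) := by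
    change HeckeCosetModule.of (heckeMul (Finsupp.single C 1) (Finsupp.single D 1)) = _
    rw [heckeMul, Finsupp.sum_single_index (by simp), Finsupp.sum_single_index (by simp)]
    simp
  rw [h]
  rfl

theorem mem_of_basisElement_mem {N : Submodule ℤ (HeckeRing Δ H ℤ)} (f : HeckeRing Δ H ℤ)
    (h : ∀ E, coeff E f ≠ 0 → basisElement E ∈ N) : f ∈ N := by
  classical
  let f' : HeckeCoset Δ H H →₀ ℤ := HeckeCosetModule.of.symm f
  have hf : f = ∑ E ∈ f'.support, coeff E f • basisElement E := by
    refine hecke_ext fun E => ?_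
    rw [map_sum]
    simp only [map_smul, coeff_basisElement, smul_eq_mul, mul_ite, mul_one, mul_zero,
      Finset.sum_ite_eq', Finsupp.mem_support_iff]
    by_cases hE : f' E = 0
    · rw [if_neg (by simpa using hE)]; exact hE
    · rw [if_pos hE]
  rw [hf]
  refine N.sum_mem fun E hE => N.smul_mem _ (h E ?_)
  exact Finsupp.mem_support_iff.1 hE

/-- If every nontrivial double coset outside `S` is the leading term of a product of two double
cosets with smaller `μ`, then `S` generates the Hecke algebra. The function `n`, bounded on the
fibres of `μ`, is larger on the remaining terms of a product, which are thus treated first. -/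
theorem adjoin_eq_top_of_leading (star : HeckeCoset Δ H H → HeckeCoset Δ H H → HeckeCoset Δ H H)
    (μ n : HeckeCoset Δ H H → ℕ) (bd : ℕ → ℕ) (S : Set (HeckeCoset Δ H H))
    (hstar : ∀ C D, structureConstant C D (star C D) = 1)
    (hμ : ∀ C D E, structureConstant C D E ≠ 0 → μ E = μ (star C D))
    (hlow : ∀ C D E, structureConstant C D E ≠ 0 → E ≠ star C D → n (star C D) < n E)
    (hbd : ∀ C, n C ≤ bd (μ C))
    (hdec : ∀ C, C = 1 ∨ C ∈ S ∨ ∃ N₁ N₂, C = star N₁ N₂ ∧ μ N₁ < μ C ∧ μ N₂ < μ C) :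
    Algebra.adjoin ℤ (basisElement '' S) = ⊤ := by
  classical
  set A := Algebra.adjoin ℤ (basisElement '' S) with hA
  have key : ∀ a b : ℕ, ∀ C : HeckeCoset Δ H H, μ C = a → bd a - n C = b →
      basisElement C ∈ A := by
    intro a
    induction a using Nat.strong_induction_on with
    | _ a iha =>
      intro b
      induction b using Nat.strong_induction_on with
      | _ b ihb =>
        intro C hCa hCb
        rcases hdec C with rfl | hC | ⟨N₁, N₂, e, h1, h2⟩
        · rw [basisElement_one]; exact A.one_mem
        · exact Algebra.subset_adjoin ⟨C, hC, rfl⟩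
        · have m1 := iha (μ N₁) (hCa ▸ h1) _ N₁ rfl rfl
          have m2 := iha (μ N₂) (hCa ▸ h2) _ N₂ rfl rfl
          -- the other double cosets in the product `N₁ N₂` have the same `μ` and larger `n`
          have m3 : basisElement N₁ * basisElement N₂ - basisElement C ∈
              Subalgebra.toSubmodule A := by
            refine mem_of_basisElement_mem _ fun E hE => ?_
            rw [map_sub, coeff_mul, coeff_basisElement] at hE
            by_cases hCE : C = E
            · subst hCE
              rw [if_pos rfl, e, hstar] at hE
              simp at hE
            · rw [if_neg hCE, sub_zero] at hE
              have hE' : structureConstant N₁ N₂ E ≠ 0 := by exact_mod_cast hE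
              have hμE : μ E = a := by rw [hμ _ _ _ hE', ← e, hCa]
              have hlt := hlow _ _ _ hE' (fun h => hCE (e.trans h.symm))
              rw [← e] at hlt
              have hb := hbd E
              rw [hμE] at hb
              exact ihb (bd a - n E) (by omega) E hμE rfl
          have m4 := A.mul_mem m1 m2
          have m5 := A.sub_mem m4 m3
          simpa using m5
  refine top_le_iff.1 fun f _ => ?_
  exact mem_of_basisElement_mem (N := Subalgebra.toSubmodule A) f fun E _ => key _ _ E rfl rfl

/-- A double coset `C₀` which is not the leading term of a product, and in whose degree the
leading terms of products determine the factors, is not a polynomial in the double cosets of `T`,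
provided that those of the same degree as `C₀` are different from it and are not leading terms of
products either. -/
theorem notMem_adjoin_of_leading {M : Type*} [MulOneClass M]
    (hcomm : ∀ C D E : HeckeCoset Δ H H, structureConstant C D E = structureConstant D C E)
    (star : HeckeCoset Δ H H → HeckeCoset Δ H H → HeckeCoset Δ H H)
    (deg : HeckeCoset Δ H H → M) (n : HeckeCoset Δ H H → ℕ)
    (hsc : ∀ C D, star C D = star D C)
    (hstar : ∀ C D, structureConstant C D (star C D) = 1)
    (hdeg : ∀ C D E, structureConstant C D E ≠ 0 → deg E = deg C * deg D)
    (hlow : ∀ C D E, structureConstant C D E ≠ 0 → E ≠ star C D → n (star C D) < n E)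
    (hone : ∀ C D, star C D = 1 → C = 1)
    (hone' : ∀ C D : HeckeCoset Δ H H, structureConstant C D (1 : HeckeCoset Δ H H) ≠ 0 → C = 1)
    (C₀ : HeckeCoset Δ H H) (hC₀ : C₀ ≠ 1) (T : Set (HeckeCoset Δ H H)) (hT₀ : C₀ ∉ T)
    (hT : ∀ C ∈ T, deg C = deg C₀ → ∀ N₁ N₂, N₁ ≠ 1 → N₂ ≠ 1 → C ≠ star N₁ N₂)
    (h₀ : ∀ N₁ N₂, N₁ ≠ 1 → N₂ ≠ 1 → C₀ ≠ star N₁ N₂)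
    (huniq : ∀ C D C' D', C ≠ 1 → D ≠ 1 → C' ≠ 1 → D' ≠ 1 → deg C * deg D = deg C₀ →
      deg C' * deg D' = deg C₀ →
      star C D = star C' D' → (C = C' ∧ D = D') ∨ (C = D' ∧ D = C')) :
    basisElement C₀ ∉ Algebra.adjoin ℤ (basisElement '' T) := by
  classical
  have hcomm' : ∀ C D : HeckeCoset Δ H H,
      basisElement C * basisElement D = basisElement D * basisElement C := fun C D =>
    hecke_ext fun E => by rw [coeff_mul, coeff_mul, hcomm]
  -- The span `I` of the nontrivial double cosets is closed under products, so the subalgebra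
  -- generated by `T` is contained in `W = ℤ + U + I²`, where `U` is the span of `T`.
  set I : Submodule ℤ (HeckeRing Δ H ℤ) := Submodule.span ℤ (basisElement '' {C | C ≠ 1}) with hI
  set U : Submodule ℤ (HeckeRing Δ H ℤ) := Submodule.span ℤ (basisElement '' (T \ {1})) with hU
  have hII : I * I ≤ I := by
    rw [hI, Submodule.span_mul_span, Submodule.span_le]
    rintro _ ⟨_, ⟨C, hC, rfl⟩, _, ⟨D, hD, rfl⟩, rfl⟩
    refine mem_of_basisElement_mem _ fun E hE => Submodule.subset_span ⟨E, ?_, rfl⟩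
    rintro rfl
    simp only [coeff_mul] at hE
    exact hC (hone' C D (by exact_mod_cast hE))
  have hUI : U ≤ I := Submodule.span_mono (Set.image_mono fun C hC => hC.2)
  set W : Submodule ℤ (HeckeRing Δ H ℤ) := 1 ⊔ U ⊔ I * I with hW
  have hWW : W * W ≤ W := by
    have a1 : U * U ≤ I * I := mul_le_mul' hUI hUI
    have a2 : U * (I * I) ≤ I * I := mul_le_mul' hUI hII
    have a3 : (I * I) * U ≤ I * I := mul_le_mul' hII hUI
    have a4 : (I * I) * (I * I) ≤ I * I := mul_le_mul' hII hII
    have b1 : (1 : Submodule ℤ (HeckeRing Δ H ℤ)) ≤ W := le_sup_left.trans le_sup_left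
    have b2 : U ≤ W := le_sup_right.trans le_sup_left
    have b3 : I * I ≤ W := le_sup_right
    conv_lhs => rw [hW]
    simp only [Submodule.sup_mul, Submodule.mul_sup, one_mul, mul_one]
    simp only [sup_le_iff]
    have c1 := a1.trans b3
    have c2 := a2.trans b3
    have c3 := a3.trans b3
    have c4 := a4.trans b3
    tauto
  have hone1 : (1 : HeckeRing Δ H ℤ) ∈ W :=
    (le_sup_left.trans le_sup_left : (1 : Submodule ℤ (HeckeRing Δ H ℤ)) ≤ W)
      (Submodule.one_le.1 le_rfl)
  have hadj : ∀ x ∈ Algebra.adjoin ℤ (basisElement '' T), x ∈ W := by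
    intro x hx
    induction hx using Algebra.adjoin_induction with
    | mem x hx =>
      obtain ⟨C, hC, rfl⟩ := hx
      by_cases h1 : C = 1
      · subst h1; exact hone1
      · exact (le_sup_right.trans le_sup_left : U ≤ W) (Submodule.subset_span ⟨C, ⟨hC, h1⟩, rfl⟩)
    | algebraMap r =>
      rw [Algebra.algebraMap_eq_smul_one]
      exact W.smul_mem _ hone1
    | add x y _ _ hx hy => exact W.add_mem hx hy
    | mul x y _ _ hx hy => exact hWW (Submodule.mul_mem_mul hx hy)
  -- Write `C₀ = o + t + z` in `W`, and `z` as a combination of products `f s` of unordered pairs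
  -- `s` of nontrivial double cosets, with leading terms `lead s`.
  intro hmem
  obtain ⟨w, hw, z, hz, e⟩ := Submodule.mem_sup.1 (hadj _ hmem)
  obtain ⟨o, ho, t, ht, rfl⟩ := Submodule.mem_sup.1 hw
  have ho' : ∀ E : HeckeCoset Δ H H, E ≠ 1 → coeff E o = 0 := by
    intro E hE
    obtain ⟨r, rfl⟩ := Submodule.mem_one.1 ho
    rw [Algebra.algebraMap_eq_smul_one, map_smul, ← basisElement_one, coeff_basisElement,
      if_neg (Ne.symm hE), smul_zero]
  let f : Sym2 {C : HeckeCoset Δ H H // C ≠ 1} → HeckeRing Δ H ℤ :=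
    Sym2.lift ⟨fun C D => basisElement C.1 * basisElement D.1, fun C D => hcomm' _ _⟩
  let lead : Sym2 {C : HeckeCoset Δ H H // C ≠ 1} → HeckeCoset Δ H H :=
    Sym2.lift ⟨fun C D => star C.1 D.1, fun C D => hsc _ _⟩
  have hz' : z ∈ Submodule.span ℤ (Set.range f) := by
    have : I * I ≤ Submodule.span ℤ (Set.range f) := by
      rw [hI, Submodule.span_mul_span]
      refine Submodule.span_mono ?_
      rintro _ ⟨_, ⟨C, hC, rfl⟩, _, ⟨D, hD, rfl⟩, rfl⟩
      exact ⟨s(⟨C, hC⟩, ⟨D, hD⟩), rfl⟩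
    exact this hz
  obtain ⟨b, rfl⟩ := (Finsupp.mem_span_range_iff_exists_finsupp).1 hz'
  have hfs : ∀ s, coeff (lead s) (f s) = 1 := by
    intro s
    induction s using Sym2.ind with
    | _ C D =>
      change coeff (star C.1 D.1) (basisElement C.1 * basisElement D.1) = 1
      rw [coeff_mul, hstar]; rfl
  have hfd : ∀ s E, coeff E (f s) ≠ 0 → deg E = deg (lead s) ∧
      (E = lead s ∨ n (lead s) < n E) := by
    intro s E
    induction s using Sym2.ind with
    | _ C D =>
      change coeff E (basisElement C.1 * basisElement D.1) ≠ 0 →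
        deg E = deg (star C.1 D.1) ∧ (E = star C.1 D.1 ∨ n (star C.1 D.1) < n E)
      rw [coeff_mul]
      intro h
      have h' : structureConstant C.1 D.1 E ≠ 0 := by exact_mod_cast h
      refine ⟨?_, ?_⟩
      · rw [hdeg _ _ _ h', hdeg C.1 D.1 (star C.1 D.1) (by rw [hstar]; exact one_ne_zero)]
      · by_cases hE : E = star C.1 D.1
        · exact Or.inl hE
        · exact Or.inr (hlow _ _ _ h' hE)
  have hlead1 : ∀ s, lead s ≠ 1 := by
    intro s
    induction s using Sym2.ind with
    | _ C D => exact fun h => C.2 (hone _ _ h)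
  have hlead0 : ∀ s, lead s ≠ C₀ := by
    intro s
    induction s using Sym2.ind with
    | _ C D => exact fun h => h₀ _ _ C.2 D.2 h.symm
  have hleadT : ∀ s, deg (lead s) = deg C₀ → lead s ∉ T := by
    intro s
    induction s using Sym2.ind with
    | _ C D => exact fun h h' => hT _ h' h _ _ C.2 D.2 rfl
  have hinj : ∀ s s', deg (lead s) = deg C₀ → lead s = lead s' → s = s' := by
    intro s s'
    induction s using Sym2.ind with
    | _ C D =>
      induction s' using Sym2.ind with
      | _ C' D' =>
        change deg (star C.1 D.1) = deg C₀ → star C.1 D.1 = star C'.1 D'.1 → _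
        intro h1 h2
        have hd := hdeg C.1 D.1 (star C.1 D.1) (by rw [hstar]; exact one_ne_zero)
        have hd' := hdeg C'.1 D'.1 (star C'.1 D'.1) (by rw [hstar]; exact one_ne_zero)
        rcases huniq _ _ _ _ C.2 D.2 C'.2 D'.2 (hd ▸ h1) (hd' ▸ h2 ▸ h1) h2 with
          ⟨h3, h4⟩ | ⟨h3, h4⟩
        · rw [Subtype.ext h3, Subtype.ext h4]
        · rw [Subtype.ext h3, Subtype.ext h4, Sym2.eq_swap]
  have hcoeff : ∀ E, E ≠ 1 → E ∉ T → coeff E (basisElement C₀) =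
      ∑ s ∈ b.support, b s * coeff E (f s) := by
    intro E hE1 hET
    have ht0 : coeff E t = 0 := coeff_eq_zero_of_mem_span (fun h => hET h.1) ht
    rw [← e, map_add, map_add, ho' E hE1, ht0, zero_add, zero_add, Finsupp.sum, map_sum]
    refine Finset.sum_congr rfl fun s _ => ?_
    rw [map_smul, smul_eq_mul]
  -- Among the pairs in `z` with the degree of `C₀`, one with smallest leading term contributes to
  -- the coefficient at that double coset, and no other pair does; but this coefficient is zero.
  set B := b.support.filter (fun s => deg (lead s) = deg C₀) with hB
  have hBempty : B = ∅ := by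
    by_contra hne
    obtain ⟨s, hs, hmin⟩ := Finset.exists_min_image B (fun s => n (lead s))
      (Finset.nonempty_iff_ne_empty.2 hne)
    rw [hB, Finset.mem_filter] at hs
    have h1 := hcoeff (lead s) (hlead1 s) (hleadT s hs.2)
    rw [coeff_basisElement, if_neg (Ne.symm (hlead0 s)), Finset.sum_eq_single s, hfs, mul_one] at h1
    · exact Finsupp.mem_support_iff.1 hs.1 h1.symm
    · intro s' hs' hss
      by_contra hc
      obtain ⟨hd, hor⟩ := hfd s' (lead s) (right_ne_zero_of_mul hc)
      rcases hor with hor | hor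
      · exact hss (hinj s s' hs.2 hor).symm
      · have := hmin s' (by rw [hB, Finset.mem_filter]; exact ⟨hs', hd ▸ hs.2⟩)
        omega
    · intro h; exact absurd hs.1 h
  -- hence `z` does not contribute to the coefficient at `C₀`
  have h1 := hcoeff C₀ hC₀ hT₀
  rw [coeff_basisElement, if_pos rfl, Finset.sum_eq_zero] at h1
  · exact one_ne_zero h1
  · intro s hs
    by_contra hc
    obtain ⟨hd, -⟩ := hfd s C₀ (right_ne_zero_of_mul hc)
    have : s ∈ B := by rw [hB, Finset.mem_filter]; exact ⟨hs, hd.symm⟩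
    rw [hBempty] at this
    simp at this

end Abstract

open Matrix NumberField IsDedekindDomain

/-! ### Quadratic extensions and semilocal subrings -/

/-- In a Dedekind domain, `x` can be changed by a multiple of `y` such that, up to factors prime
to `c`, it generates the ideal `(x, y)`. -/
theorem exists_add_mul_dvd {A : Type*} [CommRing A] [IsDedekindDomain A] (c x y : A) (hc : c ≠ 0) :
    ∃ t z : A, x + t * y ∣ (1 + c * z) * x ∧ x + t * y ∣ (1 + c * z) * y := by
  classical
  by_cases hxy : x = 0 ∧ y = 0
  · obtain ⟨rfl, rfl⟩ := hxy
    exact ⟨0, 0, by simp, by simp⟩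
  set I : Ideal A := Ideal.span {x, y} with hI
  have hxI : x ∈ I := Ideal.subset_span (by simp)
  have hyI : y ∈ I := Ideal.subset_span (by simp)
  have hI0 : I ≠ 0 := by
    intro h
    rw [h] at hxI hyI
    exact hxy ⟨by simpa using hxI, by simpa using hyI⟩
  have hcspan : Ideal.span {c} ≠ 0 := by simpa using hc
  have hfin := Ideal.finite_factors hcspan
  let s := hfin.toFinset
  -- With `t = 1` at the primes `P ∣ c` with `x ∈ P I`, and `t = 0` at the others, `x + t y`
  -- generates `I` at all primes dividing `c`.
  obtain ⟨t, ht⟩ := exists_forall_sub_mem_ideal (s := s) (fun P : HeightOneSpectrum A => P.asIdeal)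
    (fun _ => 1) (fun P _ => P.prime) (fun P _ Q _ h h' => h (HeightOneSpectrum.ext h'))
    (fun P => if x ∈ P.1.asIdeal * I then 1 else 0)
  have hnot : ∀ P ∈ s, x + t * y ∉ P.asIdeal * I := by
    intro P hP hmem
    have hlt : ¬ I ≤ P.asIdeal * I := by
      intro hle
      have h1 : I = P.asIdeal * I := le_antisymm hle Ideal.mul_le_right
      have h2 : 1 * I = P.asIdeal * I := by rw [one_mul]; exact h1
      have := mul_right_cancel₀ hI0 h2
      exact P.isPrime.ne_top (by rw [← this, Ideal.one_eq_top])
    have htP := ht P hP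
    rw [pow_one] at htP
    by_cases hx : x ∈ P.asIdeal * I
    · simp only [hx, if_true] at htP
      apply hlt
      have hy : y ∈ P.asIdeal * I := by
        have h1 : t * y ∈ P.asIdeal * I := by
          have := Ideal.sub_mem _ hmem hx
          simpa using this
        have h2 : (t - 1) * y ∈ P.asIdeal * I := Ideal.mul_mem_mul htP hyI
        have := Ideal.sub_mem _ h1 h2
        ring_nf at this
        exact this
      rw [hI, Ideal.span_le, ← hI]
      rintro w hw
      simp only [Set.mem_insert_iff, Set.mem_singleton_iff] at hw
      rcases hw with rfl | rfl <;> assumption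
    · simp only [hx, if_false, sub_zero] at htP
      have h2 : t * y ∈ P.asIdeal * I := Ideal.mul_mem_mul htP hyI
      have := Ideal.sub_mem _ hmem h2
      exact hx (by simpa using this)
  have hle : Ideal.span {x + t * y} ≤ I := by
    rw [Ideal.span_singleton_le_iff_mem]
    exact I.add_mem hxI (I.mul_mem_left _ hyI)
  obtain ⟨J, hJ⟩ := Ideal.dvd_iff_le.2 hle
  have hcop : J ⊔ Ideal.span {c} = ⊤ := by
    by_contra hne
    obtain ⟨Q, hQmax, hQ⟩ := Ideal.exists_le_maximal _ hne
    have hQc : Ideal.span {c} ≤ Q := le_sup_right.trans hQ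
    have hQ0 : Q ≠ ⊥ := fun h => hcspan (le_bot_iff.1 (h ▸ hQc))
    let P : HeightOneSpectrum A := ⟨Q, hQmax.isPrime, hQ0⟩
    refine hnot P (hfin.mem_toFinset.2 (Ideal.dvd_iff_le.2 hQc)) ?_
    have h1 : x + t * y ∈ I * J := by rw [← hJ]; exact Ideal.mem_span_singleton_self _
    rw [mul_comm] at h1
    exact Ideal.mul_mono_left (le_sup_left.trans hQ) h1
  have key : ∃ z : A, 1 + c * z ∈ J := by
    have h1 : (1 : A) ∈ J ⊔ Ideal.span {c} := by rw [hcop]; trivial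
    obtain ⟨j, hj, b, hb, e⟩ := Submodule.mem_sup.1 h1
    obtain ⟨b, rfl⟩ := Ideal.mem_span_singleton'.1 hb
    have : 1 + c * (-b) = j := by rw [← e]; ring
    exact ⟨-b, by rwa [this]⟩
  obtain ⟨z, hz⟩ := key
  have hdvd : ∀ w ∈ I, x + t * y ∣ (1 + c * z) * w := by
    intro w hw
    rw [← Ideal.mem_span_singleton, hJ, mul_comm I J]
    exact Ideal.mul_mem_mul hz hw
  exact ⟨t, z, hdvd x hxI, hdvd y hyI⟩

section Quadratic

variable {K Ω : Type*} [Field K] [NumberField K] [Field Ω] [NumberField Ω] [Algebra K Ω]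

/-- `σ` is the nontrivial automorphism of the quadratic extension `Ω / K`. -/
structure IsQuadraticConj (σ : Ω ≃ₐ[K] Ω) : Prop where
  finrank_eq : Module.finrank K Ω = 2
  ne_one : σ ≠ 1

namespace IsQuadraticConj

variable {σ : Ω ≃ₐ[K] Ω}

theorem isGalois (h : IsQuadraticConj σ) : IsGalois K Ω := by
  have : Algebra.IsQuadraticExtension K Ω := ⟨h.finrank_eq⟩
  have : FiniteDimensional K Ω := FiniteDimensional.of_finrank_eq_succ h.finrank_eq
  infer_instance

theorem card_eq (h : IsQuadraticConj σ) : Nat.card (Ω ≃ₐ[K] Ω) = 2 := by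
  have := h.isGalois
  have : FiniteDimensional K Ω := FiniteDimensional.of_finrank_eq_succ h.finrank_eq
  rw [IsGalois.card_aut_eq_finrank, h.finrank_eq]

theorem apply_apply (h : IsQuadraticConj σ) (x : Ω) : σ (σ x) = x := by
  have h1 : σ ^ Nat.card (Ω ≃ₐ[K] Ω) = 1 := pow_card_eq_one'
  rw [h.card_eq] at h1
  have := DFunLike.congr_fun h1 x
  simpa [pow_two] using this

theorem exists_of_fixed (h : IsQuadraticConj σ) {x : Ω} (hx : σ x = x) :
    ∃ k : K, algebraMap K Ω k = x := by
  have := h.isGalois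
  have : FiniteDimensional K Ω := FiniteDimensional.of_finrank_eq_succ h.finrank_eq
  refine (IsGalois.mem_range_algebraMap_iff_fixed x).2 fun f => ?_
  obtain ⟨y, hy, huniq⟩ := (Nat.card_eq_two_iff' (1 : Ω ≃ₐ[K] Ω)).1 h.card_eq
  by_cases hf : f = 1
  · rw [hf]; rfl
  · rw [huniq f hf, ← huniq σ h.ne_one, hx]

end IsQuadraticConj

theorem coe_mul {F : Type*} [Field F] (x y : 𝓞 F) : ((x * y : 𝓞 F) : F) = x * y := map_mul _ _ _

theorem coe_add {F : Type*} [Field F] (x y : 𝓞 F) : ((x + y : 𝓞 F) : F) = x + y := map_add _ _ _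

theorem coe_neg {F : Type*} [Field F] (x : 𝓞 F) : ((-x : 𝓞 F) : F) = -x := map_neg _ _

theorem coe_one {F : Type*} [Field F] : ((1 : 𝓞 F) : F) = 1 := map_one _

theorem coe_zero {F : Type*} [Field F] : ((0 : 𝓞 F) : F) = 0 := map_zero _

theorem coe_algebraMap_eq (k : 𝓞 K) :
    ((algebraMap (𝓞 K) (𝓞 Ω) k : 𝓞 Ω) : Ω) = algebraMap K Ω (k : K) := rfl

theorem conj_coe (σ : Ω ≃ₐ[K] Ω) (k : K) : σ (algebraMap K Ω k) = algebraMap K Ω k := σ.commutes k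

/-- The conjugation on the ring of integers. -/
noncomputable abbrev conjInt (σ : Ω ≃ₐ[K] Ω) : 𝓞 Ω ≃ₐ[𝓞 K] 𝓞 Ω := RingOfIntegers.mapAlgEquiv σ

theorem coe_conjInt (σ : Ω ≃ₐ[K] Ω) (x : 𝓞 Ω) : ((conjInt σ x : 𝓞 Ω) : Ω) = σ (x : Ω) := rfl

theorem IsQuadraticConj.conjInt_conjInt {σ : Ω ≃ₐ[K] Ω} (h : IsQuadraticConj σ) (x : 𝓞 Ω) :
    conjInt σ (conjInt σ x) = x := RingOfIntegers.ext (h.apply_apply (x : Ω))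

theorem IsQuadraticConj.exists_of_conjInt_eq {σ : Ω ≃ₐ[K] Ω} (h : IsQuadraticConj σ) {x : 𝓞 Ω}
    (hx : conjInt σ x = x) : ∃ k : 𝓞 K, algebraMap (𝓞 K) (𝓞 Ω) k = x := by
  obtain ⟨k, hk⟩ := h.exists_of_fixed (x := (x : Ω)) (congrArg (fun y : 𝓞 Ω => (y : Ω)) hx)
  have hint : IsIntegral ℤ k := by
    rw [← isIntegral_algebraMap_iff (algebraMap K Ω).injective, hk]
    exact x.2
  exact ⟨⟨k, hint⟩, RingOfIntegers.ext hk⟩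

variable (Ω) in
/-- The subring of the elements of `Ω` that are integral up to a denominator in `1 + c 𝓞 K`; these
are the elements which are integral at all places above `c`. -/
def semilocalRing (c : 𝓞 K) : Subring Ω where
  carrier := {x | ∃ (z : 𝓞 K) (y : 𝓞 Ω), algebraMap K Ω ((1 + c * z : 𝓞 K) : K) * x = y}
  one_mem' := ⟨0, 1, by simp⟩
  zero_mem' := ⟨0, 0, by simp⟩
  mul_mem' := by
    rintro a b ⟨z, y, h⟩ ⟨z', y', h'⟩
    refine ⟨z + z' + c * z * z', y * y', ?_⟩
    rw [coe_mul, ← h, ← h']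
    simp only [map_add, map_mul, map_one]
    ring
  add_mem' := by
    rintro a b ⟨z, y, h⟩ ⟨z', y', h'⟩
    refine ⟨z + z' + c * z * z', algebraMap (𝓞 K) (𝓞 Ω) (1 + c * z') * y +
      algebraMap (𝓞 K) (𝓞 Ω) (1 + c * z) * y', ?_⟩
    have e : ((algebraMap (𝓞 K) (𝓞 Ω) (1 + c * z') * y + algebraMap (𝓞 K) (𝓞 Ω) (1 + c * z) * y' :
        𝓞 Ω) : Ω) = algebraMap K Ω ((1 + c * z' : 𝓞 K) : K) * y +
        algebraMap K Ω ((1 + c * z : 𝓞 K) : K) * y' := by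
      rw [coe_add, coe_mul, coe_mul, coe_algebraMap_eq, coe_algebraMap_eq]
    rw [e, ← h, ← h']
    simp only [map_add, map_mul, map_one]
    ring
  neg_mem' := by
    rintro a ⟨z, y, h⟩
    refine ⟨z, -y, ?_⟩
    rw [coe_neg, ← h, mul_neg]

theorem coe_mem_semilocalRing (c : 𝓞 K) (x : 𝓞 Ω) : (x : Ω) ∈ semilocalRing Ω c :=
  ⟨0, x, by simp⟩

theorem algebraMap_mem_semilocalRing (c k : 𝓞 K) :
    algebraMap K Ω (k : K) ∈ semilocalRing Ω c :=
  coe_mem_semilocalRing c (algebraMap (𝓞 K) (𝓞 Ω) k)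

theorem mem_semilocalRing_of_isIntegral (c : 𝓞 K) {x : Ω} (hx : IsIntegral ℤ x) :
    x ∈ semilocalRing Ω c := coe_mem_semilocalRing c ⟨x, hx⟩

theorem conj_mem_semilocalRing (σ : Ω ≃ₐ[K] Ω) {c : 𝓞 K} {x : Ω} (hx : x ∈ semilocalRing Ω c) :
    σ x ∈ semilocalRing Ω c := by
  obtain ⟨z, y, h⟩ := hx
  refine ⟨z, conjInt σ y, ?_⟩
  rw [coe_conjInt, ← h, map_mul, conj_coe]

theorem one_add_mul_ne_zero {c : 𝓞 K} (hc : ¬ IsUnit c) (z : 𝓞 K) :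
    algebraMap K Ω ((1 + c * z : 𝓞 K) : K) ≠ 0 := by
  rw [Ne, FaithfulSMul.algebraMap_eq_zero_iff, ← map_zero (algebraMap (𝓞 K) K)]
  intro h
  have h' : 1 + c * z = 0 := RingOfIntegers.ext (by simpa using h)
  exact hc (IsUnit.of_mul_eq_one (-z) (by linear_combination -h'))

theorem inv_mem_semilocalRing {c : 𝓞 K} (hc : ¬ IsUnit c) (z : 𝓞 K) :
    (algebraMap K Ω ((1 + c * z : 𝓞 K) : K))⁻¹ ∈ semilocalRing Ω c :=
  ⟨z, 1, by rw [mul_inv_cancel₀ (one_add_mul_ne_zero hc z), coe_one]⟩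

/-- Every element of the semilocal ring is congruent to an integer modulo `c`. -/
theorem exists_approx {c : 𝓞 K} {x : Ω} (hx : x ∈ semilocalRing Ω c) :
    ∃ (z : 𝓞 K), IsIntegral ℤ (algebraMap K Ω ((1 + c * z : 𝓞 K) : K) * x) ∧
      ∃ r ∈ semilocalRing Ω c,
        algebraMap K Ω ((1 + c * z : 𝓞 K) : K) * x = x + algebraMap K Ω (c : K) * r := by
  obtain ⟨z, y, h⟩ := hx
  refine ⟨z, h ▸ y.2, algebraMap K Ω (z : K) * x,
    Subring.mul_mem _ (algebraMap_mem_semilocalRing c z) ⟨z, y, h⟩, ?_⟩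
  simp only [map_add, map_mul, map_one]
  ring

theorem isIntegral_of_mul_isIntegral {c : 𝓞 K} {r : Ω} (hr : r ∈ semilocalRing Ω c)
    (h : IsIntegral ℤ (algebraMap K Ω (c : K) * r)) : IsIntegral ℤ r := by
  obtain ⟨z, y, hy⟩ := hr
  have e : r = y - algebraMap (𝓞 K) (𝓞 Ω) z * (algebraMap K Ω (c : K) * r) := by
    rw [← hy, coe_algebraMap_eq]
    simp only [map_add, map_mul, map_one]
    ring
  rw [e]
  exact y.2.sub ((algebraMap (𝓞 K) (𝓞 Ω) z).2.mul h)

/-- Divisibility over a subring of a field. -/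
def DvdIn (R : Subring Ω) (x y : Ω) : Prop := ∃ r ∈ R, y = x * r

theorem DvdIn.refl (R : Subring Ω) (x : Ω) : DvdIn R x x := ⟨1, R.one_mem, by simp⟩

theorem DvdIn.zero (R : Subring Ω) (x : Ω) : DvdIn R x 0 := ⟨0, R.zero_mem, by simp⟩

theorem DvdIn.trans {R : Subring Ω} {x y z : Ω} (h : DvdIn R x y) (h' : DvdIn R y z) :
    DvdIn R x z := by
  obtain ⟨r, hr, rfl⟩ := h
  obtain ⟨s, hs, rfl⟩ := h'
  exact ⟨r * s, R.mul_mem hr hs, by ring⟩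

theorem DvdIn.mul_right {R : Subring Ω} {x y r : Ω} (h : DvdIn R x y) (hr : r ∈ R) :
    DvdIn R x (y * r) := h.trans ⟨r, hr, rfl⟩

theorem DvdIn.mul_left {R : Subring Ω} {x y r : Ω} (h : DvdIn R x y) (hr : r ∈ R) :
    DvdIn R x (r * y) := mul_comm y r ▸ h.mul_right hr

theorem DvdIn.add {R : Subring Ω} {x y z : Ω} (h : DvdIn R x y) (h' : DvdIn R x z) :
    DvdIn R x (y + z) := by
  obtain ⟨r, hr, rfl⟩ := h
  obtain ⟨s, hs, rfl⟩ := h'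
  exact ⟨r + s, R.add_mem hr hs, by ring⟩

theorem DvdIn.neg {R : Subring Ω} {x y : Ω} (h : DvdIn R x y) : DvdIn R x (-y) := by
  obtain ⟨r, hr, rfl⟩ := h
  exact ⟨-r, R.neg_mem hr, by ring⟩

theorem DvdIn.mul_mul {R : Subring Ω} {x y x' y' : Ω} (h : DvdIn R x y) (h' : DvdIn R x' y') :
    DvdIn R (x * x') (y * y') := by
  obtain ⟨r, hr, rfl⟩ := h
  obtain ⟨s, hs, rfl⟩ := h'
  exact ⟨r * s, R.mul_mem hr hs, by ring⟩

theorem DvdIn.conj (σ : Ω ≃ₐ[K] Ω) {c : 𝓞 K} {x y : Ω} (h : DvdIn (semilocalRing Ω c) x y) :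
    DvdIn (semilocalRing Ω c) (σ x) (σ y) := by
  obtain ⟨r, hr, rfl⟩ := h
  exact ⟨σ r, conj_mem_semilocalRing σ hr, map_mul _ _ _⟩

/-- Divisibility in the semilocal ring satisfies the descending chain condition on divisors: the
ideals of the integral multiples of the elements have a maximal member. -/
theorem exists_dvdIn_minimal {c : 𝓞 K} (hc : ¬ IsUnit c) (X : Set Ω) (hX : X.Nonempty)
    (hXR : ∀ x ∈ X, x ∈ semilocalRing Ω c) :
    ∃ x ∈ X, ∀ x' ∈ X, DvdIn (semilocalRing Ω c) x' x → DvdIn (semilocalRing Ω c) x x' := by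
  let I : Ω → Ideal (𝓞 Ω) := fun x =>
    { carrier := {y | DvdIn (semilocalRing Ω c) x y}
      zero_mem' := by simpa using DvdIn.zero _ x
      add_mem' := fun {a b} ha hb => by
        change DvdIn _ _ _
        rw [coe_add]; exact DvdIn.add ha hb
      smul_mem' := fun a b hb => by
        change DvdIn _ _ _
        rw [smul_eq_mul, coe_mul]; exact DvdIn.mul_left hb (coe_mem_semilocalRing c a) }
  obtain ⟨_, ⟨x, hx, rfl⟩, hmax⟩ := set_has_maximal_iff_noetherian.2
    (inferInstance : IsNoetherian (𝓞 Ω) (𝓞 Ω)) (I '' X) (hX.image I)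
  refine ⟨x, hx, fun x' hx' hd => ?_⟩
  have hle : I x ≤ I x' := fun y hy => hd.trans hy
  have h1 := hmax (I x') ⟨x', hx', rfl⟩
  have h2 : I x' ≤ I x := by
    by_contra h
    exact h1 (lt_of_le_not_ge hle h)
  obtain ⟨z, y, h⟩ := hXR x' hx'
  have h3 : y ∈ I x' := ⟨_, algebraMap_mem_semilocalRing c (1 + c * z), by rw [← h, mul_comm]⟩
  obtain ⟨r, hr, hy⟩ := h2 h3
  refine ⟨r * (algebraMap K Ω ((1 + c * z : 𝓞 K) : K))⁻¹,
    Subring.mul_mem _ hr (inv_mem_semilocalRing hc z), ?_⟩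
  have h0 := one_add_mul_ne_zero (Ω := Ω) hc z
  rw [← mul_assoc, ← hy]
  change x' = (y : Ω) * _
  rw [← h]
  field_simp

theorem DvdIn.of_mul_left {R : Subring Ω} {s x y : Ω} (hs : s ≠ 0) (h : DvdIn R (s * x) (s * y)) :
    DvdIn R x y := by
  obtain ⟨r, hr, e⟩ := h
  exact ⟨r, hr, mul_left_cancel₀ hs (by rw [e, mul_assoc])⟩

/-- A denominator in `1 + c 𝓞 Ω` can be replaced by its norm. -/
theorem dvdIn_of_dvd_mul {c : 𝓞 K} (hc : ¬ IsUnit c) {σ : Ω ≃ₐ[K] Ω} (hσ : IsQuadraticConj σ)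
    {a x z : 𝓞 Ω} (h : a ∣ (1 + algebraMap (𝓞 K) (𝓞 Ω) c * z) * x) :
    DvdIn (semilocalRing Ω c) (a : Ω) x := by
  obtain ⟨q, hq⟩ := h
  set c' := algebraMap (𝓞 K) (𝓞 Ω) c with hc'
  obtain ⟨k, hk⟩ := hσ.exists_of_conjInt_eq (x := z + conjInt σ z + c' * (z * conjInt σ z)) (by
    rw [map_add, map_add, map_mul, map_mul, hσ.conjInt_conjInt, hc', AlgEquiv.commutes]
    ring)
  have e : algebraMap (𝓞 K) (𝓞 Ω) (1 + c * k) =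
      (1 + c' * z) * (1 + c' * conjInt σ z) := by
    rw [map_add, map_mul, hk, map_one, ← hc']; ring
  have h0 := one_add_mul_ne_zero (Ω := Ω) hc k
  have hq' := congrArg (fun u : 𝓞 Ω => ((1 + c' * conjInt σ z : 𝓞 Ω) : Ω) * (u : Ω)) hq
  have e' := congrArg (fun u : 𝓞 Ω => (u : Ω)) e
  simp only [coe_mul] at hq'
  simp only [coe_algebraMap_eq, coe_mul] at e'
  refine ⟨((1 + c' * conjInt σ z : 𝓞 Ω) : Ω) * q *
    (algebraMap K Ω ((1 + c * k : 𝓞 K) : K))⁻¹,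
    Subring.mul_mem _ (Subring.mul_mem _ (coe_mem_semilocalRing _ _) (coe_mem_semilocalRing _ _))
      (inv_mem_semilocalRing hc k), ?_⟩
  field_simp
  rw [e']
  linear_combination hq'

/-- The semilocal ring has stable range one, in the strong form that the pair `(x, y)` generates a
principal ideal with a generator of the form `x + t y`. -/
theorem exists_add_mul_dvdIn {c : 𝓞 K} (hc : ¬ IsUnit c) (hc0 : c ≠ 0) {σ : Ω ≃ₐ[K] Ω}
    (hσ : IsQuadraticConj σ) {x y : Ω} (hx : x ∈ semilocalRing Ω c) (hy : y ∈ semilocalRing Ω c) :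
    ∃ t ∈ semilocalRing Ω c, DvdIn (semilocalRing Ω c) (x + t * y) x ∧
      DvdIn (semilocalRing Ω c) (x + t * y) y := by
  obtain ⟨z, x', hx'⟩ := hx
  obtain ⟨z', y', hy'⟩ := hy
  have h0 := one_add_mul_ne_zero (Ω := Ω) hc z
  have h0' := one_add_mul_ne_zero (Ω := Ω) hc z'
  set s := algebraMap (𝓞 K) (𝓞 Ω) (1 + c * z) with hs
  set s' := algebraMap (𝓞 K) (𝓞 Ω) (1 + c * z') with hs'
  have hc0' : algebraMap (𝓞 K) (𝓞 Ω) c ≠ 0 := by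
    rwa [Ne, FaithfulSMul.algebraMap_eq_zero_iff]
  obtain ⟨t, w, h1, h2⟩ := exists_add_mul_dvd _ (s' * x') (s * y') hc0'
  have k1 := dvdIn_of_dvd_mul hc hσ h1
  have k2 := dvdIn_of_dvd_mul hc hσ h2
  have ex : ((s' * x' : 𝓞 Ω) : Ω) = algebraMap K Ω ((1 + c * z : 𝓞 K) : K) *
      algebraMap K Ω ((1 + c * z' : 𝓞 K) : K) * x := by
    rw [coe_mul, ← hx', hs', coe_algebraMap_eq]; ring
  have ey : ((s * y' : 𝓞 Ω) : Ω) = algebraMap K Ω ((1 + c * z : 𝓞 K) : K) *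
      algebraMap K Ω ((1 + c * z' : 𝓞 K) : K) * y := by
    rw [coe_mul, ← hy', hs, coe_algebraMap_eq]; ring
  have et : ((s' * x' + t * (s * y') : 𝓞 Ω) : Ω) = algebraMap K Ω ((1 + c * z : 𝓞 K) : K) *
      algebraMap K Ω ((1 + c * z' : 𝓞 K) : K) * (x + t * y) := by
    rw [coe_add, coe_mul t, ex, ey]; ring
  rw [et] at k1 k2
  rw [ex] at k1
  rw [ey] at k2
  exact ⟨t, coe_mem_semilocalRing c t, k1.of_mul_left (mul_ne_zero h0 h0'),
    k2.of_mul_left (mul_ne_zero h0 h0')⟩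

/-- The variant of `exists_add_mul_dvdIn` with a multiplier in the fixed field, for elements with
a quotient in the fixed field. -/
theorem exists_add_mul_dvdIn_of_fixed {c : 𝓞 K} (hc : ¬ IsUnit c) (hc0 : c ≠ 0) {σ : Ω ≃ₐ[K] Ω}
    (hσ : IsQuadraticConj σ) {x y : Ω} (hxy : σ (x * σ y) = x * σ y) :
    ∃ t ∈ semilocalRing Ω c, σ t = t ∧ DvdIn (semilocalRing Ω c) (x + t * y) x ∧
      DvdIn (semilocalRing Ω c) (x + t * y) y := by
  by_cases hy : y = 0
  · subst hy
    exact ⟨0, Subring.zero_mem _, map_zero σ, by simpa using DvdIn.refl _ x, DvdIn.zero _ _⟩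
  have hsy : σ y ≠ 0 := by simpa using hy
  have hfix : σ (x / y) = x / y := by
    rw [map_mul, hσ.apply_apply] at hxy
    rw [map_div₀, div_eq_div_iff hsy hy, hxy]
  obtain ⟨k, hk⟩ := hσ.exists_of_fixed hfix
  obtain ⟨a, b, hb, rfl⟩ := IsFractionRing.div_surjective (A := 𝓞 K) k
  have hb0 : b ≠ 0 := nonZeroDivisors.ne_zero hb
  obtain ⟨t, z, h1, h2⟩ := exists_add_mul_dvd c a b hc0
  obtain ⟨q1, h1⟩ := h1
  obtain ⟨q2, h2⟩ := h2
  have g1 := congrArg (fun u : 𝓞 K => algebraMap K Ω (u : K)) h1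
  have g2 := congrArg (fun u : 𝓞 K => algebraMap K Ω (u : K)) h2
  simp only [coe_add a, map_mul, map_add (algebraMap K Ω) (a : K)] at g1 g2
  have h0 := one_add_mul_ne_zero (Ω := Ω) hc z
  set s := algebraMap K Ω ((1 + c * z : 𝓞 K) : K) with hs
  have hbΩ : algebraMap K Ω (b : K) ≠ 0 := by
    rw [Ne, FaithfulSMul.algebraMap_eq_zero_iff]
    simpa using hb0
  have hx : x = y * algebraMap K Ω (a : K) / algebraMap K Ω (b : K) := by
    rw [map_div₀, eq_div_iff hy] at hk
    rw [← hk]; ring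
  refine ⟨algebraMap K Ω (t : K), algebraMap_mem_semilocalRing c t, conj_coe σ _,
    ⟨algebraMap K Ω (q1 : K) * s⁻¹, Subring.mul_mem _ (algebraMap_mem_semilocalRing c q1)
      (inv_mem_semilocalRing hc z), ?_⟩,
    ⟨algebraMap K Ω (q2 : K) * s⁻¹, Subring.mul_mem _ (algebraMap_mem_semilocalRing c q2)
      (inv_mem_semilocalRing hc z), ?_⟩⟩
  · rw [hx]
    field_simp
    linear_combination g1
  · rw [hx]
    field_simp
    linear_combination g2

end Quadratic

/-! ### Similitudes of degree two and congruences modulo `c` -/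

section Matrices

variable {K Ω : Type*} [Field K] [NumberField K] [Field Ω] [NumberField Ω] [Algebra K Ω]

theorem forall_idx {p : Fin 2 ⊕ Fin 2 → Prop} :
    (∀ i, p i) ↔ p (Sum.inl 0) ∧ p (Sum.inl 1) ∧ p (Sum.inr 0) ∧ p (Sum.inr 1) := by
  simp [Sum.forall, Fin.forall_fin_two, and_assoc]

theorem sum_idx {A : Type*} [AddCommMonoid A] (f : Fin 2 ⊕ Fin 2 → A) :
    ∑ i, f i = f (Sum.inl 0) + f (Sum.inl 1) + f (Sum.inr 0) + f (Sum.inr 1) := by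
  simp [Fintype.sum_sum_type, Fin.sum_univ_two, add_assoc]

/-- The defining relation of a similitude, entry by entry. -/
theorem hasSimilitude_iff {σ : Ω ≃ₐ[K] Ω} {M : Matrix (Fin 2 ⊕ Fin 2) (Fin 2 ⊕ Fin 2) Ω} {m : K} :
    HasSimilitude σ M m ↔ ∀ i j, σ (M (Sum.inl 0) i) * M (Sum.inr 0) j +
      σ (M (Sum.inl 1) i) * M (Sum.inr 1) j - σ (M (Sum.inr 0) i) * M (Sum.inl 0) j -
      σ (M (Sum.inr 1) i) * M (Sum.inl 1) j = algebraMap K Ω m * symplecticJ 2 Ω i j := by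
  unfold HasSimilitude
  rw [← Matrix.ext_iff]
  refine forall_congr' fun i => forall_congr' fun j => ?_
  rw [Matrix.mul_apply, Matrix.smul_apply, Algebra.smul_def, sum_idx]
  simp only [Matrix.mul_apply, sum_idx, conjTr, symplecticJ, Matrix.transpose_apply,
    Matrix.map_apply, fromBlocks_apply₁₁, fromBlocks_apply₁₂, fromBlocks_apply₂₁,
    fromBlocks_apply₂₂, Matrix.zero_apply, Matrix.neg_apply, Matrix.one_apply]
  refine Eq.congr ?_ rfl
  simp
  ring

/-- The relation `M* J M = m J` also holds with `M` and `M*` exchanged, since `J² = -1` makes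
`-m⁻¹ J M* J` a left inverse of `M`, hence a right inverse. -/
theorem HasSimilitude.mul_conjTr {n : ℕ} {σ : Ω ≃ₐ[K] Ω}
    {M : Matrix (Fin n ⊕ Fin n) (Fin n ⊕ Fin n) Ω} {m : K}
    (hm : m ≠ 0) (h : HasSimilitude σ M m) : M * symplecticJ n Ω * conjTr σ M =
      m • symplecticJ n Ω := by
  unfold HasSimilitude at h
  have h1 : (m⁻¹ • (-symplecticJ n Ω * conjTr σ M * symplecticJ n Ω)) * M = 1 := by
    rw [Matrix.smul_mul, Matrix.mul_assoc, Matrix.mul_assoc, ← Matrix.mul_assoc (conjTr σ _), h,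
      Matrix.mul_smul, symplecticJ_mul_neg, smul_smul, inv_mul_cancel₀ hm, one_smul]
  have h2 := mul_eq_one_comm.1 h1
  rw [Matrix.mul_smul] at h2
  have h3 : symplecticJ n Ω * -symplecticJ n Ω = 1 := by
    rw [mul_neg, ← neg_mul, symplecticJ_mul_neg]
  have h4 : M * (-symplecticJ n Ω * conjTr σ M * symplecticJ n Ω) = m • 1 := by
    rw [← h2, smul_smul, mul_inv_cancel₀ hm, one_smul]
  calc M * symplecticJ n Ω * conjTr σ M
      = M * (-symplecticJ n Ω * conjTr σ M * symplecticJ n Ω) * symplecticJ n Ω := by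
        simp only [Matrix.neg_mul, Matrix.mul_neg, Matrix.mul_assoc] at h3 ⊢
        have h5 : symplecticJ n Ω * symplecticJ n Ω = -1 := by rw [← h3, neg_neg]
        rw [h5]
        simp
    _ = m • symplecticJ n Ω := by rw [h4, Matrix.smul_mul, Matrix.one_mul]

theorem map_symplecticJ (σ : Ω ≃ₐ[K] Ω) (n : ℕ) :
    (symplecticJ n Ω).map σ = symplecticJ n Ω := by
  ext (i | i) (j | j) <;> simp [symplecticJ, Matrix.one_apply, apply_ite σ]

/-- The transpose of a similitude is a similitude. -/
theorem HasSimilitude.transpose {n : ℕ} {σ : Ω ≃ₐ[K] Ω} (hσ : IsQuadraticConj σ)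
    {M : Matrix (Fin n ⊕ Fin n) (Fin n ⊕ Fin n) Ω} {m : K}
    (hm : m ≠ 0) (h : HasSimilitude σ M m) : HasSimilitude σ Mᵀ m := by
  have h1 := congrArg (fun A : Matrix _ _ Ω => A.map σ) (h.mul_conjTr hm)
  have e : ∀ A B : Matrix (Fin n ⊕ Fin n) (Fin n ⊕ Fin n) Ω,
      (A * B).map σ = A.map σ * B.map σ := fun A B => Matrix.map_mul (f := (σ : Ω →+* Ω))
  simp only [e] at h1
  unfold HasSimilitude
  have e1 : (conjTr σ M).map σ = Mᵀ := by
    ext i j; simp [conjTr, hσ.apply_apply]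
  have e2 : (m • symplecticJ n Ω).map σ = m • symplecticJ n Ω := by
    conv_rhs => rw [← map_symplecticJ σ n]
    ext i j
    change σ (m • _) = m • σ _
    rw [Algebra.smul_def, Algebra.smul_def, map_mul, conj_coe]
  rw [e1, e2, map_symplecticJ] at h1
  exact h1

/-- The element of the general linear group given by a matrix of similitude `m ≠ 0`. -/
noncomputable def simGL {n : ℕ} {σ : Ω ≃ₐ[K] Ω} {M : Matrix (Fin n ⊕ Fin n) (Fin n ⊕ Fin n) Ω}
    {m : K} (hm : m ≠ 0) (h : HasSimilitude σ M m) : GL (Fin n ⊕ Fin n) Ω where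
  val := M
  inv := m⁻¹ • (-symplecticJ n Ω * conjTr σ M * symplecticJ n Ω)
  val_inv := by
    rw [mul_eq_one_comm]
    unfold HasSimilitude at h
    rw [Matrix.smul_mul, Matrix.mul_assoc, Matrix.mul_assoc, ← Matrix.mul_assoc (conjTr σ _), h,
      Matrix.mul_smul, symplecticJ_mul_neg, smul_smul, inv_mul_cancel₀ hm, one_smul]
  inv_val := by
    unfold HasSimilitude at h
    rw [Matrix.smul_mul, Matrix.mul_assoc, Matrix.mul_assoc, ← Matrix.mul_assoc (conjTr σ _), h,
      Matrix.mul_smul, symplecticJ_mul_neg, smul_smul, inv_mul_cancel₀ hm, one_smul]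

/-- The transpose on the general linear group. -/
def transposeGL {n : ℕ} (g : GL (Fin n ⊕ Fin n) Ω) : GL (Fin n ⊕ Fin n) Ω where
  val := g.1ᵀ
  inv := (g⁻¹).1ᵀ
  val_inv := by rw [← Matrix.transpose_mul, ← Units.val_mul, inv_mul_cancel]; simp
  inv_val := by rw [← Matrix.transpose_mul, ← Units.val_mul, mul_inv_cancel]; simp

theorem transposeGL_mul {n : ℕ} (g h : GL (Fin n ⊕ Fin n) Ω) :
    transposeGL (g * h) = transposeGL h * transposeGL g := Units.ext (Matrix.transpose_mul _ _)

theorem transposeGL_transposeGL {n : ℕ} (g : GL (Fin n ⊕ Fin n) Ω) :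
    transposeGL (transposeGL g) = g := Units.ext (Matrix.transpose_transpose _)

theorem transposeGL_mem_modularGroup {n : ℕ} {σ : Ω ≃ₐ[K] Ω} (hσ : IsQuadraticConj σ)
    {g : GL (Fin n ⊕ Fin n) Ω} (hg : g ∈ modularGroup n σ) : transposeGL g ∈ modularGroup n σ := by
  obtain ⟨h1, u, hu⟩ := hg
  exact ⟨fun i j => h1 j i, u, hu.transpose hσ (by simp)⟩

theorem transposeGL_mem_similitudeMonoid {n : ℕ} {σ : Ω ≃ₐ[K] Ω} (hσ : IsQuadraticConj σ)
    {g : GL (Fin n ⊕ Fin n) Ω} (hg : g ∈ similitudeMonoid n σ) :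
    transposeGL g ∈ similitudeMonoid n σ := by
  obtain ⟨h1, m, hm, hu⟩ := hg
  exact ⟨fun i j => h1 j i, m, hm, hu.transpose hσ (by simpa using hm)⟩

/-- Congruence modulo `c` of matrices over the semilocal ring. -/
def CongrMod (c : 𝓞 K) {n : ℕ} (M N : Matrix (Fin n ⊕ Fin n) (Fin n ⊕ Fin n) Ω) : Prop :=
  ∀ i j, ∃ r ∈ semilocalRing Ω c, M i j = N i j + algebraMap K Ω (c : K) * r

/-- The entries lie in the semilocal ring. -/
def IsSemilocal (c : 𝓞 K) {n : ℕ} (M : Matrix (Fin n ⊕ Fin n) (Fin n ⊕ Fin n) Ω) : Prop :=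
  ∀ i j, M i j ∈ semilocalRing Ω c

variable {c : 𝓞 K} {n : ℕ} {M N P Q : Matrix (Fin n ⊕ Fin n) (Fin n ⊕ Fin n) Ω}

theorem IsIntegralMatrix.isSemilocal (h : IsIntegralMatrix M) (c : 𝓞 K) : IsSemilocal c M :=
  fun i j => mem_semilocalRing_of_isIntegral c (h i j)

theorem IsSemilocal.mul (hM : IsSemilocal c M) (hN : IsSemilocal c N) : IsSemilocal c (M * N) :=
  fun i j => by
    rw [Matrix.mul_apply]
    exact Subring.sum_mem _ fun k _ => Subring.mul_mem _ (hM i k) (hN k j)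

theorem IsSemilocal.transpose (hM : IsSemilocal c M) : IsSemilocal c Mᵀ := fun i j => hM j i

theorem IsSemilocal.conjTr (σ : Ω ≃ₐ[K] Ω) (hM : IsSemilocal c M) : IsSemilocal c (conjTr σ M) :=
  fun i j => conj_mem_semilocalRing σ (hM j i)

theorem CongrMod.refl (M : Matrix (Fin n ⊕ Fin n) (Fin n ⊕ Fin n) Ω) : CongrMod c M M :=
  fun _ _ => ⟨0, Subring.zero_mem _, by simp⟩

theorem CongrMod.symm (h : CongrMod c M N) : CongrMod c N M := fun i j => by
  obtain ⟨r, hr, e⟩ := h i j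
  exact ⟨-r, Subring.neg_mem _ hr, by rw [e]; ring⟩

theorem CongrMod.trans (h : CongrMod c M N) (h' : CongrMod c N P) : CongrMod c M P := fun i j => by
  obtain ⟨r, hr, e⟩ := h i j
  obtain ⟨s, hs, e'⟩ := h' i j
  exact ⟨r + s, Subring.add_mem _ hr hs, by rw [e, e']; ring⟩

theorem CongrMod.transpose (h : CongrMod c M N) : CongrMod c Mᵀ Nᵀ := fun i j => h j i

theorem CongrMod.isSemilocal (h : CongrMod c M N) (hN : IsSemilocal c N) : IsSemilocal c M :=
  fun i j => by
    obtain ⟨r, hr, e⟩ := h i j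
    rw [e]
    exact Subring.add_mem _ (hN i j) (Subring.mul_mem _ (algebraMap_mem_semilocalRing c c) hr)

theorem CongrMod.mul_left (h : CongrMod c M N) (hP : IsSemilocal c P) :
    CongrMod c (P * M) (P * N) := fun i j => by
  choose r hr e using h
  refine ⟨∑ k, P i k * r k j, Subring.sum_mem _ fun k _ => Subring.mul_mem _ (hP i k) (hr k j), ?_⟩
  rw [Matrix.mul_apply, Matrix.mul_apply, Finset.mul_sum, ← Finset.sum_add_distrib]
  exact Finset.sum_congr rfl fun k _ => by rw [e]; ring

theorem CongrMod.mul_right (h : CongrMod c M N) (hP : IsSemilocal c P) :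
    CongrMod c (M * P) (N * P) := by
  have := (h.transpose.mul_left hP.transpose).transpose
  simpa [Matrix.transpose_mul] using this

theorem CongrMod.mul (h : CongrMod c M N) (h' : CongrMod c P Q) (hN : IsSemilocal c N)
    (hP : IsSemilocal c P) : CongrMod c (M * P) (N * Q) :=
  (h.mul_right hP).trans (h'.mul_left hN)

theorem IsSemilocal.inv {σ : Ω ≃ₐ[K] Ω} {g : GL (Fin n ⊕ Fin n) Ω} (h : HasSimilitude σ g.1 (1 : K))
    (hg : IsSemilocal c g.1) : IsSemilocal c (g⁻¹).1 := by
  rw [HasSimilitude.inv_eq one_ne_zero h, inv_one, one_smul]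
  exact (((isIntegralMatrix_symplecticJ n Ω).neg.isSemilocal c).mul (hg.conjTr σ)).mul
    ((isIntegralMatrix_symplecticJ n Ω).isSemilocal c)

/-- The matrices of similitude and determinant `1` over the semilocal ring which are congruent
modulo `c` to elements of the modular group. -/
def approxGroup (n : ℕ) (σ : Ω ≃ₐ[K] Ω) (c : 𝓞 K) :
    Subgroup (GL (Fin n ⊕ Fin n) Ω) where
  carrier := {g | HasSimilitude σ g.1 (1 : K) ∧ g.1.det = 1 ∧
    ∃ γ ∈ modularGroup n σ, CongrMod c g.1 γ.1}
  one_mem' := ⟨HasSimilitude.one σ n, by simp, 1, Subgroup.one_mem _, CongrMod.refl _⟩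
  mul_mem' := by
    rintro g h ⟨h1, h2, γ, h3, h4⟩ ⟨h1', h2', γ', h3', h4'⟩
    refine ⟨by simpa using h1.mul h1', ?_, γ * γ', Subgroup.mul_mem _ h3 h3', ?_⟩
    · rw [Units.val_mul, Matrix.det_mul, h2, h2', one_mul]
    · rw [Units.val_mul, Units.val_mul]
      exact h4.mul h4' (h3.1.isSemilocal c) (h4'.isSemilocal (h3'.1.isSemilocal c))
  inv_mem' := by
    rintro g ⟨h1, h2, γ, h3, h4⟩
    refine ⟨by simpa using h1.inv one_ne_zero, ?_, γ⁻¹, Subgroup.inv_mem _ h3, ?_⟩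
    · have := congrArg Matrix.det (Units.mul_inv g)
      rw [Matrix.det_mul, h2, one_mul, Matrix.det_one] at this
      exact this
    · have hg : IsSemilocal c (g⁻¹).1 := IsSemilocal.inv h1 (h4.isSemilocal (h3.1.isSemilocal c))
      have hγ : IsSemilocal c (γ⁻¹).1 := ((Subgroup.inv_mem _ h3).1).isSemilocal c
      have h5 := (h4.mul_left hg).mul_right hγ
      rw [Units.inv_mul, Matrix.one_mul, Matrix.mul_assoc, Units.mul_inv, Matrix.mul_one] at h5
      exact h5.symm

variable {σ : Ω ≃ₐ[K] Ω}

theorem approxGroup_isSemilocal {g : GL (Fin n ⊕ Fin n) Ω} (hg : g ∈ approxGroup n σ c) :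
    IsSemilocal c g.1 := by
  obtain ⟨h1, h2, γ, h3, h4⟩ := hg
  exact h4.isSemilocal (h3.1.isSemilocal c)

theorem transposeGL_mem_approxGroup (hσ : IsQuadraticConj σ) {g : GL (Fin n ⊕ Fin n) Ω}
    (hg : g ∈ approxGroup n σ c) :
    transposeGL g ∈ approxGroup n σ c := by
  obtain ⟨h1, h2, γ, h3, h4⟩ := hg
  exact ⟨h1.transpose hσ one_ne_zero, (Matrix.det_transpose _).trans h2, transposeGL γ,
    transposeGL_mem_modularGroup hσ h3, h4.transpose⟩

/-- A matrix of similitude and determinant `1` which is congruent modulo `c` to an integral matrix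
of similitude `1` defines an element of `approxGroup`. -/
theorem exists_mem_approxGroup (h : HasSimilitude σ M (1 : K))
    (hd : M.det = 1) (hN : HasSimilitude σ N (1 : K)) (hNi : IsIntegralMatrix N)
    (hc : CongrMod c M N) : ∃ g ∈ approxGroup n σ c, g.1 = M :=
  ⟨simGL one_ne_zero h, ⟨h, hd, simGL one_ne_zero hN, ⟨hNi, 1, by
    rw [Units.val_one, coe_one]; exact hN⟩, hc⟩, rfl⟩

/-! ### Elementary matrices -/

/-- `diag(U, U*⁻¹)` for the upper triangular transvection `U`. -/
def upperLevi (σ : Ω ≃ₐ[K] Ω) (t : Ω) : Matrix (Fin 2 ⊕ Fin 2) (Fin 2 ⊕ Fin 2) Ω :=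
  fromBlocks !![1, t; 0, 1] 0 0 !![1, 0; -σ t, 1]

/-- `diag(U, U*⁻¹)` for the lower triangular transvection `U`. -/
def lowerLevi (σ : Ω ≃ₐ[K] Ω) (t : Ω) : Matrix (Fin 2 ⊕ Fin 2) (Fin 2 ⊕ Fin 2) Ω :=
  fromBlocks !![1, 0; t, 1] 0 0 !![1, -σ t; 0, 1]

/-- The upper unipotent matrix of a hermitian matrix. -/
def upperUnip (σ : Ω ≃ₐ[K] Ω) (a b s : Ω) : Matrix (Fin 2 ⊕ Fin 2) (Fin 2 ⊕ Fin 2) Ω :=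
  fromBlocks 1 !![a, s; σ s, b] 0 1

/-- The lower unipotent matrix of a hermitian matrix. -/
def lowerUnip (σ : Ω ≃ₐ[K] Ω) (a b s : Ω) : Matrix (Fin 2 ⊕ Fin 2) (Fin 2 ⊕ Fin 2) Ω :=
  fromBlocks 1 0 !![a, s; σ s, b] 1

theorem symplecticJ_two : symplecticJ 2 Ω =
    fromBlocks 0 !![1, 0; 0, 1] !![-1, 0; 0, -1] 0 := by
  ext (i | i) (j | j) <;> fin_cases i <;> fin_cases j <;> simp [symplecticJ]

theorem hasSimilitude_upperLevi (hσ : IsQuadraticConj σ) (t : Ω) :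
    HasSimilitude σ (upperLevi σ t) (1 : K) := by
  rw [hasSimilitude_iff, symplecticJ_two]
  simp [upperLevi, hσ.apply_apply]

theorem hasSimilitude_lowerLevi (hσ : IsQuadraticConj σ) (t : Ω) :
    HasSimilitude σ (lowerLevi σ t) (1 : K) := by
  rw [hasSimilitude_iff, symplecticJ_two]
  simp [lowerLevi, hσ.apply_apply]

theorem hasSimilitude_upperUnip (hσ : IsQuadraticConj σ) {a b : Ω} (s : Ω) (ha : σ a = a)
    (hb : σ b = b) : HasSimilitude σ (upperUnip σ a b s) (1 : K) := by
  rw [hasSimilitude_iff, symplecticJ_two]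
  simp [upperUnip, hσ.apply_apply, ha, hb]

theorem hasSimilitude_lowerUnip (hσ : IsQuadraticConj σ) {a b : Ω} (s : Ω) (ha : σ a = a)
    (hb : σ b = b) : HasSimilitude σ (lowerUnip σ a b s) (1 : K) := by
  rw [hasSimilitude_iff, symplecticJ_two]
  simp [lowerUnip, hσ.apply_apply, ha, hb]

/-- Elementary matrices over the semilocal ring lie in `approxGroup`: the same matrix with an
integral parameter congruent to `t` modulo `c` is the required element of the modular group. -/
theorem exists_upperLevi (hσ : IsQuadraticConj σ) {t : Ω} (ht : t ∈ semilocalRing Ω c) :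
    ∃ g ∈ approxGroup 2 σ c, g.1 = upperLevi σ t := by
  obtain ⟨z, hz, r, hr, e⟩ := exists_approx ht
  set y := algebraMap K Ω ((1 + c * z : 𝓞 K) : K) * t
  have hyσ : IsIntegral ℤ (σ y) := hz.map (σ : Ω →+* Ω).toIntAlgHom
  refine exists_mem_approxGroup (hasSimilitude_upperLevi hσ t) ?_ (hasSimilitude_upperLevi hσ y) ?_
      ?_
  · simp [upperLevi, Matrix.det_fromBlocks_zero₂₁]
  · unfold IsIntegralMatrix
    simp [upperLevi, isIntegral_zero, isIntegral_one, hz, hyσ.neg]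
  · have h0 : ∃ r ∈ semilocalRing Ω c, c = 0 ∨ r = 0 := ⟨0, Subring.zero_mem _, Or.inr rfl⟩
    have h3 : ∃ r ∈ semilocalRing Ω c, t = y + algebraMap K Ω (c : K) * r :=
      ⟨-r, Subring.neg_mem _ hr, by rw [e]; ring⟩
    have h4 : ∃ r ∈ semilocalRing Ω c, -σ t = -σ y + algebraMap K Ω (c : K) * r :=
      ⟨σ r, conj_mem_semilocalRing σ hr, by rw [e, map_add, map_mul, conj_coe]; ring⟩
    unfold CongrMod
    simp [upperLevi, h3, h4, h0]

theorem exists_lowerLevi (hσ : IsQuadraticConj σ) {t : Ω} (ht : t ∈ semilocalRing Ω c) :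
    ∃ g ∈ approxGroup 2 σ c, g.1 = lowerLevi σ t := by
  obtain ⟨z, hz, r, hr, e⟩ := exists_approx ht
  set y := algebraMap K Ω ((1 + c * z : 𝓞 K) : K) * t
  have hyσ : IsIntegral ℤ (σ y) := hz.map (σ : Ω →+* Ω).toIntAlgHom
  refine exists_mem_approxGroup (hasSimilitude_lowerLevi hσ t) ?_ (hasSimilitude_lowerLevi hσ y) ?_
      ?_
  · simp [lowerLevi, Matrix.det_fromBlocks_zero₂₁]
  · unfold IsIntegralMatrix
    simp [lowerLevi, isIntegral_zero, isIntegral_one, hz, hyσ.neg]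
  · have h0 : ∃ r ∈ semilocalRing Ω c, c = 0 ∨ r = 0 := ⟨0, Subring.zero_mem _, Or.inr rfl⟩
    have h3 : ∃ r ∈ semilocalRing Ω c, t = y + algebraMap K Ω (c : K) * r :=
      ⟨-r, Subring.neg_mem _ hr, by rw [e]; ring⟩
    have h4 : ∃ r ∈ semilocalRing Ω c, -σ t = -σ y + algebraMap K Ω (c : K) * r :=
      ⟨σ r, conj_mem_semilocalRing σ hr, by rw [e, map_add, map_mul, conj_coe]; ring⟩
    unfold CongrMod
    simp [lowerLevi, h3, h4, h0]

/-- The approximations are obtained by multiplication with elements of `K`, so that those of the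
diagonal entries remain fixed by the conjugation. -/
theorem exists_upperUnip (hσ : IsQuadraticConj σ) {a b s : Ω} (ha : a ∈ semilocalRing Ω c)
    (hb : b ∈ semilocalRing Ω c) (hs : s ∈ semilocalRing Ω c) (ha' : σ a = a) (hb' : σ b = b) :
    ∃ g ∈ approxGroup 2 σ c, g.1 = upperUnip σ a b s := by
  obtain ⟨z, hz, r, hr, e⟩ := exists_approx ha
  obtain ⟨z₁, hz₁, r₁, hr₁, e₁⟩ := exists_approx hb
  obtain ⟨z₂, hz₂, r₂, hr₂, e₂⟩ := exists_approx hs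
  set x := algebraMap K Ω ((1 + c * z : 𝓞 K) : K) * a with hx
  set x₁ := algebraMap K Ω ((1 + c * z₁ : 𝓞 K) : K) * b with hx₁
  set x₂ := algebraMap K Ω ((1 + c * z₂ : 𝓞 K) : K) * s with hx₂
  have hyσ : IsIntegral ℤ (σ x₂) := hz₂.map (σ : Ω →+* Ω).toIntAlgHom
  refine exists_mem_approxGroup (hasSimilitude_upperUnip hσ s ha' hb') ?_
    (hasSimilitude_upperUnip hσ x₂ (a := x) (b := x₁) ?_ ?_) ?_ ?_
  · simp [upperUnip]
  · rw [hx, map_mul, conj_coe, ha']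
  · rw [hx₁, map_mul, conj_coe, hb']
  · unfold IsIntegralMatrix
    simp [upperUnip, Matrix.one_apply, isIntegral_zero, isIntegral_one, hz, hz₁, hz₂, hyσ]
  · have h0 : ∃ r ∈ semilocalRing Ω c, c = 0 ∨ r = 0 := ⟨0, Subring.zero_mem _, Or.inr rfl⟩
    have h1 : ∃ r ∈ semilocalRing Ω c, a = x + algebraMap K Ω (c : K) * r :=
      ⟨-r, Subring.neg_mem _ hr, by rw [e]; ring⟩
    have h2 : ∃ r ∈ semilocalRing Ω c, b = x₁ + algebraMap K Ω (c : K) * r :=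
      ⟨-r₁, Subring.neg_mem _ hr₁, by rw [e₁]; ring⟩
    have h3 : ∃ r ∈ semilocalRing Ω c, s = x₂ + algebraMap K Ω (c : K) * r :=
      ⟨-r₂, Subring.neg_mem _ hr₂, by rw [e₂]; ring⟩
    have h4 : ∃ r ∈ semilocalRing Ω c, σ s = σ x₂ + algebraMap K Ω (c : K) * r :=
      ⟨-σ r₂, Subring.neg_mem _ (conj_mem_semilocalRing σ hr₂), by
        rw [e₂, map_add, map_mul, conj_coe]; ring⟩
    unfold CongrMod
    simp [upperUnip, h1, h2, h3, h4, h0]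

theorem exists_lowerUnip (hσ : IsQuadraticConj σ) {a b s : Ω} (ha : a ∈ semilocalRing Ω c)
    (hb : b ∈ semilocalRing Ω c) (hs : s ∈ semilocalRing Ω c) (ha' : σ a = a) (hb' : σ b = b) :
    ∃ g ∈ approxGroup 2 σ c, g.1 = lowerUnip σ a b s := by
  obtain ⟨z, hz, r, hr, e⟩ := exists_approx ha
  obtain ⟨z₁, hz₁, r₁, hr₁, e₁⟩ := exists_approx hb
  obtain ⟨z₂, hz₂, r₂, hr₂, e₂⟩ := exists_approx hs
  set x := algebraMap K Ω ((1 + c * z : 𝓞 K) : K) * a with hx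
  set x₁ := algebraMap K Ω ((1 + c * z₁ : 𝓞 K) : K) * b with hx₁
  set x₂ := algebraMap K Ω ((1 + c * z₂ : 𝓞 K) : K) * s with hx₂
  have hyσ : IsIntegral ℤ (σ x₂) := hz₂.map (σ : Ω →+* Ω).toIntAlgHom
  refine exists_mem_approxGroup (hasSimilitude_lowerUnip hσ s ha' hb') ?_
    (hasSimilitude_lowerUnip hσ x₂ (a := x) (b := x₁) ?_ ?_) ?_ ?_
  · simp [lowerUnip]
  · rw [hx, map_mul, conj_coe, ha']
  · rw [hx₁, map_mul, conj_coe, hb']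
  · unfold IsIntegralMatrix
    simp [lowerUnip, Matrix.one_apply, isIntegral_zero, isIntegral_one, hz, hz₁, hz₂, hyσ]
  · have h0 : ∃ r ∈ semilocalRing Ω c, c = 0 ∨ r = 0 := ⟨0, Subring.zero_mem _, Or.inr rfl⟩
    have h1 : ∃ r ∈ semilocalRing Ω c, a = x + algebraMap K Ω (c : K) * r :=
      ⟨-r, Subring.neg_mem _ hr, by rw [e]; ring⟩
    have h2 : ∃ r ∈ semilocalRing Ω c, b = x₁ + algebraMap K Ω (c : K) * r :=
      ⟨-r₁, Subring.neg_mem _ hr₁, by rw [e₁]; ring⟩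
    have h3 : ∃ r ∈ semilocalRing Ω c, s = x₂ + algebraMap K Ω (c : K) * r :=
      ⟨-r₂, Subring.neg_mem _ hr₂, by rw [e₂]; ring⟩
    have h4 : ∃ r ∈ semilocalRing Ω c, σ s = σ x₂ + algebraMap K Ω (c : K) * r :=
      ⟨-σ r₂, Subring.neg_mem _ (conj_mem_semilocalRing σ hr₂), by
        rw [e₂, map_add, map_mul, conj_coe]; ring⟩
    unfold CongrMod
    simp [lowerUnip, h1, h2, h3, h4, h0]

/-! ### Reduction of a column -/

theorem mulVec_idx (M : Matrix (Fin 2 ⊕ Fin 2) (Fin 2 ⊕ Fin 2) Ω) (v : Fin 2 ⊕ Fin 2 → Ω)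
    (i : Fin 2 ⊕ Fin 2) : (M *ᵥ v) i = M i (Sum.inl 0) * v (Sum.inl 0) +
      M i (Sum.inl 1) * v (Sum.inl 1) + M i (Sum.inr 0) * v (Sum.inr 0) +
      M i (Sum.inr 1) * v (Sum.inr 1) := by
  simp only [Matrix.mulVec, dotProduct, sum_idx]

theorem mulVec_mem {v : Fin 2 ⊕ Fin 2 → Ω} {M : Matrix (Fin 2 ⊕ Fin 2) (Fin 2 ⊕ Fin 2) Ω}
    (hM : IsSemilocal c M) (hv : ∀ i, v i ∈ semilocalRing Ω c) (i : Fin 2 ⊕ Fin 2) :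
    (M *ᵥ v) i ∈ semilocalRing Ω c := by
  simp only [Matrix.mulVec, dotProduct]
  exact Subring.sum_mem _ fun k _ => Subring.mul_mem _ (hM i k) (hv k)

/-- The first entry of a vector can be made a generator of the ideal of all its entries. -/
theorem exists_mulVec_dvdIn (hc : ¬ IsUnit c) (hc0 : c ≠ 0) (hσ : IsQuadraticConj σ)
    {v : Fin 2 ⊕ Fin 2 → Ω} (hv : ∀ i, v i ∈ semilocalRing Ω c) :
    ∃ g ∈ approxGroup 2 σ c, ∀ i, DvdIn (semilocalRing Ω c) ((g.1 *ᵥ v) (Sum.inl 0))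
      ((g.1 *ᵥ v) i) := by
  set R := semilocalRing Ω c with hR
  -- the first entry becomes a generator of the ideal of the first two entries
  obtain ⟨t, ht, h1, h2⟩ := exists_add_mul_dvdIn hc hc0 hσ (hv (Sum.inl 0)) (hv (Sum.inl 1))
  obtain ⟨g₁, hg₁, e₁⟩ := exists_upperLevi hσ ht
  set w := g₁.1 *ᵥ v with hw
  have hwR : ∀ i, w i ∈ R := mulVec_mem (approxGroup_isSemilocal hg₁) hv
  have hw0 : w (Sum.inl 0) = v (Sum.inl 0) + t * v (Sum.inl 1) := by
    rw [hw, e₁, mulVec_idx]; simp [upperLevi]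
  have hw1 : w (Sum.inl 1) = v (Sum.inl 1) := by
    rw [hw, e₁, mulVec_idx]; simp [upperLevi]
  -- the second entry is cleared
  obtain ⟨k, hk, hk'⟩ : DvdIn R (w (Sum.inl 0)) (w (Sum.inl 1)) := by rw [hw0, hw1]; exact h2
  obtain ⟨g₂, hg₂, e₂⟩ := exists_lowerLevi hσ (Subring.neg_mem _ hk)
  set x := g₂.1 *ᵥ w with hx
  have hxR : ∀ i, x i ∈ R := mulVec_mem (approxGroup_isSemilocal hg₂) hwR
  have hx1 : x (Sum.inl 1) = 0 := by
    rw [hx, e₂, mulVec_idx]; simp [lowerLevi, hk']; ring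
  -- the fourth entry becomes a generator of the ideal of the last two entries
  obtain ⟨t', ht', h3, h4⟩ := exists_add_mul_dvdIn hc hc0 hσ (hxR (Sum.inr 1)) (hxR (Sum.inr 0))
  obtain ⟨g₃, hg₃, e₃⟩ := exists_upperLevi hσ (Subring.neg_mem _ (conj_mem_semilocalRing σ ht'))
  set y := g₃.1 *ᵥ x with hy
  have hyR : ∀ i, y i ∈ R := mulVec_mem (approxGroup_isSemilocal hg₃) hxR
  have hy1 : y (Sum.inl 1) = 0 := by
    rw [hy, e₃, mulVec_idx]; simp [upperLevi, hx1]
  have hy2 : y (Sum.inr 0) = x (Sum.inr 0) := by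
    rw [hy, e₃, mulVec_idx]; simp [upperLevi]
  have hy3 : y (Sum.inr 1) = x (Sum.inr 1) + t' * x (Sum.inr 0) := by
    rw [hy, e₃, mulVec_idx]; simp [upperLevi, hσ.apply_apply]; ring
  -- the first entry becomes a generator of the ideal of the first and the fourth entry
  obtain ⟨s, hs, h5, h6⟩ := exists_add_mul_dvdIn hc hc0 hσ (hyR (Sum.inl 0)) (hyR (Sum.inr 1))
  obtain ⟨g₄, hg₄, e₄⟩ := exists_upperUnip hσ (Subring.zero_mem _) (Subring.zero_mem _) hs
    (map_zero σ) (map_zero σ)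
  refine ⟨g₄ * g₃ * g₂ * g₁, Subgroup.mul_mem _ (Subgroup.mul_mem _ (Subgroup.mul_mem _ hg₄ hg₃)
    hg₂) hg₁, ?_⟩
  have hz : (g₄ * g₃ * g₂ * g₁).1 *ᵥ v = g₄.1 *ᵥ y := by
    rw [hy, hx, hw]
    simp only [Units.val_mul, Matrix.mulVec_mulVec, Matrix.mul_assoc]
  rw [hz, e₄]
  have hz0 : (upperUnip σ 0 0 s *ᵥ y) (Sum.inl 0) = y (Sum.inl 0) + s * y (Sum.inr 1) := by
    rw [mulVec_idx]; simp [upperUnip]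
  have hz1 : (upperUnip σ 0 0 s *ᵥ y) (Sum.inl 1) = σ s * y (Sum.inr 0) := by
    rw [mulVec_idx]; simp [upperUnip, hy1]
  have hz2 : (upperUnip σ 0 0 s *ᵥ y) (Sum.inr 0) = y (Sum.inr 0) := by
    rw [mulVec_idx]; simp [upperUnip]
  have hz3 : (upperUnip σ 0 0 s *ᵥ y) (Sum.inr 1) = y (Sum.inr 1) := by
    rw [mulVec_idx]; simp [upperUnip]
  have h7 : DvdIn R (y (Sum.inr 1)) (y (Sum.inr 0)) := by rw [hy2, hy3]; exact h4
  rw [forall_idx, hz0, hz1, hz2, hz3]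
  exact ⟨DvdIn.refl _ _, (h6.trans h7).mul_left (conj_mem_semilocalRing σ hs), h6.trans h7, h6⟩

/-- An isotropic vector whose first entry divides all others is reduced to a multiple of the first
unit vector, by a matrix whose first row is the first unit vector. -/
theorem exists_mulVec_clear (hσ : IsQuadraticConj σ)
    {v : Fin 2 ⊕ Fin 2 → Ω} (h0 : v (Sum.inl 0) ≠ 0)
    (hd : ∀ i, DvdIn (semilocalRing Ω c) (v (Sum.inl 0)) (v i))
    (hiso : σ (v (Sum.inl 0)) * v (Sum.inr 0) + σ (v (Sum.inl 1)) * v (Sum.inr 1) -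
      σ (v (Sum.inr 0)) * v (Sum.inl 0) - σ (v (Sum.inr 1)) * v (Sum.inl 1) = 0) :
    ∃ g ∈ approxGroup 2 σ c, g.1 *ᵥ v = Pi.single (Sum.inl 0) (v (Sum.inl 0)) ∧
      g.1 (Sum.inl 0) = Pi.single (Sum.inl 0) 1 := by
  obtain ⟨k, hk, hk'⟩ := hd (Sum.inl 1)
  obtain ⟨a, ha, ha'⟩ := hd (Sum.inr 0)
  obtain ⟨b, hb, hb'⟩ := hd (Sum.inr 1)
  have hσ0 : σ (v (Sum.inl 0)) ≠ 0 := by simpa using h0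
  -- `d` is the third entry divided by the first one, once the second entry is cleared
  set d := a + σ k * b with hdd
  have hdσ : σ d = d := by
    rw [hk', ha', hb', map_mul, map_mul, map_mul] at hiso
    have h1 : σ (v (Sum.inl 0)) * v (Sum.inl 0) * (d - σ d) = 0 := by
      rw [hdd, map_add, map_mul, hσ.apply_apply]; linear_combination hiso
    have h2 := (mul_eq_zero.1 h1).resolve_left (mul_ne_zero hσ0 h0)
    exact (sub_eq_zero.1 h2).symm
  have hdR : d ∈ semilocalRing Ω c :=
    Subring.add_mem _ ha (Subring.mul_mem _ (conj_mem_semilocalRing σ hk) hb)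
  obtain ⟨g₁, hg₁, e₁⟩ := exists_lowerLevi hσ (Subring.neg_mem _ hk)
  obtain ⟨g₂, hg₂, e₂⟩ := exists_lowerUnip hσ (Subring.neg_mem _ hdR) (Subring.zero_mem _)
    (Subring.neg_mem _ (conj_mem_semilocalRing σ hb)) (by rw [map_neg, hdσ]) (map_zero σ)
  refine ⟨g₂ * g₁, Subgroup.mul_mem _ hg₂ hg₁, ?_, ?_⟩
  · rw [Units.val_mul, ← Matrix.mulVec_mulVec, e₁, e₂]
    have w0 : (lowerLevi σ (-k) *ᵥ v) (Sum.inl 0) = v (Sum.inl 0) := by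
      rw [mulVec_idx]; simp [lowerLevi]
    have w1 : (lowerLevi σ (-k) *ᵥ v) (Sum.inl 1) = 0 := by
      rw [mulVec_idx]; simp [lowerLevi, hk']; ring
    have w2 : (lowerLevi σ (-k) *ᵥ v) (Sum.inr 0) = d * v (Sum.inl 0) := by
      rw [mulVec_idx]; simp [lowerLevi, ha', hb', hdd]; ring
    have w3 : (lowerLevi σ (-k) *ᵥ v) (Sum.inr 1) = v (Sum.inl 0) * b := by
      rw [mulVec_idx]; simp [lowerLevi, hb']
    ext i
    revert i
    rw [forall_idx]
    simp only [mulVec_idx (lowerUnip σ _ _ _), w0, w1, w2, w3]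
    refine ⟨?_, ?_, ?_, ?_⟩ <;> simp [lowerUnip, hσ.apply_apply]
    ring
  · rw [Units.val_mul, e₁, e₂]
    ext i
    revert i
    rw [forall_idx]
    simp only [Matrix.mul_apply, sum_idx]
    refine ⟨?_, ?_, ?_, ?_⟩ <;> simp [lowerUnip, lowerLevi]

end Matrices

/-! ### Diagonalization over the semilocal ring -/

section Diagonalization

variable {K Ω : Type*} [Field K] [NumberField K] [Field Ω] [NumberField Ω] [Algebra K Ω]
  {σ : Ω ≃ₐ[K] Ω} {c : 𝓞 K}

/-- The double coset of `M` with respect to `approxGroup`. -/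
def approxOrbit (σ : Ω ≃ₐ[K] Ω) (c : 𝓞 K) (M : GL (Fin 2 ⊕ Fin 2) Ω) :
    Set (GL (Fin 2 ⊕ Fin 2) Ω) :=
  {N | ∃ g₁ ∈ approxGroup 2 σ c, ∃ g₂ ∈ approxGroup 2 σ c, N = g₁ * M * g₂}

theorem self_mem_approxOrbit (M : GL (Fin 2 ⊕ Fin 2) Ω) : M ∈ approxOrbit σ c M :=
  ⟨1, Subgroup.one_mem _, 1, Subgroup.one_mem _, by simp⟩

theorem mul_mem_approxOrbit {M N g : GL (Fin 2 ⊕ Fin 2) Ω} (hN : N ∈ approxOrbit σ c M)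
    (hg : g ∈ approxGroup 2 σ c) : g * N ∈ approxOrbit σ c M := by
  obtain ⟨g₁, h₁, g₂, h₂, rfl⟩ := hN
  exact ⟨g * g₁, Subgroup.mul_mem _ hg h₁, g₂, h₂, by simp [mul_assoc]⟩

theorem transposeGL_mem_approxOrbit (hσ : IsQuadraticConj σ) {M N : GL (Fin 2 ⊕ Fin 2) Ω}
    (hN : N ∈ approxOrbit σ c M) : transposeGL N ∈ approxOrbit σ c (transposeGL M) := by
  obtain ⟨g₁, h₁, g₂, h₂, rfl⟩ := hN
  exact ⟨_, transposeGL_mem_approxGroup hσ h₂, _, transposeGL_mem_approxGroup hσ h₁, by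
    rw [transposeGL_mul, transposeGL_mul, mul_assoc]⟩

theorem approxOrbit_isSemilocal {M N : GL (Fin 2 ⊕ Fin 2) Ω} (hM : IsSemilocal c M.1)
    (hN : N ∈ approxOrbit σ c M) : IsSemilocal c N.1 := by
  obtain ⟨g₁, h₁, g₂, h₂, rfl⟩ := hN
  exact ((approxGroup_isSemilocal h₁).mul hM).mul (approxGroup_isSemilocal h₂)

theorem approxOrbit_hasSimilitude {M N : GL (Fin 2 ⊕ Fin 2) Ω} {m : K}
    (hM : HasSimilitude σ M.1 m) (hN : N ∈ approxOrbit σ c M) : HasSimilitude σ N.1 m := by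
  obtain ⟨g₁, h₁, g₂, h₂, rfl⟩ := hN
  have := (h₁.1.mul hM).mul h₂.1
  rwa [one_mul, mul_one] at this

/-- The upper left entry of `N` is minimal for divisibility in the double coset of `M`. -/
def IsMinimalIn (σ : Ω ≃ₐ[K] Ω) (c : 𝓞 K) (M N : GL (Fin 2 ⊕ Fin 2) Ω) : Prop :=
  ∀ N' ∈ approxOrbit σ c M,
    DvdIn (semilocalRing Ω c) (N'.1 (Sum.inl 0) (Sum.inl 0)) (N.1 (Sum.inl 0) (Sum.inl 0)) →
    DvdIn (semilocalRing Ω c) (N.1 (Sum.inl 0) (Sum.inl 0)) (N'.1 (Sum.inl 0) (Sum.inl 0))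

theorem IsMinimalIn.transpose (hσ : IsQuadraticConj σ) {M N : GL (Fin 2 ⊕ Fin 2) Ω}
    (h : IsMinimalIn σ c M N) : IsMinimalIn σ c (transposeGL M) (transposeGL N) := by
  intro N' hN' hd
  have h1 := transposeGL_mem_approxOrbit hσ hN'
  rw [transposeGL_transposeGL] at h1
  exact h (transposeGL N') h1 hd

theorem mul_apply_mulVec (g N : Matrix (Fin 2 ⊕ Fin 2) (Fin 2 ⊕ Fin 2) Ω) (i j : Fin 2 ⊕ Fin 2) :
    (g * N) i j = (g *ᵥ fun k => N k j) i := by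
  simp only [Matrix.mul_apply, Matrix.mulVec, dotProduct]

/-- A minimal upper left entry divides its column: a generator of the ideal of the entries of this
column can be moved to the upper left corner. -/
theorem IsMinimalIn.dvdIn_col (hc : ¬ IsUnit c) (hc0 : c ≠ 0) (hσ : IsQuadraticConj σ)
    {M N : GL (Fin 2 ⊕ Fin 2) Ω} (hM : IsSemilocal c M.1) (hN : N ∈ approxOrbit σ c M)
    (h : IsMinimalIn σ c M N) (i : Fin 2 ⊕ Fin 2) :
    DvdIn (semilocalRing Ω c) (N.1 (Sum.inl 0) (Sum.inl 0)) (N.1 i (Sum.inl 0)) := by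
  have hNR := approxOrbit_isSemilocal hM hN
  obtain ⟨g, hg, hd⟩ := exists_mulVec_dvdIn hc hc0 hσ (v := fun k => N.1 k (Sum.inl 0))
    (fun k => hNR k _)
  simp only [← mul_apply_mulVec] at hd
  have key : ∀ i, DvdIn (semilocalRing Ω c) ((g.1 * N.1) (Sum.inl 0) (Sum.inl 0))
      (N.1 i (Sum.inl 0)) := by
    intro i
    have e : N.1 = (g⁻¹).1 * (g.1 * N.1) := by
      rw [← Matrix.mul_assoc, Units.inv_mul, Matrix.one_mul]
    have hgi := approxGroup_isSemilocal (Subgroup.inv_mem _ hg)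
    have e' : N.1 i (Sum.inl 0) = ((g⁻¹).1 * (g.1 * N.1)) i (Sum.inl 0) := by rw [← e]
    generalize g.1 * N.1 = X at hd e' ⊢
    rw [e', Matrix.mul_apply, sum_idx]
    exact (((hd _).mul_left (hgi _ _)).add ((hd _).mul_left (hgi _ _))).add
      ((hd _).mul_left (hgi _ _)) |>.add ((hd _).mul_left (hgi _ _))
  exact (h (g * N) (mul_mem_approxOrbit hN hg) (key _)).trans (key i)

theorem IsMinimalIn.dvdIn_row (hc : ¬ IsUnit c) (hc0 : c ≠ 0) (hσ : IsQuadraticConj σ)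
    {M N : GL (Fin 2 ⊕ Fin 2) Ω} (hM : IsSemilocal c M.1) (hN : N ∈ approxOrbit σ c M)
    (h : IsMinimalIn σ c M N) (j : Fin 2 ⊕ Fin 2) :
    DvdIn (semilocalRing Ω c) (N.1 (Sum.inl 0) (Sum.inl 0)) (N.1 (Sum.inl 0) j) :=
  IsMinimalIn.dvdIn_col hc hc0 hσ (M := transposeGL M) (N := transposeGL N) hM.transpose
    (transposeGL_mem_approxOrbit hσ hN) (h.transpose hσ) j

/-- The first row and the first column of `N` are `α` times the first unit vector. -/
structure IsSplitOff (α : Ω) (N : Matrix (Fin 2 ⊕ Fin 2) (Fin 2 ⊕ Fin 2) Ω) : Prop where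
  col : ∀ i, N i (Sum.inl 0) = (Pi.single (Sum.inl 0) α : Fin 2 ⊕ Fin 2 → Ω) i
  row : ∀ j, N (Sum.inl 0) j = (Pi.single (Sum.inl 0) α : Fin 2 ⊕ Fin 2 → Ω) j

theorem IsSplitOff.transpose {α : Ω} {N : Matrix (Fin 2 ⊕ Fin 2) (Fin 2 ⊕ Fin 2) Ω}
    (h : IsSplitOff α N) : IsSplitOff α Nᵀ := ⟨h.row, h.col⟩

/-- If the first row and column are trivial, so is the third row, by the pairing of the first
column with all columns. -/
theorem IsSplitOff.row_inr {α : Ω} {N : Matrix (Fin 2 ⊕ Fin 2) (Fin 2 ⊕ Fin 2) Ω} {m : K}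
    (h : IsSplitOff α N) (hα : α ≠ 0) (hN : HasSimilitude σ N m) (j : Fin 2 ⊕ Fin 2) :
    N (Sum.inr 0) j = (Pi.single (Sum.inr 0) (algebraMap K Ω m / σ α) : Fin 2 ⊕ Fin 2 → Ω) j := by
  have hσα : σ α ≠ 0 := by simpa using hα
  have h1 := hasSimilitude_iff.1 hN (Sum.inl 0) j
  simp only [h.col, h.row, symplecticJ_two] at h1
  have h2 : σ α * N (Sum.inr 0) j = algebraMap K Ω m *
      (Pi.single (Sum.inr 0) 1 : Fin 2 ⊕ Fin 2 → Ω) j := by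
    revert h1; revert j
    rw [forall_idx]; simp
  have h3 : N (Sum.inr 0) j = (algebraMap K Ω m / σ α) *
      (Pi.single (Sum.inr 0) 1 : Fin 2 ⊕ Fin 2 → Ω) j := by
    field_simp; linear_combination h2
  rw [h3]
  revert j
  rw [forall_idx]; simp

/-- Multiplication from the left by a matrix whose first row is the first unit vector does not
change the first row. -/
theorem mul_apply_of_row_eq_single {g : Matrix (Fin 2 ⊕ Fin 2) (Fin 2 ⊕ Fin 2) Ω}
    (hg : g (Sum.inl 0) = Pi.single (Sum.inl 0) 1) (N : Matrix (Fin 2 ⊕ Fin 2) (Fin 2 ⊕ Fin 2) Ω)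
    (j : Fin 2 ⊕ Fin 2) : (g * N) (Sum.inl 0) j = N (Sum.inl 0) j := by
  rw [Matrix.mul_apply, sum_idx, hg]; simp

theorem IsMinimalIn.congr {M N N₁ : GL (Fin 2 ⊕ Fin 2) Ω} (h : IsMinimalIn σ c M N)
    (e : N₁.1 (Sum.inl 0) (Sum.inl 0) = N.1 (Sum.inl 0) (Sum.inl 0)) : IsMinimalIn σ c M N₁ := by
  intro N' hN' hd
  rw [e] at hd ⊢
  exact h N' hN' hd

theorem exists_isMinimalIn (hc : ¬ IsUnit c) {M : GL (Fin 2 ⊕ Fin 2) Ω}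
    (hM : IsSemilocal c M.1) : ∃ N ∈ approxOrbit σ c M, IsMinimalIn σ c M N := by
  obtain ⟨α, ⟨N, hN, e⟩, hmin⟩ := exists_dvdIn_minimal hc
    (X := {x | ∃ N ∈ approxOrbit σ c M, N.1 (Sum.inl 0) (Sum.inl 0) = x})
    ⟨_, M, self_mem_approxOrbit M, rfl⟩ (by
      rintro _ ⟨N, hN, rfl⟩
      exact approxOrbit_isSemilocal hM hN _ _)
  refine ⟨N, hN, fun N' hN' hd => ?_⟩
  rw [e] at hd ⊢
  exact hmin _ ⟨N', hN', rfl⟩ hd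

theorem IsMinimalIn.ne_zero (hc : ¬ IsUnit c) (hc0 : c ≠ 0) (hσ : IsQuadraticConj σ)
    {M N : GL (Fin 2 ⊕ Fin 2) Ω} (hM : IsSemilocal c M.1) (hN : N ∈ approxOrbit σ c M)
    (h : IsMinimalIn σ c M N) : N.1 (Sum.inl 0) (Sum.inl 0) ≠ 0 := by
  intro h0
  have hcol : ∀ i, N.1 i (Sum.inl 0) = 0 := by
    intro i
    obtain ⟨r, -, e⟩ := h.dvdIn_col hc hc0 hσ hM hN i
    rw [e, h0, zero_mul]
  have h1 := congrFun (congrFun (Units.inv_mul N) (Sum.inl 0)) (Sum.inl 0)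
  rw [Matrix.mul_apply] at h1
  simp [hcol] at h1

/-- The column below a minimal upper left entry can be cleared without changing the first row. -/
theorem IsMinimalIn.exists_clear (hc : ¬ IsUnit c) (hc0 : c ≠ 0) (hσ : IsQuadraticConj σ)
    {M N : GL (Fin 2 ⊕ Fin 2) Ω} (hM : IsSemilocal c M.1) {m : K}
    (hMs : HasSimilitude σ M.1 m) (hN : N ∈ approxOrbit σ c M) (h : IsMinimalIn σ c M N) :
    ∃ N₁ ∈ approxOrbit σ c M, (∀ i, N₁.1 i (Sum.inl 0) =
      (Pi.single (Sum.inl 0) (N.1 (Sum.inl 0) (Sum.inl 0)) : Fin 2 ⊕ Fin 2 → Ω) i) ∧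
      ∀ j, N₁.1 (Sum.inl 0) j = N.1 (Sum.inl 0) j := by
  have iso : σ (N.1 (Sum.inl 0) (Sum.inl 0)) * N.1 (Sum.inr 0) (Sum.inl 0) +
      σ (N.1 (Sum.inl 1) (Sum.inl 0)) * N.1 (Sum.inr 1) (Sum.inl 0) -
      σ (N.1 (Sum.inr 0) (Sum.inl 0)) * N.1 (Sum.inl 0) (Sum.inl 0) -
      σ (N.1 (Sum.inr 1) (Sum.inl 0)) * N.1 (Sum.inl 1) (Sum.inl 0) = 0 := by
    rw [hasSimilitude_iff.1 (approxOrbit_hasSimilitude hMs hN), symplecticJ_two]; simp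
  obtain ⟨g, hg, hg1, hg2⟩ := exists_mulVec_clear hσ (v := fun k => N.1 k (Sum.inl 0))
    (h.ne_zero hc hc0 hσ hM hN) (h.dvdIn_col hc hc0 hσ hM hN) iso
  refine ⟨g * N, mul_mem_approxOrbit hN hg, fun i => ?_, fun j => ?_⟩
  · rw [Units.val_mul, mul_apply_mulVec, hg1]
  · rw [Units.val_mul, mul_apply_of_row_eq_single hg2]

/-- Splitting off a hyperbolic plane: an element of the double coset with minimal upper left entry
can be chosen with trivial first row and column. -/
theorem exists_isSplitOff (hc : ¬ IsUnit c) (hc0 : c ≠ 0) (hσ : IsQuadraticConj σ)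
    {M : GL (Fin 2 ⊕ Fin 2) Ω} (hM : IsSemilocal c M.1) {m : K} (hm : m ≠ 0)
    (hMs : HasSimilitude σ M.1 m) :
    ∃ α : Ω, α ≠ 0 ∧ ∃ N ∈ approxOrbit σ c M, IsMinimalIn σ c M N ∧ IsSplitOff α N.1 := by
  obtain ⟨N, hN, hmin⟩ := exists_isMinimalIn (σ := σ) hc hM
  have hα := hmin.ne_zero hc hc0 hσ hM hN
  obtain ⟨N₁, hN₁, h1, -⟩ := hmin.exists_clear hc hc0 hσ hM hMs hN
  have hmin₁ : IsMinimalIn σ c M N₁ := hmin.congr (by rw [h1, Pi.single_eq_same])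
  -- the first row is cleared as the first column of the transpose
  have hM' : IsSemilocal c (transposeGL M).1 := hM.transpose
  have hMs' : HasSimilitude σ (transposeGL M).1 m := hMs.transpose hσ hm
  have hmin' := hmin₁.transpose hσ
  have hN₁' := transposeGL_mem_approxOrbit hσ hN₁
  obtain ⟨N₂, hN₂, h2, h3⟩ := hmin'.exists_clear hc hc0 hσ hM' hMs' hN₁'
  have hN₃ := transposeGL_mem_approxOrbit hσ hN₂
  rw [transposeGL_transposeGL] at hN₃
  have hcol : ∀ i, (transposeGL N₂).1 i (Sum.inl 0) = N₁.1 i (Sum.inl 0) := h3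
  have hrow : ∀ j, (transposeGL N₂).1 (Sum.inl 0) j =
    (Pi.single (Sum.inl 0) (N₁.1 (Sum.inl 0) (Sum.inl 0)) : Fin 2 ⊕ Fin 2 → Ω) j := h2
  refine ⟨N.1 (Sum.inl 0) (Sum.inl 0), hα, transposeGL N₂, hN₃, hmin₁.congr (hcol _), ?_⟩
  refine ⟨fun i => ?_, fun j => ?_⟩
  · rw [hcol, h1]
  · rw [hrow, h1, Pi.single_eq_same]

/-- A minimal entry which is split off divides the second and the fourth row: adding one of these
rows to the first one leaves the upper left entry unchanged, hence minimal. -/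
theorem IsSplitOff.dvdIn (hc : ¬ IsUnit c) (hc0 : c ≠ 0) (hσ : IsQuadraticConj σ)
    {M N : GL (Fin 2 ⊕ Fin 2) Ω} (hM : IsSemilocal c M.1) (hN : N ∈ approxOrbit σ c M)
    (h : IsMinimalIn σ c M N) {α : Ω} (hs : IsSplitOff α N.1) (j : Fin 2 ⊕ Fin 2) :
    DvdIn (semilocalRing Ω c) α (N.1 (Sum.inl 1) j) ∧
      DvdIn (semilocalRing Ω c) α (N.1 (Sum.inr 1) j) := by
  have key : ∀ g ∈ approxGroup 2 σ c, (g.1 * N.1) (Sum.inl 0) (Sum.inl 0) = α →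
      DvdIn (semilocalRing Ω c) α ((g.1 * N.1) (Sum.inl 0) j) := by
    intro g hg e
    have h1 : IsMinimalIn σ c M (g * N) := by
      intro N' hN' hd
      rw [Units.val_mul, e] at hd ⊢
      have h2 : N.1 (Sum.inl 0) (Sum.inl 0) = α := by rw [hs.col]; simp
      have h3 := h N' hN'
      rw [h2] at h3
      exact h3 hd
    have h2 := h1.dvdIn_row hc hc0 hσ hM (mul_mem_approxOrbit hN hg) j
    rw [Units.val_mul, e] at h2
    exact h2
  have hrow : DvdIn (semilocalRing Ω c) α (N.1 (Sum.inl 0) j) := by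
    rw [hs.row]
    revert j
    rw [forall_idx]
    simp [DvdIn.refl, DvdIn.zero]
  constructor
  · obtain ⟨g, hg, e⟩ := exists_upperLevi hσ (c := c) (Subring.one_mem _)
    have e1 : ∀ j, (g.1 * N.1) (Sum.inl 0) j = N.1 (Sum.inl 0) j + N.1 (Sum.inl 1) j := by
      intro j; rw [e, Matrix.mul_apply, sum_idx]; simp [upperLevi]
    have h1 := key g hg (by rw [e1, hs.col, hs.col]; simp)
    rw [e1] at h1
    have := h1.add hrow.neg
    simpa using this
  · obtain ⟨g, hg, e⟩ := exists_upperUnip hσ (c := c) (Subring.zero_mem _) (Subring.zero_mem _)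
      (Subring.one_mem _) (map_zero σ) (map_zero σ)
    have e1 : ∀ j, (g.1 * N.1) (Sum.inl 0) j = N.1 (Sum.inl 0) j + N.1 (Sum.inr 1) j := by
      intro j; rw [e, Matrix.mul_apply, sum_idx]; simp [upperUnip]
    have h1 := key g hg (by rw [e1, hs.col, hs.col]; simp)
    rw [e1] at h1
    have := h1.add hrow.neg
    simpa using this

end Diagonalization

section Diagonalization

variable {K Ω : Type*} [Field K] [NumberField K] [Field Ω] [NumberField Ω] [Algebra K Ω]
  {σ : Ω ≃ₐ[K] Ω} {c : 𝓞 K}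

/-- Among the elements of the double coset of `M` with split off entry `α`, the second diagonal
entry of `N` is minimal for divisibility. -/
def IsMinimalSplit (σ : Ω ≃ₐ[K] Ω) (c : 𝓞 K) (α : Ω) (M N : GL (Fin 2 ⊕ Fin 2) Ω) : Prop :=
  ∀ N' ∈ approxOrbit σ c M, IsSplitOff α N'.1 →
    DvdIn (semilocalRing Ω c) (N'.1 (Sum.inl 1) (Sum.inl 1)) (N.1 (Sum.inl 1) (Sum.inl 1)) →
    DvdIn (semilocalRing Ω c) (N.1 (Sum.inl 1) (Sum.inl 1)) (N'.1 (Sum.inl 1) (Sum.inl 1))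

theorem IsMinimalSplit.transpose (hσ : IsQuadraticConj σ) {α : Ω} {M N : GL (Fin 2 ⊕ Fin 2) Ω}
    (h : IsMinimalSplit σ c α M N) :
    IsMinimalSplit σ c α (transposeGL M) (transposeGL N) := by
  intro N' hN' hs hd
  have h1 := transposeGL_mem_approxOrbit hσ hN'
  rw [transposeGL_transposeGL] at h1
  exact h (transposeGL N') h1 hs.transpose hd

theorem IsMinimalSplit.congr {α : Ω} {M N N₁ : GL (Fin 2 ⊕ Fin 2) Ω}
    (h : IsMinimalSplit σ c α M N)
    (e : N₁.1 (Sum.inl 1) (Sum.inl 1) = N.1 (Sum.inl 1) (Sum.inl 1)) :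
    IsMinimalSplit σ c α M N₁ := by
  intro N' hN' hs hd
  rw [e] at hd ⊢
  exact h N' hN' hs hd

/-- The unipotent matrices which add a multiple of the fourth row to the second one, or conversely,
preserve the part which is split off. -/
theorem IsSplitOff.shear {α t : Ω} {N : Matrix (Fin 2 ⊕ Fin 2) (Fin 2 ⊕ Fin 2) Ω}
    (h : IsSplitOff α N) : IsSplitOff α (upperUnip σ 0 t 0 * N) ∧
      (∀ j, (upperUnip σ 0 t 0 * N) (Sum.inl 1) j = N (Sum.inl 1) j + t * N (Sum.inr 1) j) ∧
      IsSplitOff α (lowerUnip σ 0 t 0 * N) ∧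
      (∀ j, (lowerUnip σ 0 t 0 * N) (Sum.inl 1) j = N (Sum.inl 1) j) ∧
      (∀ j, (lowerUnip σ 0 t 0 * N) (Sum.inr 1) j = N (Sum.inr 1) j + t * N (Sum.inl 1) j) := by
  have e0 : ∀ i, N i (Sum.inl 0) = (Pi.single (Sum.inl 0) α : Fin 2 ⊕ Fin 2 → Ω) i := h.col
  refine ⟨⟨?_, fun j => ?_⟩, fun j => ?_, ⟨?_, fun j => ?_⟩, fun j => ?_, fun j => ?_⟩
  · rw [forall_idx]
    simp only [Matrix.mul_apply, sum_idx, e0]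
    simp [upperUnip]
  · rw [← h.row]
    simp only [Matrix.mul_apply, sum_idx]
    simp [upperUnip]
  · simp only [Matrix.mul_apply, sum_idx]
    simp [upperUnip]
  · rw [forall_idx]
    simp only [Matrix.mul_apply, sum_idx, e0]
    simp [lowerUnip]
  · rw [← h.row]
    simp only [Matrix.mul_apply, sum_idx]
    simp [lowerUnip]
  · simp only [Matrix.mul_apply, sum_idx]
    simp [lowerUnip]
  · simp only [Matrix.mul_apply, sum_idx]
    simp [lowerUnip, add_comm]

/-- The second column is isotropic, and its pairing with the fourth column is `m`. -/
theorem IsSplitOff.isotropic {α : Ω} (hα : α ≠ 0) {N : Matrix (Fin 2 ⊕ Fin 2) (Fin 2 ⊕ Fin 2) Ω}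
    {m : K} (h : IsSplitOff α N) (hN : HasSimilitude σ N m) :
    σ (N (Sum.inl 1) (Sum.inl 1)) * N (Sum.inr 1) (Sum.inl 1) =
      σ (N (Sum.inr 1) (Sum.inl 1)) * N (Sum.inl 1) (Sum.inl 1) ∧
    σ (N (Sum.inl 1) (Sum.inl 1)) * N (Sum.inr 1) (Sum.inr 1) -
      σ (N (Sum.inr 1) (Sum.inl 1)) * N (Sum.inl 1) (Sum.inr 1) = algebraMap K Ω m := by
  have h1 := hasSimilitude_iff.1 hN (Sum.inl 1) (Sum.inl 1)
  have h2 := hasSimilitude_iff.1 hN (Sum.inl 1) (Sum.inr 1)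
  rw [h.row, h.row_inr hα hN, symplecticJ_two] at h1
  rw [h.row, h.row_inr hα hN, h.row, h.row_inr hα hN, symplecticJ_two] at h2
  simp at h1 h2
  exact ⟨by linear_combination h1, h2⟩

/-- As the second column is isotropic, a generator of the ideal of its entries is obtained by adding
a multiple with a factor fixed by the conjugation; such a step is realized by an upper unipotent
matrix. -/
theorem IsMinimalSplit.dvdIn_col (hc : ¬ IsUnit c) (hc0 : c ≠ 0) (hσ : IsQuadraticConj σ)
    {α : Ω} (hα : α ≠ 0) {m : K} {M N : GL (Fin 2 ⊕ Fin 2) Ω} (hM : HasSimilitude σ M.1 m)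
    (hN : N ∈ approxOrbit σ c M) (h : IsMinimalSplit σ c α M N) (hs : IsSplitOff α N.1) :
    DvdIn (semilocalRing Ω c) (N.1 (Sum.inl 1) (Sum.inl 1)) (N.1 (Sum.inr 1) (Sum.inl 1)) := by
  obtain ⟨t, ht, ht', h1, h2⟩ := exists_add_mul_dvdIn_of_fixed hc hc0 hσ
    (x := N.1 (Sum.inl 1) (Sum.inl 1)) (y := N.1 (Sum.inr 1) (Sum.inl 1)) (by
      rw [map_mul, hσ.apply_apply, (hs.isotropic hα (approxOrbit_hasSimilitude hM hN)).1, mul_comm])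
  obtain ⟨g, hg, e⟩ := exists_upperUnip hσ (c := c) (Subring.zero_mem _) ht (Subring.zero_mem _)
    (map_zero σ) ht'
  obtain ⟨s1, s2, -⟩ := hs.shear (σ := σ) (t := t)
  have hgN : (g * N).1 = upperUnip σ 0 t 0 * N.1 := by rw [Units.val_mul, e]
  have h3 := h (g * N) (mul_mem_approxOrbit hN hg) (by rw [hgN]; exact s1)
    (by rw [hgN, s2]; exact h1)
  rw [hgN, s2] at h3
  exact h3.trans h2

theorem IsMinimalSplit.dvdIn_row (hc : ¬ IsUnit c) (hc0 : c ≠ 0) (hσ : IsQuadraticConj σ)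
    {α : Ω} (hα : α ≠ 0) {m : K} (hm : m ≠ 0) {M N : GL (Fin 2 ⊕ Fin 2) Ω}
    (hM : HasSimilitude σ M.1 m)
    (hN : N ∈ approxOrbit σ c M) (h : IsMinimalSplit σ c α M N) (hs : IsSplitOff α N.1) :
    DvdIn (semilocalRing Ω c) (N.1 (Sum.inl 1) (Sum.inl 1)) (N.1 (Sum.inl 1) (Sum.inr 1)) := by
  have hM' : HasSimilitude σ (transposeGL M).1 m := hM.transpose hσ hm
  exact (h.transpose hσ).dvdIn_col hc hc0 hσ hα hM' (transposeGL_mem_approxOrbit hσ hN) hs.transpose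

theorem exists_isMinimalSplit (hc : ¬ IsUnit c) {M : GL (Fin 2 ⊕ Fin 2) Ω}
    (hM : IsSemilocal c M.1) {α : Ω} {N : GL (Fin 2 ⊕ Fin 2) Ω} (hN : N ∈ approxOrbit σ c M)
    (hs : IsSplitOff α N.1) :
    ∃ N ∈ approxOrbit σ c M, IsSplitOff α N.1 ∧ IsMinimalSplit σ c α M N := by
  obtain ⟨β, ⟨N, hN, hs, e⟩, hmin⟩ := exists_dvdIn_minimal hc
    (X := {x | ∃ N ∈ approxOrbit σ c M, IsSplitOff α N.1 ∧ N.1 (Sum.inl 1) (Sum.inl 1) = x})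
    ⟨_, N, hN, hs, rfl⟩ (by
      rintro _ ⟨N, hN, -, rfl⟩
      exact approxOrbit_isSemilocal hM hN _ _)
  refine ⟨N, hN, hs, fun N' hN' hs' hd => ?_⟩
  rw [e] at hd ⊢
  exact hmin _ ⟨N', hN', hs', rfl⟩ hd

theorem IsMinimalSplit.ne_zero (hc : ¬ IsUnit c) (hc0 : c ≠ 0) (hσ : IsQuadraticConj σ)
    {α : Ω} (hα : α ≠ 0) {m : K} (hm : m ≠ 0) {M N : GL (Fin 2 ⊕ Fin 2) Ω}
    (hM : HasSimilitude σ M.1 m)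
    (hN : N ∈ approxOrbit σ c M) (h : IsMinimalSplit σ c α M N) (hs : IsSplitOff α N.1) :
    N.1 (Sum.inl 1) (Sum.inl 1) ≠ 0 := by
  intro h0
  obtain ⟨r, -, e⟩ := h.dvdIn_col hc hc0 hσ hα hM hN hs
  have h1 := (hs.isotropic hα (approxOrbit_hasSimilitude hM hN)).2
  rw [e, h0] at h1
  simp at h1
  exact hm ((map_eq_zero (algebraMap K Ω)).1 h1.symm)

/-- The second column can be cleared below a minimal second diagonal entry. -/
theorem IsMinimalSplit.exists_clear (hc : ¬ IsUnit c) (hc0 : c ≠ 0) (hσ : IsQuadraticConj σ)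
    {α : Ω} (hα : α ≠ 0) {m : K} (hm : m ≠ 0) {M N : GL (Fin 2 ⊕ Fin 2) Ω}
    (hM : HasSimilitude σ M.1 m)
    (hN : N ∈ approxOrbit σ c M) (h : IsMinimalSplit σ c α M N) (hs : IsSplitOff α N.1) :
    ∃ N₁ ∈ approxOrbit σ c M, IsSplitOff α N₁.1 ∧ N₁.1 (Sum.inr 1) (Sum.inl 1) = 0 ∧
      ∀ j, N₁.1 (Sum.inl 1) j = N.1 (Sum.inl 1) j := by
  obtain ⟨k, hk, e⟩ := h.dvdIn_col hc hc0 hσ hα hM hN hs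
  have ha := h.ne_zero hc hc0 hσ hα hm hM hN hs
  have h1 := (hs.isotropic hα (approxOrbit_hasSimilitude hM hN)).1
  -- the quotient is fixed by the conjugation since the column is isotropic
  have hk' : σ k = k := by
    rw [e, map_mul] at h1
    have hsa : σ (N.1 (Sum.inl 1) (Sum.inl 1)) ≠ 0 := by simpa using ha
    refine mul_left_cancel₀ (mul_ne_zero hsa ha) ?_
    linear_combination -h1
  obtain ⟨g, hg, eg⟩ := exists_lowerUnip hσ (c := c) (Subring.zero_mem _) (Subring.neg_mem _ hk)
    (Subring.zero_mem _) (map_zero σ) (by rw [map_neg, hk'])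
  obtain ⟨-, -, s1, s2, s3⟩ := hs.shear (σ := σ) (t := -k)
  have hgN : (g * N).1 = lowerUnip σ 0 (-k) 0 * N.1 := by rw [Units.val_mul, eg]
  refine ⟨g * N, mul_mem_approxOrbit hN hg, by rw [hgN]; exact s1, ?_, ?_⟩
  · rw [hgN, s3, e]; ring
  · rw [hgN]; exact s2

/-- The diagonal matrix of similitude `m` with upper left block `diag(α₁, α₂)`. -/
def simDiag (σ : Ω ≃ₐ[K] Ω) (α₁ α₂ : Ω) (m : K) : Matrix (Fin 2 ⊕ Fin 2) (Fin 2 ⊕ Fin 2) Ω :=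
  Matrix.diagonal (Sum.elim ![α₁, α₂] ![algebraMap K Ω m / σ α₁, algebraMap K Ω m / σ α₂])

/-- Elementary divisor theorem over the semilocal ring. -/
theorem exists_simDiag (hc : ¬ IsUnit c) (hc0 : c ≠ 0) (hσ : IsQuadraticConj σ)
    {M : GL (Fin 2 ⊕ Fin 2) Ω} (hM : IsSemilocal c M.1) {m : K} (hm : m ≠ 0)
    (hMs : HasSimilitude σ M.1 m) :
    ∃ α₁ α₂ : Ω, α₁ ≠ 0 ∧ α₂ ≠ 0 ∧ α₁ ∈ semilocalRing Ω c ∧ α₂ ∈ semilocalRing Ω c ∧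
      DvdIn (semilocalRing Ω c) α₁ α₂ ∧
      DvdIn (semilocalRing Ω c) α₂ (algebraMap K Ω m / σ α₂) ∧
      ∃ N ∈ approxOrbit σ c M, N.1 = simDiag σ α₁ α₂ m := by
  obtain ⟨α, hα, N₀, hN₀, hmin₀, hs₀⟩ := exists_isSplitOff hc hc0 hσ hM hm hMs
  obtain ⟨N₁, hN₁, hs₁, hmin₁⟩ := exists_isMinimalSplit hc hM hN₀ hs₀
  have ha := hmin₁.ne_zero hc hc0 hσ hα hm hMs hN₁ hs₁
  obtain ⟨N₂, hN₂, hs₂, h20, h21⟩ := hmin₁.exists_clear hc hc0 hσ hα hm hMs hN₁ hs₁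
  have hmin₂ : IsMinimalSplit σ c α M N₂ := hmin₁.congr (h21 _)
  have hMs' : HasSimilitude σ (transposeGL M).1 m := hMs.transpose hσ hm
  have hN₂' := transposeGL_mem_approxOrbit hσ hN₂
  -- the second row is cleared as the second column of the transpose
  obtain ⟨N₃, hN₃, hs₃, h30, h31⟩ := (hmin₂.transpose hσ).exists_clear hc hc0 hσ hα hm hMs' hN₂'
    hs₂.transpose
  have hN₄ := transposeGL_mem_approxOrbit hσ hN₃
  rw [transposeGL_transposeGL] at hN₄
  obtain ⟨N, hNdef⟩ : ∃ N, N = transposeGL N₃ := ⟨_, rfl⟩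
  rw [← hNdef] at hN₄
  have hs : IsSplitOff α N.1 := by rw [hNdef]; exact hs₃.transpose
  have hb : N.1 (Sum.inl 1) (Sum.inr 1) = 0 := by rw [hNdef]; exact h30
  have hcol : ∀ j, N.1 j (Sum.inl 1) = N₂.1 j (Sum.inl 1) := by rw [hNdef]; exact h31
  have he : N.1 (Sum.inr 1) (Sum.inl 1) = 0 := by rw [hcol, h20]
  have haa : N.1 (Sum.inl 1) (Sum.inl 1) = N₁.1 (Sum.inl 1) (Sum.inl 1) := by rw [hcol, h21]
  have hmin : IsMinimalSplit σ c α M N := hmin₁.congr haa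
  rw [← haa] at ha
  have hNs := approxOrbit_hasSimilitude hMs hN₄
  have hsa : σ (N.1 (Sum.inl 1) (Sum.inl 1)) ≠ 0 := by simpa using ha
  have hf : N.1 (Sum.inr 1) (Sum.inr 1) = algebraMap K Ω m / σ (N.1 (Sum.inl 1) (Sum.inl 1)) := by
    have := (hs.isotropic hα hNs).2
    rw [he, map_zero, zero_mul, sub_zero] at this
    rw [eq_div_iff hsa, mul_comm, this]
  have hα0 : N.1 (Sum.inl 0) (Sum.inl 0) = α := by rw [hs.col, Pi.single_eq_same]
  have hNR := approxOrbit_isSemilocal hM hN₄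
  refine ⟨α, N.1 (Sum.inl 1) (Sum.inl 1), hα, ha, hα0 ▸ hNR _ _, hNR _ _, ?_, ?_, N, hN₄, ?_⟩
  · refine (IsSplitOff.dvdIn hc hc0 hσ hM hN₄ (hmin₀.congr ?_) hs (Sum.inl 1)).1
    rw [hα0, hs₀.col, Pi.single_eq_same]
  -- adding the fourth row to the second one puts `m / σ α₂` into the row of the minimal entry `α₂`
  · obtain ⟨g, hg, e⟩ := exists_upperUnip hσ (c := c) (Subring.zero_mem _) (Subring.one_mem _)
      (Subring.zero_mem _) (map_zero σ) (map_one σ)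
    obtain ⟨s1, s2, -⟩ := hs.shear (σ := σ) (t := 1)
    have hgN : (g * N).1 = upperUnip σ 0 1 0 * N.1 := by rw [Units.val_mul, e]
    have h4 : (g * N).1 (Sum.inl 1) (Sum.inl 1) = N.1 (Sum.inl 1) (Sum.inl 1) := by
      rw [hgN, s2, he, mul_zero, add_zero]
    have h5 := (hmin.congr h4).dvdIn_row hc hc0 hσ hα hm hMs (mul_mem_approxOrbit hN₄ hg)
      (by rw [hgN]; exact s1)
    rwa [h4, hgN, s2, hb, zero_add, one_mul, hf] at h5
  · have r0 := hs.row
    have r2 := hs.row_inr hα hNs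
    have c0 := hs.col
    have c2 : ∀ i, N.1 i (Sum.inr 0) =
        (Pi.single (Sum.inr 0) (algebraMap K Ω m / σ α) : Fin 2 ⊕ Fin 2 → Ω) i :=
      hs.transpose.row_inr hα (hNs.transpose hσ hm)
    refine Matrix.ext ?_
    unfold simDiag
    simp only [forall_idx, r0, r2, c0, c2, he, hb, hf]
    simp

end Diagonalization

/-! ### The ideals of entries and of minors of order two -/

section Minors

/-- The minor of order two with rows `i`, `j` and columns `k`, `l`. -/
def minor {A : Type*} [CommRing A] (M : Matrix (Fin 2 ⊕ Fin 2) (Fin 2 ⊕ Fin 2) A)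
    (i j k l : Fin 2 ⊕ Fin 2) : A := M i k * M j l - M i l * M j k

/-- The Cauchy–Binet formula for minors of order two. -/
theorem minor_mul {A : Type*} [CommRing A] (M N : Matrix (Fin 2 ⊕ Fin 2) (Fin 2 ⊕ Fin 2) A)
    (i j k l : Fin 2 ⊕ Fin 2) : minor (M * N) i j k l =
      minor M i j (Sum.inl 0) (Sum.inl 1) * minor N (Sum.inl 0) (Sum.inl 1) k l +
      minor M i j (Sum.inl 0) (Sum.inr 0) * minor N (Sum.inl 0) (Sum.inr 0) k l +
      minor M i j (Sum.inl 0) (Sum.inr 1) * minor N (Sum.inl 0) (Sum.inr 1) k l +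
      minor M i j (Sum.inl 1) (Sum.inr 0) * minor N (Sum.inl 1) (Sum.inr 0) k l +
      minor M i j (Sum.inl 1) (Sum.inr 1) * minor N (Sum.inl 1) (Sum.inr 1) k l +
      minor M i j (Sum.inr 0) (Sum.inr 1) * minor N (Sum.inr 0) (Sum.inr 1) k l := by
  simp only [minor, Matrix.mul_apply, sum_idx]
  ring

theorem minor_transpose {A : Type*} [CommRing A] (M : Matrix (Fin 2 ⊕ Fin 2) (Fin 2 ⊕ Fin 2) A)
    (i j k l : Fin 2 ⊕ Fin 2) : minor Mᵀ i j k l = minor M k l i j := by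
  simp only [minor, Matrix.transpose_apply]; ring

theorem minor_diagonal {A : Type*} [CommRing A] (d : Fin 2 ⊕ Fin 2 → A)
    (i j k l : Fin 2 ⊕ Fin 2) : minor (Matrix.diagonal d) i j k l = 0 ∨
      i ≠ j ∧ (minor (Matrix.diagonal d) i j k l = d i * d j ∨
        minor (Matrix.diagonal d) i j k l = -(d i * d j)) := by
  unfold minor
  simp only [Matrix.diagonal_apply]
  by_cases h1 : i = k
  · subst h1
    by_cases h2 : j = l
    · subst h2
      by_cases h3 : i = j
      · subst h3; left; simp
      · right; exact ⟨h3, Or.inl (by simp [h3])⟩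
    · left
      by_cases h3 : j = i
      · subst h3; simp [h2]
      · simp [h2, h3]
  · by_cases h2 : i = l
    · subst h2
      by_cases h3 : j = k
      · subst h3
        right; exact ⟨h1, Or.inr (by simp [h1])⟩
      · left; simp [h1, h3]
    · left; simp [h1, h2]

end Minors

section Ideals

variable {K Ω : Type*} [Field K] [NumberField K] [Field Ω] [NumberField Ω] [Algebra K Ω]
  {σ : Ω ≃ₐ[K] Ω} {c : 𝓞 K}

/-- The ideal generated by the entries of an integral matrix. -/
def entryIdeal (M : Matrix (Fin 2 ⊕ Fin 2) (Fin 2 ⊕ Fin 2) Ω) : Ideal (𝓞 Ω) :=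
  Ideal.span {y | ∃ i j, (y : Ω) = M i j}

/-- The ideal generated by the minors of order two of an integral matrix. -/
def minorIdeal (M : Matrix (Fin 2 ⊕ Fin 2) (Fin 2 ⊕ Fin 2) Ω) : Ideal (𝓞 Ω) :=
  Ideal.span {y | ∃ i j k l, (y : Ω) = minor M i j k l}

theorem exists_mem_entryIdeal {M : Matrix (Fin 2 ⊕ Fin 2) (Fin 2 ⊕ Fin 2) Ω}
    (hM : IsIntegralMatrix M) (i j : Fin 2 ⊕ Fin 2) : ∃ y ∈ entryIdeal M, (y : Ω) = M i j :=
  ⟨⟨M i j, hM i j⟩, Ideal.subset_span ⟨i, j, rfl⟩, rfl⟩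

theorem isIntegral_minor {M : Matrix (Fin 2 ⊕ Fin 2) (Fin 2 ⊕ Fin 2) Ω}
    (hM : IsIntegralMatrix M) (i j k l : Fin 2 ⊕ Fin 2) : IsIntegral ℤ (minor M i j k l) :=
  ((hM _ _).mul (hM _ _)).sub ((hM _ _).mul (hM _ _))

theorem exists_mem_minorIdeal {M : Matrix (Fin 2 ⊕ Fin 2) (Fin 2 ⊕ Fin 2) Ω}
    (hM : IsIntegralMatrix M) (i j k l : Fin 2 ⊕ Fin 2) :
    ∃ y ∈ minorIdeal M, (y : Ω) = minor M i j k l :=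
  ⟨⟨minor M i j k l, isIntegral_minor hM i j k l⟩, Ideal.subset_span ⟨i, j, k, l, rfl⟩, rfl⟩

theorem entryIdeal_mul_le {M N : Matrix (Fin 2 ⊕ Fin 2) (Fin 2 ⊕ Fin 2) Ω}
    (hM : IsIntegralMatrix M) (hN : IsIntegralMatrix N) :
    entryIdeal (M * N) ≤ entryIdeal M * entryIdeal N := by
  refine Ideal.span_le.2 ?_
  rintro y ⟨i, j, hy⟩
  choose a ha ea using exists_mem_entryIdeal hM
  choose b hb eb using exists_mem_entryIdeal hN
  have e : y = a i (Sum.inl 0) * b (Sum.inl 0) j + a i (Sum.inl 1) * b (Sum.inl 1) j +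
      a i (Sum.inr 0) * b (Sum.inr 0) j + a i (Sum.inr 1) * b (Sum.inr 1) j := by
    refine RingOfIntegers.ext ?_
    rw [hy, Matrix.mul_apply, sum_idx]
    simp only [coe_add, coe_mul, ea, eb]
  rw [e]
  have h : ∀ k, a i k * b k j ∈ entryIdeal M * entryIdeal N :=
    fun k => Ideal.mul_mem_mul (ha i k) (hb k j)
  exact add_mem (add_mem (add_mem (h _) (h _)) (h _)) (h _)

theorem minorIdeal_mul_le {M N : Matrix (Fin 2 ⊕ Fin 2) (Fin 2 ⊕ Fin 2) Ω}
    (hM : IsIntegralMatrix M) (hN : IsIntegralMatrix N) :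
    minorIdeal (M * N) ≤ minorIdeal M * minorIdeal N := by
  refine Ideal.span_le.2 ?_
  rintro y ⟨i, j, k, l, hy⟩
  choose a ha ea using exists_mem_minorIdeal hM
  choose b hb eb using exists_mem_minorIdeal hN
  have h : ∀ p q, a i j p q * b p q k l ∈ minorIdeal M * minorIdeal N :=
    fun p q => Ideal.mul_mem_mul (ha _ _ _ _) (hb _ _ _ _)
  have e : y = a i j (Sum.inl 0) (Sum.inl 1) * b (Sum.inl 0) (Sum.inl 1) k l +
      a i j (Sum.inl 0) (Sum.inr 0) * b (Sum.inl 0) (Sum.inr 0) k l +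
      a i j (Sum.inl 0) (Sum.inr 1) * b (Sum.inl 0) (Sum.inr 1) k l +
      a i j (Sum.inl 1) (Sum.inr 0) * b (Sum.inl 1) (Sum.inr 0) k l +
      a i j (Sum.inl 1) (Sum.inr 1) * b (Sum.inl 1) (Sum.inr 1) k l +
      a i j (Sum.inr 0) (Sum.inr 1) * b (Sum.inr 0) (Sum.inr 1) k l := by
    refine RingOfIntegers.ext ?_
    rw [hy, minor_mul]
    simp only [coe_add, coe_mul, ea, eb]
  rw [e]
  exact add_mem (add_mem (add_mem (add_mem (add_mem (h _ _) (h _ _)) (h _ _)) (h _ _)) (h _ _))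
    (h _ _)

theorem entryIdeal_transpose (M : Matrix (Fin 2 ⊕ Fin 2) (Fin 2 ⊕ Fin 2) Ω) :
    entryIdeal Mᵀ = entryIdeal M := by
  unfold entryIdeal
  congr 1
  ext y
  exact ⟨fun ⟨i, j, h⟩ => ⟨j, i, h⟩, fun ⟨i, j, h⟩ => ⟨j, i, h⟩⟩

theorem minorIdeal_transpose (M : Matrix (Fin 2 ⊕ Fin 2) (Fin 2 ⊕ Fin 2) Ω) :
    minorIdeal Mᵀ = minorIdeal M := by
  unfold minorIdeal
  congr 1
  ext y
  simp only [minor_transpose]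
  exact ⟨fun ⟨i, j, k, l, h⟩ => ⟨k, l, i, j, h⟩, fun ⟨i, j, k, l, h⟩ => ⟨k, l, i, j, h⟩⟩

theorem entryIdeal_le_of_mul {g M N h : GL (Fin 2 ⊕ Fin 2) Ω} (hg : g ∈ modularGroup 2 σ)
    (hh : h ∈ modularGroup 2 σ) (hM : IsIntegralMatrix M.1) (e : N = g * M * h) :
    entryIdeal N.1 ≤ entryIdeal M.1 := by
  have h1 : N.1 = g.1 * M.1 * h.1 := by rw [e]; rfl
  rw [h1]
  exact (entryIdeal_mul_le (hg.1.mul hM) hh.1).trans (Ideal.mul_le_left.trans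
    ((entryIdeal_mul_le hg.1 hM).trans Ideal.mul_le_right))

theorem minorIdeal_le_of_mul {g M N h : GL (Fin 2 ⊕ Fin 2) Ω} (hg : g ∈ modularGroup 2 σ)
    (hh : h ∈ modularGroup 2 σ) (hM : IsIntegralMatrix M.1) (e : N = g * M * h) :
    minorIdeal N.1 ≤ minorIdeal M.1 := by
  have h1 : N.1 = g.1 * M.1 * h.1 := by rw [e]; rfl
  rw [h1]
  exact (minorIdeal_mul_le (hg.1.mul hM) hh.1).trans (Ideal.mul_le_left.trans
    ((minorIdeal_mul_le hg.1 hM).trans Ideal.mul_le_right))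

/-- The element `α` generates the extension of the ideal `I` to the semilocal ring. -/
structure GeneratesAt (c : 𝓞 K) (I : Ideal (𝓞 Ω)) (α : Ω) : Prop where
  exists_mem : ∃ z : 𝓞 K, ∃ y ∈ I, (y : Ω) = algebraMap K Ω ((1 + c * z : 𝓞 K) : K) * α
  dvdIn : ∀ y ∈ I, DvdIn (semilocalRing Ω c) α (y : Ω)

/-- The extension of the ideal `I` to the semilocal ring. -/
def extension (c : 𝓞 K) (I : Ideal (𝓞 Ω)) : AddSubgroup Ω where
  carrier := {x | ∃ z : 𝓞 K, ∃ y ∈ I, (y : Ω) = algebraMap K Ω ((1 + c * z : 𝓞 K) : K) * x}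
  zero_mem' := ⟨0, 0, I.zero_mem, by simp⟩
  add_mem' := by
    rintro a b ⟨z, y, hy, e⟩ ⟨z', y', hy', e'⟩
    -- `(1 + c z) (1 + c z') = 1 + c (z + z' + c z z')` is a common denominator
    refine ⟨z + z' + c * z * z', algebraMap (𝓞 K) (𝓞 Ω) (1 + c * z') * y +
      algebraMap (𝓞 K) (𝓞 Ω) (1 + c * z) * y', I.add_mem (I.mul_mem_left _ hy)
      (I.mul_mem_left _ hy'), ?_⟩
    rw [coe_add, coe_mul, coe_mul, coe_algebraMap_eq, coe_algebraMap_eq, e, e']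
    simp only [map_add, map_mul, map_one]
    ring
  neg_mem' := by
    rintro a ⟨z, y, hy, e⟩
    exact ⟨z, -y, I.neg_mem hy, by rw [coe_neg, e, mul_neg]⟩

theorem mul_mem_extension {I : Ideal (𝓞 Ω)} {r x : Ω} (hr : r ∈ semilocalRing Ω c)
    (hx : x ∈ extension c I) : r * x ∈ extension c I := by
  obtain ⟨z, y, e⟩ := hr
  obtain ⟨z', y', hy', e'⟩ := hx
  refine ⟨z + z' + c * z * z', y * y', I.mul_mem_left _ hy', ?_⟩
  rw [coe_mul, ← e, e']
  simp only [map_add, map_mul, map_one]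
  ring

theorem coe_mem_extension {I : Ideal (𝓞 Ω)} {y : 𝓞 Ω} (hy : y ∈ I) : (y : Ω) ∈ extension c I :=
  ⟨0, y, hy, by simp⟩

theorem GeneratesAt.of_span {s : Set (𝓞 Ω)} {α : Ω} (h1 : α ∈ extension c (Ideal.span s))
    (h2 : ∀ y ∈ s, DvdIn (semilocalRing Ω c) α (y : Ω)) : GeneratesAt c (Ideal.span s) α := by
  refine ⟨h1, fun y hy => ?_⟩
  refine Submodule.span_induction (p := fun (y : 𝓞 Ω) _ => DvdIn (semilocalRing Ω c) α (y : Ω)) h2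
      ?_ ?_ ?_ hy
  · rw [coe_zero]; exact DvdIn.zero _ _
  · intro x y _ _ hx hy
    rw [coe_add]; exact hx.add hy
  · intro a x _ hx
    rw [smul_eq_mul, coe_mul]
    exact hx.mul_left (coe_mem_semilocalRing c a)

theorem GeneratesAt.dvdIn_of_mem (hc : ¬ IsUnit c) {I : Ideal (𝓞 Ω)} {α x : Ω}
    (h : GeneratesAt c I α) (hx : x ∈ extension c I) : DvdIn (semilocalRing Ω c) α x := by
  obtain ⟨z, y, hy, e⟩ := hx
  have h1 := (h.dvdIn y hy).mul_left (inv_mem_semilocalRing hc z)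
  rwa [e, inv_mul_cancel_left₀ (one_add_mul_ne_zero hc z)] at h1

theorem GeneratesAt.dvdIn_dvdIn (hc : ¬ IsUnit c) {I : Ideal (𝓞 Ω)} {α β : Ω}
    (h : GeneratesAt c I α) (h' : GeneratesAt c I β) : DvdIn (semilocalRing Ω c) α β :=
  h.dvdIn_of_mem hc h'.exists_mem

theorem isSemilocal_minor {M : Matrix (Fin 2 ⊕ Fin 2) (Fin 2 ⊕ Fin 2) Ω} (hM : IsSemilocal c M)
    (i j k l : Fin 2 ⊕ Fin 2) : minor M i j k l ∈ semilocalRing Ω c :=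
  Subring.sub_mem _ (Subring.mul_mem _ (hM _ _) (hM _ _)) (Subring.mul_mem _ (hM _ _) (hM _ _))

/-- The elementary divisors over the semilocal ring generate the ideals of entries and of minors of
order two. -/
theorem generatesAt_of_simDiag {M N : GL (Fin 2 ⊕ Fin 2) Ω} (hM : IsIntegralMatrix M.1)
    (hN : N ∈ approxOrbit σ c M) {α₁ α₂ : Ω} {m : K} (e : N.1 = simDiag σ α₁ α₂ m)
    (h12 : DvdIn (semilocalRing Ω c) α₁ α₂)
    (h2 : DvdIn (semilocalRing Ω c) α₂ (algebraMap K Ω m / σ α₂)) (hα₁ : α₁ ≠ 0)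
    (hα₂ : α₂ ≠ 0) :
    GeneratesAt c (entryIdeal M.1) α₁ ∧ GeneratesAt c (minorIdeal M.1) (α₁ * α₂) := by
  obtain ⟨g₁, hg₁, g₂, hg₂, hN⟩ := hN
  have hMN : M.1 = (g₁⁻¹).1 * N.1 * (g₂⁻¹).1 := by
    rw [← Units.val_mul, ← Units.val_mul, hN]; congr 1; group
  have hNM : N.1 = g₁.1 * M.1 * g₂.1 := by rw [hN]; rfl
  have s1 := approxGroup_isSemilocal hg₁
  have s2 := approxGroup_isSemilocal hg₂
  have t1 := approxGroup_isSemilocal (Subgroup.inv_mem _ hg₁)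
  have t2 := approxGroup_isSemilocal (Subgroup.inv_mem _ hg₂)
  have hσ₁ : σ α₁ ≠ 0 := by simpa using hα₁
  have hσ₂ : σ α₂ ≠ 0 := by simpa using hα₂
  -- `m / σ α₂` divides `m / σ α₁`
  have h3 : DvdIn (semilocalRing Ω c) (algebraMap K Ω m / σ α₂) (algebraMap K Ω m / σ α₁) := by
    obtain ⟨r, hr, er⟩ := h12.conj σ
    refine ⟨r, hr, ?_⟩
    field_simp
    rw [er]
    ring
  -- `α₁` divides all diagonal entries, and `α₂` all but the first one
  have hd : ∀ i, DvdIn (semilocalRing Ω c) α₁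
      (Sum.elim ![α₁, α₂] ![algebraMap K Ω m / σ α₁, algebraMap K Ω m / σ α₂] i) := by
    rw [forall_idx]
    simp only [Sum.elim_inl, Sum.elim_inr, Matrix.cons_val_zero, Matrix.cons_val_one]
    exact ⟨DvdIn.refl _ _, h12, h12.trans (h2.trans h3), h12.trans h2⟩
  have hd' : ∀ i, i ≠ Sum.inl 0 → DvdIn (semilocalRing Ω c) α₂
      (Sum.elim ![α₁, α₂] ![algebraMap K Ω m / σ α₁, algebraMap K Ω m / σ α₂] i) := by
    rw [forall_idx]
    simp only [Sum.elim_inl, Sum.elim_inr, Matrix.cons_val_zero, Matrix.cons_val_one]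
    exact ⟨fun h => absurd rfl h, fun _ => DvdIn.refl _ _, fun _ => h2.trans h3, fun _ => h2⟩
  constructor
  · refine GeneratesAt.of_span ?_ ?_
    · have e0 : α₁ = N.1 (Sum.inl 0) (Sum.inl 0) := by rw [e]; simp [simDiag]
      rw [e0, hNM, Matrix.mul_apply]
      refine AddSubgroup.sum_mem _ fun k _ => ?_
      rw [mul_comm]
      refine mul_mem_extension (s2 _ _) ?_
      rw [Matrix.mul_apply]
      refine AddSubgroup.sum_mem _ fun l _ => mul_mem_extension (s1 _ _) ?_
      obtain ⟨y, hy, ey⟩ := exists_mem_entryIdeal hM l k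
      rw [← ey]
      exact coe_mem_extension hy
    · rintro y ⟨i, j, ey⟩
      rw [ey, hMN, e]
      unfold simDiag
      rw [Matrix.mul_apply, sum_idx]
      simp only [Matrix.mul_diagonal]
      exact (((((hd _).mul_left (t1 _ _)).mul_right (t2 _ _)).add
        (((hd _).mul_left (t1 _ _)).mul_right (t2 _ _))).add
        (((hd _).mul_left (t1 _ _)).mul_right (t2 _ _))).add
        (((hd _).mul_left (t1 _ _)).mul_right (t2 _ _))
  · refine GeneratesAt.of_span ?_ ?_
    · have e0 : α₁ * α₂ = minor N.1 (Sum.inl 0) (Sum.inl 1) (Sum.inl 0) (Sum.inl 1) := by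
        rw [e]; simp [simDiag, minor]
      have hE : ∀ i j k l, minor M.1 i j k l ∈ extension c (minorIdeal M.1) := by
        intro i j k l
        obtain ⟨y, hy, ey⟩ := exists_mem_minorIdeal hM i j k l
        rw [← ey]
        exact coe_mem_extension hy
      have hE' : ∀ i j k l, minor (g₁.1 * M.1) i j k l ∈ extension c (minorIdeal M.1) := by
        intro i j k l
        rw [minor_mul]
        have := fun p q => mul_mem_extension (isSemilocal_minor s1 i j p q) (hE p q k l)
        exact add_mem (add_mem (add_mem (add_mem (add_mem (this _ _) (this _ _)) (this _ _))
          (this _ _)) (this _ _)) (this _ _)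
      change α₁ * α₂ ∈ extension c (minorIdeal M.1)
      rw [e0, hNM, minor_mul]
      have := fun p q k l => mul_comm (minor g₂.1 p q k l) _ ▸
        mul_mem_extension (isSemilocal_minor s2 p q k l) (hE' (Sum.inl 0) (Sum.inl 1) p q)
      exact add_mem (add_mem (add_mem (add_mem (add_mem (this _ _ _ _) (this _ _ _ _))
        (this _ _ _ _)) (this _ _ _ _)) (this _ _ _ _)) (this _ _ _ _)
    · have hmul : ∀ i j, i ≠ j → DvdIn (semilocalRing Ω c) (α₁ * α₂)
          (Sum.elim ![α₁, α₂] ![algebraMap K Ω m / σ α₁, algebraMap K Ω m / σ α₂] i *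
            Sum.elim ![α₁, α₂] ![algebraMap K Ω m / σ α₁, algebraMap K Ω m / σ α₂] j) := by
        intro i j hij
        by_cases hi : i = Sum.inl 0
        · exact (hd i).mul_mul (hd' j fun hj => hij (hi.trans hj.symm))
        · rw [mul_comm α₁]
          exact (hd' i hi).mul_mul (hd j)
      have hD : ∀ i j k l, DvdIn (semilocalRing Ω c) (α₁ * α₂) (minor N.1 i j k l) := by
        intro i j k l
        rw [e]
        unfold simDiag
        rcases minor_diagonal (Sum.elim ![α₁, α₂] ![algebraMap K Ω m / σ α₁,
          algebraMap K Ω m / σ α₂]) i j k l with h | ⟨hij, h | h⟩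
        · rw [h]; exact DvdIn.zero _ _
        · rw [h]; exact hmul i j hij
        · rw [h]; exact (hmul i j hij).neg
      have hD' : ∀ i j k l, DvdIn (semilocalRing Ω c) (α₁ * α₂)
          (minor ((g₁⁻¹).1 * N.1) i j k l) := by
        intro i j k l
        rw [minor_mul]
        have := fun p q => (hD p q k l).mul_left (isSemilocal_minor t1 i j p q)
        exact (((((this _ _).add (this _ _)).add (this _ _)).add (this _ _)).add (this _ _)).add
          (this _ _)
      rintro y ⟨i, j, k, l, ey⟩
      rw [ey, hMN, minor_mul]
      have := fun p q => (hD' i j p q).mul_right (isSemilocal_minor t2 p q k l)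
      exact (((((this _ _).add (this _ _)).add (this _ _)).add (this _ _)).add (this _ _)).add
          (this _ _)

end Ideals

/-! ### The ideal of minors is principal -/

section Principal

variable {K Ω : Type*} [Field K] [NumberField K] [Field Ω] [NumberField Ω] [Algebra K Ω]
  {σ : Ω ≃ₐ[K] Ω} {c : 𝓞 K}

/-- The conjugate of an ideal. -/
noncomputable def conjIdeal (σ : Ω ≃ₐ[K] Ω) (I : Ideal (𝓞 Ω)) : Ideal (𝓞 Ω) :=
  I.map (conjInt σ)

theorem mem_conjIdeal (hσ : IsQuadraticConj σ) {I : Ideal (𝓞 Ω)} {x : 𝓞 Ω} :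
    x ∈ conjIdeal σ I ↔ conjInt σ x ∈ I := by
  unfold conjIdeal
  rw [Ideal.mem_map_of_equiv]
  constructor
  · rintro ⟨y, hy, rfl⟩
    rwa [hσ.conjInt_conjInt]
  · intro h
    exact ⟨_, h, hσ.conjInt_conjInt x⟩

theorem conjIdeal_conjIdeal (hσ : IsQuadraticConj σ) (I : Ideal (𝓞 Ω)) :
    conjIdeal σ (conjIdeal σ I) = I := by
  ext x
  rw [mem_conjIdeal hσ, mem_conjIdeal hσ, hσ.conjInt_conjInt]

theorem conjIdeal_mul (I J : Ideal (𝓞 Ω)) :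
    conjIdeal σ (I * J) = conjIdeal σ I * conjIdeal σ J := Ideal.map_mul _ _ _

theorem conjIdeal_span_singleton (x : 𝓞 Ω) :
    conjIdeal σ (Ideal.span {x}) = Ideal.span {conjInt σ x} := by
  unfold conjIdeal
  rw [Ideal.map_span, Set.image_singleton]

theorem conjIdeal_mono {I J : Ideal (𝓞 Ω)} (h : I ≤ J) : conjIdeal σ I ≤ conjIdeal σ J :=
  Ideal.map_mono h

theorem conjIdeal_ne_bot (hσ : IsQuadraticConj σ) {I : Ideal (𝓞 Ω)} (h : I ≠ ⊥) :
    conjIdeal σ I ≠ ⊥ := by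
  intro h'
  apply h
  rw [← conjIdeal_conjIdeal hσ I, h']
  exact Ideal.map_bot

/-- A matrix of similitude `m` divides `m`, with integral cofactor `-J M* J`. -/
theorem exists_mul_eq_smul {M : GL (Fin 2 ⊕ Fin 2) Ω} (hM : IsIntegralMatrix M.1) {m : K}
    (hm : m ≠ 0) (hs : HasSimilitude σ M.1 m) :
    ∃ N, IsIntegralMatrix N ∧ M.1 * N = m • (1 : Matrix (Fin 2 ⊕ Fin 2) (Fin 2 ⊕ Fin 2) Ω) ∧
      (M⁻¹).1 = m⁻¹ • N := by
  refine ⟨_, ((isIntegralMatrix_symplecticJ 2 Ω).neg.mul (hM.conjTr σ)).mul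
    (isIntegralMatrix_symplecticJ 2 Ω), ?_, hs.inv_eq hm⟩
  have h := Units.mul_inv M
  rw [hs.inv_eq hm, Matrix.mul_smul] at h
  rw [← h, smul_smul, mul_inv_cancel₀ hm, one_smul]

theorem algebraMap_mem_entryIdeal {M : GL (Fin 2 ⊕ Fin 2) Ω} (hM : IsIntegralMatrix M.1) {m : 𝓞 K}
    (hm : m ≠ 0) (hs : HasSimilitude σ M.1 (m : K)) :
    algebraMap (𝓞 K) (𝓞 Ω) m ∈ entryIdeal M.1 := by
  obtain ⟨N, hN, e, -⟩ := exists_mul_eq_smul hM (by simpa using hm) hs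
  obtain ⟨y, hy, ey⟩ := exists_mem_entryIdeal (hM.mul hN) (Sum.inl 0) (Sum.inl 0)
  have h1 : y = algebraMap (𝓞 K) (𝓞 Ω) m := RingOfIntegers.ext (by
    rw [ey, e, coe_algebraMap_eq, Matrix.smul_apply, Matrix.one_apply_eq, Algebra.smul_def,
      mul_one])
  rw [← h1]
  exact Ideal.mul_le_left (entryIdeal_mul_le hM hN hy)

theorem algebraMap_sq_mem_minorIdeal {M : GL (Fin 2 ⊕ Fin 2) Ω} (hM : IsIntegralMatrix M.1)
    {m : 𝓞 K} (hm : m ≠ 0) (hs : HasSimilitude σ M.1 (m : K)) :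
    algebraMap (𝓞 K) (𝓞 Ω) m ^ 2 ∈ minorIdeal M.1 := by
  obtain ⟨N, hN, e, -⟩ := exists_mul_eq_smul hM (by simpa using hm) hs
  obtain ⟨y, hy, ey⟩ := exists_mem_minorIdeal (hM.mul hN) (Sum.inl 0) (Sum.inl 1) (Sum.inl 0)
    (Sum.inl 1)
  have h1 : y = algebraMap (𝓞 K) (𝓞 Ω) m ^ 2 := RingOfIntegers.ext (by
    rw [ey, e, pow_two, coe_mul, coe_algebraMap_eq]
    simp [minor, Algebra.smul_def])
  rw [← h1]
  exact Ideal.mul_le_left (minorIdeal_mul_le hM hN hy)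

/-- The determinant divides `m ^ 4`, by `M N = m`. -/
theorem exists_det_dvd {M : GL (Fin 2 ⊕ Fin 2) Ω} (hM : IsIntegralMatrix M.1) {m : 𝓞 K}
    (hm : m ≠ 0) (hs : HasSimilitude σ M.1 (m : K)) :
    ∃ δ : 𝓞 Ω, (δ : Ω) = M.1.det ∧ δ ∣ algebraMap (𝓞 K) (𝓞 Ω) m ^ 4 := by
  obtain ⟨N, hN, e, -⟩ := exists_mul_eq_smul hM (by simpa using hm) hs
  have d1 : IsIntegral ℤ M.1.det := IsIntegral.det fun i j => hM i j
  have d2 : IsIntegral ℤ N.det := IsIntegral.det fun i j => hN i j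
  refine ⟨⟨_, d1⟩, rfl, ⟨_, d2⟩, RingOfIntegers.ext ?_⟩
  have h1 := congrArg Matrix.det e
  rw [Matrix.det_mul] at h1
  have h2 : (m : K) • (1 : Matrix (Fin 2 ⊕ Fin 2) (Fin 2 ⊕ Fin 2) Ω) =
      (algebraMap K Ω (m : K)) • 1 := by
    ext i j; simp only [Matrix.smul_apply, Algebra.smul_def]; rfl
  rw [h2, Matrix.det_smul] at h1
  have h3 : Fintype.card (Fin 2 ⊕ Fin 2) = 4 := rfl
  rw [h3, Matrix.det_one, mul_one] at h1
  have h4 : ((algebraMap (𝓞 K) (𝓞 Ω) m ^ 4 : 𝓞 Ω) : Ω) = algebraMap K Ω (m : K) ^ 4 := by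
    simp only [pow_succ, pow_zero, one_mul, coe_mul, coe_algebraMap_eq]
  rw [h4, ← h1]
  rfl

/-- An ideal of `𝓞 Ω` fixed by the conjugation and coprime to `c`, where `c` is a multiple of
`θ - σ θ`, is extended from `𝓞 K`. -/
theorem exists_eq_span_of_conjIdeal_eq [IsPrincipalIdealRing (𝓞 K)] (hσ : IsQuadraticConj σ)
    {θ w : 𝓞 Ω} (hc : algebraMap (𝓞 K) (𝓞 Ω) c = (θ - conjInt σ θ) * w) {B : Ideal (𝓞 Ω)}
    (hB : conjIdeal σ B = B) (hcop : B ⊔ Ideal.span {algebraMap (𝓞 K) (𝓞 Ω) c} = ⊤) :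
    ∃ k s : 𝓞 K, B = Ideal.span {algebraMap (𝓞 K) (𝓞 Ω) k} ∧ k ∣ 1 + c * s := by
  have hconj : ∀ b ∈ B, conjInt σ b ∈ B := fun b hb => by
    rwa [← mem_conjIdeal hσ, hB]
  -- traces and norms lie in `𝓞 K`
  have htr : ∀ b : 𝓞 Ω, ∃ t : 𝓞 K, algebraMap (𝓞 K) (𝓞 Ω) t = b + conjInt σ b := fun b =>
    hσ.exists_of_conjInt_eq (by rw [map_add, hσ.conjInt_conjInt, add_comm])
  have hnr : ∀ b : 𝓞 Ω, ∃ t : 𝓞 K, algebraMap (𝓞 K) (𝓞 Ω) t = b * conjInt σ b := fun b =>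
    hσ.exists_of_conjInt_eq (by rw [map_mul, hσ.conjInt_conjInt, mul_comm])
  -- `k` generates the intersection of `B` with `𝓞 K`; it is coprime to `c`, as the norm of an
  -- element of `B` congruent to `1` shows
  obtain ⟨k, hk⟩ := (IsPrincipalIdealRing.principal (B.comap (algebraMap (𝓞 K) (𝓞 Ω)))).principal
  have hk' : ∀ x : 𝓞 K, algebraMap (𝓞 K) (𝓞 Ω) x ∈ B ↔ k ∣ x := by
    intro x
    rw [← Ideal.mem_span_singleton]
    change x ∈ B.comap (algebraMap (𝓞 K) (𝓞 Ω)) ↔ _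
    rw [hk]
  obtain ⟨s, hs⟩ : ∃ s, k ∣ 1 + c * s := by
    have h1 : (1 : 𝓞 Ω) ∈ B ⊔ Ideal.span {algebraMap (𝓞 K) (𝓞 Ω) c} := by
      rw [hcop]; exact Submodule.mem_top
    obtain ⟨b, hb, y, hy, e⟩ := Submodule.mem_sup.1 h1
    obtain ⟨r, rfl⟩ := Ideal.mem_span_singleton.1 hy
    obtain ⟨t, ht⟩ := htr r
    obtain ⟨n, hn⟩ := hnr r
    refine ⟨-t + c * n, (hk' _).1 ?_⟩
    have e1 : algebraMap (𝓞 K) (𝓞 Ω) (1 + c * (-t + c * n)) = b * conjInt σ b := by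
      have e2 : b = 1 - algebraMap (𝓞 K) (𝓞 Ω) c * r := by rw [← e]; ring
      rw [e2]
      simp only [map_add, map_mul, map_one, map_neg, ht, hn, map_sub, AlgEquiv.commutes]
      ring
    rw [e1]
    exact B.mul_mem_right _ hb
  refine ⟨k, s, le_antisymm ?_ ?_, hs⟩
  · intro b hb
    -- `(θ - σ θ) b` is a combination of the traces of `σ b` and of `θ σ b`, which `k` divides
    have h1 : algebraMap (𝓞 K) (𝓞 Ω) k ∣ algebraMap (𝓞 K) (𝓞 Ω) c * b := by
      obtain ⟨t₁, ht₁⟩ := htr (conjInt σ b)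
      obtain ⟨t₂, ht₂⟩ := htr (θ * conjInt σ b)
      have d1 : k ∣ t₁ := (hk' _).1 (by
        rw [ht₁]; exact B.add_mem (hconj _ hb) (hconj _ (hconj _ hb)))
      have d2 : k ∣ t₂ := (hk' _).1 (by
        rw [ht₂]
        exact B.add_mem (B.mul_mem_left _ (hconj _ hb)) (hconj _ (B.mul_mem_left _ (hconj _ hb))))
      have e1 : algebraMap (𝓞 K) (𝓞 Ω) c * b = w * (θ * algebraMap (𝓞 K) (𝓞 Ω) t₁ -
          algebraMap (𝓞 K) (𝓞 Ω) t₂) := by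
        rw [hc, ht₁, ht₂, map_mul, hσ.conjInt_conjInt]
        ring
      rw [e1]
      exact ((map_dvd _ d1).mul_left θ |>.sub (map_dvd _ d2)).mul_left w
    rw [Ideal.mem_span_singleton]
    have e2 : b = algebraMap (𝓞 K) (𝓞 Ω) (1 + c * s) * b -
        algebraMap (𝓞 K) (𝓞 Ω) s * (algebraMap (𝓞 K) (𝓞 Ω) c * b) := by
      simp only [map_add, map_mul, map_one]; ring
    rw [e2]
    exact ((map_dvd _ hs).mul_right b).sub (h1.mul_left _)
  · rw [Ideal.span_singleton_le_iff_mem]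
    exact (hk' k).2 dvd_rfl

theorem det_simDiag {α₁ α₂ : Ω} (h1 : α₁ ≠ 0) (h2 : α₂ ≠ 0) (m : K) :
    (simDiag σ α₁ α₂ m).det * σ (α₁ * α₂) = algebraMap K Ω m ^ 2 * (α₁ * α₂) := by
  have h1' : σ α₁ ≠ 0 := by simpa using h1
  have h2' : σ α₂ ≠ 0 := by simpa using h2
  unfold simDiag
  rw [Matrix.det_diagonal, Fintype.prod_sum_type, Fin.prod_univ_two, Fin.prod_univ_two, map_mul]
  simp only [Sum.elim_inl, Sum.elim_inr, Matrix.cons_val_zero, Matrix.cons_val_one]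
  field_simp

theorem det_approxOrbit {M N : GL (Fin 2 ⊕ Fin 2) Ω} (hN : N ∈ approxOrbit σ c M) :
    N.1.det = M.1.det := by
  obtain ⟨g₁, h₁, g₂, h₂, rfl⟩ := hN
  rw [Units.val_mul, Units.val_mul, Matrix.det_mul, Matrix.det_mul, h₁.2.1, h₂.2.1, one_mul,
    mul_one]

/-- The ideal of minors of order two is principal, and a generator of its extension to the
semilocal ring differs from a global generator by an element of `K`. -/
theorem exists_minorIdeal_eq_span [IsPrincipalIdealRing (𝓞 K)] (hσ : IsQuadraticConj σ)
    {θ w : 𝓞 Ω} {m : 𝓞 K} (hm : m ≠ 0) (hcu : ¬ IsUnit c)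
    (hc : algebraMap (𝓞 K) (𝓞 Ω) c = (θ - conjInt σ θ) * w) (hmc : m ∣ c)
    {M : GL (Fin 2 ⊕ Fin 2) Ω} (hM : IsIntegralMatrix M.1) (hs : HasSimilitude σ M.1 (m : K))
    {α : Ω} (hg : GeneratesAt c (minorIdeal M.1) α)
    (hdet : M.1.det * σ α = algebraMap K Ω (m : K) ^ 2 * α) :
    ∃ (β : 𝓞 Ω) (k z s : 𝓞 K), minorIdeal M.1 = Ideal.span {β} ∧ k ∣ 1 + c * s ∧
      algebraMap K Ω ((1 + c * z : 𝓞 K) : K) * α = algebraMap K Ω (k : K) * (β : Ω) := by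
  set I := minorIdeal M.1 with hI
  obtain ⟨z, y, hy, ey⟩ := hg.exists_mem
  have hm' : algebraMap (𝓞 K) (𝓞 Ω) m ≠ 0 := by
    rwa [Ne, FaithfulSMul.algebraMap_eq_zero_iff]
  have hI0 : I ≠ 0 := fun h => pow_ne_zero 2 hm' (by
    have := algebraMap_sq_mem_minorIdeal hM hm hs
    rw [← hI, h] at this
    exact this)
  obtain ⟨B, hB⟩ : I ∣ Ideal.span {y} := Ideal.dvd_iff_le.2
      ((Ideal.span_singleton_le_iff_mem _).2 hy)
  -- the ideal `(y)` differs from `I` by an ideal `B` which is trivial at the primes dividing `c`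
  have hcop : B ⊔ Ideal.span {algebraMap (𝓞 K) (𝓞 Ω) c} = ⊤ := by
    have h1 : I ≤ I * (B ⊔ Ideal.span {algebraMap (𝓞 K) (𝓞 Ω) c}) := by
      intro x hx
      obtain ⟨r, ⟨z', r', er⟩, ex⟩ := hg.dvdIn x hx
      have e1 : algebraMap (𝓞 K) (𝓞 Ω) ((1 + c * z) * (1 + c * z')) * x = y * r' := by
        refine RingOfIntegers.ext ?_
        rw [coe_mul, coe_mul, ey, ← er, ex, coe_algebraMap_eq, coe_mul, map_mul]
        ring
      have e2 : x = y * r' - algebraMap (𝓞 K) (𝓞 Ω) (z + z' + c * z * z') *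
          (x * algebraMap (𝓞 K) (𝓞 Ω) c) := by
        rw [← e1]
        simp only [map_add, map_mul, map_one]
        ring
      rw [e2, Ideal.mul_sup]
      refine Ideal.sub_mem _ (Ideal.mul_mem_right _ _ ?_) (Ideal.mul_mem_left _ _ ?_)
      · refine Ideal.mem_sup_left ?_
        rw [← hB]; exact Ideal.mem_span_singleton_self y
      · exact Ideal.mem_sup_right (Ideal.mul_mem_mul hx (Ideal.mem_span_singleton_self _))
    have h2 : I * (B ⊔ Ideal.span {algebraMap (𝓞 K) (𝓞 Ω) c}) = I * 1 := by
      rw [mul_one]; exact le_antisymm Ideal.mul_le_left h1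
    exact (mul_left_cancel₀ hI0 h2).trans Ideal.one_eq_top
  obtain ⟨δ, eδ, hδ⟩ := exists_det_dvd hM hm hs
  -- by the determinant, `(y)` and its conjugate differ by divisors of a power of `m`, to which `B`
  -- is coprime; so `B` is fixed by the conjugation
  have eδ' : δ * conjInt σ y = algebraMap (𝓞 K) (𝓞 Ω) m ^ 2 * y := by
    refine RingOfIntegers.ext ?_
    rw [coe_mul, eδ, coe_conjInt, ey, map_mul, conj_coe, pow_two, coe_mul, coe_mul,
      coe_algebraMap_eq, ey]
    linear_combination algebraMap K Ω ((1 + c * z : 𝓞 K) : K) * hdet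
  have hcm : IsCoprime B (Ideal.span {algebraMap (𝓞 K) (𝓞 Ω) m}) := by
    rw [Ideal.isCoprime_iff_sup_eq, eq_top_iff, ← hcop]
    refine sup_le_sup le_rfl ?_
    rw [Ideal.span_singleton_le_span_singleton]
    exact map_dvd _ hmc
  have hcop' : IsCoprime B (Ideal.span {δ} * conjIdeal σ I) := by
    refine IsCoprime.mul_right ?_ ?_
    · refine (hcm.pow_right (n := 4)).of_isCoprime_of_dvd_right ?_
      rw [Ideal.span_singleton_pow]
      exact Ideal.dvd_iff_le.2 ((Ideal.span_singleton_le_span_singleton).2 hδ)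
    · refine (hcm.pow_right (n := 2)).of_isCoprime_of_dvd_right ?_
      rw [Ideal.span_singleton_pow, Ideal.dvd_iff_le, Ideal.span_singleton_le_iff_mem,
        mem_conjIdeal hσ, map_pow, AlgEquiv.commutes]
      exact algebraMap_sq_mem_minorIdeal hM hm hs
  have hdvd : B ∣ conjIdeal σ B := by
    refine hcop'.dvd_of_dvd_mul_left ?_
    have h1 : Ideal.span {δ} * conjIdeal σ I * conjIdeal σ B =
        Ideal.span {algebraMap (𝓞 K) (𝓞 Ω) m ^ 2} * I * B := by
      rw [mul_assoc, mul_assoc, ← conjIdeal_mul, ← hB, conjIdeal_span_singleton,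
        Ideal.span_singleton_mul_span_singleton, Ideal.span_singleton_mul_span_singleton, eδ']
    rw [h1]
    exact Dvd.intro_left _ rfl
  have hBB : conjIdeal σ B = B := by
    refine le_antisymm (Ideal.dvd_iff_le.1 hdvd) ?_
    have := conjIdeal_mono (σ := σ) (Ideal.dvd_iff_le.1 hdvd)
    rwa [conjIdeal_conjIdeal hσ] at this
  obtain ⟨k, s, hk, hks⟩ := exists_eq_span_of_conjIdeal_eq hσ hc hBB hcop
  have hyB : Ideal.span {y} ≤ B := by rw [hB]; exact Ideal.mul_le_right
  rw [hk, Ideal.span_singleton_le_span_singleton] at hyB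
  obtain ⟨β, rfl⟩ := hyB
  have hk0 : Ideal.span {algebraMap (𝓞 K) (𝓞 Ω) k} ≠ 0 := by
    intro h0
    have h3 : k = 0 := by
      have := Ideal.span_singleton_eq_bot.1 h0
      rwa [FaithfulSMul.algebraMap_eq_zero_iff] at this
    rw [h3, zero_dvd_iff] at hks
    exact hcu (IsUnit.of_mul_eq_one (-s) (by linear_combination -hks))
  refine ⟨β, k, z, s, ?_, hks, ?_⟩
  · rw [← Ideal.span_singleton_mul_span_singleton, hk, mul_comm] at hB
    exact (mul_right_cancel₀ hk0 hB).symm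
  · rw [← ey, coe_mul, coe_algebraMap_eq]

end Principal

/-! ### The invariants determine the double coset -/

section Injectivity

variable {K Ω : Type*} [Field K] [NumberField K] [Field Ω] [NumberField Ω] [Algebra K Ω]
  {σ : Ω ≃ₐ[K] Ω} {c : 𝓞 K}

theorem simDiag_mul (a b a' b' : Ω) (m m' : K) :
    simDiag σ a b m * simDiag σ a' b' m' = simDiag σ (a * a') (b * b') (m * m') := by
  unfold simDiag
  rw [Matrix.diagonal_mul_diagonal]
  congr 1
  funext i
  revert i
  rw [forall_idx]
  simp [div_mul_div_comm]

theorem hasSimilitude_simDiag (hσ : IsQuadraticConj σ) {a b : Ω} (ha : a ≠ 0) (hb : b ≠ 0) (m : K) :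
    HasSimilitude σ (simDiag σ a b m) m := by
  have ha' : σ a ≠ 0 := by simpa using ha
  have hb' : σ b ≠ 0 := by simpa using hb
  rw [hasSimilitude_iff, symplecticJ_two]
  simp [simDiag, mul_div_cancel₀, ha', hb', ha, hb, hσ.apply_apply]

/-- By the factorization of `diag(u, u⁻¹)` into elementary matrices. -/
theorem exists_mem_approxGroup_diag (hσ : IsQuadraticConj σ) {u : Ω} (hu : u ≠ 0)
    (h1 : u ∈ semilocalRing Ω c) (h2 : u⁻¹ ∈ semilocalRing Ω c) :
    ∃ g ∈ approxGroup 2 σ c, g.1 = simDiag σ u u⁻¹ (1 : K) := by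
  have hu' : σ u ≠ 0 := by simpa using hu
  obtain ⟨g₁, hg₁, e₁⟩ := exists_upperLevi hσ h1
  obtain ⟨g₂, hg₂, e₂⟩ := exists_lowerLevi hσ (Subring.neg_mem _ h2)
  obtain ⟨g₃, hg₃, e₃⟩ := exists_upperLevi hσ (c := c) (Subring.neg_mem _ (Subring.one_mem _))
  obtain ⟨g₄, hg₄, e₄⟩ := exists_lowerLevi hσ (c := c) (Subring.one_mem _)
  refine ⟨g₁ * g₂ * g₁ * (g₃ * g₄ * g₃), Subgroup.mul_mem _ (Subgroup.mul_mem _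
    (Subgroup.mul_mem _ hg₁ hg₂) hg₁) (Subgroup.mul_mem _ (Subgroup.mul_mem _ hg₃ hg₄) hg₃), ?_⟩
  have p1 : upperLevi σ u * lowerLevi σ (-u⁻¹) * upperLevi σ u =
      fromBlocks !![0, u; -u⁻¹, 0] 0 0 !![0, (σ u)⁻¹; -σ u, 0] := by
    simp [upperLevi, lowerLevi, Matrix.fromBlocks_multiply, hu, hu']
  have p2 : upperLevi σ (-1) * lowerLevi σ 1 * upperLevi σ (-1) =
      fromBlocks !![0, -1; 1, 0] 0 0 !![0, -1; 1, 0] := by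
    simp [upperLevi, lowerLevi, Matrix.fromBlocks_multiply]
  simp only [Units.val_mul, e₁, e₂, e₃, e₄]
  rw [p1, p2, Matrix.fromBlocks_multiply]
  refine Matrix.ext ?_
  simp only [forall_idx]
  simp [simDiag]

/-- By the factorization of `diag(u, u⁻¹)` into elementary matrices of `SL₂`, embedded in the second
and the fourth coordinate; the parameters have to be fixed by the conjugation. -/
theorem exists_mem_approxGroup_real (hσ : IsQuadraticConj σ) {u : Ω} (hu : u ≠ 0)
    (hfix : σ u = u) (h1 : u ∈ semilocalRing Ω c) (h2 : u⁻¹ ∈ semilocalRing Ω c) :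
    ∃ g ∈ approxGroup 2 σ c, g.1 = simDiag σ 1 u (1 : K) := by
  have z := Subring.zero_mem (semilocalRing Ω c)
  obtain ⟨g₁, hg₁, e₁⟩ := exists_upperUnip hσ z h1 z (map_zero σ) hfix
  obtain ⟨g₂, hg₂, e₂⟩ := exists_lowerUnip hσ z (Subring.neg_mem _ h2) z (map_zero σ)
    (by rw [map_neg, map_inv₀, hfix])
  obtain ⟨g₃, hg₃, e₃⟩ := exists_upperUnip hσ (c := c) z (Subring.neg_mem _ (Subring.one_mem _)) z
    (map_zero σ) (by rw [map_neg, map_one])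
  obtain ⟨g₄, hg₄, e₄⟩ := exists_lowerUnip hσ (c := c) z (Subring.one_mem _) z
    (map_zero σ) (map_one σ)
  refine ⟨g₁ * g₂ * g₁ * (g₃ * g₄ * g₃), Subgroup.mul_mem _ (Subgroup.mul_mem _
    (Subgroup.mul_mem _ hg₁ hg₂) hg₁) (Subgroup.mul_mem _ (Subgroup.mul_mem _ hg₃ hg₄) hg₃), ?_⟩
  have one2 : (1 : Matrix (Fin 2) (Fin 2) Ω) = !![1, 0; 0, 1] := by
    ext i j; fin_cases i <;> fin_cases j <;> rfl
  have z2 : (0 : Fin 2 → Ω) = ![0, 0] := by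
    ext i; fin_cases i <;> rfl
  have p1 : upperUnip σ 0 u 0 * lowerUnip σ 0 (-u⁻¹) 0 * upperUnip σ 0 u 0 =
      fromBlocks !![1, 0; 0, 0] !![0, 0; 0, u] !![0, 0; 0, -u⁻¹] !![1, 0; 0, 0] := by
    simp [upperUnip, lowerUnip, Matrix.fromBlocks_multiply, hu, one2]
    exact z2
  have p2 : upperUnip σ 0 (-1) 0 * lowerUnip σ 0 1 0 * upperUnip σ 0 (-1) 0 =
      fromBlocks !![1, 0; 0, 0] !![0, 0; 0, -1] !![0, 0; 0, 1] !![1, 0; 0, 0] := by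
    simp [upperUnip, lowerUnip, Matrix.fromBlocks_multiply, one2]
    exact z2
  simp only [Units.val_mul, e₁, e₂, e₃, e₄]
  rw [p1, p2, Matrix.fromBlocks_multiply]
  refine Matrix.ext ?_
  simp only [forall_idx]
  simp [simDiag, hfix]

theorem exists_mem_modularGroup_unit (hσ : IsQuadraticConj σ) (w : (𝓞 Ω)ˣ) :
    ∃ g ∈ modularGroup 2 σ, g.1 = simDiag σ 1 ((w : 𝓞 Ω) : Ω) (1 : K) := by
  have hw : ((w : 𝓞 Ω) : Ω) ≠ 0 := by simp
  have h := hasSimilitude_simDiag hσ one_ne_zero hw (1 : K)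
  refine ⟨simGL one_ne_zero h, ⟨?_, 1, by rw [Units.val_one, coe_one]; exact h⟩, rfl⟩
  have e : (σ ((w : 𝓞 Ω) : Ω))⁻¹ = ((conjInt σ ((w⁻¹ : (𝓞 Ω)ˣ) : 𝓞 Ω) : 𝓞 Ω) : Ω) := by
    rw [coe_conjInt, ← map_inv₀]
    congr 1
    refine inv_eq_of_mul_eq_one_right ?_
    rw [← coe_mul, Units.mul_inv, coe_one]
  have h1 : IsIntegral ℤ (σ ((w : 𝓞 Ω) : Ω))⁻¹ := by rw [e]; exact RingOfIntegers.isIntegral_coe _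
  have h2 : IsIntegral ℤ ((w : 𝓞 Ω) : Ω) := RingOfIntegers.isIntegral_coe _
  change IsIntegralMatrix (simDiag σ 1 ((w : 𝓞 Ω) : Ω) (1 : K))
  unfold IsIntegralMatrix
  simp only [forall_idx]
  simp [simDiag, isIntegral_zero, isIntegral_one, h1, h2]

theorem exists_not_fixed (hσ : IsQuadraticConj σ) : ∃ θ : 𝓞 Ω, θ - conjInt σ θ ≠ 0 := by
  by_contra hcon
  push Not at hcon
  refine hσ.ne_one (AlgEquiv.ext fun x => ?_)
  obtain ⟨a, b, hb, rfl⟩ := IsFractionRing.div_surjective (A := 𝓞 Ω) x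
  have h : ∀ y : 𝓞 Ω, σ (y : Ω) = y := fun y => by
    rw [← coe_conjInt, ← sub_eq_zero.1 (hcon y)]
  rw [AlgEquiv.one_apply, map_div₀]
  exact congrArg₂ _ (h a) (h b)

/-- A multiple of a given number which is also divisible by a discriminant. -/
theorem exists_modulus (hσ : IsQuadraticConj σ) {a : 𝓞 K} (ha : a ≠ 0) :
    ∃ (c : 𝓞 K) (θ w : 𝓞 Ω), ¬ IsUnit c ∧ c ≠ 0 ∧ a ∣ c ∧
      algebraMap (𝓞 K) (𝓞 Ω) c = (θ - conjInt σ θ) * w := by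
  obtain ⟨π, hπ, hπ'⟩ := Ring.exists_not_isUnit_of_not_isField (RingOfIntegers.not_isField K)
  obtain ⟨θ, hθ⟩ := exists_not_fixed hσ
  obtain ⟨d, hd⟩ := hσ.exists_of_conjInt_eq
    (x := (θ - conjInt σ θ) * conjInt σ (θ - conjInt σ θ))
    (by rw [map_mul, hσ.conjInt_conjInt, mul_comm])
  refine ⟨a * π * d, θ, algebraMap (𝓞 K) (𝓞 Ω) (a * π) * conjInt σ (θ - conjInt σ θ), ?_, ?_, ?_,
      ?_⟩
  · intro h
    exact hπ' (isUnit_of_mul_isUnit_right (isUnit_of_mul_isUnit_left h))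
  · refine mul_ne_zero (mul_ne_zero ha hπ) ?_
    rintro rfl
    rw [map_zero] at hd
    refine mul_ne_zero hθ ?_ hd.symm
    intro h
    have h1 := congrArg (conjInt σ) h
    rw [hσ.conjInt_conjInt, map_zero] at h1
    exact hθ h1
  · rw [mul_assoc]; exact Dvd.intro _ rfl
  · rw [map_mul, hd]; ring

/-- A unit of the semilocal ring, up to a global unit and an element of `K`, is congruent to a
modular matrix. -/
theorem exists_congrMod_simDiag (hσ : IsQuadraticConj σ) {u₁ u₂ κ : Ω} (w : (𝓞 Ω)ˣ)
    (hu : u₁ ≠ 0) (hκ : κ ≠ 0) (hu1 : u₁ ∈ semilocalRing Ω c) (hu2 : u₁⁻¹ ∈ semilocalRing Ω c)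
    (hκ1 : κ ∈ semilocalRing Ω c) (hκ2 : κ⁻¹ ∈ semilocalRing Ω c) (hfix : σ κ = κ)
    (h : u₁ * u₂ = ((w : 𝓞 Ω) : Ω) * κ) :
    ∃ t : GL (Fin 2 ⊕ Fin 2) Ω, t.1 = simDiag σ u₁ u₂ (1 : K) ∧ IsSemilocal c t.1 ∧
      ∃ γ ∈ modularGroup 2 σ, CongrMod c t.1 γ.1 := by
  obtain ⟨g₁, h₁, e₁⟩ := exists_mem_approxGroup_diag hσ hu hu1 hu2
  obtain ⟨g₂, h₂, e₂⟩ := exists_mem_modularGroup_unit hσ w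
  obtain ⟨g₃, h₃, e₃⟩ := exists_mem_approxGroup_real hσ hκ hfix hκ1 hκ2
  have s₁ := approxGroup_isSemilocal h₁
  have s₃ := approxGroup_isSemilocal h₃
  obtain ⟨-, -, γ₁, k₁, c₁⟩ := h₁
  obtain ⟨-, -, γ₃, k₃, c₃⟩ := h₃
  refine ⟨g₁ * g₂ * g₃, ?_, (s₁.mul (h₂.1.isSemilocal c)).mul s₃, γ₁ * g₂ * γ₃,
    Subgroup.mul_mem _ (Subgroup.mul_mem _ k₁ h₂) k₃, ?_⟩
  · rw [Units.val_mul, Units.val_mul, e₁, e₂, e₃, simDiag_mul, simDiag_mul]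
    congr 1
    · ring
    · rw [mul_assoc, ← h, inv_mul_cancel_left₀ hu]
    · ring
  · simp only [Units.val_mul]
    exact (c₁.mul_right (h₂.1.isSemilocal c)).mul c₃
      ((k₁.1.mul h₂.1).isSemilocal c) s₃

/-- If `M'` is congruent to `γ₁ M γ₂` modulo a multiple of the similitude `m`, then `M' γ₂⁻¹ M⁻¹` is
integral, since `m M⁻¹` is. -/
theorem mem_modularGroup_of_congr {m c₁ : 𝓞 K} (hm : m ≠ 0) (hc : c = m * c₁)
    {M M' : GL (Fin 2 ⊕ Fin 2) Ω} (hM : IsIntegralMatrix M.1) (hM' : IsIntegralMatrix M'.1)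
    (hs : HasSimilitude σ M.1 (m : K)) (hs' : HasSimilitude σ M'.1 (m : K))
    {γ₁ γ₂ : GL (Fin 2 ⊕ Fin 2) Ω} (h₁ : γ₁ ∈ modularGroup 2 σ) (h₂ : γ₂ ∈ modularGroup 2 σ)
    (h : CongrMod c M'.1 (γ₁.1 * M.1 * γ₂.1)) :
    ∃ X ∈ modularGroup 2 σ, M' = X * M * γ₂ := by
  have hm' : (m : K) ≠ 0 := by simpa using hm
  obtain ⟨u₁, hu₁⟩ := h₁.2
  obtain ⟨u₂, hu₂⟩ := h₂.2
  refine ⟨M' * γ₂⁻¹ * M⁻¹, ⟨?_, u₂⁻¹, ?_⟩, by group⟩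
  · obtain ⟨N, hN, -, hinv⟩ := exists_mul_eq_smul hM hm' hs
    choose r hr er using h
    have hint : ∀ i j, IsIntegral ℤ (r i j) := fun i j => by
      refine isIntegral_of_mul_isIntegral (hr i j) ?_
      have e1 : algebraMap K Ω (c : K) * r i j = M'.1 i j - (γ₁.1 * M.1 * γ₂.1) i j := by
        rw [er]; ring
      rw [e1]
      exact (hM' i j).sub (((h₁.1.mul hM).mul h₂.1) i j)
    have hM'e : M'.1 = γ₁.1 * M.1 * γ₂.1 + algebraMap K Ω (c : K) • Matrix.of r := by
      ext i j
      rw [er i j]; rfl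
    have hγ₂ : IsIntegralMatrix (γ₂⁻¹).1 := (Subgroup.inv_mem _ h₂).1
    have hmΩ : algebraMap K Ω (m : K) ≠ 0 := by simpa using hm'
    have e2 : (M' * γ₂⁻¹ * M⁻¹).1 = γ₁.1 + algebraMap K Ω (c₁ : K) •
        (Matrix.of r * (γ₂⁻¹).1 * N) := by
      have e3 : γ₁.1 * M.1 * γ₂.1 * (γ₂⁻¹).1 * (M⁻¹).1 = γ₁.1 := by
        rw [← Units.val_mul, ← Units.val_mul, ← Units.val_mul, ← Units.val_mul]
        congr 1; group
      have e4 : (M⁻¹).1 = (algebraMap K Ω (m : K))⁻¹ • N := by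
        rw [hinv]; ext i j
        simp only [Matrix.smul_apply, Algebra.smul_def, map_inv₀]; rfl
      rw [Units.val_mul, Units.val_mul, hM'e, Matrix.add_mul, Matrix.add_mul, e3, e4]
      congr 1
      rw [Matrix.smul_mul, Matrix.smul_mul, Matrix.mul_smul, smul_smul, hc, coe_mul, map_mul]
      congr 1
      field_simp
    rw [e2]
    intro i j
    refine (h₁.1 i j).add ?_
    rw [Matrix.smul_apply, smul_eq_mul]
    refine IsIntegral.mul ?_ (IsIntegralMatrix.mul (IsIntegralMatrix.mul (fun i j => hint i j) hγ₂)
        hN i j)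
    exact (algebraMap (𝓞 K) (𝓞 Ω) c₁).2
  · have h3 := (hs'.mul (hu₂.inv (by simp))).mul (hs.inv hm')
    have e : (m : K) * ((u₂ : 𝓞 K) : K)⁻¹ * (m : K)⁻¹ = (((u₂⁻¹ : (𝓞 K)ˣ) : 𝓞 K) : K) := by
      rw [mul_comm (m : K), mul_inv_cancel_right₀ hm']
      refine inv_eq_of_mul_eq_one_right ?_
      rw [← coe_mul, Units.mul_inv, coe_one]
    rw [e] at h3
    exact h3

/-- The similitude and the ideals of entries and of minors determine the double coset. -/
theorem exists_eq_mul_of_ideals_eq [IsPrincipalIdealRing (𝓞 K)] (hσ : IsQuadraticConj σ)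
    {m : 𝓞 K} (hm : m ≠ 0)
    {M M' : GL (Fin 2 ⊕ Fin 2) Ω} (hM : IsIntegralMatrix M.1) (hM' : IsIntegralMatrix M'.1)
    (hs : HasSimilitude σ M.1 (m : K)) (hs' : HasSimilitude σ M'.1 (m : K))
    (h1 : entryIdeal M.1 = entryIdeal M'.1) (h2 : minorIdeal M.1 = minorIdeal M'.1) :
    ∃ X ∈ modularGroup 2 σ, ∃ Y ∈ modularGroup 2 σ, M' = X * M * Y := by
  have hm' : (m : K) ≠ 0 := by simpa using hm
  obtain ⟨c, θ, w, hcu, hc0, ⟨c₁, hmc⟩, hcθ⟩ := exists_modulus hσ hm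
  obtain ⟨α₁, α₂, ha1, ha2, -, -, hd1, hd2, N, hN, eN⟩ :=
    exists_simDiag hcu hc0 hσ (hM.isSemilocal c) hm' hs
  obtain ⟨α₁', α₂', ha1', ha2', -, -, hd1', hd2', N', hN', eN'⟩ :=
    exists_simDiag hcu hc0 hσ (hM'.isSemilocal c) hm' hs'
  obtain ⟨G1, G2⟩ := generatesAt_of_simDiag hM hN eN hd1 hd2 ha1 ha2
  obtain ⟨G1', G2'⟩ := generatesAt_of_simDiag hM' hN' eN' hd1' hd2' ha1' ha2'
  have D := det_simDiag (σ := σ) ha1 ha2 (m : K)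
  rw [← eN, det_approxOrbit hN] at D
  have D' := det_simDiag (σ := σ) ha1' ha2' (m : K)
  rw [← eN', det_approxOrbit hN'] at D'
  obtain ⟨β, k, z, s, eI, hk, eα⟩ := exists_minorIdeal_eq_span hσ hm hcu hcθ ⟨c₁, hmc⟩ hM hs G2 D
  obtain ⟨β', k', z', s', eI', hk', eα'⟩ :=
    exists_minorIdeal_eq_span hσ hm hcu hcθ ⟨c₁, hmc⟩ hM' hs' G2' D'
  -- the quotients of the elementary divisors
  rw [← h1] at G1'
  obtain ⟨u, hu, eu⟩ := G1.dvdIn_dvdIn hcu G1'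
  obtain ⟨v, hv, ev⟩ := G1'.dvdIn_dvdIn hcu G1
  have huv : u * v = 1 := by
    rw [eu, mul_assoc] at ev
    exact (mul_eq_left₀ ha1).1 ev.symm
  have hu0 : u ≠ 0 := left_ne_zero_of_mul_eq_one huv
  have hui : u⁻¹ = v := inv_eq_of_mul_eq_one_right huv
  obtain ⟨ω, hω⟩ : Associated β β' := by
    rw [← Ideal.span_singleton_eq_span_singleton, ← eI, ← eI', h2]
  -- elements of `K` dividing an element of `1 + c 𝓞 K` are units of the semilocal ring
  have kinv : ∀ k s : 𝓞 K, k ∣ 1 + c * s → algebraMap K Ω (k : K) ≠ 0 ∧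
      (algebraMap K Ω (k : K))⁻¹ ∈ semilocalRing Ω c := by
    rintro k s ⟨l, hl⟩
    have hne := one_add_mul_ne_zero (Ω := Ω) hcu s
    have e1 : algebraMap K Ω ((1 + c * s : 𝓞 K) : K) =
        algebraMap K Ω (k : K) * algebraMap K Ω (l : K) := by rw [hl, coe_mul, map_mul]
    have hk0 : algebraMap K Ω (k : K) ≠ 0 := fun h => hne (by rw [e1, h, zero_mul])
    have hl0 : algebraMap K Ω (l : K) ≠ 0 := fun h => hne (by rw [e1, h, mul_zero])
    refine ⟨hk0, ?_⟩
    have e2 : (algebraMap K Ω (k : K))⁻¹ = algebraMap K Ω (l : K) *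
        (algebraMap K Ω ((1 + c * s : 𝓞 K) : K))⁻¹ := by
      rw [e1]; field_simp
    rw [e2]
    exact Subring.mul_mem _ (algebraMap_mem_semilocalRing c l) (inv_mem_semilocalRing hcu s)
  obtain ⟨hk0, hkR⟩ := kinv k s hk
  obtain ⟨hk0', hkR'⟩ := kinv k' s' hk'
  have hz0 := one_add_mul_ne_zero (Ω := Ω) hcu z
  have hz0' := one_add_mul_ne_zero (Ω := Ω) hcu z'
  set A := algebraMap K Ω (k : K)
  set A' := algebraMap K Ω (k' : K)
  set Z := algebraMap K Ω ((1 + c * z : 𝓞 K) : K)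
  set Z' := algebraMap K Ω ((1 + c * z' : 𝓞 K) : K)
  -- the determinant of `diag(u, α₂' / α₂)` is a global unit times the element `κ` of `K`; this is
  -- where the principal ideals of minors enter
  obtain ⟨κ, hκ⟩ : ∃ κ, κ = A' * Z * (A⁻¹ * Z'⁻¹) := ⟨_, rfl⟩
  have hκi : κ⁻¹ = A * Z' * (A'⁻¹ * Z⁻¹) := by
    rw [hκ]; field_simp
  have hκ0 : κ ≠ 0 := by
    rw [hκ]
    exact mul_ne_zero (mul_ne_zero hk0' hz0) (mul_ne_zero (inv_ne_zero hk0) (inv_ne_zero hz0'))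
  have hβ' : (β' : Ω) = (β : Ω) * ((ω : 𝓞 Ω) : Ω) := by rw [← hω, coe_mul]
  have hprod : u * (α₂' / α₂) = ((ω : 𝓞 Ω) : Ω) * κ := by
    rw [hβ'] at eα'
    have e3 : u = α₁' / α₁ := by rw [eu]; field_simp
    have hβ0 : (β : Ω) ≠ 0 := by
      intro h0
      rw [h0, mul_zero] at eα
      exact mul_ne_zero hz0 (mul_ne_zero ha1 ha2) eα
    rw [e3, hκ]
    field_simp
    refine mul_left_cancel₀ hβ0 ?_
    linear_combination ((β : Ω) * A) * eα' - A' * (β : Ω) * ((ω : 𝓞 Ω) : Ω) * eα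
  obtain ⟨t, et, hts, γ, hγ, htγ⟩ := exists_congrMod_simDiag hσ ω hu0 hκ0 hu (hui ▸ hv)
    (by rw [hκ]; exact Subring.mul_mem _ (Subring.mul_mem _ (algebraMap_mem_semilocalRing c _)
      (algebraMap_mem_semilocalRing c _)) (Subring.mul_mem _ hkR (inv_mem_semilocalRing hcu z')))
    (by rw [hκi]; exact Subring.mul_mem _ (Subring.mul_mem _ (algebraMap_mem_semilocalRing c _)
      (algebraMap_mem_semilocalRing c _)) (Subring.mul_mem _ hkR' (inv_mem_semilocalRing hcu z)))
    (by rw [hκ]; simp only [map_mul, map_inv₀, A, A', Z, Z', conj_coe]) hprod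
  have hNN : N' = t * N := by
    refine Units.ext ?_
    rw [Units.val_mul, eN', eN, et, simDiag_mul, one_mul, eu, mul_comm u, div_mul_cancel₀ _ ha2]
  obtain ⟨g₁, hg₁, g₂, hg₂, eN1⟩ := hN
  obtain ⟨g₁', hg₁', g₂', hg₂', eN1'⟩ := hN'
  have hfin : M' = (g₁'⁻¹ * t * g₁) * M * (g₂ * g₂'⁻¹) := by
    have : M' = g₁'⁻¹ * N' * g₂'⁻¹ := by rw [eN1']; group
    rw [this, hNN, eN1]; group
  -- all factors are congruent modulo `c` to modular matrices, and `c` is a multiple of `m`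
  obtain ⟨-, -, δ₁, hδ₁, k₁⟩ := hg₁
  have s2 := approxGroup_isSemilocal hg₂
  obtain ⟨-, -, δ₂, hδ₂, k₂⟩ := hg₂
  have s1' := approxGroup_isSemilocal (Subgroup.inv_mem _ hg₁')
  obtain ⟨-, -, δ₁', hδ₁', k₁'⟩ := Subgroup.inv_mem _ hg₁'
  have s2' := approxGroup_isSemilocal (Subgroup.inv_mem _ hg₂')
  obtain ⟨-, -, δ₂', hδ₂', k₂'⟩ := Subgroup.inv_mem _ hg₂'
  have q1 : CongrMod c (g₁'⁻¹ * t * g₁).1 (δ₁' * γ * δ₁).1 := by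
    simp only [Units.val_mul]
    exact (k₁'.mul htγ (hδ₁'.1.isSemilocal c) hts).mul k₁
      ((hδ₁'.1.mul hγ.1).isSemilocal c) (k₁.isSemilocal (hδ₁.1.isSemilocal c))
  have q2 : CongrMod c (g₂ * g₂'⁻¹).1 (δ₂ * δ₂').1 := by
    rw [Units.val_mul, Units.val_mul]
    exact k₂.mul k₂' (hδ₂.1.isSemilocal c) s2'
  have hΓ1 : δ₁' * γ * δ₁ ∈ modularGroup 2 σ :=
    Subgroup.mul_mem _ (Subgroup.mul_mem _ hδ₁' hγ) hδ₁
  have hΓ2 : δ₂ * δ₂' ∈ modularGroup 2 σ := Subgroup.mul_mem _ hδ₂ hδ₂'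
  have q3 : CongrMod c M'.1 ((δ₁' * γ * δ₁).1 * M.1 * (δ₂ * δ₂').1) := by
    have e : M'.1 = (g₁'⁻¹ * t * g₁).1 * M.1 * (g₂ * g₂'⁻¹).1 := by
      rw [← Units.val_mul, ← Units.val_mul, ← hfin]
    rw [e]
    refine (q1.mul_right (hM.isSemilocal c)).mul q2 ((hΓ1.1.mul hM).isSemilocal c) ?_
    rw [Units.val_mul]
    exact s2.mul s2'
  obtain ⟨X, hX, eX⟩ := mem_modularGroup_of_congr hm hmc hM hM' hs hs' hΓ1 hΓ2 q3
  exact ⟨X, hX, _, hΓ2, eX⟩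

end Injectivity

/-! ### Relative norms and the ideal invariants of a double coset -/

section Invariants

variable {K Ω : Type*} [Field K] [NumberField K] [Field Ω] [NumberField Ω] [Algebra K Ω]
  {σ : Ω ≃ₐ[K] Ω}

theorem algebraMap_intNorm (hσ : IsQuadraticConj σ) (x : 𝓞 Ω) :
    algebraMap (𝓞 K) (𝓞 Ω) (Algebra.intNorm (𝓞 K) (𝓞 Ω) x) = x * conjInt σ x := by
  classical
  have := hσ.isGalois
  have : FiniteDimensional K Ω := FiniteDimensional.of_finrank_eq_succ hσ.finrank_eq
  refine RingOfIntegers.ext ?_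
  have h1 := Algebra.algebraMap_intNorm (A := 𝓞 K) (K := K) (L := Ω) (B := 𝓞 Ω) x
  have h2 := Algebra.norm_eq_prod_automorphisms K (x : Ω)
  have huniv : (Finset.univ : Finset (Ω ≃ₐ[K] Ω)) = {1, σ} := by
    refine (Finset.eq_of_subset_of_card_le (Finset.subset_univ _) ?_).symm
    rw [Finset.card_pair hσ.ne_one.symm, Finset.card_univ, ← Nat.card_eq_fintype_card, hσ.card_eq]
  rw [huniv, Finset.prod_pair hσ.ne_one.symm] at h2
  rw [coe_mul, coe_algebraMap_eq, coe_conjInt]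
  exact (congrArg (algebraMap K Ω) h1).trans h2

theorem relNorm_conjIdeal (I : Ideal (𝓞 Ω)) :
    Ideal.relNorm (𝓞 K) (conjIdeal σ I) = Ideal.relNorm (𝓞 K) I :=
  Ideal.relNorm_map_algEquiv (conjInt σ) I

theorem relNorm_map_algebraMap (hσ : IsQuadraticConj σ) (I : Ideal (𝓞 K)) :
    Ideal.relNorm (𝓞 K) (I.map (algebraMap (𝓞 K) (𝓞 Ω))) = I ^ 2 := by
  rw [Ideal.relNorm_algebraMap, ← hσ.finrank_eq, IsFractionRing.finrank_eq (𝓞 K) K (𝓞 Ω) Ω]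

theorem eq_top_of_relNorm_eq_one {I : Ideal (𝓞 Ω)} (h : Ideal.relNorm (𝓞 K) I = 1) : I = 1 := by
  have h1 := Ideal.relNorm_le_comap (𝓞 K) I
  rw [h, Ideal.one_eq_top, top_le_iff, Ideal.comap_eq_top_iff] at h1
  rw [h1, Ideal.one_eq_top]

/-- The product of an ideal and its conjugate is extended from its relative norm. -/
theorem map_relNorm_eq_mul_conjIdeal (hσ : IsQuadraticConj σ) (I : Ideal (𝓞 Ω)) :
    (Ideal.relNorm (𝓞 K) I).map (algebraMap (𝓞 K) (𝓞 Ω)) = I * conjIdeal σ I := by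
  by_cases hI : I = ⊥
  · rw [hI, Ideal.relNorm_bot, Ideal.map_bot, Ideal.bot_mul]
  -- one inclusion holds elementwise, and both sides have the same relative norm
  have hle : (Ideal.relNorm (𝓞 K) I).map (algebraMap (𝓞 K) (𝓞 Ω)) ≤ I * conjIdeal σ I := by
    rw [Ideal.map_relNorm, Ideal.span_le]
    rintro _ ⟨x, hx, rfl⟩
    change algebraMap (𝓞 K) (𝓞 Ω) (Algebra.intNorm (𝓞 K) (𝓞 Ω) x) ∈ _
    rw [algebraMap_intNorm hσ]
    refine Ideal.mul_mem_mul hx ?_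
    rw [mem_conjIdeal hσ, hσ.conjInt_conjInt]
    exact hx
  obtain ⟨Q, hQ⟩ := Ideal.dvd_iff_le.2 hle
  have h1 := congrArg (Ideal.relNorm (𝓞 K)) hQ
  rw [relNorm_map_algebraMap hσ, map_mul, map_mul, relNorm_conjIdeal (K := K), ← pow_two] at h1
  have h0 : Ideal.relNorm (𝓞 K) I ^ 2 ≠ 0 := pow_ne_zero 2 fun h =>
    hI (Ideal.relNorm_eq_bot_iff.1 h)
  have h2 : Ideal.relNorm (𝓞 K) Q = 1 := mul_left_cancel₀ h0 (by rw [mul_one]; exact h1.symm)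
  rw [hQ, eq_top_of_relNorm_eq_one h2, mul_one]

theorem minorIdeal_le_sq {M : Matrix (Fin 2 ⊕ Fin 2) (Fin 2 ⊕ Fin 2) Ω}
    (hM : IsIntegralMatrix M) : minorIdeal M ≤ entryIdeal M ^ 2 := by
  refine Ideal.span_le.2 ?_
  rintro y ⟨i, j, k, l, hy⟩
  choose a ha ea using exists_mem_entryIdeal hM
  have e : y = a i k * a j l - a i l * a j k := by
    refine RingOfIntegers.ext ?_
    rw [hy, minor, ← ea, ← ea, ← ea, ← ea, ← coe_mul, ← coe_mul]
    exact (map_sub (algebraMap (𝓞 Ω) Ω) _ _).symm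
  rw [e, pow_two]
  exact Ideal.sub_mem _ (Ideal.mul_mem_mul (ha _ _) (ha _ _)) (Ideal.mul_mem_mul (ha _ _) (ha _ _))

/-- The local condition that the second elementary divisor divides the third one, in terms of
ideals. -/
theorem span_mul_le_minorIdeal (hσ : IsQuadraticConj σ) {m : 𝓞 K} (hm : m ≠ 0)
    {M : GL (Fin 2 ⊕ Fin 2) Ω} (hM : IsIntegralMatrix M.1) (hs : HasSimilitude σ M.1 (m : K)) :
    Ideal.span {algebraMap (𝓞 K) (𝓞 Ω) m} * (entryIdeal M.1 * conjIdeal σ (entryIdeal M.1)) ≤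
      minorIdeal M.1 * conjIdeal σ (minorIdeal M.1) := by
  have hm' : (m : K) ≠ 0 := by simpa using hm
  obtain ⟨c, -, -, hcu, hc0, ⟨c₁, hmc⟩, -⟩ := exists_modulus hσ (pow_ne_zero 4 hm)
  obtain ⟨α₁, α₂, ha1, ha2, -, -, hd1, hd2, N, hN, eN⟩ :=
    exists_simDiag hcu hc0 hσ (hM.isSemilocal c) hm' hs
  obtain ⟨G1, G2⟩ := generatesAt_of_simDiag hM hN eN hd1 hd2 ha1 ha2
  have hconj : ∀ y ∈ minorIdeal M.1, conjInt σ y ∈ conjIdeal σ (minorIdeal M.1) := fun y hy => by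
    rw [mem_conjIdeal hσ, hσ.conjInt_conjInt]; exact hy
  -- since `c` lies in the ideal on the right, the inclusion can be checked over the semilocal ring
  have hc : algebraMap (𝓞 K) (𝓞 Ω) c ∈ minorIdeal M.1 * conjIdeal σ (minorIdeal M.1) := by
    have h1 := algebraMap_sq_mem_minorIdeal hM hm hs
    have h2 := hconj _ h1
    rw [map_pow, AlgEquiv.commutes] at h2
    have h3 := Ideal.mul_mem_right (algebraMap (𝓞 K) (𝓞 Ω) c₁) _ (Ideal.mul_mem_mul h1 h2)
    have e : algebraMap (𝓞 K) (𝓞 Ω) c = algebraMap (𝓞 K) (𝓞 Ω) m ^ 2 *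
        algebraMap (𝓞 K) (𝓞 Ω) m ^ 2 * algebraMap (𝓞 K) (𝓞 Ω) c₁ := by
      rw [hmc, map_mul, map_pow]; ring
    rwa [e]
  have key : ∀ x ∈ entryIdeal M.1, ∀ y ∈ conjIdeal σ (entryIdeal M.1),
      algebraMap (𝓞 K) (𝓞 Ω) m * (x * y) ∈ minorIdeal M.1 * conjIdeal σ (minorIdeal M.1) := by
    intro x hx y hy
    obtain ⟨r₁, hr₁, e₁⟩ := G1.dvdIn x hx
    obtain ⟨r₂, hr₂, e₂⟩ := G1.dvdIn _ ((mem_conjIdeal hσ).1 hy)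
    obtain ⟨r₃, hr₃, e₃⟩ := hd2
    obtain ⟨z, w, hw, ew⟩ := G2.exists_mem
    have hσ2 : σ α₂ ≠ 0 := by simpa using ha2
    have e₂' : (y : Ω) = σ α₁ * σ r₂ := by
      rw [← map_mul, ← e₂, coe_conjInt, hσ.apply_apply]
    have e₃' : algebraMap K Ω (m : K) = α₂ * r₃ * σ α₂ := by rw [← e₃, div_mul_cancel₀ _ hσ2]
    obtain ⟨z', r, er⟩ := Subring.mul_mem _ (Subring.mul_mem _ hr₁ (conj_mem_semilocalRing σ hr₂))
        hr₃
    have e4 : algebraMap (𝓞 K) (𝓞 Ω) ((1 + c * z) * (1 + c * z) * (1 + c * z')) *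
        (algebraMap (𝓞 K) (𝓞 Ω) m * (x * y)) = w * conjInt σ w * r := by
      refine RingOfIntegers.ext ?_
      simp only [coe_conjInt, ew, ← er, coe_algebraMap_eq, e₁, e₂', e₃', map_mul, conj_coe]
      ring
    have e5 : algebraMap (𝓞 K) (𝓞 Ω) m * (x * y) = w * conjInt σ w * r -
        algebraMap (𝓞 K) (𝓞 Ω) c * (algebraMap (𝓞 K) (𝓞 Ω)
        (z + z + z' + c * z * z + (c + c) * z * z' +
          c * c * z * z * z') * (algebraMap (𝓞 K) (𝓞 Ω) m * (x * y))) := by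
      rw [← e4]
      simp only [map_add, map_mul, map_one]
      ring
    rw [e5]
    exact Ideal.sub_mem _ (Ideal.mul_mem_right _ _ (Ideal.mul_mem_mul hw (hconj w hw)))
      (Ideal.mul_mem_right _ _ hc)
  rw [Ideal.span_singleton_mul_le_iff]
  intro x hx
  refine Submodule.mul_induction_on hx key fun a b ha hb => ?_
  rw [mul_add]
  exact Ideal.add_mem _ ha hb

theorem HasSimilitude.unique {M : Matrix (Fin 2 ⊕ Fin 2) (Fin 2 ⊕ Fin 2) Ω} {m m' : K}
    (h : HasSimilitude σ M m) (h' : HasSimilitude σ M m') : m = m' := by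
  have h1 := h.symm.trans h'
  have h2 := congrFun (congrFun h1 (Sum.inl 0)) (Sum.inr 0)
  simpa [symplecticJ_two, Algebra.smul_def] using h2

/-- The ideal of entries of a double coset. -/
noncomputable def cosetEntries (C : HermitianCoset 2 σ) : Ideal (𝓞 Ω) :=
  entryIdeal ((Quotient.out C : similitudeMonoid 2 σ) : GL (Fin 2 ⊕ Fin 2) Ω).1

/-- The ideal of minors of order two of a double coset. -/
noncomputable def cosetMinors (C : HermitianCoset 2 σ) : Ideal (𝓞 Ω) :=
  minorIdeal ((Quotient.out C : similitudeMonoid 2 σ) : GL (Fin 2 ⊕ Fin 2) Ω).1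

/-- The ideal generated by the similitude of a double coset. -/
noncomputable def cosetSimilitude (C : HermitianCoset 2 σ) : Ideal (𝓞 K) :=
  Ideal.span {similitude (Quotient.out C)}

theorem similitude_spec (g : similitudeMonoid 2 σ) :
    similitude g ≠ 0 ∧ HasSimilitude σ g.1.1 (similitude g : K) := g.2.2.choose_spec

theorem exists_eq_mul_of_mk_eq {g h : similitudeMonoid 2 σ}
    (e : HeckeCoset.mk (modularGroup 2 σ) (modularGroup 2 σ) g =
      HeckeCoset.mk (modularGroup 2 σ) (modularGroup 2 σ) h) :
    ∃ X ∈ modularGroup 2 σ, ∃ Y ∈ modularGroup 2 σ, h.1 = X * g.1 * Y := (mk_eq_mk_iff g h).1 e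

theorem cosetEntries_mk {C : HermitianCoset 2 σ} {g : similitudeMonoid 2 σ}
    (e : HeckeCoset.mk (modularGroup 2 σ) (modularGroup 2 σ) g = C) :
    cosetEntries C = entryIdeal g.1.1 := by
  have e' : HeckeCoset.mk (modularGroup 2 σ) (modularGroup 2 σ) (Quotient.out C) =
    HeckeCoset.mk _ _ g := (Quotient.out_eq C).trans e.symm
  obtain ⟨X, hX, Y, hY, h⟩ := exists_eq_mul_of_mk_eq e'
  obtain ⟨X', hX', Y', hY', h'⟩ := exists_eq_mul_of_mk_eq e'.symm
  exact le_antisymm (entryIdeal_le_of_mul hX' hY' g.2.1 h')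
    (entryIdeal_le_of_mul hX hY (Quotient.out C).2.1 h)

theorem cosetMinors_mk {C : HermitianCoset 2 σ} {g : similitudeMonoid 2 σ}
    (e : HeckeCoset.mk (modularGroup 2 σ) (modularGroup 2 σ) g = C) :
    cosetMinors C = minorIdeal g.1.1 := by
  have e' : HeckeCoset.mk (modularGroup 2 σ) (modularGroup 2 σ) (Quotient.out C) =
    HeckeCoset.mk _ _ g := (Quotient.out_eq C).trans e.symm
  obtain ⟨X, hX, Y, hY, h⟩ := exists_eq_mul_of_mk_eq e'
  obtain ⟨X', hX', Y', hY', h'⟩ := exists_eq_mul_of_mk_eq e'.symm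
  exact le_antisymm (minorIdeal_le_of_mul hX' hY' g.2.1 h')
    (minorIdeal_le_of_mul hX hY (Quotient.out C).2.1 h)

theorem cosetSimilitude_mk {C : HermitianCoset 2 σ} {g : similitudeMonoid 2 σ}
    (e : HeckeCoset.mk (modularGroup 2 σ) (modularGroup 2 σ) g = C) {m : 𝓞 K}
    (hm : HasSimilitude σ g.1.1 (m : K)) : cosetSimilitude C = Ideal.span {m} := by
  have e' : HeckeCoset.mk (modularGroup 2 σ) (modularGroup 2 σ) (Quotient.out C) =
    HeckeCoset.mk _ _ g := (Quotient.out_eq C).trans e.symm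
  obtain ⟨X, hX, Y, hY, h⟩ := exists_eq_mul_of_mk_eq e'
  obtain ⟨-, u, hu⟩ := hX
  obtain ⟨-, v, hv⟩ := hY
  have h1 := (hu.mul (similitude_spec (Quotient.out C)).2).mul hv
  have h2 : g.1.1 = X.1 * (Quotient.out C : similitudeMonoid 2 σ).1.1 * Y.1 := by rw [h]; rfl
  rw [← h2] at h1
  have h3 := hm.unique h1
  unfold cosetSimilitude
  rw [Ideal.span_singleton_eq_span_singleton]
  refine ⟨u * v, RingOfIntegers.ext ?_⟩
  rw [h3, Units.val_mul, coe_mul, coe_mul]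
  ring

/-- Every unit of `𝓞 K` is the similitude of a modular matrix. -/
theorem exists_simDiag_unit (hσ : IsQuadraticConj σ) (u : (𝓞 K)ˣ) :
    ∃ g ∈ modularGroup 2 σ, HasSimilitude σ g.1 ((u : 𝓞 K) : K) := by
  have hu : ((u : 𝓞 K) : K) ≠ 0 := by simp
  have h := hasSimilitude_simDiag hσ (one_ne_zero (α := Ω)) one_ne_zero ((u : 𝓞 K) : K)
  refine ⟨simGL hu h, ⟨?_, u, h⟩, h⟩
  change IsIntegralMatrix (simDiag σ 1 1 ((u : 𝓞 K) : K))
  have h2 : IsIntegral ℤ (algebraMap K Ω ((u : 𝓞 K) : K)) :=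
    (algebraMap (𝓞 K) (𝓞 Ω) u).2
  unfold IsIntegralMatrix
  simp only [forall_idx]
  simp [simDiag, isIntegral_zero, isIntegral_one, h2]

/-- A double coset is determined by the ideals generated by its similitude, its entries and its
minors of order two. -/
theorem coset_ext [IsPrincipalIdealRing (𝓞 K)] (hσ : IsQuadraticConj σ)
    {C D : HermitianCoset 2 σ} (h1 : cosetEntries C = cosetEntries D)
    (h2 : cosetMinors C = cosetMinors D) (h3 : cosetSimilitude C = cosetSimilitude D) : C = D := by
  obtain ⟨hm, hs⟩ := similitude_spec (Quotient.out C)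
  obtain ⟨hm', hs'⟩ := similitude_spec (Quotient.out D)
  unfold cosetSimilitude at h3
  rw [Ideal.span_singleton_eq_span_singleton] at h3
  obtain ⟨u, hu⟩ := h3
  obtain ⟨g, hg, hgu⟩ := exists_simDiag_unit hσ u
  have hgi := hg.1.mul (Quotient.out C).2.1
  have hgs : HasSimilitude σ (g * (Quotient.out C).1).1 (similitude (Quotient.out D) : K) := by
    have := hgu.mul hs
    rwa [mul_comm, ← coe_mul, hu] at this
  have hgM : g * (Quotient.out C).1 ∈ similitudeMonoid 2 σ := ⟨hgi, _, hm', hgs⟩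
  have hC : HeckeCoset.mk (modularGroup 2 σ) (modularGroup 2 σ) ⟨_, hgM⟩ = C := by
    refine Eq.trans ?_ (Quotient.out_eq C)
    exact ((mk_eq_mk_iff _ _).2 ⟨g, hg, 1, Subgroup.one_mem _, by simp⟩).symm
  rw [cosetEntries_mk hC] at h1
  rw [cosetMinors_mk hC] at h2
  obtain ⟨X, hX, Y, hY, e⟩ := exists_eq_mul_of_ideals_eq hσ hm' hgi (Quotient.out D).2.1 hgs hs'
    h1 h2
  rw [← hC, ← Quotient.out_eq D]
  exact (mk_eq_mk_iff _ _).2 ⟨X, hX, Y, hY, e⟩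

theorem cosetEntries_ne_bot (C : HermitianCoset 2 σ) : cosetEntries C ≠ ⊥ := by
  obtain ⟨hm, hs⟩ := similitude_spec (Quotient.out C)
  intro h
  have := algebraMap_mem_entryIdeal (Quotient.out C).2.1 hm hs
  change _ ∈ cosetEntries C at this
  rw [h, Ideal.mem_bot, FaithfulSMul.algebraMap_eq_zero_iff] at this
  exact hm this

theorem cosetMinors_ne_bot (C : HermitianCoset 2 σ) : cosetMinors C ≠ ⊥ := by
  obtain ⟨hm, hs⟩ := similitude_spec (Quotient.out C)
  intro h
  have := algebraMap_sq_mem_minorIdeal (Quotient.out C).2.1 hm hs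
  change _ ∈ cosetMinors C at this
  rw [h, Ideal.mem_bot] at this
  exact hm ((FaithfulSMul.algebraMap_eq_zero_iff _ _).1 (pow_eq_zero_iff (two_ne_zero) |>.1 this))

theorem cosetSimilitude_ne_bot (C : HermitianCoset 2 σ) : cosetSimilitude C ≠ ⊥ := by
  rw [cosetSimilitude, Ne, Ideal.span_singleton_eq_bot]
  exact (similitude_spec (Quotient.out C)).1

theorem cosetMinors_isPrincipal [IsPrincipalIdealRing (𝓞 K)] (hσ : IsQuadraticConj σ)
    (C : HermitianCoset 2 σ) : ∃ β, cosetMinors C = Ideal.span {β} := by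
  obtain ⟨hm, hs⟩ := similitude_spec (Quotient.out C)
  have hM := (Quotient.out C).2.1
  have hm' : (similitude (Quotient.out C) : K) ≠ 0 := by simpa using hm
  obtain ⟨c, θ, w, hcu, hc0, hmc, hcθ⟩ := exists_modulus hσ hm
  obtain ⟨α₁, α₂, ha1, ha2, -, -, hd1, hd2, N, hN, eN⟩ :=
    exists_simDiag hcu hc0 hσ (hM.isSemilocal c) hm' hs
  obtain ⟨G1, G2⟩ := generatesAt_of_simDiag hM hN eN hd1 hd2 ha1 ha2
  have D := det_simDiag (σ := σ) ha1 ha2 (similitude (Quotient.out C) : K)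
  rw [← eN, det_approxOrbit hN] at D
  obtain ⟨β, k, z, s, eI, -⟩ := exists_minorIdeal_eq_span hσ hm hcu hcθ hmc hM hs G2 D
  exact ⟨β, eI⟩

/-- The triple `(A, B, D)` of ideals attached to a double coset: `A` is the ideal of entries,
`A² B` the ideal of minors of order two, and `D · N(A B)` is generated by the similitude. -/
structure IsTriple (C : HermitianCoset 2 σ) (t : Ideal (𝓞 Ω) × Ideal (𝓞 Ω) × Ideal (𝓞 K)) :
    Prop where
  entries : cosetEntries C = t.1
  minors : cosetMinors C = t.1 ^ 2 * t.2.1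
  similitude : cosetSimilitude C = t.2.2 * Ideal.relNorm (𝓞 K) (t.1 * t.2.1)

/-- The existence of `D` is the condition that the second elementary divisor divides the third one,
which reads `N(A B)² ∣ m²` after taking relative norms. -/
theorem exists_isTriple (hσ : IsQuadraticConj σ) (C : HermitianCoset 2 σ) :
    ∃ t, IsTriple C t := by
  obtain ⟨hm, hs⟩ := similitude_spec (Quotient.out C)
  have hM := (Quotient.out C).2.1
  obtain ⟨B, hB⟩ := Ideal.dvd_iff_le.2 (minorIdeal_le_sq hM)
  change cosetMinors C = cosetEntries C ^ 2 * B at hB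
  have h1 := span_mul_le_minorIdeal hσ hm hM hs
  change Ideal.span _ * (cosetEntries C * conjIdeal σ (cosetEntries C)) ≤
    cosetMinors C * conjIdeal σ (cosetMinors C) at h1
  set A := cosetEntries C with hA
  have hA0 : A * conjIdeal σ A ≠ 0 :=
    mul_ne_zero (cosetEntries_ne_bot C) (conjIdeal_ne_bot hσ (cosetEntries_ne_bot C))
  rw [hB, pow_two, conjIdeal_mul, conjIdeal_mul] at h1
  have e : A * A * B * (conjIdeal σ A * conjIdeal σ A * conjIdeal σ B) =
      (A * conjIdeal σ A) * ((A * B) * conjIdeal σ (A * B)) := by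
    rw [conjIdeal_mul]; ring
  rw [e, mul_comm (Ideal.span _), ← Ideal.dvd_iff_le, mul_dvd_mul_iff_left hA0,
    ← map_relNorm_eq_mul_conjIdeal hσ, ← Set.image_singleton, ← Ideal.map_span] at h1
  have h2 := map_dvd (Ideal.relNorm (𝓞 K)) h1
  rw [relNorm_map_algebraMap hσ, relNorm_map_algebraMap hσ] at h2
  have h3 : Ideal.relNorm (𝓞 K) (A * B) ∣ cosetSimilitude C :=
      (UniqueFactorizationMonoid.pow_dvd_pow_iff_dvd two_ne_zero).1 h2
  obtain ⟨D, hD⟩ := h3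
  exact ⟨(A, B, D), hA.symm, hB, by rw [hD, mul_comm]⟩

end Invariants

/-! ### Normal forms and leading terms of products -/

section NormalForms

variable {K Ω : Type*} [Field K] [NumberField K] [Field Ω] [NumberField Ω] [Algebra K Ω]
  {σ : Ω ≃ₐ[K] Ω}

/-- In a field of class number two, the product of two ideals which are not principal is
principal. -/
theorem isPrincipal_mul_of_not (hΩ : NumberField.classNumber Ω = 2) {I J : Ideal (𝓞 Ω)}
    (hI0 : I ≠ ⊥) (hJ0 : J ≠ ⊥) (hI : ¬ I.IsPrincipal) (hJ : ¬ J.IsPrincipal) :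
    (I * J).IsPrincipal := by
  have hI' : I ∈ nonZeroDivisors (Ideal (𝓞 Ω)) := mem_nonZeroDivisors_of_ne_zero hI0
  have hJ' : J ∈ nonZeroDivisors (Ideal (𝓞 Ω)) := mem_nonZeroDivisors_of_ne_zero hJ0
  have h1 : ClassGroup.mk0 ⟨I, hI'⟩ ≠ 1 := fun h => hI ((ClassGroup.mk0_eq_one_iff hI').1 h)
  have h2 : ClassGroup.mk0 ⟨J, hJ'⟩ ≠ 1 := fun h => hJ ((ClassGroup.mk0_eq_one_iff hJ').1 h)
  have hcard : Nat.card (ClassGroup (𝓞 Ω)) = 2 := by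
    rw [Nat.card_eq_fintype_card]; exact hΩ
  obtain ⟨g, hg, huniq⟩ := (Nat.card_eq_two_iff' (1 : ClassGroup (𝓞 Ω))).1 hcard
  have h3 : ClassGroup.mk0 ⟨I, hI'⟩ * ClassGroup.mk0 ⟨J, hJ'⟩ = 1 := by
    rw [huniq _ h1, huniq _ h2, ← pow_two, ← hcard]
    exact pow_card_eq_one'
  rw [← map_mul] at h3
  exact (ClassGroup.mk0_eq_one_iff (mul_mem hI' hJ')).1 h3

theorem isPrincipal_of_mul_span {I : Ideal (𝓞 Ω)} {δ : 𝓞 Ω} (hδ : δ ≠ 0)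
    (h : (Ideal.span {δ} * I).IsPrincipal) : I.IsPrincipal := by
  obtain ⟨β, hβ⟩ := h.principal
  change _ = Ideal.span {β} at hβ
  obtain ⟨b, hb, rfl⟩ := Ideal.mem_span_singleton_mul.1
    (hβ.symm ▸ Ideal.mem_span_singleton_self β : β ∈ Ideal.span {δ} * I)
  rw [← Ideal.span_singleton_mul_span_singleton] at hβ
  have h0 : Ideal.span {δ} ≠ 0 := by
    rw [Ne, Ideal.zero_eq_bot, Ideal.span_singleton_eq_bot]; exact hδ
  exact ⟨b, mul_left_cancel₀ h0 hβ⟩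

theorem isPrincipal_sq (hΩ : NumberField.classNumber Ω = 2) {I : Ideal (𝓞 Ω)} (hI0 : I ≠ ⊥) :
    ∃ δ, I ^ 2 = Ideal.span {δ} ∧ δ ≠ 0 := by
  have h : ∃ δ, I ^ 2 = Ideal.span {δ} := by
    by_cases hI : I.IsPrincipal
    · obtain ⟨a, ha⟩ := hI.principal
      exact ⟨a ^ 2, by rw [ha, ← Ideal.span_singleton_pow]⟩
    · obtain ⟨δ, hδ⟩ := (isPrincipal_mul_of_not hΩ hI0 hI0 hI hI).principal
      exact ⟨δ, by rw [pow_two, hδ]⟩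
  obtain ⟨δ, hδ⟩ := h
  refine ⟨δ, hδ, ?_⟩
  rintro rfl
  have h1 : I ^ 2 = 0 := by rw [hδ]; simp
  exact hI0 ((pow_eq_zero_iff two_ne_zero).1 h1)

/-- The data of a normal form: `A = (a, b)`, `A² = (δ)`, `δ = a x + b y`, and `μ` generates the
relative norm of `A`; the remaining parameters are the entries of the lower right block. -/
structure NormalData (σ : Ω ≃ₐ[K] Ω) (A : Ideal (𝓞 Ω)) where
  (a b x y δ a' b' x' y' : 𝓞 Ω)
  μ : 𝓞 K
  span_eq : A = Ideal.span {a} ⊔ Ideal.span {b}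
  x_mem : x ∈ A
  y_mem : y ∈ A
  sq_eq : A ^ 2 = Ideal.span {δ}
  δ_ne : δ ≠ 0
  μ_eq : Ideal.relNorm (𝓞 K) A = Ideal.span {μ}
  det_eq : a * x + b * y = δ
  a'_mem : a' ∈ A
  b'_mem : b' ∈ A
  x'_mem : x' ∈ A
  y'_mem : y' ∈ A
  a'_eq : a' * conjInt σ δ = algebraMap (𝓞 K) (𝓞 Ω) μ * conjInt σ a
  b'_eq : b' * conjInt σ δ = algebraMap (𝓞 K) (𝓞 Ω) μ * conjInt σ b
  x'_eq : x' * conjInt σ δ = algebraMap (𝓞 K) (𝓞 Ω) μ * conjInt σ x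
  y'_eq : y' * conjInt σ δ = algebraMap (𝓞 K) (𝓞 Ω) μ * conjInt σ y

/-- The number `d` allows to choose the second generator `b` in a prescribed multiple of `A`; any
nonzero element of a nonzero ideal of a Dedekind domain is part of a pair of generators. -/
theorem exists_normalData [IsPrincipalIdealRing (𝓞 K)] (hσ : IsQuadraticConj σ)
    (hΩ : NumberField.classNumber Ω = 2) {A : Ideal (𝓞 Ω)} (hA : A ≠ ⊥) {d : 𝓞 Ω} (hd : d ≠ 0) :
    ∃ N : NormalData σ A, N.b ∈ A * Ideal.span {d} := by
  obtain ⟨δ, hδ, hδ0⟩ := isPrincipal_sq hΩ hA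
  obtain ⟨μ, hμ⟩ := (IsPrincipalIdealRing.principal (Ideal.relNorm (𝓞 K) A)).principal
  change _ = Ideal.span {μ} at hμ
  have hAd : A * Ideal.span {d} ≠ ⊥ := mul_ne_zero hA (by
    rw [Ne, Ideal.zero_eq_bot, Ideal.span_singleton_eq_bot]; exact hd)
  obtain ⟨b, hb, hb0⟩ := Submodule.exists_mem_ne_zero_of_ne_bot hAd
  have hbA : b ∈ A := Ideal.mul_le_left hb
  obtain ⟨a, ha⟩ := IsDedekindDomain.exists_sup_span_eq
    ((Ideal.span_singleton_le_iff_mem A).2 hbA)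
    (by rw [Ne, Ideal.zero_eq_bot, Ideal.span_singleton_eq_bot]; exact hb0)
  have haA : a ∈ A := by
    rw [← ha]; exact Ideal.mem_sup_right (Ideal.mem_span_singleton_self a)
  -- elements of `A` multiplied with `μ / σ δ`
  have key : ∀ x ∈ A, ∃ x' ∈ A, x' * conjInt σ δ = algebraMap (𝓞 K) (𝓞 Ω) μ * conjInt σ x := by
    intro x hx
    have h1 : algebraMap (𝓞 K) (𝓞 Ω) μ * conjInt σ x ∈ A * Ideal.span {conjInt σ δ} := by
      rw [← conjIdeal_span_singleton, ← hδ, pow_two, conjIdeal_mul, ← mul_assoc,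
        ← map_relNorm_eq_mul_conjIdeal hσ, hμ, Ideal.map_span, Set.image_singleton]
      refine Ideal.mul_mem_mul (Ideal.mem_span_singleton_self _) ?_
      rw [mem_conjIdeal hσ, hσ.conjInt_conjInt]
      exact hx
    obtain ⟨x', hx', e⟩ := Ideal.mem_mul_span_singleton.1 h1
    exact ⟨x', hx', e⟩
  -- `A² = (δ)` and `A = (a, b)` give the bottom row of a matrix of determinant `δ`
  have hδ1 : δ ∈ A * (Ideal.span {b} ⊔ Ideal.span {a}) := by
    rw [ha, ← pow_two, hδ]; exact Ideal.mem_span_singleton_self δ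
  rw [Ideal.mul_sup] at hδ1
  obtain ⟨u, hu, v, hv, e⟩ := Submodule.mem_sup.1 hδ1
  obtain ⟨y, hy, rfl⟩ := Ideal.mem_mul_span_singleton.1 hu
  obtain ⟨x, hx, rfl⟩ := Ideal.mem_mul_span_singleton.1 hv
  obtain ⟨a', ha', ea⟩ := key a haA
  obtain ⟨b', hb', eb⟩ := key b hbA
  obtain ⟨x', hx', ex⟩ := key x hx
  obtain ⟨y', hy', ey⟩ := key y hy
  exact ⟨⟨a, b, x, y, δ, a', b', x', y', μ, by rw [sup_comm, ha], hx, hy, hδ, hδ0, hμ,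
    by rw [← e]; ring, ha', hb', hx', hy', ea, eb, ex, ey⟩, hb⟩

namespace NormalData

variable {A : Ideal (𝓞 Ω)}

/-- The common factors of the rows of the normal form. -/
noncomputable def rowFactor (σ : Ω ≃ₐ[K] Ω) (β : 𝓞 Ω) (κ : 𝓞 K) : Fin 2 ⊕ Fin 2 → 𝓞 Ω :=
  Sum.elim ![1, β] ![algebraMap (𝓞 K) (𝓞 Ω) κ * β * conjInt σ β, algebraMap (𝓞 K) (𝓞 Ω) κ * β]

/-- The rows of the normal form up to common factors. -/
noncomputable def core (N : NormalData σ A) : Matrix (Fin 2 ⊕ Fin 2) (Fin 2 ⊕ Fin 2) (𝓞 Ω) :=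
  fromBlocks !![N.a, N.b; -N.y, N.x] 0 0 !![N.x', N.y'; -N.b', N.a']

/-- The normal form `diag(1, β, κ β σ β, κ β) · diag(U, μ U*⁻¹)` with `U = (a, b; -y, x)`. -/
noncomputable def intMatrix (N : NormalData σ A) (β : 𝓞 Ω) (κ : 𝓞 K) :
    Matrix (Fin 2 ⊕ Fin 2) (Fin 2 ⊕ Fin 2) (𝓞 Ω) :=
  Matrix.of fun i j => rowFactor σ β κ i * N.core i j

/-- The normal form as a matrix over the field. -/
noncomputable def matrix (N : NormalData σ A) (β : 𝓞 Ω) (κ : 𝓞 K) :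
    Matrix (Fin 2 ⊕ Fin 2) (Fin 2 ⊕ Fin 2) Ω :=
  (N.intMatrix β κ).map (algebraMap (𝓞 Ω) Ω)

theorem a_mem (N : NormalData σ A) : N.a ∈ A :=
  N.span_eq.ge (Ideal.mem_sup_left (Ideal.mem_span_singleton_self _))

theorem b_mem (N : NormalData σ A) : N.b ∈ A :=
  N.span_eq.ge (Ideal.mem_sup_right (Ideal.mem_span_singleton_self _))

theorem core_mem (N : NormalData σ A) : ∀ i j, N.core i j ∈ A := by
  simp only [forall_idx]
  simp [core, N.a_mem, N.b_mem, N.x_mem, N.y_mem, N.a'_mem, N.b'_mem, N.x'_mem, N.y'_mem]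

theorem isIntegralMatrix (N : NormalData σ A) (β : 𝓞 Ω) (κ : 𝓞 K) :
    IsIntegralMatrix (N.matrix β κ) := fun _ _ => RingOfIntegers.isIntegral_coe _

/-- The lower right block is `μ` times the inverse conjugate transpose of the upper left one, up to
the row factors, whose pairings all equal `κ β σ β`. -/
theorem hasSimilitude (hσ : IsQuadraticConj σ) (N : NormalData σ A) (β : 𝓞 Ω) (κ : 𝓞 K) :
    HasSimilitude σ (N.matrix β κ) ((κ * N.μ * Algebra.intNorm (𝓞 K) (𝓞 Ω) β : 𝓞 K) : K) := by
  have hδ : conjInt σ N.δ ≠ 0 := by simpa using N.δ_ne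
  have hd : conjInt σ N.a * conjInt σ N.x + conjInt σ N.b * conjInt σ N.y = conjInt σ N.δ := by
    rw [← map_mul, ← map_mul, ← map_add, N.det_eq]
  have hδσ : conjInt σ (conjInt σ N.δ) = N.δ := hσ.conjInt_conjInt _
  -- the relations between the two blocks
  have r1 : conjInt σ N.a * N.x' + conjInt σ N.y * N.b' = algebraMap (𝓞 K) (𝓞 Ω) N.μ := by
    refine mul_right_cancel₀ hδ ?_
    linear_combination conjInt σ N.a * N.x'_eq + conjInt σ N.y * N.b'_eq +
      algebraMap (𝓞 K) (𝓞 Ω) N.μ * hd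
  have r2 : conjInt σ N.b * N.y' + conjInt σ N.x * N.a' = algebraMap (𝓞 K) (𝓞 Ω) N.μ := by
    refine mul_right_cancel₀ hδ ?_
    linear_combination conjInt σ N.b * N.y'_eq + conjInt σ N.x * N.a'_eq +
      algebraMap (𝓞 K) (𝓞 Ω) N.μ * hd
  have r3 : conjInt σ N.a * N.y' - conjInt σ N.y * N.a' = 0 := by
    refine mul_right_cancel₀ hδ ?_
    linear_combination conjInt σ N.a * N.y'_eq - conjInt σ N.y * N.a'_eq
  have r4 : conjInt σ N.b * N.x' - conjInt σ N.x * N.b' = 0 := by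
    refine mul_right_cancel₀ hδ ?_
    linear_combination conjInt σ N.b * N.x'_eq - conjInt σ N.x * N.b'_eq
  have s1 := congrArg (conjInt σ) r1
  have s2 := congrArg (conjInt σ) r2
  have s3 := congrArg (conjInt σ) r3
  have s4 := congrArg (conjInt σ) r4
  simp only [map_add, map_sub, map_mul, hσ.conjInt_conjInt, AlgEquiv.commutes, map_zero]
    at s1 s2 s3 s4
  have hn := algebraMap_intNorm hσ β
  rw [hasSimilitude_iff, symplecticJ_two]
  have key : ∀ i j, conjInt σ (rowFactor σ β κ (Sum.inl 0) * N.core (Sum.inl 0) i) *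
      (rowFactor σ β κ (Sum.inr 0) * N.core (Sum.inr 0) j) +
      conjInt σ (rowFactor σ β κ (Sum.inl 1) * N.core (Sum.inl 1) i) *
      (rowFactor σ β κ (Sum.inr 1) * N.core (Sum.inr 1) j) -
      conjInt σ (rowFactor σ β κ (Sum.inr 0) * N.core (Sum.inr 0) i) *
      (rowFactor σ β κ (Sum.inl 0) * N.core (Sum.inl 0) j) -
      conjInt σ (rowFactor σ β κ (Sum.inr 1) * N.core (Sum.inr 1) i) *
      (rowFactor σ β κ (Sum.inl 1) * N.core (Sum.inl 1) j) =
      algebraMap (𝓞 K) (𝓞 Ω) (κ * N.μ * Algebra.intNorm (𝓞 K) (𝓞 Ω) β) *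
        (fromBlocks 0 !![1, 0; 0, 1] !![-1, 0; 0, -1] 0 :
          Matrix (Fin 2 ⊕ Fin 2) (Fin 2 ⊕ Fin 2) (𝓞 Ω)) i j := by
    rw [map_mul, map_mul, hn]
    simp only [forall_idx]
    simp only [rowFactor, core, Sum.elim_inl, Sum.elim_inr, fromBlocks_apply₁₁,
      fromBlocks_apply₁₂, fromBlocks_apply₂₁, fromBlocks_apply₂₂, Matrix.of_apply,
      Matrix.cons_val_zero, Matrix.cons_val_one, Matrix.zero_apply, map_mul, map_one, map_neg,
      map_zero, hσ.conjInt_conjInt, AlgEquiv.commutes]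
    set k := algebraMap (𝓞 K) (𝓞 Ω) κ
    set B := conjInt σ β
    refine ⟨⟨?_, ?_, ?_, ?_⟩, ⟨?_, ?_, ?_, ?_⟩, ⟨?_, ?_, ?_, ?_⟩, ⟨?_, ?_, ?_, ?_⟩⟩
    · ring
    · ring
    · linear_combination k * β * B * r1
    · linear_combination k * β * B * r3
    · ring
    · ring
    · linear_combination k * β * B * r4
    · linear_combination k * β * B * r2
    · linear_combination -(k * β * B) * s1
    · linear_combination -(k * β * B) * s4
    · ring
    · ring
    · linear_combination -(k * β * B) * s3
    · linear_combination -(k * β * B) * s2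
    · ring
    · ring
  intro i j
  have h := congrArg (algebraMap (𝓞 Ω) Ω) (key i j)
  simp only [map_add, map_sub, map_mul (algebraMap (𝓞 Ω) Ω)] at h
  have hJ : algebraMap (𝓞 Ω) Ω ((fromBlocks 0 !![1, 0; 0, 1] !![-1, 0; 0, -1] 0 :
      Matrix (Fin 2 ⊕ Fin 2) (Fin 2 ⊕ Fin 2) (𝓞 Ω)) i j) =
      (fromBlocks 0 !![1, 0; 0, 1] !![-1, 0; 0, -1] 0 :
        Matrix (Fin 2 ⊕ Fin 2) (Fin 2 ⊕ Fin 2) Ω) i j := by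
    revert j
    revert i
    simp
  rw [hJ] at h
  exact h

theorem entryIdeal_map (X : Matrix (Fin 2 ⊕ Fin 2) (Fin 2 ⊕ Fin 2) (𝓞 Ω)) :
    entryIdeal (X.map (algebraMap (𝓞 Ω) Ω)) = Ideal.span {y | ∃ i j, y = X i j} := by
  unfold entryIdeal
  congr 1
  ext y
  simp only [Set.mem_ofPred_eq, Matrix.map_apply]
  exact exists_congr fun i => exists_congr fun j =>
    (FaithfulSMul.algebraMap_injective (𝓞 Ω) Ω).eq_iff

theorem minor_map (X : Matrix (Fin 2 ⊕ Fin 2) (Fin 2 ⊕ Fin 2) (𝓞 Ω)) (i j k l : Fin 2 ⊕ Fin 2) :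
    minor (X.map (algebraMap (𝓞 Ω) Ω)) i j k l = algebraMap (𝓞 Ω) Ω (minor X i j k l) := by
  simp [minor]

theorem minorIdeal_map (X : Matrix (Fin 2 ⊕ Fin 2) (Fin 2 ⊕ Fin 2) (𝓞 Ω)) :
    minorIdeal (X.map (algebraMap (𝓞 Ω) Ω)) = Ideal.span {y | ∃ i j k l, y = minor X i j k l} := by
  unfold minorIdeal
  congr 1
  ext y
  simp only [Set.mem_ofPred_eq, minor_map]
  exact exists_congr fun i => exists_congr fun j => exists_congr fun k => exists_congr fun l =>
    (FaithfulSMul.algebraMap_injective (𝓞 Ω) Ω).eq_iff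

theorem entryIdeal_matrix (N : NormalData σ A) (β : 𝓞 Ω) (κ : 𝓞 K) :
    entryIdeal (N.matrix β κ) = A := by
  rw [matrix, entryIdeal_map]
  refine le_antisymm (Ideal.span_le.2 ?_) ?_
  · rintro _ ⟨i, j, rfl⟩
    exact Ideal.mul_mem_left _ _ (N.core_mem i j)
  · conv_lhs => rw [N.span_eq]
    refine sup_le ?_ ?_ <;> rw [Ideal.span_singleton_le_iff_mem]
    · exact Ideal.subset_span ⟨Sum.inl 0, Sum.inl 0, by simp [intMatrix, rowFactor, core]⟩
    · exact Ideal.subset_span ⟨Sum.inl 0, Sum.inl 1, by simp [intMatrix, rowFactor, core]⟩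

theorem minor_intMatrix (N : NormalData σ A) (β : 𝓞 Ω) (κ : 𝓞 K) :
    minor (N.intMatrix β κ) (Sum.inl 0) (Sum.inl 1) (Sum.inl 0) (Sum.inl 1) = β * N.δ := by
  rw [← N.det_eq]
  simp [minor, intMatrix, rowFactor, core]
  ring

theorem dvd_rowFactor (β : 𝓞 Ω) (κ : 𝓞 K) : ∀ i, i ≠ Sum.inl 0 → β ∣ rowFactor σ β κ i := by
  simp only [forall_idx]
  refine ⟨fun h => absurd rfl h, fun _ => dvd_rfl, fun _ => ?_, fun _ => ?_⟩
  · exact ⟨algebraMap (𝓞 K) (𝓞 Ω) κ * conjInt σ β, by simp [rowFactor]; ring⟩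
  · exact ⟨algebraMap (𝓞 K) (𝓞 Ω) κ, by simp [rowFactor]; ring⟩

/-- All row factors but the first are divisible by `β`, so that `β` divides every product of two of
them; the upper left minor `β δ` generates the ideal. -/
theorem minorIdeal_matrix (N : NormalData σ A) (β : 𝓞 Ω) (κ : 𝓞 K) :
    minorIdeal (N.matrix β κ) = A ^ 2 * Ideal.span {β} := by
  rw [matrix, minorIdeal_map]
  refine le_antisymm (Ideal.span_le.2 ?_) ?_
  · rintro _ ⟨i, j, k, l, rfl⟩
    have e : minor (N.intMatrix β κ) i j k l =
        (rowFactor σ β κ i * rowFactor σ β κ j) * minor N.core i j k l := by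
      simp only [minor, intMatrix, Matrix.of_apply]; ring
    by_cases hij : i = j
    · subst hij
      have : minor (N.intMatrix β κ) i i k l = 0 := by simp only [minor]; ring
      rw [this]
      exact Submodule.zero_mem _
    · have hd : β ∣ rowFactor σ β κ i * rowFactor σ β κ j := by
        by_cases hi : i = Sum.inl 0
        · exact (dvd_rowFactor β κ j fun h => hij (hi.trans h.symm)).mul_left _
        · exact (dvd_rowFactor β κ i hi).mul_right _
      obtain ⟨r, hr⟩ := hd
      rw [e, hr, mul_comm (A ^ 2), mul_assoc]
      refine Ideal.mul_mem_mul (Ideal.mem_span_singleton_self β) (Ideal.mul_mem_left _ _ ?_)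
      rw [pow_two]
      exact Ideal.sub_mem _ (Ideal.mul_mem_mul (N.core_mem _ _) (N.core_mem _ _))
        (Ideal.mul_mem_mul (N.core_mem _ _) (N.core_mem _ _))
  · rw [N.sq_eq, Ideal.span_singleton_mul_span_singleton, Ideal.span_singleton_le_iff_mem]
    refine Ideal.subset_span ⟨Sum.inl 0, Sum.inl 1, Sum.inl 0, Sum.inl 1, ?_⟩
    rw [minor_intMatrix, mul_comm]

theorem matrix_mul {A' : Ideal (𝓞 Ω)} (N : NormalData σ A) (N' : NormalData σ A') (β β' : 𝓞 Ω)
    (κ κ' : 𝓞 K) : N.matrix β κ * N'.matrix β' κ' =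
      (N.intMatrix β κ * N'.intMatrix β' κ').map (algebraMap (𝓞 Ω) Ω) := by
  rw [matrix, matrix, ← Matrix.map_mul]

/-- If the entry `b` of the left factor is divisible by enough, no cancellation occurs in the ideal
of entries of a product of normal forms. -/
theorem entryIdeal_matrix_mul {A' : Ideal (𝓞 Ω)} (N : NormalData σ A) (N' : NormalData σ A')
    (β β' : 𝓞 Ω) (κ κ' : 𝓞 K) (hb : N.b ∈ A * Ideal.span {β' * N'.δ}) :
    entryIdeal (N.matrix β κ * N'.matrix β' κ') = A * A' := by
  refine le_antisymm ?_ ?_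
  · have := entryIdeal_mul_le (N.isIntegralMatrix β κ) (N'.isIntegralMatrix β' κ')
    rwa [entryIdeal_matrix, entryIdeal_matrix] at this
  rw [matrix_mul, entryIdeal_map]
  set J : Ideal (𝓞 Ω) := Ideal.span {y | ∃ i j, y = (N.intMatrix β κ * N'.intMatrix β' κ') i j}
    with hJ
  have j0 : N.a * N'.a - N.b * β' * N'.y ∈ J := Ideal.subset_span ⟨Sum.inl 0, Sum.inl 0, by
    rw [Matrix.mul_apply, sum_idx]; simp [intMatrix, rowFactor, core]; ring⟩
  have j1 : N.a * N'.b + N.b * β' * N'.x ∈ J := Ideal.subset_span ⟨Sum.inl 0, Sum.inl 1, by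
    rw [Matrix.mul_apply, sum_idx]; simp [intMatrix, rowFactor, core]; ring⟩
  have h1 : N.a * (β' * N'.δ) ∈ J := by
    have := J.add_mem (J.mul_mem_left (β' * N'.x) j0) (J.mul_mem_left (β' * N'.y) j1)
    convert this using 1
    rw [← N'.det_eq]; ring
  have h2 : N.b * (β' * N'.δ) ∈ J := by
    have := J.sub_mem (J.mul_mem_left N'.a j1) (J.mul_mem_left N'.b j0)
    convert this using 1
    rw [← N'.det_eq]; ring
  -- eliminating with Cramer's rule; then `b` lies in `J`, which decouples the entries
  have h3 : A * Ideal.span {β' * N'.δ} ≤ J := by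
    rw [N.span_eq, Ideal.sup_mul, Ideal.span_singleton_mul_span_singleton,
      Ideal.span_singleton_mul_span_singleton]
    exact sup_le ((Ideal.span_singleton_le_iff_mem J).2 h1)
      ((Ideal.span_singleton_le_iff_mem J).2 h2)
  have h4 : N.b ∈ J := h3 hb
  have h5 : N.a * N'.a ∈ J := by
    have := J.add_mem j0 (J.mul_mem_left (β' * N'.y) h4)
    convert this using 1
    ring
  have h6 : N.a * N'.b ∈ J := by
    have := J.sub_mem j1 (J.mul_mem_left (β' * N'.x) h4)
    convert this using 1
    ring
  conv_lhs => rw [N.span_eq, N'.span_eq]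
  simp only [Ideal.sup_mul, Ideal.mul_sup, Ideal.span_singleton_mul_span_singleton, sup_le_iff,
    Ideal.span_singleton_le_iff_mem]
  exact ⟨⟨h5, J.mul_mem_right _ h4⟩, ⟨h6, J.mul_mem_right _ h4⟩⟩

/-- The upper left minors of two normal forms multiply, because the upper right blocks vanish; so no
cancellation occurs in the ideal of minors. -/
theorem minorIdeal_matrix_mul {A' : Ideal (𝓞 Ω)} (N : NormalData σ A) (N' : NormalData σ A')
    (β β' : 𝓞 Ω) (κ κ' : 𝓞 K) : minorIdeal (N.matrix β κ * N'.matrix β' κ') =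
      (A ^ 2 * Ideal.span {β}) * (A' ^ 2 * Ideal.span {β'}) := by
  refine le_antisymm ?_ ?_
  · have := minorIdeal_mul_le (N.isIntegralMatrix β κ) (N'.isIntegralMatrix β' κ')
    rwa [minorIdeal_matrix, minorIdeal_matrix] at this
  · rw [matrix_mul, minorIdeal_map, N.sq_eq, N'.sq_eq, Ideal.span_singleton_mul_span_singleton,
      Ideal.span_singleton_mul_span_singleton, Ideal.span_singleton_mul_span_singleton,
      Ideal.span_singleton_le_iff_mem]
    refine Ideal.subset_span ⟨Sum.inl 0, Sum.inl 1, Sum.inl 0, Sum.inl 1, ?_⟩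
    have h0 : ∀ i j q, minor (N.intMatrix β κ) (Sum.inl i) (Sum.inl j) q (Sum.inr 0) = 0 ∧
        minor (N.intMatrix β κ) (Sum.inl i) (Sum.inl j) q (Sum.inr 1) = 0 := by
      intro i j q; simp [minor, intMatrix, core]
    rw [minor_mul, minor_intMatrix, minor_intMatrix]
    simp only [(h0 _ _ _).1, (h0 _ _ _).2]
    ring

end NormalData

end NormalForms

/-! ### Double cosets as triples of ideals -/

section Triples

variable {K Ω : Type*} [Field K] [NumberField K] [Field Ω] [NumberField Ω] [Algebra K Ω]
  {σ : Ω ≃ₐ[K] Ω}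

theorem IsTriple.unique {C : HermitianCoset 2 σ} {t t' : Ideal (𝓞 Ω) × Ideal (𝓞 Ω) × Ideal (𝓞 K)}
    (h : IsTriple C t) (h' : IsTriple C t') : t = t' := by
  obtain ⟨A, B, D⟩ := t
  obtain ⟨A', B', D'⟩ := t'
  obtain rfl : A = A' := h.entries.symm.trans h'.entries
  have hA : A ≠ 0 := fun h0 => cosetEntries_ne_bot C (h.entries.trans h0)
  obtain rfl : B = B' := mul_left_cancel₀ (pow_ne_zero 2 hA) (h.minors.symm.trans h'.minors)
  have hB : B ≠ 0 := right_ne_zero_of_mul (h.minors ▸ cosetMinors_ne_bot C : A ^ 2 * B ≠ 0)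
  have h0 : Ideal.relNorm (𝓞 K) (A * B) ≠ 0 := fun h =>
    mul_ne_zero hA hB (Ideal.relNorm_eq_bot_iff.1 h)
  obtain rfl : D = D' := mul_right_cancel₀ h0 (h.similitude.symm.trans h'.similitude)
  rfl

theorem IsTriple.eq [IsPrincipalIdealRing (𝓞 K)] (hσ : IsQuadraticConj σ)
    {C D : HermitianCoset 2 σ} {t : Ideal (𝓞 Ω) × Ideal (𝓞 Ω) × Ideal (𝓞 K)}
    (h : IsTriple C t) (h' : IsTriple D t) : C = D :=
  coset_ext hσ (h.entries.trans h'.entries.symm) (h.minors.trans h'.minors.symm)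
    (h.similitude.trans h'.similitude.symm)

/-- The triples which belong to double cosets: nonzero ideals, the second one of which is
principal. -/
structure IsValid (t : Ideal (𝓞 Ω) × Ideal (𝓞 Ω) × Ideal (𝓞 K)) : Prop where
  fst : t.1 ≠ 0
  snd : t.2.1 ≠ 0
  thd : t.2.2 ≠ 0
  principal : t.2.1.IsPrincipal

theorem IsValid.mul {t t' : Ideal (𝓞 Ω) × Ideal (𝓞 Ω) × Ideal (𝓞 K)} (h : IsValid t)
    (h' : IsValid t') : IsValid (t * t') := by
  refine ⟨mul_ne_zero h.fst h'.fst, mul_ne_zero h.snd h'.snd, mul_ne_zero h.thd h'.thd, ?_⟩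
  obtain ⟨a, ha⟩ := h.principal
  obtain ⟨b, hb⟩ := h'.principal
  refine ⟨a * b, ?_⟩
  change t.2.1 * t'.2.1 = _
  rw [ha, hb]
  exact Ideal.span_singleton_mul_span_singleton a b

theorem IsTriple.isValid [IsPrincipalIdealRing (𝓞 K)] (hσ : IsQuadraticConj σ)
    (hΩ : NumberField.classNumber Ω = 2) {C : HermitianCoset 2 σ}
    {t : Ideal (𝓞 Ω) × Ideal (𝓞 Ω) × Ideal (𝓞 K)} (h : IsTriple C t) : IsValid t := by
  have hA : t.1 ≠ 0 := h.entries ▸ cosetEntries_ne_bot C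
  have hB : t.2.1 ≠ 0 := right_ne_zero_of_mul
    (h.minors ▸ cosetMinors_ne_bot C : t.1 ^ 2 * t.2.1 ≠ 0)
  refine ⟨hA, hB, left_ne_zero_of_mul (h.similitude ▸ cosetSimilitude_ne_bot C), ?_⟩
  obtain ⟨δ, hδ, hδ0⟩ := isPrincipal_sq hΩ hA
  obtain ⟨β, hβ⟩ := cosetMinors_isPrincipal hσ C
  refine isPrincipal_of_mul_span hδ0 ⟨β, ?_⟩
  rw [← hδ, ← h.minors, hβ]

namespace NormalData

variable {A : Ideal (𝓞 Ω)}

theorem μ_ne (N : NormalData σ A) : N.μ ≠ 0 := by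
  intro h
  have h1 := N.μ_eq
  rw [h, Ideal.span_singleton_eq_bot.2 rfl, Ideal.relNorm_eq_bot_iff] at h1
  have h2 : N.δ ∈ A ^ 2 := N.sq_eq.ge (Ideal.mem_span_singleton_self _)
  have h3 : N.δ ∈ A := Ideal.pow_le_self two_ne_zero h2
  exact N.δ_ne ((Submodule.mem_bot _).1 (h1.le h3))

theorem similitude_ne (N : NormalData σ A) {β : 𝓞 Ω} {κ : 𝓞 K} (hβ : β ≠ 0) (hκ : κ ≠ 0) :
    κ * N.μ * Algebra.intNorm (𝓞 K) (𝓞 Ω) β ≠ 0 :=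
  mul_ne_zero (mul_ne_zero hκ N.μ_ne) (by rwa [Ne, Algebra.intNorm_eq_zero])

/-- The normal form as an element of the monoid of similitudes. -/
noncomputable def toMonoid (hσ : IsQuadraticConj σ) (N : NormalData σ A) {β : 𝓞 Ω} {κ : 𝓞 K}
    (hβ : β ≠ 0) (hκ : κ ≠ 0) : similitudeMonoid 2 σ :=
  ⟨simGL (by simpa using N.similitude_ne hβ hκ) (N.hasSimilitude hσ β κ),
    N.isIntegralMatrix β κ, _, N.similitude_ne hβ hκ, N.hasSimilitude hσ β κ⟩

theorem isTriple (hσ : IsQuadraticConj σ) (N : NormalData σ A) {β : 𝓞 Ω} {κ : 𝓞 K}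
    (hβ : β ≠ 0) (hκ : κ ≠ 0) :
    IsTriple (HeckeCoset.mk (modularGroup 2 σ) (modularGroup 2 σ) (N.toMonoid hσ hβ hκ))
      (A, Ideal.span {β}, Ideal.span {κ}) := by
  refine ⟨?_, ?_, ?_⟩
  · rw [cosetEntries_mk rfl]; exact N.entryIdeal_matrix β κ
  · rw [cosetMinors_mk rfl]; exact N.minorIdeal_matrix β κ
  · have hs : HasSimilitude σ (N.toMonoid hσ hβ hκ).1.1 _ := N.hasSimilitude hσ β κ
    rw [cosetSimilitude_mk rfl hs, map_mul, N.μ_eq, Ideal.relNorm_singleton,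
      Ideal.span_singleton_mul_span_singleton, Ideal.span_singleton_mul_span_singleton, mul_assoc]

end NormalData

/-- Every valid triple belongs to a double coset, represented by a normal form whose second
generator `b` lies in `A d` for a given `d`. -/
theorem IsValid.exists_coset [IsPrincipalIdealRing (𝓞 K)] (hσ : IsQuadraticConj σ)
    (hΩ : NumberField.classNumber Ω = 2) {t : Ideal (𝓞 Ω) × Ideal (𝓞 Ω) × Ideal (𝓞 K)}
    (h : IsValid t) {d : 𝓞 Ω} (hd : d ≠ 0) : ∃ (N : NormalData σ t.1) (β : 𝓞 Ω) (κ : 𝓞 K)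
      (hβ : β ≠ 0) (hκ : κ ≠ 0), N.b ∈ t.1 * Ideal.span {d} ∧
      IsTriple (HeckeCoset.mk (modularGroup 2 σ) (modularGroup 2 σ) (N.toMonoid hσ hβ hκ)) t := by
  obtain ⟨A, B, D⟩ := t
  obtain ⟨hA, hB, hD, β, hβ⟩ := h
  change A ≠ 0 at hA
  change B ≠ 0 at hB
  change D ≠ 0 at hD
  change B = Ideal.span {β} at hβ
  subst hβ
  obtain ⟨κ, hκ⟩ := (IsPrincipalIdealRing.principal D).principal
  change D = Ideal.span {κ} at hκ
  subst hκ
  rw [Ne, Ideal.zero_eq_bot, Ideal.span_singleton_eq_bot] at hB hD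
  obtain ⟨N, hN⟩ := exists_normalData hσ hΩ hA hd
  exact ⟨N, β, κ, hB, hD, hN, N.isTriple hσ hB hD⟩

/-- If no cancellation occurs in the ideals of entries and of minors, the triples multiply. -/
theorem IsTriple.of_mul {g k : similitudeMonoid 2 σ}
    {t t' : Ideal (𝓞 Ω) × Ideal (𝓞 Ω) × Ideal (𝓞 K)}
    (hg : IsTriple (HeckeCoset.mk (modularGroup 2 σ) (modularGroup 2 σ) g) t)
    (hk : IsTriple (HeckeCoset.mk (modularGroup 2 σ) (modularGroup 2 σ) k) t')
    (h1 : entryIdeal (g.1.1 * k.1.1) = t.1 * t'.1)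
    (h2 : minorIdeal (g.1.1 * k.1.1) = (t.1 ^ 2 * t.2.1) * (t'.1 ^ 2 * t'.2.1)) :
    IsTriple (HeckeCoset.mk (modularGroup 2 σ) (modularGroup 2 σ) (g * k)) (t * t') := by
  refine ⟨?_, ?_, ?_⟩
  · rw [cosetEntries_mk rfl]; exact h1
  · rw [cosetMinors_mk rfl]
    refine h2.trans ?_
    change _ = (t.1 * t'.1) ^ 2 * (t.2.1 * t'.2.1)
    ring
  · obtain ⟨-, hm⟩ := similitude_spec g
    obtain ⟨-, hm'⟩ := similitude_spec k
    have e1 := hg.similitude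
    have e2 := hk.similitude
    rw [cosetSimilitude_mk rfl hm] at e1
    rw [cosetSimilitude_mk rfl hm'] at e2
    have h3 : HasSimilitude σ (g * k).1.1 ((HeckeAlgebra.similitude g * HeckeAlgebra.similitude k :
        𝓞 K) : K) := by
      rw [coe_mul]
      exact hm.mul hm'
    rw [cosetSimilitude_mk rfl h3, ← Ideal.span_singleton_mul_span_singleton, e1, e2]
    change _ = t.2.2 * t'.2.2 * Ideal.relNorm (𝓞 K) (t.1 * t'.1 * (t.2.1 * t'.2.1))
    simp only [map_mul]
    ring

/-- The product of two double cosets contains the double coset whose triple is the product of the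
triples. -/
theorem exists_isTriple_mul [IsPrincipalIdealRing (𝓞 K)] (hσ : IsQuadraticConj σ)
    (hΩ : NumberField.classNumber Ω = 2) {C D : HermitianCoset 2 σ}
    {t t' : Ideal (𝓞 Ω) × Ideal (𝓞 Ω) × Ideal (𝓞 K)} (hC : IsTriple C t) (hD : IsTriple D t') :
    ∃ E, structureConstant C D E ≠ 0 ∧ IsTriple E (t * t') := by
  -- the left factor is chosen after the right one, with `b` divisible by `β' δ'`
  obtain ⟨N', β', κ', hβ', hκ', -, h'⟩ := (hD.isValid hσ hΩ).exists_coset hσ hΩ (one_ne_zero)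
  obtain ⟨N, β, κ, hβ, hκ, hb, h⟩ := (hC.isValid hσ hΩ).exists_coset hσ hΩ
    (mul_ne_zero hβ' N'.δ_ne)
  refine ⟨HeckeCoset.mk _ _ (N.toMonoid hσ hβ hκ * N'.toMonoid hσ hβ' hκ'), ?_,
    IsTriple.of_mul h h' (N.entryIdeal_matrix_mul N' β β' κ κ' hb) ?_⟩
  · exact (structureConstant_ne_zero_iff _ _ _).2 ⟨_, _, h.eq hσ hC, h'.eq hσ hD, rfl⟩
  · have e1 := (N.isTriple hσ hβ hκ).unique h
    have e2 := (N'.isTriple hσ hβ' hκ').unique h'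
    refine (N.minorIdeal_matrix_mul N' β β' κ κ').trans ?_
    rw [← e1, ← e2]

theorem isTriple_one : IsTriple (1 : HermitianCoset 2 σ) 1 := by
  have h1 : HeckeCoset.mk (modularGroup 2 σ) (modularGroup 2 σ) 1 = (1 : HermitianCoset 2 σ) := rfl
  have hi : IsIntegralMatrix (1 : Matrix (Fin 2 ⊕ Fin 2) (Fin 2 ⊕ Fin 2) Ω) := IsIntegralMatrix.one
  refine ⟨?_, ?_, ?_⟩
  · rw [cosetEntries_mk h1]
    change _ = (1 : Ideal (𝓞 Ω))
    rw [Ideal.one_eq_top, Ideal.eq_top_iff_one]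
    exact Ideal.subset_span ⟨Sum.inl 0, Sum.inl 0, by simp⟩
  · rw [cosetMinors_mk h1]
    change _ = (1 : Ideal (𝓞 Ω)) ^ 2 * 1
    rw [one_pow, one_mul, Ideal.one_eq_top, Ideal.eq_top_iff_one]
    exact Ideal.subset_span ⟨Sum.inl 0, Sum.inl 1, Sum.inl 0, Sum.inl 1, by simp [minor]⟩
  · have hs : HasSimilitude σ ((1 : similitudeMonoid 2 σ) : GL (Fin 2 ⊕ Fin 2) Ω).1
        ((1 : 𝓞 K) : K) := by
      simpa using HasSimilitude.one σ 2
    rw [cosetSimilitude_mk h1 hs]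
    change _ = (1 : Ideal (𝓞 K)) * Ideal.relNorm (𝓞 K) ((1 : Ideal (𝓞 Ω)) * 1)
    rw [one_mul, one_mul, map_one, Ideal.span_singleton_one, Ideal.one_eq_top]

/-- Entries and minors of a double coset in a product lie in the products of the ideals, and the
similitudes multiply. -/
theorem le_of_structureConstant_ne_zero {C D E : HermitianCoset 2 σ}
    (h : structureConstant C D E ≠ 0) : cosetEntries E ≤ cosetEntries C * cosetEntries D ∧
      cosetMinors E ≤ cosetMinors C * cosetMinors D ∧
      cosetSimilitude E = cosetSimilitude C * cosetSimilitude D := by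
  obtain ⟨x, rfl⟩ : ∃ x, HeckeCoset.mk _ _ x = E := ⟨_, Quotient.out_eq E⟩
  obtain ⟨g, k, rfl, rfl, e⟩ := (structureConstant_ne_zero_iff _ _ _).1 h
  have e' : x = g * k := Subtype.ext e
  subst e'
  refine ⟨?_, ?_, ?_⟩
  · rw [cosetEntries_mk rfl, cosetEntries_mk rfl, cosetEntries_mk rfl]
    exact entryIdeal_mul_le g.2.1 k.2.1
  · rw [cosetMinors_mk rfl, cosetMinors_mk rfl, cosetMinors_mk rfl]
    exact minorIdeal_mul_le g.2.1 k.2.1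
  · obtain ⟨-, hm⟩ := similitude_spec g
    obtain ⟨-, hm'⟩ := similitude_spec k
    have h3 : HasSimilitude σ (g * k).1.1 ((similitude g * similitude k : 𝓞 K) : K) := by
      rw [coe_mul]
      exact hm.mul hm'
    rw [cosetSimilitude_mk rfl h3, cosetSimilitude_mk rfl hm, cosetSimilitude_mk rfl hm',
      Ideal.span_singleton_mul_span_singleton]

/-- The transposition is an anti-automorphism which fixes every double coset, because it preserves
entries, minors of order two and similitude; hence the Hecke algebra is commutative. -/
theorem structureConstant_symm [IsPrincipalIdealRing (𝓞 K)] (hσ : IsQuadraticConj σ)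
    (C D E : HermitianCoset 2 σ) : structureConstant C D E = structureConstant D C E := by
  refine structureConstant_comm transposeGL transposeGL_mul
    (fun a ha => transposeGL_mem_modularGroup hσ ha) transposeGL_transposeGL (fun a => ?_) C D E
  have hb := transposeGL_mem_similitudeMonoid hσ a.2
  refine ⟨⟨_, hb⟩, rfl, coset_ext hσ ?_ ?_ ?_⟩
  · rw [cosetEntries_mk rfl, cosetEntries_mk rfl]
    exact entryIdeal_transpose a.1.1
  · rw [cosetMinors_mk rfl, cosetMinors_mk rfl]
    exact minorIdeal_transpose a.1.1
  · obtain ⟨hm0, hm⟩ := similitude_spec a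
    have hm0' : (similitude a : K) ≠ 0 := by simpa using hm0
    have hm' : HasSimilitude σ (⟨_, hb⟩ : similitudeMonoid 2 σ).1.1 (similitude a : K) :=
      HasSimilitude.transpose hσ hm0' hm
    rw [cosetSimilitude_mk rfl hm]
    exact cosetSimilitude_mk rfl hm'

/-- The triple of ideals of a double coset. -/
noncomputable def triple (hσ : IsQuadraticConj σ) (C : HermitianCoset 2 σ) :
    Ideal (𝓞 Ω) × Ideal (𝓞 Ω) × Ideal (𝓞 K) := (exists_isTriple hσ C).choose

theorem isTriple_triple (hσ : IsQuadraticConj σ) (C : HermitianCoset 2 σ) :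
    IsTriple C (triple hσ C) := (exists_isTriple hσ C).choose_spec

theorem IsTriple.triple_eq {hσ : IsQuadraticConj σ} {C : HermitianCoset 2 σ}
    {t : Ideal (𝓞 Ω) × Ideal (𝓞 Ω) × Ideal (𝓞 K)} (h : IsTriple C t) : triple hσ C = t :=
  (isTriple_triple hσ C).unique h

theorem triple_injective [IsPrincipalIdealRing (𝓞 K)] (hσ : IsQuadraticConj σ) :
    Function.Injective (triple hσ : HermitianCoset 2 σ → _) := fun C D h =>
  (isTriple_triple hσ C).eq hσ (h ▸ isTriple_triple hσ D)

theorem triple_one (hσ : IsQuadraticConj σ) : triple hσ (1 : HermitianCoset 2 σ) = 1 :=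
  isTriple_one.triple_eq

theorem triple_eq_one [IsPrincipalIdealRing (𝓞 K)] (hσ : IsQuadraticConj σ)
    {C : HermitianCoset 2 σ} : triple hσ C = 1 ↔ C = 1 := by
  rw [← triple_one hσ]
  exact (triple_injective hσ).eq_iff

theorem IsValid.exists_triple_eq [IsPrincipalIdealRing (𝓞 K)] (hσ : IsQuadraticConj σ)
    (hΩ : NumberField.classNumber Ω = 2) {t : Ideal (𝓞 Ω) × Ideal (𝓞 Ω) × Ideal (𝓞 K)}
    (h : IsValid t) : ∃ C : HermitianCoset 2 σ, triple hσ C = t := by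
  obtain ⟨N, β, κ, hβ, hκ, -, h⟩ := h.exists_coset hσ hΩ one_ne_zero
  exact ⟨_, h.triple_eq⟩

/-- The leading double coset of a product: its triple is the product of the triples. -/
noncomputable def leading [IsPrincipalIdealRing (𝓞 K)] (hσ : IsQuadraticConj σ)
    (hΩ : NumberField.classNumber Ω = 2) (C D : HermitianCoset 2 σ) : HermitianCoset 2 σ :=
  (exists_isTriple_mul hσ hΩ (isTriple_triple hσ C) (isTriple_triple hσ D)).choose

theorem triple_leading [IsPrincipalIdealRing (𝓞 K)] (hσ : IsQuadraticConj σ)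
    (hΩ : NumberField.classNumber Ω = 2) (C D : HermitianCoset 2 σ) :
    triple hσ (leading hσ hΩ C D) = triple hσ C * triple hσ D :=
  (exists_isTriple_mul hσ hΩ (isTriple_triple hσ C) (isTriple_triple hσ D)).choose_spec.2.triple_eq

theorem structureConstant_leading_ne_zero [IsPrincipalIdealRing (𝓞 K)] (hσ : IsQuadraticConj σ)
    (hΩ : NumberField.classNumber Ω = 2) (C D : HermitianCoset 2 σ) :
    structureConstant C D (leading hσ hΩ C D) ≠ 0 :=
  (exists_isTriple_mul hσ hΩ (isTriple_triple hσ C) (isTriple_triple hσ D)).choose_spec.1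

end Triples

/-! ### Leading coefficients of products -/

section LeadingCoefficient

variable {K Ω : Type*} [Field K] [NumberField K] [Field Ω] [NumberField Ω] [Algebra K Ω]
  {σ : Ω ≃ₐ[K] Ω} {c : 𝓞 K}

theorem GeneratesAt.mul {I J : Ideal (𝓞 Ω)} {α β : Ω} (hα : GeneratesAt c I α)
    (hβ : GeneratesAt c J β) : GeneratesAt c (I * J) (α * β) := by
  refine ⟨?_, fun y hy => ?_⟩
  · obtain ⟨z, y, hy, e⟩ := hα.exists_mem
    obtain ⟨z', y', hy', e'⟩ := hβ.exists_mem
    refine ⟨z + z' + c * z * z', y * y', Ideal.mul_mem_mul hy hy', ?_⟩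
    rw [coe_mul, e, e']
    simp only [map_add, map_mul, map_one]
    ring
  · refine Submodule.mul_induction_on hy (fun a ha b hb => ?_) fun a b ha hb => ?_
    · rw [coe_mul]; exact (hα.dvdIn a ha).mul_mul (hβ.dvdIn b hb)
    · rw [coe_add]; exact ha.add hb

/-- The entries of `M` are divisible by `α₁`, and its minors of order two by `α₁ α₂`. -/
structure DivBounds (c : 𝓞 K) (α₁ α₂ : Ω) (M : Matrix (Fin 2 ⊕ Fin 2) (Fin 2 ⊕ Fin 2) Ω) :
    Prop where
  entry : ∀ i j, DvdIn (semilocalRing Ω c) α₁ (M i j)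
  minor : ∀ i j k l, DvdIn (semilocalRing Ω c) (α₁ * α₂) (minor M i j k l)

theorem DivBounds.of_generatesAt {α₁ α₂ : Ω} {M : Matrix (Fin 2 ⊕ Fin 2) (Fin 2 ⊕ Fin 2) Ω}
    (hM : IsIntegralMatrix M) (h1 : GeneratesAt c (entryIdeal M) α₁)
    (h2 : GeneratesAt c (minorIdeal M) (α₁ * α₂)) : DivBounds c α₁ α₂ M := by
  refine ⟨fun i j => ?_, fun i j k l => ?_⟩
  · obtain ⟨y, hy, e⟩ := exists_mem_entryIdeal hM i j
    rw [← e]; exact h1.dvdIn y hy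
  · obtain ⟨y, hy, e⟩ := exists_mem_minorIdeal hM i j k l
    rw [← e]; exact h2.dvdIn y hy

theorem DivBounds.transpose {α₁ α₂ : Ω} {M : Matrix (Fin 2 ⊕ Fin 2) (Fin 2 ⊕ Fin 2) Ω}
    (h : DivBounds c α₁ α₂ M) : DivBounds c α₁ α₂ Mᵀ :=
  ⟨fun i j => h.entry j i, fun i j k l => by rw [minor_transpose]; exact h.minor k l i j⟩

theorem DivBounds.mul_left {α₁ α₂ : Ω} {M g : Matrix (Fin 2 ⊕ Fin 2) (Fin 2 ⊕ Fin 2) Ω}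
    (h : DivBounds c α₁ α₂ M) (hg : IsSemilocal c g) : DivBounds c α₁ α₂ (g * M) := by
  refine ⟨fun i j => ?_, fun i j k l => ?_⟩
  · rw [Matrix.mul_apply, sum_idx]
    have := fun k => (h.entry k j).mul_left (hg i k)
    exact (((this _).add (this _)).add (this _)).add (this _)
  · rw [minor_mul]
    have := fun p q => (h.minor p q k l).mul_left (isSemilocal_minor hg i j p q)
    exact (((((this _ _).add (this _ _)).add (this _ _)).add (this _ _)).add (this _ _)).add
      (this _ _)

theorem DivBounds.mul_right {α₁ α₂ : Ω} {M g : Matrix (Fin 2 ⊕ Fin 2) (Fin 2 ⊕ Fin 2) Ω}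
    (h : DivBounds c α₁ α₂ M) (hg : IsSemilocal c g) : DivBounds c α₁ α₂ (M * g) := by
  have := (h.transpose.mul_left hg.transpose).transpose
  simpa [Matrix.transpose_mul] using this

section Valuation

variable {Γ₀ : Type*} [LinearOrderedCommGroupWithZero Γ₀]

theorem map_le_of_dvdIn {v : Valuation Ω Γ₀} (hv : ∀ r ∈ semilocalRing Ω c, v r ≤ 1) {x y : Ω}
    (h : DvdIn (semilocalRing Ω c) x y) : v y ≤ v x := by
  obtain ⟨r, hr, rfl⟩ := h
  rw [map_mul]
  exact mul_le_of_le_one_right' (hv r hr)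

theorem map_add_four_le (v : Valuation Ω Γ₀) {a b c d : Ω} {g : Γ₀} (ha : v a ≤ g) (hb : v b ≤ g)
    (hc : v c ≤ g) (hd : v d ≤ g) : v (a + b + c + d) ≤ g :=
  v.map_add_le (v.map_add_le (v.map_add_le ha hb) hc) hd

/-- In a factorization `A B = D` in which the upper left entry of `D` has the largest valuation
possible, the second column of `B` is bounded by the minors of `B`. -/
theorem map_column_le (v : Valuation Ω Γ₀) {A B D : Matrix (Fin 2 ⊕ Fin 2) (Fin 2 ⊕ Fin 2) Ω}
    (hAB : A * B = D) (h01 : D (Sum.inl 0) (Sum.inl 1) = 0) {a b b' : Γ₀} (ha0 : a ≠ 0)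
    (hb0 : b ≠ 0) (hD : v (D (Sum.inl 0) (Sum.inl 0)) = a * b) (hA : ∀ i j, v (A i j) ≤ a)
    (hB : ∀ i j, v (B i j) ≤ b) (hB2 : ∀ i j k l, v (minor B i j k l) ≤ b * b')
    (i : Fin 2 ⊕ Fin 2) : v (B i (Sum.inl 1)) ≤ b' := by
  have hD0 : D (Sum.inl 0) (Sum.inl 0) ≠ 0 := fun h => by
    rw [h, map_zero] at hD; exact mul_ne_zero ha0 hb0 hD.symm
  -- a maximal entry of the first column
  obtain ⟨k, hk⟩ : ∃ k, v (B k (Sum.inl 0)) = b := by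
    by_contra hne
    push Not at hne
    have hlt : ∀ k, v (A (Sum.inl 0) k * B k (Sum.inl 0)) < a * b := fun k => by
      rw [map_mul]
      exact mul_lt_mul_of_le_of_lt_of_nonneg_of_pos (hA _ _) (lt_of_le_of_ne (hB _ _) (hne k))
        zero_le (zero_lt_iff.2 ha0)
    have h := congrFun (congrFun hAB (Sum.inl 0)) (Sum.inl 0)
    rw [Matrix.mul_apply, sum_idx] at h
    have h2 := v.map_add_lt (v.map_add_lt (v.map_add_lt (hlt (Sum.inl 0)) (hlt (Sum.inl 1)))
      (hlt (Sum.inr 0))) (hlt (Sum.inr 1))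
    rw [h, hD] at h2
    exact lt_irrefl _ h2
  have hBk : B k (Sum.inl 0) ≠ 0 := fun h => by rw [h, map_zero] at hk; exact hb0 hk.symm
  set t := B k (Sum.inl 1) / B k (Sum.inl 0) with ht
  -- the second column minus a multiple of the first one
  have hw : ∀ i, v (B i (Sum.inl 1) - t * B i (Sum.inl 0)) ≤ b' := by
    intro i
    have e : B i (Sum.inl 1) - t * B i (Sum.inl 0) =
        minor B k i (Sum.inl 0) (Sum.inl 1) / B k (Sum.inl 0) := by
      rw [ht]; unfold minor; field_simp
    rw [e, map_div₀, hk, div_le_iff₀ (zero_lt_iff.2 hb0), mul_comm]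
    exact hB2 _ _ _ _
  have hsum : -(t * D (Sum.inl 0) (Sum.inl 0)) =
      A (Sum.inl 0) (Sum.inl 0) * (B (Sum.inl 0) (Sum.inl 1) - t * B (Sum.inl 0) (Sum.inl 0)) +
      A (Sum.inl 0) (Sum.inl 1) * (B (Sum.inl 1) (Sum.inl 1) - t * B (Sum.inl 1) (Sum.inl 0)) +
      A (Sum.inl 0) (Sum.inr 0) * (B (Sum.inr 0) (Sum.inl 1) - t * B (Sum.inr 0) (Sum.inl 0)) +
      A (Sum.inl 0) (Sum.inr 1) * (B (Sum.inr 1) (Sum.inl 1) - t * B (Sum.inr 1) (Sum.inl 0)) := by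
    have h0 := congrFun (congrFun hAB (Sum.inl 0)) (Sum.inl 0)
    have h1 := congrFun (congrFun hAB (Sum.inl 0)) (Sum.inl 1)
    rw [Matrix.mul_apply, sum_idx] at h0 h1
    rw [h01] at h1
    rw [← h0]
    linear_combination -h1
  have htb : v t * b ≤ b' := by
    have h1 : v (t * D (Sum.inl 0) (Sum.inl 0)) ≤ a * b' := by
      rw [← Valuation.map_neg, hsum]
      have h2 : ∀ k, v (A (Sum.inl 0) k * (B k (Sum.inl 1) - t * B k (Sum.inl 0))) ≤ a * b' :=
        fun k => by rw [map_mul]; exact mul_le_mul' (hA _ _) (hw _)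
      exact map_add_four_le v (h2 _) (h2 _) (h2 _) (h2 _)
    rw [map_mul, hD, mul_left_comm] at h1
    exact (mul_le_mul_iff_right₀ (zero_lt_iff.2 ha0)).1 h1
  have h3 : B i (Sum.inl 1) = (B i (Sum.inl 1) - t * B i (Sum.inl 0)) + t * B i (Sum.inl 0) := by
    ring
  rw [h3]
  refine v.map_add_le (hw i) ?_
  rw [map_mul]
  exact (mul_le_mul' le_rfl (hB i _)).trans htb

/-- In a factorization of a leading diagonal matrix, the columns of the right factor are divisible
by its elementary divisors. -/
theorem map_entry_le {v : Valuation Ω Γ₀} (hv : ∀ r ∈ semilocalRing Ω c, v r ≤ 1)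
    {A B : Matrix (Fin 2 ⊕ Fin 2) (Fin 2 ⊕ Fin 2) Ω} {mA mB : K}
    {α₁ α₂ β₁ β₂ ξ₁ ξ₂ : Ω} (hAB : A * B = simDiag σ ξ₁ ξ₂ (mA * mB)) (hmA : mA ≠ 0)
    (hsA : HasSimilitude σ A mA) (hA : DivBounds c α₁ α₂ A)
    (hB : DivBounds c β₁ β₂ B) (hα₁ : α₁ ≠ 0) (hα₂ : α₂ ≠ 0) (hβ₁ : β₁ ≠ 0) (hβ₂ : β₂ ≠ 0)
    (h1 : DvdIn (semilocalRing Ω c) (α₁ * β₁) ξ₁) (h1' : DvdIn (semilocalRing Ω c) ξ₁ (α₁ * β₁))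
    (h2 : DvdIn (semilocalRing Ω c) (α₂ * β₂) ξ₂) (h2' : DvdIn (semilocalRing Ω c) ξ₂ (α₂ * β₂)) :
    ∀ i j, v (B i j) ≤ v (simDiag σ β₁ β₂ mB j j) := by
  have hσn : ∀ x : Ω, x ≠ 0 → σ x ≠ 0 := fun x hx => by simpa using hx
  have hvn : ∀ x : Ω, x ≠ 0 → v x ≠ 0 := fun x hx => by simpa using hx
  have hmA' : algebraMap K Ω mA ≠ 0 := by simpa using hmA
  -- the valuation composed with the conjugation
  let w : Valuation Ω Γ₀ := v.comap (σ : Ω →+* Ω)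
  have hw : ∀ x, w x = v (σ x) := fun x => rfl
  have hwr : ∀ r ∈ semilocalRing Ω c, w r ≤ 1 := fun r hr => hv _ (conj_mem_semilocalRing σ hr)
  have hξ1 : ∀ u : Valuation Ω Γ₀, (∀ r ∈ semilocalRing Ω c, u r ≤ 1) → u ξ₁ = u α₁ * u β₁ :=
    fun u hu => by
      rw [← map_mul]
      exact le_antisymm (map_le_of_dvdIn hu h1) (map_le_of_dvdIn hu h1')
  have hξ2 : ∀ u : Valuation Ω Γ₀, (∀ r ∈ semilocalRing Ω c, u r ≤ 1) → u ξ₂ = u α₂ * u β₂ :=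
    fun u hu => by
      rw [← map_mul]
      exact le_antisymm (map_le_of_dvdIn hu h2) (map_le_of_dvdIn hu h2')
  -- the second column of `B` and, with respect to the conjugate valuation, the second row of `A`
  have hcol : ∀ i, v (B i (Sum.inl 1)) ≤ v β₂ :=
    map_column_le v hAB (by simp [simDiag]) (hvn _ hα₁) (hvn _ hβ₁)
      (by simpa [simDiag] using hξ1 v hv) (fun i j => map_le_of_dvdIn hv (hA.entry i j))
      (fun i j => map_le_of_dvdIn hv (hB.entry i j))
      (fun i j k l => (map_le_of_dvdIn hv (hB.minor i j k l)).trans_eq (map_mul _ _ _))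
  have hrow : ∀ i, v (σ (A (Sum.inl 1) i)) ≤ v (σ α₂) := by
    have e : Bᵀ * Aᵀ = (simDiag σ ξ₁ ξ₂ (mA * mB))ᵀ := by rw [← Matrix.transpose_mul, hAB]
    exact map_column_le w e (by simp [simDiag]) (by simpa [hw] using hβ₁)
      (by simpa [hw] using hα₁) (by simpa [simDiag, mul_comm] using hξ1 w hwr)
      (fun i j => map_le_of_dvdIn hwr (hB.transpose.entry i j))
      (fun i j => map_le_of_dvdIn hwr (hA.transpose.entry i j))
      (fun i j k l => (map_le_of_dvdIn hwr (hA.transpose.minor i j k l)).trans_eq (map_mul _ _ _))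
  have hrow0 : ∀ i, v (σ (A (Sum.inl 0) i)) ≤ v (σ α₁) := fun i =>
    map_le_of_dvdIn hwr (hA.entry _ i)
  -- `mA J B = A* J D`
  have hJ : algebraMap K Ω mA • (symplecticJ 2 Ω * B) =
      conjTr σ A * (symplecticJ 2 Ω * simDiag σ ξ₁ ξ₂ (mA * mB)) := by
    rw [← hAB, ← Matrix.mul_assoc, ← Matrix.mul_assoc, hsA, Matrix.smul_mul]
    ext i j
    simp only [Matrix.smul_apply, Algebra.smul_def]
    rfl
  -- so the last two columns of `B` are controlled by the first two rows of `A`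
  have hent : ∀ p (q : Fin 2), v (algebraMap K Ω mA) * v ((symplecticJ 2 Ω * B) p (Sum.inr q)) =
      v (σ (A (Sum.inl q) p)) * v (simDiag σ ξ₁ ξ₂ (mA * mB) (Sum.inr q) (Sum.inr q)) := by
    intro p q
    have h := congrFun (congrFun hJ p) (Sum.inr q)
    have e : (conjTr σ A * (symplecticJ 2 Ω * simDiag σ ξ₁ ξ₂ (mA * mB))) p (Sum.inr q) =
        σ (A (Sum.inl q) p) * simDiag σ ξ₁ ξ₂ (mA * mB) (Sum.inr q) (Sum.inr q) := by
      rw [Matrix.mul_apply, sum_idx]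
      fin_cases q <;> simp [symplecticJ_two, simDiag, conjTr]
    rw [e, Matrix.smul_apply, smul_eq_mul] at h
    rw [← map_mul, h, map_mul]
  have hq : ∀ (q : Fin 2) (α β ξ : Ω), α ≠ 0 → β ≠ 0 →
      (∀ i, v (σ (A (Sum.inl q) i)) ≤ v (σ α)) → v (σ ξ) = v (σ α) * v (σ β) →
      simDiag σ ξ₁ ξ₂ (mA * mB) (Sum.inr q) (Sum.inr q) = algebraMap K Ω (mA * mB) / σ ξ →
      simDiag σ β₁ β₂ mB (Sum.inr q) (Sum.inr q) = algebraMap K Ω mB / σ β →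
      ∀ p, v ((symplecticJ 2 Ω * B) p (Sum.inr q)) ≤
        v (simDiag σ β₁ β₂ mB (Sum.inr q) (Sum.inr q)) := by
    intro q α β ξ hα hβ hr hξ hd hd' p
    have h := hent p q
    have hA0 := hvn _ hmA'
    have hα0 := hvn _ (hσn _ hα)
    have hβ0 := hvn _ (hσn _ hβ)
    rw [← mul_le_mul_iff_right₀ (zero_lt_iff.2 hA0), h, hd, hd', map_div₀, map_div₀, hξ, map_mul,
      map_mul]
    calc v (σ (A (Sum.inl q) p)) * (v (algebraMap K Ω mA) * v (algebraMap K Ω mB) /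
          (v (σ α) * v (σ β))) ≤ v (σ α) * (v (algebraMap K Ω mA) * v (algebraMap K Ω mB) /
          (v (σ α) * v (σ β))) := mul_le_mul' (hr p) le_rfl
      _ = v (algebraMap K Ω mA) * (v (algebraMap K Ω mB) / v (σ β)) := by
        field_simp
  have hJB : ∀ (q : Fin 2) (g : Γ₀), (∀ p, v ((symplecticJ 2 Ω * B) p (Sum.inr q)) ≤ g) →
      ∀ p, v (B p (Sum.inr q)) ≤ g := by
    intro q g h
    rw [forall_idx]
    have h0 := h (Sum.inl 0)
    have h1 := h (Sum.inl 1)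
    have h2 := h (Sum.inr 0)
    have h3 := h (Sum.inr 1)
    rw [Matrix.mul_apply, sum_idx] at h0 h1 h2 h3
    simp [symplecticJ_two] at h0 h1 h2 h3
    exact ⟨h2, h3, h0, h1⟩
  have hr0 := hJB 0 _ (hq 0 α₁ β₁ ξ₁ hα₁ hβ₁ hrow0 (hξ1 w hwr) (by simp [simDiag])
    (by simp [simDiag]))
  have hr1 := hJB 1 _ (hq 1 α₂ β₂ ξ₂ hα₂ hβ₂ hrow (hξ2 w hwr) (by simp [simDiag])
    (by simp [simDiag]))
  intro i
  rw [forall_idx]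
  refine ⟨?_, ?_, hr0 i, hr1 i⟩
  · simpa [simDiag] using map_le_of_dvdIn hv (hB.entry i (Sum.inl 0))
  · simpa [simDiag] using hcol i

/-- The right factors of two factorizations of a leading diagonal matrix differ by a matrix which is
integral with respect to the valuation. -/
theorem map_mul_inv_le_one (hσ : IsQuadraticConj σ) {v : Valuation Ω Γ₀}
    {B B' : GL (Fin 2 ⊕ Fin 2) Ω} {m : K} (hm : m ≠ 0)
    (hs : HasSimilitude σ B.1 m) {β₁ β₂ : Ω} (hβ₁ : β₁ ≠ 0) (hβ₂ : β₂ ≠ 0)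
    (hB : ∀ i j, v (σ (B.1 i j)) ≤ v (σ (simDiag σ β₁ β₂ m j j)))
    (hB' : ∀ i j, v (B'.1 i j) ≤ v (simDiag σ β₁ β₂ m j j)) (p q : Fin 2 ⊕ Fin 2) :
    v ((B'.1 * (B⁻¹).1) p q) ≤ 1 := by
  have hm' : algebraMap K Ω m ≠ 0 := by simpa using hm
  have hσ1 : σ β₁ ≠ 0 := by simpa using hβ₁
  have hσ2 : σ β₂ ≠ 0 := by simpa using hβ₂
  set d := fun i => simDiag σ β₁ β₂ m i i with hd
  -- the product of diagonal entries in dual positions is the similitude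
  have d0 : d (Sum.inl 0) * σ (d (Sum.inr 0)) = algebraMap K Ω m := by
    simp [hd, simDiag, hσ.apply_apply]; field_simp
  have d1 : d (Sum.inl 1) * σ (d (Sum.inr 1)) = algebraMap K Ω m := by
    simp [hd, simDiag, hσ.apply_apply]; field_simp
  have d2 : d (Sum.inr 0) * σ (d (Sum.inl 0)) = algebraMap K Ω m := by
    simp [hd, simDiag]; field_simp
  have d3 : d (Sum.inr 1) * σ (d (Sum.inl 1)) = algebraMap K Ω m := by
    simp [hd, simDiag]; field_simp
  have hterm : ∀ i j, d i * σ (d j) = algebraMap K Ω m → ∀ q,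
      v ((algebraMap K Ω m)⁻¹ * (B'.1 p i * σ (B.1 q j))) ≤ 1 := by
    intro i j hij q
    have h1 : v (B'.1 p i * σ (B.1 q j)) ≤ v (algebraMap K Ω m) := by
      rw [← hij, map_mul, map_mul]
      exact mul_le_mul' (hB' p i) (hB q j)
    rw [map_mul, map_inv₀]
    exact (mul_le_mul' le_rfl h1).trans_eq (inv_mul_cancel₀ (by simpa using hm))
  rw [hs.inv_eq hm, Matrix.mul_smul, Matrix.smul_apply, Algebra.smul_def, map_inv₀, map_mul]
  have hexp : ∀ q', (B'.1 * (-symplecticJ 2 Ω * conjTr σ B.1)) p q' =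
      -(B'.1 p (Sum.inl 0) * σ (B.1 q' (Sum.inr 0))) +
      -(B'.1 p (Sum.inl 1) * σ (B.1 q' (Sum.inr 1)))
      + B'.1 p (Sum.inr 0) * σ (B.1 q' (Sum.inl 0)) +
      B'.1 p (Sum.inr 1) * σ (B.1 q' (Sum.inl 1)) := by
    intro q'
    simp only [Matrix.mul_apply, sum_idx, symplecticJ_two, conjTr]
    simp
  have hle : ∀ q',
      v ((algebraMap K Ω m)⁻¹ * (B'.1 * (-symplecticJ 2 Ω * conjTr σ B.1)) p q') ≤ 1 := by
    intro q'
    rw [hexp, mul_add, mul_add, mul_add]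
    refine map_add_four_le v ?_ ?_ ?_ ?_
    · rw [mul_neg, Valuation.map_neg]; exact hterm _ _ d0 q'
    · rw [mul_neg, Valuation.map_neg]; exact hterm _ _ d1 q'
    · exact hterm _ _ d2 q'
    · exact hterm _ _ d3 q'
  rw [← Matrix.mul_assoc, ← map_mul]
  rw [Matrix.mul_apply (M := B'.1 * (-symplecticJ 2 Ω * conjTr σ B.1)), sum_idx]
  revert q
  rw [forall_idx]
  simp [symplecticJ_two] at hle ⊢
  exact ⟨hle.2.1, hle.2.2, hle.1.1, hle.1.2⟩

end Valuation

/-- Every prime of `𝓞 Ω` contains a nonzero element of `𝓞 K`, by way of the relative norm. -/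
theorem exists_mem_asIdeal (P : HeightOneSpectrum (𝓞 Ω)) :
    ∃ c : 𝓞 K, ¬ IsUnit c ∧ c ≠ 0 ∧ algebraMap (𝓞 K) (𝓞 Ω) c ∈ P.asIdeal := by
  have h : P.asIdeal.comap (algebraMap (𝓞 K) (𝓞 Ω)) ≠ ⊥ := fun h => by
    have h1 := Ideal.relNorm_le_comap (𝓞 K) P.asIdeal
    rw [h, le_bot_iff, Ideal.relNorm_eq_bot_iff] at h1
    exact P.ne_bot h1
  obtain ⟨c, hc, hc0⟩ := Submodule.exists_mem_ne_zero_of_ne_bot h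
  exact ⟨c, fun hu => P.isPrime.ne_top (Ideal.eq_top_of_isUnit_mem _ hc (hu.map _)), hc0, hc⟩

/-- The semilocal ring lies in the local rings at the primes dividing `c`. -/
theorem valuation_le_one_of_mem_semilocalRing {P : HeightOneSpectrum (𝓞 Ω)}
    (hc : algebraMap (𝓞 K) (𝓞 Ω) c ∈ P.asIdeal) {r : Ω} (hr : r ∈ semilocalRing Ω c) :
    P.valuation Ω r ≤ 1 := by
  obtain ⟨z, y, e⟩ := hr
  have h1 : P.valuation Ω (algebraMap K Ω ((1 + c * z : 𝓞 K) : K)) = 1 := by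
    have h2 : P.valuation Ω ((algebraMap (𝓞 K) (𝓞 Ω) (c * z) : 𝓞 Ω) : Ω) < 1 :=
      (P.valuation_lt_one_iff_mem (K := Ω) _).2 (by
        rw [map_mul]; exact Ideal.mul_mem_right _ _ hc)
    rw [coe_algebraMap_eq] at h2
    have h3 : algebraMap K Ω ((1 + c * z : 𝓞 K) : K) = 1 + algebraMap K Ω ((c * z : 𝓞 K) : K) := by
      simp
    rw [h3]
    exact (P.valuation Ω).map_one_add_of_lt h2
  have h2 := congrArg (P.valuation Ω) e
  rw [map_mul, h1, one_mul] at h2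
  rw [h2]
  exact P.valuation_le_one y

/-- The elementary divisor theorem for elements of the monoid of similitudes, together with the
ideals which the elementary divisors generate. -/
theorem exists_simDiag_generatesAt {g : similitudeMonoid 2 σ} (hσ : IsQuadraticConj σ)
    (hcu : ¬ IsUnit c) (hc0 : c ≠ 0) :
    ∃ α₁ α₂ : Ω, α₁ ≠ 0 ∧ α₂ ≠ 0 ∧ (∃ h₁ ∈ approxGroup 2 σ c, ∃ h₂ ∈ approxGroup 2 σ c,
      (h₁ * g.1 * h₂).1 = simDiag σ α₁ α₂ (similitude g : K)) ∧
      GeneratesAt c (entryIdeal g.1.1) α₁ ∧ GeneratesAt c (minorIdeal g.1.1) (α₁ * α₂) := by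
  obtain ⟨hm, hs⟩ := similitude_spec g
  have hm' : (similitude g : K) ≠ 0 := by simpa using hm
  obtain ⟨α₁, α₂, ha1, ha2, -, -, hd1, hd2, N, hN, eN⟩ :=
    exists_simDiag hcu hc0 hσ (g.2.1.isSemilocal c) hm' hs
  obtain ⟨G1, G2⟩ := generatesAt_of_simDiag g.2.1 hN eN hd1 hd2 ha1 ha2
  obtain ⟨h₁, hh₁, h₂, hh₂, e⟩ := hN
  exact ⟨α₁, α₂, ha1, ha2, ⟨h₁, hh₁, h₂, hh₂, by rw [← eN, e]⟩, G1, G2⟩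

/-- The leading double coset of a product occurs with multiplicity one: the right factors of any
two factorizations of its elements differ by an element of the modular group, as is seen at every
prime. -/
theorem structureConstant_le_one_of_isTriple (hσ : IsQuadraticConj σ) {C D E : HermitianCoset 2 σ}
    (h1 : cosetEntries E = cosetEntries C * cosetEntries D)
    (h2 : cosetMinors E = cosetMinors C * cosetMinors D) : structureConstant C D E ≤ 1 := by
  obtain ⟨x, rfl⟩ : ∃ x, HeckeCoset.mk _ _ x = E := ⟨_, Quotient.out_eq E⟩
  refine structureConstant_le_one C D x ?_
  rintro g k g' k' rfl rfl hg hk e e'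
  have E1 := cosetEntries_mk hg
  have E2 := cosetMinors_mk hg
  have F1 := cosetEntries_mk hk
  have F2 := cosetMinors_mk hk
  rw [cosetEntries_mk rfl] at E1 F1
  rw [cosetMinors_mk rfl] at E2 F2
  rw [cosetEntries_mk rfl, cosetEntries_mk rfl, cosetEntries_mk rfl] at h1
  rw [cosetMinors_mk rfl, cosetMinors_mk rfl, cosetMinors_mk rfl] at h2
  obtain ⟨hmx, hsx⟩ := similitude_spec x
  obtain ⟨hmg, hsg⟩ := similitude_spec g
  obtain ⟨hmk, hsk⟩ := similitude_spec k
  obtain ⟨hmg', hsg'⟩ := similitude_spec g'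
  obtain ⟨hmk', hsk'⟩ := similitude_spec k'
  have hmk0 : (similitude k : K) ≠ 0 := by simpa using hmk
  have hmg0 : (similitude g : K) ≠ 0 := by simpa using hmg
  have hmk0' : (similitude k' : K) ≠ 0 := by simpa using hmk'
  have hmg0' : (similitude g' : K) ≠ 0 := by simpa using hmg'
  have S1 := cosetSimilitude_mk hk hsk'
  rw [cosetSimilitude_mk rfl hsk, Ideal.span_singleton_eq_span_singleton] at S1
  obtain ⟨u, hu⟩ := S1
  have hxg : (similitude x : K) = similitude g * similitude k := by
    have h := hsg.mul hsk
    have e2 : x.1.1 = g.1.1 * k.1.1 := by rw [e]; rfl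
    rw [← e2] at h
    exact hsx.unique h
  have hxg' : (similitude x : K) = similitude g' * similitude k' := by
    have h := hsg'.mul hsk'
    have e2 : x.1.1 = g'.1.1 * k'.1.1 := by rw [e']; rfl
    rw [← e2] at h
    exact hsx.unique h
  have hkk : (similitude k' : K) = similitude k * ((u : 𝓞 K) : K) := by rw [← hu, coe_mul]
  refine ⟨fun p q => ?_, u, ?_⟩
  · have hmem : ((k' : GL (Fin 2 ⊕ Fin 2) Ω).1 * ((k : GL (Fin 2 ⊕ Fin 2) Ω)⁻¹).1) p q ∈
        (algebraMap (𝓞 Ω) Ω).range := by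
      refine HeightOneSpectrum.mem_integers_of_valuation_le_one Ω _ fun P => ?_
      obtain ⟨c, hcu, hc0, hcP⟩ := exists_mem_asIdeal (K := K) P
      have hv : ∀ r ∈ semilocalRing Ω c, P.valuation Ω r ≤ 1 := fun r hr =>
        valuation_le_one_of_mem_semilocalRing hcP hr
      have hw : ∀ r ∈ semilocalRing Ω c, ((P.valuation Ω).comap (σ : Ω →+* Ω)) r ≤ 1 := fun r hr =>
        hv _ (conj_mem_semilocalRing σ hr)
      obtain ⟨α₁, α₂, ha1, ha2, -, G1, G2⟩ := exists_simDiag_generatesAt (g := g) hσ hcu hc0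
      obtain ⟨β₁, β₂, hb1, hb2, -, H1, H2⟩ := exists_simDiag_generatesAt (g := k) hσ hcu hc0
      obtain ⟨ξ₁, ξ₂, hx1, hx2, ⟨h₁, hh₁, h₂, hh₂, ex⟩, X1, X2⟩ :=
        exists_simDiag_generatesAt (g := x) hσ hcu hc0
      rw [h1] at X1
      rw [h2] at X2
      have Y1 := G1.mul H1
      have Y2 := G2.mul H2
      have d1 := X1.dvdIn_dvdIn hcu Y1
      have d1' := Y1.dvdIn_dvdIn hcu X1
      -- the quotients of the minors by the entries
      have e2 : ∀ a₁ a₂ b₁ b₂ : Ω, a₁ * a₂ * (b₁ * b₂) = a₁ * b₁ * (a₂ * b₂) := by intros; ring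
      have d2 : DvdIn (semilocalRing Ω c) ξ₂ (α₂ * β₂) := by
        refine DvdIn.of_mul_left hx1 ((X2.dvdIn_dvdIn hcu Y2).trans ?_)
        rw [e2]
        exact d1'.mul_mul (DvdIn.refl _ _)
      have d2' : DvdIn (semilocalRing Ω c) (α₂ * β₂) ξ₂ := by
        refine DvdIn.of_mul_left (mul_ne_zero ha1 hb1) ?_
        rw [← e2]
        exact (Y2.dvdIn_dvdIn hcu X2).trans (d1.mul_mul (DvdIn.refl _ _))
      have s1 := approxGroup_isSemilocal hh₁
      have s2 := approxGroup_isSemilocal hh₂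
      -- the columns of both right factors, multiplied by `h₂`, are divisible by the elementary
      -- divisors of `k`
      have B : ∀ (a b : similitudeMonoid 2 σ) (ma mb : K), (x : GL (Fin 2 ⊕ Fin 2) Ω) = a * b →
          entryIdeal a.1.1 = entryIdeal g.1.1 → minorIdeal a.1.1 = minorIdeal g.1.1 →
          entryIdeal b.1.1 = entryIdeal k.1.1 → minorIdeal b.1.1 = minorIdeal k.1.1 →
          ma ≠ 0 → HasSimilitude σ a.1.1 ma →
          (similitude x : K) = ma * mb →
          ∀ v : Valuation Ω (WithZero (Multiplicative ℤ)), (∀ r ∈ semilocalRing Ω c, v r ≤ 1) →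
          ∀ i j, v ((b.1 * h₂).1 i j) ≤ v (simDiag σ β₁ β₂ mb j j) := by
        intro a b ma mb hab ea ea2 eb eb2 hma hsa hxm v hv
        have hA := (DivBounds.of_generatesAt a.2.1 (ea ▸ G1) (ea2 ▸ G2)).mul_left s1
        have hB := (DivBounds.of_generatesAt b.2.1 (eb ▸ H1) (eb2 ▸ H2)).mul_right s2
        have hAB : (h₁.1 * a.1.1) * (b.1.1 * h₂.1) = simDiag σ ξ₁ ξ₂ (ma * mb) := by
          rw [← hxm, ← ex, hab]
          simp only [Units.val_mul, Matrix.mul_assoc]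
        have hs : HasSimilitude σ (h₁.1 * a.1.1) ma := by
          have := hh₁.1.mul hsa
          rwa [one_mul] at this
        exact map_entry_le hv hAB hma hs hA hB ha1 ha2 hb1 hb2 d1' d1 d2' d2
      have Bk := B g k _ _ e rfl rfl rfl rfl hmg0 hsg hxg _ hw
      have Bk' := B g' k' _ _ e' E1.symm E2.symm F1.symm F2.symm hmg0' hsg' hxg' _ hv
      have hsk2 : HasSimilitude σ (k.1 * h₂).1 (similitude k : K) := by
        have := hsk.mul hh₂.1
        rwa [mul_one] at this
      -- the two similitudes differ by a unit
      have hBk' : ∀ i j, P.valuation Ω ((k'.1 * h₂).1 i j) ≤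
          P.valuation Ω (simDiag σ β₁ β₂ (similitude k : K) j j) := by
        intro i j
        refine (Bk' i j).trans ?_
        have hu1 : P.valuation Ω (algebraMap K Ω ((u : 𝓞 K) : K)) ≤ 1 := by
          rw [← coe_algebraMap_eq]; exact P.valuation_le_one _
        rw [hkk]
        revert j
        rw [forall_idx]
        simp only [simDiag, Matrix.diagonal_apply_eq, Sum.elim_inl, Sum.elim_inr,
          Matrix.cons_val_zero, Matrix.cons_val_one, le_refl, true_and]
        refine ⟨?_, ?_⟩ <;>
        · rw [map_mul, mul_div_right_comm, map_mul]
          exact mul_le_of_le_one_right' hu1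
      have := map_mul_inv_le_one hσ hmk0 hsk2 hb1 hb2 Bk hBk' p q
      have e3 : (k'.1 * h₂).1 * ((k.1 * h₂)⁻¹).1 = k'.1.1 * (k.1⁻¹).1 := by
        rw [← Units.val_mul, ← Units.val_mul]
        congr 1
        group
      rwa [e3] at this
    obtain ⟨y, hy⟩ := hmem
    have h3 : IsIntegral ℤ (algebraMap (𝓞 Ω) Ω y) := RingOfIntegers.isIntegral_coe y
    rw [hy] at h3
    exact h3
  · have h := hsk'.mul (hsk.inv hmk0)
    rw [hkk, mul_comm (similitude k : K), mul_inv_cancel_right₀ hmk0] at h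
    exact h

/-- The leading double coset occurs in a product with coefficient one. -/
theorem structureConstant_leading [IsPrincipalIdealRing (𝓞 K)] (hσ : IsQuadraticConj σ)
    (hΩ : NumberField.classNumber Ω = 2) (C D : HermitianCoset 2 σ) :
    structureConstant C D (leading hσ hΩ C D) = 1 := by
  refine le_antisymm (structureConstant_le_one_of_isTriple hσ ?_ ?_)
    (Nat.one_le_iff_ne_zero.2 (structureConstant_leading_ne_zero hσ hΩ C D))
  · have h := (isTriple_triple hσ (leading hσ hΩ C D)).entries
    rw [triple_leading] at h
    rw [h, (isTriple_triple hσ C).entries, (isTriple_triple hσ D).entries]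
    rfl
  · have h := (isTriple_triple hσ (leading hσ hΩ C D)).minors
    rw [triple_leading] at h
    rw [h, (isTriple_triple hσ C).minors, (isTriple_triple hσ D).minors]
    simp only [Prod.fst_mul, Prod.snd_mul]
    ring

end LeadingCoefficient

/-! ### Elementary divisors over the completions -/

section ElementaryDivisors

/-- If too large a block of a square matrix is divisible by `x`, then so is the determinant. -/
theorem dvd_det_of_block {R : Type*} [CommRing R] {n : ℕ} (Z : Matrix (Fin n) (Fin n) R) {x : R}
    (r : Fin n) (h : ∀ i j, i ≤ r → r ≤ j → x ∣ Z i j) : x ∣ Z.det := by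
  rw [Matrix.det_apply]
  refine Finset.dvd_sum fun τ _ => ?_
  -- by counting, no permutation maps the columns from `r` on into the rows after `r`
  obtain ⟨j, hj, hτ⟩ : ∃ j, r ≤ j ∧ τ j ≤ r := by
    by_contra hne
    push Not at hne
    have h1 : (Finset.Ici r).card ≤ (Finset.Ioi r).card :=
      Finset.card_le_card_of_injOn τ (fun j hj => Finset.mem_coe.2 (Finset.mem_Ioi.2
        (hne j (Finset.mem_Ici.1 hj)))) τ.injective.injOn
    rw [Fin.card_Ici, Fin.card_Ioi] at h1
    have := r.2
    omega
  rw [Units.smul_def, zsmul_eq_mul]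
  exact ((h _ _ hτ hj).trans (Finset.dvd_prod_of_mem (fun i => Z (τ i) i)
    (Finset.mem_univ j))).mul_left _

variable {Ω : Type*} [Field Ω] [NumberField Ω] {P : HeightOneSpectrum (𝓞 Ω)}

theorem valued_algebraMap (x : Ω) :
    Valued.v (algebraMap Ω (P.adicCompletion Ω) x) = P.valuation Ω x :=
  HeightOneSpectrum.valuedAdicCompletion_eq_valuation' P x

/-- Uniqueness of elementary divisors: if `e r > e' r`, then the matrix comparing the two
diagonalizations has a block divisible by a prime element which is too large for an invertible
matrix. -/
theorem HasElementaryDivisors.le {n : ℕ} {M : Matrix (Fin n ⊕ Fin n) (Fin n ⊕ Fin n) Ω}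
    {e e' : Fin (n + n) → ℕ} (h : HasElementaryDivisors P M e) (h' : HasElementaryDivisors P M e')
    (r : Fin (n + n)) : e r ≤ e' r := by
  obtain ⟨hmono, ϖ, U, V, hϖ, hM⟩ := h
  obtain ⟨hmono', ϖ', U', V', hϖ', hM'⟩ := h'
  by_contra hlt
  push Not at hlt
  have hinj : Function.Injective (algebraMap (P.adicCompletionIntegers Ω) (P.adicCompletion Ω)) :=
    FaithfulSMul.algebraMap_injective _ _
  have h1 := Matrix.map_injective hinj (hM.symm.trans hM')
  -- `W D = D' Z` with invertible `W` and `Z`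
  set D : Matrix (Fin n ⊕ Fin n) (Fin n ⊕ Fin n) (P.adicCompletionIntegers Ω) :=
    Matrix.diagonal (fun i => ϖ ^ e (finSumFinEquiv i)) with hD
  set D' : Matrix (Fin n ⊕ Fin n) (Fin n ⊕ Fin n) (P.adicCompletionIntegers Ω) :=
    Matrix.diagonal (fun i => ϖ' ^ e' (finSumFinEquiv i)) with hD'
  have h2 : (U'⁻¹ * U).1 * D = D' * (V' * V⁻¹).1 := by
    have e1 : (U'⁻¹).1 * U'.1 = 1 := by rw [← Units.val_mul, inv_mul_cancel]; rfl
    have e2 : V.1 * (V⁻¹).1 = 1 := by rw [← Units.val_mul, mul_inv_cancel]; rfl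
    calc (U'⁻¹ * U).1 * D = (U'⁻¹).1 * (U.1 * D * V.1) * (V⁻¹).1 := by
          rw [Units.val_mul, Matrix.mul_assoc, Matrix.mul_assoc, Matrix.mul_assoc,
            Matrix.mul_assoc, e2, Matrix.mul_one]
      _ = (U'⁻¹).1 * (U'.1 * D' * V'.1) * (V⁻¹).1 := by rw [h1]
      _ = ((U'⁻¹).1 * U'.1) * D' * (V'.1 * (V⁻¹).1) := by simp only [Matrix.mul_assoc]
      _ = D' * (V' * V⁻¹).1 := by rw [e1, Matrix.one_mul, Units.val_mul]
  have hass := IsDiscreteValuationRing.associated_of_irreducible _ hϖ' hϖ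
  have hdvd : ∀ i j, finSumFinEquiv i ≤ r → r ≤ finSumFinEquiv j → ϖ' ∣ (V' * V⁻¹).1 i j := by
    intro i j hi hj
    have h3 := congrFun (congrFun h2 i) j
    rw [hD, hD', Matrix.mul_diagonal, Matrix.diagonal_mul] at h3
    have hlt' : e' (finSumFinEquiv i) + 1 ≤ e (finSumFinEquiv j) :=
      (Nat.succ_le_of_lt ((hmono' hi).trans_lt hlt)).trans (hmono hj)
    have h4 : ϖ' ^ (e' (finSumFinEquiv i) + 1) ∣ ϖ ^ e (finSumFinEquiv j) :=
      (pow_dvd_pow _ hlt').trans ((hass.pow_pow (n := e (finSumFinEquiv j))).dvd)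
    have h5 := h4.mul_left ((U'⁻¹ * U).1 i j)
    rw [h3, pow_succ] at h5
    exact (mul_dvd_mul_iff_left (pow_ne_zero _ hϖ'.ne_zero)).1 h5
  have hdet := dvd_det_of_block ((V' * V⁻¹).1.submatrix finSumFinEquiv.symm finSumFinEquiv.symm) r
    (fun i j hi hj => hdvd _ _ (by simpa using hi) (by simpa using hj))
  rw [Matrix.det_submatrix_equiv_self] at hdet
  exact hϖ'.not_isUnit (isUnit_of_dvd_unit hdet
    ((Matrix.isUnit_iff_isUnit_det _).1 (V' * V⁻¹).isUnit))

theorem HasElementaryDivisors.elementaryDivisors_eq {n : ℕ}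
    {M : Matrix (Fin n ⊕ Fin n) (Fin n ⊕ Fin n) Ω} {e : Fin (n + n) → ℕ}
    (h : HasElementaryDivisors P M e) : elementaryDivisors P M = e := by
  unfold elementaryDivisors
  have h' : ∃ e, HasElementaryDivisors P M e := ⟨e, h⟩
  rw [dif_pos h']
  exact funext fun r => le_antisymm (h'.choose_spec.le h r) (h.le h'.choose_spec r)

/-- An invertible matrix which is integral at `P`, together with its inverse, is invertible over the
completion. -/
theorem exists_adic_lift {ι : Type*} [Fintype ι] [DecidableEq ι] {X Y : Matrix ι ι Ω}
    (hXY : X * Y = 1) (hX : ∀ i j, P.valuation Ω (X i j) ≤ 1)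
    (hY : ∀ i j, P.valuation Ω (Y i j) ≤ 1) :
    ∃ U : GL ι (P.adicCompletionIntegers Ω),
      U.1.map (algebraMap (P.adicCompletionIntegers Ω) (P.adicCompletion Ω)) =
        X.map (algebraMap Ω (P.adicCompletion Ω)) := by
  have hinj : Function.Injective (algebraMap (P.adicCompletionIntegers Ω) (P.adicCompletion Ω)) :=
    FaithfulSMul.algebraMap_injective _ _
  have hlift : ∀ X : Matrix ι ι Ω, (∀ i j, P.valuation Ω (X i j) ≤ 1) →
      ∃ X' : Matrix ι ι (P.adicCompletionIntegers Ω),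
        X'.map (algebraMap (P.adicCompletionIntegers Ω) (P.adicCompletion Ω)) =
          X.map (algebraMap Ω (P.adicCompletion Ω)) := fun X hX =>
    ⟨Matrix.of fun i j => ⟨algebraMap Ω (P.adicCompletion Ω) (X i j),
      (HeightOneSpectrum.mem_adicCompletionIntegers _ _ _).2 (by
        rw [valued_algebraMap]; exact hX i j)⟩, rfl⟩
  obtain ⟨X', hX'⟩ := hlift X hX
  obtain ⟨Y', hY'⟩ := hlift Y hY
  have h1 : X' * Y' = 1 := Matrix.map_injective hinj (by
    beta_reduce
    rw [Matrix.map_mul, hX', hY', ← Matrix.map_mul, hXY, Matrix.map_one _ (map_zero _) (map_one _),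
      Matrix.map_one _ (map_zero _) (map_one _)])
  exact ⟨⟨X', Y', h1, mul_eq_one_comm.1 h1⟩, hX'⟩

/-- A prime element of the completion can be taken from the field itself. -/
theorem exists_irreducible_adic (P : HeightOneSpectrum (𝓞 Ω)) :
    ∃ (π : Ω) (ϖ : P.adicCompletionIntegers Ω), P.valuation Ω π = WithZero.exp (-1 : ℤ) ∧
      Irreducible ϖ ∧ (ϖ : P.adicCompletion Ω) = algebraMap Ω (P.adicCompletion Ω) π := by
  obtain ⟨π, hπ⟩ := P.valuation_exists_uniformizer Ω
  have hle : P.valuation Ω π ≤ 1 := by rw [hπ, ← WithZero.exp_zero, WithZero.exp_le_exp]; simp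
  have hmem : algebraMap Ω (P.adicCompletion Ω) π ∈ P.adicCompletionIntegers Ω :=
    (HeightOneSpectrum.mem_adicCompletionIntegers _ _ _).2 (by rw [valued_algebraMap]; exact hle)
  refine ⟨π, ⟨_, hmem⟩, hπ, ⟨?_, ?_⟩, rfl⟩
  · rw [HeightOneSpectrum.adicCompletionIntegers.isUnit_iff_valued_eq_one]
    change Valued.v (algebraMap Ω (P.adicCompletion Ω) π) ≠ 1
    rw [valued_algebraMap, hπ, ← WithZero.exp_zero, Ne, WithZero.exp_inj]
    simp
  · intro a b hab
    have h1 : Valued.v (a : P.adicCompletion Ω) * Valued.v (b : P.adicCompletion Ω) =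
        WithZero.exp (-1 : ℤ) := by
      rw [← map_mul, ← hπ, ← valued_algebraMap]
      exact congrArg Valued.v (congrArg Subtype.val hab).symm
    have ha := (HeightOneSpectrum.mem_adicCompletionIntegers _ _ _).1 a.2
    have hb := (HeightOneSpectrum.mem_adicCompletionIntegers _ _ _).1 b.2
    rw [HeightOneSpectrum.adicCompletionIntegers.isUnit_iff_valued_eq_one,
      HeightOneSpectrum.adicCompletionIntegers.isUnit_iff_valued_eq_one]
    have ha0 : Valued.v (a : P.adicCompletion Ω) ≠ 0 := left_ne_zero_of_mul
        (h1 ▸ WithZero.exp_ne_zero)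
    have hb0 : Valued.v (b : P.adicCompletion Ω) ≠ 0 := right_ne_zero_of_mul
        (h1 ▸ WithZero.exp_ne_zero)
    rw [← WithZero.exp_log ha0, ← WithZero.exp_zero] at ha ⊢
    rw [← WithZero.exp_log hb0, ← WithZero.exp_zero] at hb
    rw [← WithZero.exp_log hb0]
    rw [← WithZero.exp_log ha0, ← WithZero.exp_log hb0, ← WithZero.exp_add, WithZero.exp_inj] at h1
    rw [WithZero.exp_le_exp] at ha hb
    rw [WithZero.exp_inj, WithZero.exp_inj]
    omega

/-- A diagonalization over the local ring at `P`, with the diagonal entries in any order, gives the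
elementary divisors. -/
theorem hasElementaryDivisors_of_eq {n : ℕ} {M X X' Y Y' : Matrix (Fin n ⊕ Fin n) (Fin n ⊕ Fin n) Ω}
    {d : Fin n ⊕ Fin n → Ω} (τ : Fin n ⊕ Fin n ≃ Fin n ⊕ Fin n) {e : Fin (n + n) → ℕ}
    (he : Monotone e) (hM : M = X * Matrix.diagonal d * Y) (hXX' : X * X' = 1) (hYY' : Y * Y' = 1)
    (hX : ∀ i j, P.valuation Ω (X i j) ≤ 1) (hX' : ∀ i j, P.valuation Ω (X' i j) ≤ 1)
    (hY : ∀ i j, P.valuation Ω (Y i j) ≤ 1) (hY' : ∀ i j, P.valuation Ω (Y' i j) ≤ 1)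
    (hd : ∀ i, P.valuation Ω (d (τ i)) = WithZero.exp (-(e (finSumFinEquiv i) : ℤ))) :
    HasElementaryDivisors P M e := by
  obtain ⟨π, ϖ, hπ, hϖ, hϖπ⟩ := exists_irreducible_adic P
  have hπ0 : π ≠ 0 := fun h => by
    rw [h, map_zero] at hπ; exact WithZero.exp_ne_zero hπ.symm
  -- the unit parts of the diagonal entries are absorbed into the right factor
  let u : Fin n ⊕ Fin n → Ω := fun i => d (τ i) / π ^ e (finSumFinEquiv i)
  have hu : ∀ i, P.valuation Ω (u i) = 1 := by
    intro i
    have h1 : P.valuation Ω (π ^ e (finSumFinEquiv i)) =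
        WithZero.exp (-(e (finSumFinEquiv i) : ℤ)) := by
      rw [map_pow, hπ, ← WithZero.exp_nsmul]
      simp
    change P.valuation Ω (d (τ i) / π ^ e (finSumFinEquiv i)) = 1
    rw [map_div₀, hd, h1, div_self WithZero.exp_ne_zero]
  have hu0 : ∀ i, u i ≠ 0 := fun i h => by have := hu i; rw [h, map_zero] at this; simp at this
  obtain ⟨U, hU⟩ := exists_adic_lift (P := P) (X := X.submatrix id τ) (Y := X'.submatrix τ id)
    (by rw [Matrix.submatrix_mul_equiv, hXX']; rfl) (fun i j => hX _ _) (fun i j => hX' _ _)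
  obtain ⟨V, hV⟩ := exists_adic_lift (P := P)
    (X := Matrix.diagonal u * Y.submatrix τ id)
    (Y := Y'.submatrix id τ * Matrix.diagonal fun i => (u i)⁻¹) (by
      have h1 : Y.submatrix τ id * Y'.submatrix id τ = 1 := by
        have h := Matrix.submatrix_mul_equiv Y Y' τ (Equiv.refl _) τ
        rw [hYY', Matrix.submatrix_one_equiv] at h
        exact h
      rw [Matrix.mul_assoc, ← Matrix.mul_assoc (Y.submatrix τ id), h1, Matrix.one_mul,
        Matrix.diagonal_mul_diagonal]
      simp [hu0])
    (fun i j => by rw [Matrix.diagonal_mul, map_mul, hu, one_mul]; exact hY _ _)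
    (fun i j => by rw [Matrix.mul_diagonal, map_mul, map_inv₀, hu, inv_one, mul_one]; exact hY' _ _)
  refine ⟨he, ϖ, U, V, hϖ, ?_⟩
  have h1 : M = X.submatrix id τ * Matrix.diagonal (fun i => π ^ e (finSumFinEquiv i)) *
      (Matrix.diagonal u * Y.submatrix τ id) := by
    rw [← Matrix.mul_assoc, Matrix.mul_assoc _ _ (Matrix.diagonal u), Matrix.diagonal_mul_diagonal]
    have e1 : (Matrix.diagonal fun i => π ^ e (finSumFinEquiv i) * u i) =
        (Matrix.diagonal d).submatrix τ τ := by
      rw [Matrix.submatrix_diagonal_equiv]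
      congr 1
      ext i
      exact mul_div_cancel₀ _ (pow_ne_zero _ hπ0)
    rw [e1, Matrix.submatrix_mul_equiv, Matrix.submatrix_mul_equiv, hM]
    rfl
  rw [h1, Matrix.map_mul, Matrix.map_mul, Matrix.map_mul (L := U.1 * _), Matrix.map_mul (L := U.1),
    hU, hV]
  congr 2
  rw [Matrix.diagonal_map (map_zero _), Matrix.diagonal_map (map_zero _)]
  congr 1
  funext i
  simp only [map_pow]
  exact congrArg (· ^ _) hϖπ.symm

end ElementaryDivisors

/-! ### The data of a double coset in terms of its triple -/

section Data

variable {K Ω : Type*} [Field K] [NumberField K] [Field Ω] [NumberField Ω] [Algebra K Ω]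
  {σ : Ω ≃ₐ[K] Ω} {c : 𝓞 K} {P : HeightOneSpectrum (𝓞 Ω)}

/-- The exponent of the prime `P` in the ideal `I`. -/
noncomputable def ord (P : HeightOneSpectrum (𝓞 Ω)) (I : Ideal (𝓞 Ω)) : ℕ :=
  multiplicity P.asIdeal I

theorem finiteMultiplicity {I : Ideal (𝓞 Ω)} (hI : I ≠ 0) : FiniteMultiplicity P.asIdeal I :=
  FiniteMultiplicity.of_prime_left P.prime hI

theorem ord_mul {I J : Ideal (𝓞 Ω)} (hI : I ≠ 0) (hJ : J ≠ 0) :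
    ord P (I * J) = ord P I + ord P J :=
  multiplicity_mul P.prime (finiteMultiplicity (mul_ne_zero hI hJ))

theorem ord_one : ord P 1 = 0 :=
  multiplicity_eq_zero.2 fun h => P.prime.not_isUnit (isUnit_of_dvd_one h)

theorem pow_dvd_iff_le_ord {I : Ideal (𝓞 Ω)} (hI : I ≠ 0) {k : ℕ} :
    P.asIdeal ^ k ∣ I ↔ k ≤ ord P I :=
  (finiteMultiplicity hI).pow_dvd_iff_le_multiplicity

theorem ord_prime [DecidableEq (HeightOneSpectrum (𝓞 Ω))] (P Q : HeightOneSpectrum (𝓞 Ω)) :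
    ord P Q.asIdeal = if P = Q then 1 else 0 := by
  split_ifs with h
  · subst h
    exact multiplicity_self
  · refine multiplicity_eq_zero.2 fun hd => h (HeightOneSpectrum.ext ?_)
    exact associated_iff_eq.1 ((P.prime.dvd_prime_iff_associated Q.prime).1 hd)

theorem eq_of_ord_eq {I J : Ideal (𝓞 Ω)} (hI : I ≠ 0) (hJ : J ≠ 0)
    (h : ∀ P : HeightOneSpectrum (𝓞 Ω), ord P I = ord P J) : I = J := by
  have key : ∀ I J : Ideal (𝓞 Ω), I ≠ 0 → J ≠ 0 → (∀ P : HeightOneSpectrum (𝓞 Ω),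
      ord P I = ord P J) → I ∣ J := by
    intro I
    refine UniqueFactorizationMonoid.induction_on_prime I ?_ ?_ ?_
    · intro J h0; exact absurd rfl h0
    · intro U hU J _ _ _; exact hU.dvd
    · intro A p hA hp ih J hpA hJ hord
      let P : HeightOneSpectrum (𝓞 Ω) := ⟨p, Ideal.isPrime_of_prime hp, hp.ne_zero⟩
      have h1 : p ∣ J := by
        have h2 : P.asIdeal ^ 1 ∣ J := by
          rw [pow_dvd_iff_le_ord hJ, ← hord, ← pow_dvd_iff_le_ord hpA, pow_one]
          exact Dvd.intro _ rfl
        rwa [pow_one] at h2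
      obtain ⟨J', rfl⟩ := h1
      have hJ' := right_ne_zero_of_mul hJ
      refine mul_dvd_mul_left p (ih J' hA hJ' fun Q => ?_)
      have h3 := hord Q
      rw [ord_mul hp.ne_zero hA, ord_mul hp.ne_zero hJ'] at h3
      omega
  exact associated_iff_eq.1 (associated_of_dvd_dvd (key I J hI hJ h) (key J I hJ hI fun P =>
    (h P).symm))

theorem GeneratesAt.conj (hσ : IsQuadraticConj σ) {I : Ideal (𝓞 Ω)} {α : Ω}
    (h : GeneratesAt c I α) : GeneratesAt c (conjIdeal σ I) (σ α) := by
  refine ⟨?_, fun y hy => ?_⟩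
  · obtain ⟨z, y, hy, e⟩ := h.exists_mem
    refine ⟨z, conjInt σ y, ?_, ?_⟩
    · rw [mem_conjIdeal hσ, hσ.conjInt_conjInt]; exact hy
    · rw [coe_conjInt, e, map_mul, conj_coe]
  · have h1 := (h.dvdIn _ ((mem_conjIdeal hσ).1 hy)).conj σ
    rwa [coe_conjInt, hσ.apply_apply] at h1

theorem generatesAt_span (c : 𝓞 K) (y : 𝓞 Ω) : GeneratesAt c (Ideal.span {y}) (y : Ω) :=
  GeneratesAt.of_span ⟨0, y, Ideal.mem_span_singleton_self y, by simp⟩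
    fun z hz => by rw [Set.mem_singleton_iff.1 hz]; exact DvdIn.refl _ _

/-- If `P` divides `c`, the valuation at `P` of an ideal is that of a generator over the semilocal
ring. -/
theorem GeneratesAt.valuation_eq (hc : algebraMap (𝓞 K) (𝓞 Ω) c ∈ P.asIdeal) {I : Ideal (𝓞 Ω)}
    (hI : I ≠ 0) {α : Ω} (h : GeneratesAt c I α) :
    P.valuation Ω α = WithZero.exp (-(ord P I : ℤ)) := by
  have hcu : ¬ IsUnit c := fun hu =>
    P.isPrime.ne_top (Ideal.eq_top_of_isUnit_mem _ hc (hu.map _))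
  have hval : ∀ (y : 𝓞 Ω) (k : ℕ), P.valuation Ω (y : Ω) ≤ WithZero.exp (-(k : ℤ)) ↔
      y ∈ P.asIdeal ^ k := fun y k => by
    have h1 : P.valuation Ω (y : Ω) = P.intValuation y := P.valuation_of_algebraMap y
    rw [h1, P.intValuation_le_pow_iff_mem]
  refine le_antisymm ?_ ?_
  · obtain ⟨z, y, hy, e⟩ := h.exists_mem
    have h1 : α = (algebraMap K Ω ((1 + c * z : 𝓞 K) : K))⁻¹ * (y : Ω) := by
      rw [e, inv_mul_cancel_left₀ (one_add_mul_ne_zero hcu z)]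
    rw [h1, map_mul]
    refine (mul_le_of_le_one_left' (valuation_le_one_of_mem_semilocalRing hc
      (inv_mem_semilocalRing hcu z))).trans ((hval _ _).2 ?_)
    exact Ideal.dvd_iff_le.1 ((pow_dvd_iff_le_ord hI).2 le_rfl) hy
  · have h1 : ¬ I ≤ P.asIdeal ^ (ord P I + 1) := fun hle =>
      absurd ((pow_dvd_iff_le_ord hI).1 (Ideal.dvd_iff_le.2 hle)) (by omega)
    obtain ⟨y, hy, hyP⟩ := Set.not_subset.1 h1
    have hy0 : P.valuation Ω (y : Ω) ≠ 0 := fun h0 => hyP ((hval _ _).1 (by rw [h0]; exact zero_le))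
    have h2 : ¬ P.valuation Ω (y : Ω) ≤ WithZero.exp (-((ord P I + 1 : ℕ) : ℤ)) := fun h =>
      hyP ((hval _ _).1 h)
    obtain ⟨r, hr, e⟩ := h.dvdIn y hy
    have h3 : P.valuation Ω (y : Ω) ≤ P.valuation Ω α := by
      rw [e, map_mul]
      exact mul_le_of_le_one_right' (valuation_le_one_of_mem_semilocalRing hc hr)
    refine le_trans ?_ h3
    rw [← WithZero.exp_log hy0, WithZero.exp_le_exp] at h2 ⊢
    push_cast at h2
    omega

/-- The elementary divisors and the similitude at the prime `P` in terms of the triple of ideals of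
a double coset. -/
noncomputable def dataOf (σ : Ω ≃ₐ[K] Ω) (t : Ideal (𝓞 Ω) × Ideal (𝓞 Ω) × Ideal (𝓞 K)) :
    DivisorData 2 Ω := fun P =>
  (![ord P t.1, ord P t.1 + ord P t.2.1,
    ord P t.1 + ord P t.2.1 + ord P (t.2.2.map (algebraMap (𝓞 K) (𝓞 Ω))),
    ord P t.1 + ord P t.2.1 + ord P (t.2.2.map (algebraMap (𝓞 K) (𝓞 Ω))) +
      ord P (conjIdeal σ t.2.1)],
    ord P t.1 + ord P t.2.1 + ord P (t.2.2.map (algebraMap (𝓞 K) (𝓞 Ω))) +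
      ord P (conjIdeal σ t.1) + ord P (conjIdeal σ t.2.1))

theorem map_ne_zero' {I : Ideal (𝓞 K)} (hI : I ≠ 0) : I.map (algebraMap (𝓞 K) (𝓞 Ω)) ≠ 0 := by
  rw [Ne, Ideal.zero_eq_bot, Ideal.map_eq_bot_iff_of_injective
      (FaithfulSMul.algebraMap_injective _ _)]
  exact hI

theorem IsTriple.map_span_similitude (hσ : IsQuadraticConj σ) {C : HermitianCoset 2 σ}
    {t : Ideal (𝓞 Ω) × Ideal (𝓞 Ω) × Ideal (𝓞 K)} (h : IsTriple C t) :
    Ideal.span {algebraMap (𝓞 K) (𝓞 Ω) (HeckeAlgebra.similitude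
      (Quotient.out C : similitudeMonoid 2 σ))} =
      t.2.2.map (algebraMap (𝓞 K) (𝓞 Ω)) * (t.1 * t.2.1) *
        (conjIdeal σ t.1 * conjIdeal σ t.2.1) := by
  have h1 := congrArg (Ideal.map (algebraMap (𝓞 K) (𝓞 Ω))) h.similitude
  rw [cosetSimilitude, Ideal.map_span, Set.image_singleton, Ideal.map_mul,
    map_relNorm_eq_mul_conjIdeal hσ, conjIdeal_mul] at h1
  exact h1.trans (mul_assoc _ _ _).symm

/-- The data of a double coset are given by its triple: over the semilocal ring at `P` a
representative is equivalent to a diagonal matrix, whose entries generate the ideals in question. -/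
theorem divisorData_eq [IsPrincipalIdealRing (𝓞 K)] (hσ : IsQuadraticConj σ)
    (hΩ : NumberField.classNumber Ω = 2) {C : HermitianCoset 2 σ}
    {t : Ideal (𝓞 Ω) × Ideal (𝓞 Ω) × Ideal (𝓞 K)} (h : IsTriple C t) :
    divisorData C = dataOf σ t := by
  funext P
  have hv := h.isValid hσ hΩ
  have hA' : conjIdeal σ t.1 ≠ 0 := conjIdeal_ne_bot hσ hv.fst
  have hB' : conjIdeal σ t.2.1 ≠ 0 := conjIdeal_ne_bot hσ hv.snd
  have hD' := map_ne_zero' (Ω := Ω) hv.thd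
  have hAB := mul_ne_zero hv.fst hv.snd
  have hAB' := mul_ne_zero hA' hB'
  have hm := h.map_span_similitude hσ
  refine Prod.ext ?_ ?_
  · obtain ⟨c, hcu, hc0, hcP⟩ := exists_mem_asIdeal (K := K) P
    obtain ⟨α₁, α₂, ha1, ha2, ⟨h₁, hh₁, h₂, hh₂, e⟩, G1, G2⟩ :=
      exists_simDiag_generatesAt (g := (Quotient.out C : similitudeMonoid 2 σ)) hσ hcu hc0
    change GeneratesAt c (cosetEntries C) α₁ at G1
    change GeneratesAt c (cosetMinors C) (α₁ * α₂) at G2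
    rw [h.entries] at G1
    rw [h.minors] at G2
    -- the valuations of `α₁`, `α₁ α₂`, their conjugates, and the similitude
    have v1 := G1.valuation_eq hcP hv.fst
    have v2 := G2.valuation_eq hcP (mul_ne_zero (pow_ne_zero 2 hv.fst) hv.snd)
    have w1 := (G1.conj hσ).valuation_eq hcP hA'
    have w2 := (G2.conj hσ).valuation_eq hcP
      (conjIdeal_ne_bot hσ (mul_ne_zero (pow_ne_zero 2 hv.fst) hv.snd))
    have vm := (generatesAt_span c (algebraMap (𝓞 K) (𝓞 Ω)
        (similitude (Quotient.out C)))).valuation_eq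
      hcP (by rw [hm]; exact mul_ne_zero (mul_ne_zero hD' hAB) hAB')
    rw [pow_two, map_mul, v1, ord_mul (mul_ne_zero hv.fst hv.fst) hv.snd, ord_mul hv.fst hv.fst]
      at v2
    rw [pow_two, conjIdeal_mul, conjIdeal_mul, map_mul, map_mul, w1, ord_mul (mul_ne_zero hA' hA')
        hB',
      ord_mul hA' hA'] at w2
    rw [hm, ord_mul (mul_ne_zero hD' hAB) hAB', ord_mul hD' hAB, ord_mul hv.fst hv.snd,
      ord_mul hA' hB', coe_algebraMap_eq] at vm
    have hexp : ∀ {x : WithZero (Multiplicative ℤ)} {k l : ℤ}, WithZero.exp k * x = WithZero.exp l →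
        x = WithZero.exp (l - k) := by
      intro x k l hx
      rw [WithZero.exp_sub, ← hx, mul_div_cancel_left₀ _ WithZero.exp_ne_zero]
    have v2' := hexp v2
    have w2' := hexp w2
    have hX := fun (g : GL (Fin 2 ⊕ Fin 2) Ω) (hg : g ∈ approxGroup 2 σ c) i j =>
      valuation_le_one_of_mem_semilocalRing hcP (approxGroup_isSemilocal hg i j)
    have hM : (Quotient.out C : similitudeMonoid 2 σ).1.1 =
        (h₁⁻¹).1 * simDiag σ α₁ α₂ (similitude (Quotient.out C) : K) * (h₂⁻¹).1 := by
      rw [← e, ← Units.val_mul, ← Units.val_mul]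
      congr 1
      group
    -- in increasing order the diagonal entries are `α₁`, `α₂`, `m / σ α₂`, `m / σ α₁`: the last two
    -- positions are exchanged
    refine (hasElementaryDivisors_of_eq (X' := h₁.1) (Y' := h₂.1)
      (Equiv.sumCongr (Equiv.refl _) (Equiv.swap 0 1)) ?_ hM (by simp) (by simp)
      (hX _ (Subgroup.inv_mem _ hh₁)) (hX _ hh₁) (hX _ (Subgroup.inv_mem _ hh₂)) (hX _ hh₂)
      ?_).elementaryDivisors_eq
    · intro i j hij
      fin_cases i <;> fin_cases j <;> simp [dataOf] at hij ⊢ <;> omega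
    · rw [forall_idx]
      have f0 : finSumFinEquiv (Sum.inl 0 : Fin 2 ⊕ Fin 2) = (0 : Fin 4) := rfl
      have f1 : finSumFinEquiv (Sum.inl 1 : Fin 2 ⊕ Fin 2) = (1 : Fin 4) := rfl
      have f2 : finSumFinEquiv (Sum.inr 0 : Fin 2 ⊕ Fin 2) = (2 : Fin 4) := rfl
      have f3 : finSumFinEquiv (Sum.inr 1 : Fin 2 ⊕ Fin 2) = (3 : Fin 4) := rfl
      rw [f0, f1, f2, f3]
      simp only [Equiv.sumCongr_apply, Sum.map_inl, Sum.map_inr, Equiv.refl_apply,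
        Equiv.swap_apply_left, Equiv.swap_apply_right, Sum.elim_inl, Sum.elim_inr,
        Matrix.cons_val_zero, Matrix.cons_val_one, dataOf]
      refine ⟨v1, ?_, ?_, ?_⟩
      · rw [v2']; congr 1; push_cast; ring
      · rw [map_div₀, vm, w2', ← WithZero.exp_sub]
        congr 1
        simp only [Matrix.cons_val]
        push_cast; ring
      · rw [map_div₀, vm, w1, ← WithZero.exp_sub]
        congr 1
        simp only [Matrix.cons_val]
        push_cast; ring
  · change ord P _ = _
    rw [hm, ord_mul (mul_ne_zero hD' hAB) hAB', ord_mul hD' hAB, ord_mul hv.fst hv.snd,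
      ord_mul hA' hB']
    simp only [dataOf]
    ring

theorem dataOf_mul (hσ : IsQuadraticConj σ) {t t' : Ideal (𝓞 Ω) × Ideal (𝓞 Ω) × Ideal (𝓞 K)}
    (h1 : t.1 ≠ 0) (h2 : t.2.1 ≠ 0) (h3 : t.2.2 ≠ 0) (h1' : t'.1 ≠ 0) (h2' : t'.2.1 ≠ 0)
    (h3' : t'.2.2 ≠ 0) : dataOf σ (t * t') = dataOf σ t + dataOf σ t' := by
  funext P
  have hc : ∀ {I : Ideal (𝓞 Ω)}, I ≠ 0 → conjIdeal σ I ≠ 0 := fun h => conjIdeal_ne_bot hσ h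
  simp only [dataOf, Pi.add_apply, Prod.fst_mul, Prod.snd_mul, conjIdeal_mul, Ideal.map_mul,
    ord_mul h1 h1', ord_mul h2 h2', ord_mul (map_ne_zero' h3) (map_ne_zero' h3'),
    ord_mul (hc h1) (hc h1'), ord_mul (hc h2) (hc h2')]
  refine Prod.ext ?_ ?_
  · funext i
    fin_cases i <;> simp <;> omega
  · simp; omega

/-- The first three entries of the data at all primes determine the three ideals; an ideal of `𝓞 K`
is determined by its extension to `𝓞 Ω` since the relative norm of the extension is the square. -/
theorem dataOf_injective (hσ : IsQuadraticConj σ) {t t' : Ideal (𝓞 Ω) × Ideal (𝓞 Ω) × Ideal (𝓞 K)}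
    (ht : IsValid t) (ht' : IsValid t') (h : dataOf σ t = dataOf σ t') : t = t' := by
  have h0 : ∀ P, ord P t.1 = ord P t'.1 := fun P =>
    congrFun (congrArg Prod.fst (congrFun h P)) (0 : Fin 4)
  have h1 : ∀ P, ord P t.1 + ord P t.2.1 = ord P t'.1 + ord P t'.2.1 := fun P =>
    congrFun (congrArg Prod.fst (congrFun h P)) (1 : Fin 4)
  have h2 : ∀ P, ord P t.1 + ord P t.2.1 + ord P (t.2.2.map (algebraMap (𝓞 K) (𝓞 Ω))) =
      ord P t'.1 + ord P t'.2.1 + ord P (t'.2.2.map (algebraMap (𝓞 K) (𝓞 Ω))) := fun P =>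
    congrFun (congrArg Prod.fst (congrFun h P)) (2 : Fin 4)
  have e1 := eq_of_ord_eq ht.fst ht'.fst h0
  have e2 := eq_of_ord_eq ht.snd ht'.snd fun P => by have := h0 P; have := h1 P; omega
  have e3 := eq_of_ord_eq (map_ne_zero' ht.thd) (map_ne_zero' ht'.thd) fun P => by
    have := h1 P; have := h2 P; omega
  have e4 := congrArg (Ideal.relNorm (𝓞 K)) e3
  rw [relNorm_map_algebraMap hσ, relNorm_map_algebraMap hσ] at e4
  have e5 : t.2.2 = t'.2.2 := associated_iff_eq.1 (associated_of_dvd_dvd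
    ((UniqueFactorizationMonoid.pow_dvd_pow_iff_dvd two_ne_zero).1 e4.dvd)
    ((UniqueFactorizationMonoid.pow_dvd_pow_iff_dvd two_ne_zero).1 e4.symm.dvd))
  exact Prod.ext e1 (Prod.ext e2 e5)

end Data

/-! ### Decomposition of primes -/

section Primes

variable {K Ω : Type*} [Field K] [NumberField K] [Field Ω] [NumberField Ω] [Algebra K Ω]
  {σ : Ω ≃ₐ[K] Ω}

theorem conjIdeal_map (I : Ideal (𝓞 K)) : conjIdeal σ (I.map (algebraMap (𝓞 K) (𝓞 Ω))) =
    I.map (algebraMap (𝓞 K) (𝓞 Ω)) := by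
  refine (Ideal.map_map _ (conjInt σ : 𝓞 Ω →+* 𝓞 Ω)).trans ?_
  congr 1
  exact RingHom.ext fun x => (conjInt σ).commutes x

theorem map_algebraMap_one : (1 : Ideal (𝓞 K)).map (algebraMap (𝓞 K) (𝓞 Ω)) = 1 := by
  rw [Ideal.one_eq_top, Ideal.one_eq_top]
  exact Ideal.map_top _

theorem conjIdeal_one : conjIdeal σ 1 = 1 := by
  rw [Ideal.one_eq_top]
  exact Ideal.map_top _

/-- The conjugate of a prime. -/
noncomputable def conjPrime (hσ : IsQuadraticConj σ) (P : HeightOneSpectrum (𝓞 Ω)) :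
    HeightOneSpectrum (𝓞 Ω) :=
  ⟨conjIdeal σ P.asIdeal, Ideal.map_isPrime_of_equiv (conjInt σ), conjIdeal_ne_bot hσ P.ne_bot⟩

theorem conjPrime_conjPrime (hσ : IsQuadraticConj σ) (P : HeightOneSpectrum (𝓞 Ω)) :
    conjPrime hσ (conjPrime hσ P) = P := HeightOneSpectrum.ext (conjIdeal_conjIdeal hσ _)

theorem conjPrime_isPrincipal_iff (hσ : IsQuadraticConj σ) (P : HeightOneSpectrum (𝓞 Ω)) :
    (conjPrime hσ P).asIdeal.IsPrincipal ↔ P.asIdeal.IsPrincipal := by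
  have key : ∀ P : HeightOneSpectrum (𝓞 Ω), P.asIdeal.IsPrincipal →
      (conjPrime hσ P).asIdeal.IsPrincipal := by
    rintro P ⟨a, ha⟩
    change P.asIdeal = Ideal.span {a} at ha
    refine ⟨conjInt σ a, ?_⟩
    change conjIdeal σ P.asIdeal = Ideal.span {_}
    rw [ha, conjIdeal_span_singleton]
  exact ⟨fun h => conjPrime_conjPrime hσ P ▸ key _ h, key P⟩

/-- `P` lies over `p`. -/
def Above (P : HeightOneSpectrum (𝓞 Ω)) (p : HeightOneSpectrum (𝓞 K)) : Prop :=
  P.asIdeal ∣ p.asIdeal.map (algebraMap (𝓞 K) (𝓞 Ω))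

theorem exists_above_prime (P : HeightOneSpectrum (𝓞 Ω)) :
    ∃ p : HeightOneSpectrum (𝓞 K), Above P p := by
  obtain ⟨c, -, hc0, hc⟩ := exists_mem_asIdeal (K := K) P
  exact ⟨⟨P.asIdeal.comap (algebraMap (𝓞 K) (𝓞 Ω)), Ideal.comap_isPrime _ _, fun h => hc0
    ((Submodule.mem_bot _).1 (h.le hc))⟩, Ideal.dvd_iff_le.2 Ideal.map_comap_le⟩

theorem exists_prime_above (hσ : IsQuadraticConj σ) (p : HeightOneSpectrum (𝓞 K)) :
    ∃ P : HeightOneSpectrum (𝓞 Ω), Above P p := by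
  have h1 : p.asIdeal.map (algebraMap (𝓞 K) (𝓞 Ω)) ≠ ⊤ := fun h => by
    have h2 := relNorm_map_algebraMap hσ p.asIdeal
    rw [h, Ideal.relNorm_top, eq_comm, ← Ideal.one_eq_top] at h2
    exact p.prime.not_isUnit (isUnit_of_dvd_one (h2 ▸ dvd_pow_self _ two_ne_zero))
  obtain ⟨M, hM, hle⟩ := Ideal.exists_le_maximal _ h1
  refine ⟨⟨M, hM.isPrime, fun h => ?_⟩, Ideal.dvd_iff_le.2 hle⟩
  rw [h, le_bot_iff] at hle
  exact map_ne_zero' p.prime.ne_zero hle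

/-- The relative norm of a prime over `p` is `p²` or `p`, as it divides the relative norm `p²` of
the extension of `p`. -/
theorem Above.cases (hσ : IsQuadraticConj σ) {P : HeightOneSpectrum (𝓞 Ω)}
    {p : HeightOneSpectrum (𝓞 K)} (h : Above P p) : IsInert p P ∨
      p.asIdeal.map (algebraMap (𝓞 K) (𝓞 Ω)) = P.asIdeal * (conjPrime hσ P).asIdeal := by
  obtain ⟨X, hX⟩ := id h
  have h1 := congrArg (Ideal.relNorm (𝓞 K)) hX
  rw [relNorm_map_algebraMap hσ, map_mul] at h1
  obtain ⟨i, hi, ha⟩ := (dvd_prime_pow p.prime 2).1 (Dvd.intro _ h1.symm)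
  rw [associated_iff_eq] at ha
  interval_cases i
  · exact absurd (eq_top_of_relNorm_eq_one (ha.trans (pow_zero _))) P.prime.ne_one
  · right
    rw [pow_one] at ha
    rw [← ha]
    exact map_relNorm_eq_mul_conjIdeal hσ P.asIdeal
  · left
    rw [ha] at h1
    have h2 : Ideal.relNorm (𝓞 K) X = 1 :=
      mul_left_cancel₀ (pow_ne_zero 2 p.prime.ne_zero) (by rw [mul_one]; exact h1.symm)
    rw [eq_top_of_relNorm_eq_one h2, mul_one] at hX
    exact hX

theorem IsRamified.above {P : HeightOneSpectrum (𝓞 Ω)} {p : HeightOneSpectrum (𝓞 K)}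
    (h : IsRamified p P) : Above P p := Dvd.intro _ ((pow_two _).symm.trans h.symm)

theorem IsSplit.above {P P' : HeightOneSpectrum (𝓞 Ω)} {p : HeightOneSpectrum (𝓞 K)}
    (h : IsSplit p P P') : Above P p := Dvd.intro _ h.2.symm

theorem IsInert.conjPrime_eq (hσ : IsQuadraticConj σ) {P : HeightOneSpectrum (𝓞 Ω)}
    {p : HeightOneSpectrum (𝓞 K)} (h : IsInert p P) : conjPrime hσ P = P := by
  refine HeightOneSpectrum.ext ?_
  have h1 := conjIdeal_map (σ := σ) p.asIdeal
  rw [h] at h1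
  exact h1

theorem IsRamified.conjPrime_eq (hσ : IsQuadraticConj σ) {P : HeightOneSpectrum (𝓞 Ω)}
    {p : HeightOneSpectrum (𝓞 K)} (h : IsRamified p P) : conjPrime hσ P = P := by
  refine HeightOneSpectrum.ext ?_
  have h1 := conjIdeal_map (σ := σ) p.asIdeal
  rw [h, pow_two, conjIdeal_mul] at h1
  have h2 : (conjPrime hσ P).asIdeal ∣ P.asIdeal * P.asIdeal := Dvd.intro _ h1
  rcases (conjPrime hσ P).prime.dvd_or_dvd h2 with h3 | h3 <;>
  exact associated_iff_eq.1 (((conjPrime hσ P).prime.dvd_prime_iff_associated P.prime).1 h3)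

theorem IsSplit.conjPrime_eq (hσ : IsQuadraticConj σ) {P P' : HeightOneSpectrum (𝓞 Ω)}
    {p : HeightOneSpectrum (𝓞 K)} (h : IsSplit p P P') : conjPrime hσ P = P' := by
  rcases h.above.cases hσ with h1 | h1
  · have h2 : P.asIdeal * P'.asIdeal = P.asIdeal * 1 := by rw [← h.2, mul_one]; exact h1
    exact absurd (mul_left_cancel₀ P.prime.ne_zero h2) P'.prime.ne_one
  · refine HeightOneSpectrum.ext (mul_left_cancel₀ P.prime.ne_zero ?_)
    rw [← h1, h.2]

/-- A prime is inert, ramified or split, and in the last case its conjugate is different. -/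
theorem Above.trichotomy (hσ : IsQuadraticConj σ) {P : HeightOneSpectrum (𝓞 Ω)}
    {p : HeightOneSpectrum (𝓞 K)} (h : Above P p) : IsInert p P ∨ IsRamified p P ∨
      IsSplit p P (conjPrime hσ P) := by
  rcases h.cases hσ with h1 | h1
  · exact Or.inl h1
  · by_cases h2 : P = conjPrime hσ P
    · refine Or.inr (Or.inl ?_)
      rw [← h2, ← pow_two] at h1
      exact h1
    · exact Or.inr (Or.inr ⟨h2, h1⟩)

theorem IsInert.isPrincipal [IsPrincipalIdealRing (𝓞 K)] {P : HeightOneSpectrum (𝓞 Ω)}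
    {p : HeightOneSpectrum (𝓞 K)} (h : IsInert p P) : P.asIdeal.IsPrincipal := by
  obtain ⟨a, ha⟩ := (IsPrincipalIdealRing.principal p.asIdeal).principal
  change p.asIdeal = Ideal.span {a} at ha
  refine ⟨algebraMap (𝓞 K) (𝓞 Ω) a, ?_⟩
  unfold IsInert at h
  rw [← h, ha, Ideal.map_span, Set.image_singleton]

theorem Above.eq_or_eq {P Q : HeightOneSpectrum (𝓞 Ω)} (hσ : IsQuadraticConj σ)
    {p : HeightOneSpectrum (𝓞 K)} (hP : Above P p) (hQ : Above Q p) :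
    Q = P ∨ Q = conjPrime hσ P := by
  have hass : ∀ R : HeightOneSpectrum (𝓞 Ω), Q.asIdeal ∣ R.asIdeal → Q = R := fun R h =>
    HeightOneSpectrum.ext (associated_iff_eq.1 ((Q.prime.dvd_prime_iff_associated R.prime).1 h))
  unfold Above at hQ
  rcases hP.cases hσ with h | h
  · unfold IsInert at h
    rw [h] at hQ
    exact Or.inl (hass P hQ)
  · rw [h] at hQ
    exact (Q.prime.dvd_or_dvd hQ).imp (hass _) (hass _)

end Primes

/-! ### The list of atoms -/

section Atoms

variable {K Ω : Type*} [Field K] [NumberField K] [Field Ω] [NumberField Ω] [Algebra K Ω]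
  {σ : Ω ≃ₐ[K] Ω}

/-- The data of a triple with one prime component are concentrated at this prime and its
conjugate, which may coincide. -/
theorem dataOf_entries (hσ : IsQuadraticConj σ) (P : HeightOneSpectrum (𝓞 Ω)) :
    dataOf σ (P.asIdeal, 1, 1) =
      dataAt P ![1, 1, 1, 1] 1 + dataAt (conjPrime hσ P) ![0, 0, 0, 0] 1 := by
  classical
  funext Q
  have h := ord_prime Q (conjPrime hσ P)
  change ord Q (conjIdeal σ P.asIdeal) = _ at h
  simp only [dataOf, dataAt, Pi.add_apply, Pi.single_apply, conjIdeal_one, ord_one, ord_prime, h,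
    map_algebraMap_one]
  refine Prod.ext (funext fun i => ?_) ?_
  · fin_cases i <;> split_ifs <;> simp
  · split_ifs <;> simp

theorem dataOf_minors (hσ : IsQuadraticConj σ) (P : HeightOneSpectrum (𝓞 Ω)) :
    dataOf σ (1, P.asIdeal, 1) =
      dataAt P ![0, 1, 1, 1] 1 + dataAt (conjPrime hσ P) ![0, 0, 0, 1] 1 := by
  classical
  funext Q
  have h := ord_prime Q (conjPrime hσ P)
  change ord Q (conjIdeal σ P.asIdeal) = _ at h
  simp only [dataOf, dataAt, Pi.add_apply, Pi.single_apply, conjIdeal_one, ord_one, ord_prime, h,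
    map_algebraMap_one]
  refine Prod.ext (funext fun i => ?_) ?_
  · fin_cases i <;> split_ifs <;> simp
  · split_ifs <;> simp

theorem dataOf_scalar_inert {P : HeightOneSpectrum (𝓞 Ω)} {p : HeightOneSpectrum (𝓞 K)}
    (h : IsInert p P) : dataOf σ (1, 1, p.asIdeal) = dataAt P ![0, 0, 1, 1] 1 := by
  classical
  funext Q
  unfold IsInert at h
  simp only [dataOf, dataAt, Pi.single_apply, conjIdeal_one, ord_one, h, ord_prime]
  refine Prod.ext (funext fun i => ?_) ?_
  · fin_cases i <;> split_ifs <;> simp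
  · split_ifs <;> simp

theorem dataOf_scalar {P P' : HeightOneSpectrum (𝓞 Ω)} {p : HeightOneSpectrum (𝓞 K)}
    (h : p.asIdeal.map (algebraMap (𝓞 K) (𝓞 Ω)) = P.asIdeal * P'.asIdeal) :
    dataOf σ (1, 1, p.asIdeal) = dataAt P ![0, 0, 1, 1] 1 + dataAt P' ![0, 0, 1, 1] 1 := by
  classical
  funext Q
  simp only [dataOf, dataAt, Pi.add_apply, Pi.single_apply, conjIdeal_one, ord_one, h,
    ord_mul P.prime.ne_zero P'.prime.ne_zero, ord_prime]
  refine Prod.ext (funext fun i => ?_) ?_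
  · fin_cases i <;> split_ifs <;> simp
  · split_ifs <;> simp

theorem dataOf_minors_mul (hσ : IsQuadraticConj σ) (P Q : HeightOneSpectrum (𝓞 Ω)) :
    dataOf σ (1, P.asIdeal * Q.asIdeal, 1) =
      dataOf σ (1, P.asIdeal, 1) + dataOf σ (1, Q.asIdeal, 1) := by
  rw [← dataOf_mul hσ one_ne_zero P.prime.ne_zero one_ne_zero one_ne_zero Q.prime.ne_zero
    one_ne_zero]
  congr 1
  exact Prod.ext (one_mul _).symm (Prod.ext rfl (one_mul _).symm)

theorem dataAt_add (P : HeightOneSpectrum (𝓞 Ω)) (a b : Fin 4 → ℕ) (l k : ℕ) :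
    dataAt P a l + dataAt P b k = dataAt P (a + b) (l + k) := by
  classical
  unfold dataAt
  rw [← Pi.single_add]
  rfl

/-- The triples which are atoms of the monoid of triples. -/
inductive IsAtomic : Ideal (𝓞 Ω) × Ideal (𝓞 Ω) × Ideal (𝓞 K) → Prop
  | entries (P : HeightOneSpectrum (𝓞 Ω)) : IsAtomic (P.asIdeal, 1, 1)
  | scalar (p : HeightOneSpectrum (𝓞 K)) : IsAtomic (1, 1, p.asIdeal)
  | minors (P : HeightOneSpectrum (𝓞 Ω)) (hP : P.asIdeal.IsPrincipal) : IsAtomic (1, P.asIdeal, 1)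
  | minors_mul (P Q : HeightOneSpectrum (𝓞 Ω)) (hP : ¬ P.asIdeal.IsPrincipal)
      (hQ : ¬ Q.asIdeal.IsPrincipal) : IsAtomic (1, P.asIdeal * Q.asIdeal, 1)

theorem nonprincipalFactor_minors [IsPrincipalIdealRing (𝓞 K)] (hσ : IsQuadraticConj σ)
    {P : HeightOneSpectrum (𝓞 Ω)}
    {p : HeightOneSpectrum (𝓞 K)} (h : Above P p) (hP : ¬ P.asIdeal.IsPrincipal) :
    NonprincipalFactor p (dataOf σ (1, P.asIdeal, 1)) := by
  rw [dataOf_minors hσ]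
  rcases h.trichotomy hσ with h | h | h
  · exact absurd h.isPrincipal hP
  · rw [h.conjPrime_eq, dataAt_add]
    convert NonprincipalFactor.ramified P h hP using 2
    funext i; fin_cases i <;> rfl
  · convert NonprincipalFactor.split_three P _ h hP using 1
    unfold splitDataAt
    congr 2
    funext i; fin_cases i <;> rfl

/-- The factors of the products over two primes are the data of the triples `(1, P, 1)` with `P` not
principal, which do not belong to double cosets themselves. -/
theorem NonprincipalFactor.exists_prime (hσ : IsQuadraticConj σ) {p : HeightOneSpectrum (𝓞 K)}
    {d : DivisorData 2 Ω} (h : NonprincipalFactor p d) : ∃ P : HeightOneSpectrum (𝓞 Ω),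
      ¬ P.asIdeal.IsPrincipal ∧ Above P p ∧ d = dataOf σ (1, P.asIdeal, 1) := by
  cases h with
  | ramified P h hP =>
    refine ⟨P, hP, h.above, ?_⟩
    rw [dataOf_minors hσ, h.conjPrime_eq, dataAt_add]
    congr 1
    funext i; fin_cases i <;> rfl
  | split_one P P' h hP =>
    have e := h.conjPrime_eq hσ
    refine ⟨P', ?_, Dvd.intro_left _ h.2.symm, ?_⟩
    · rw [← e, conjPrime_isPrincipal_iff]; exact hP
    · rw [dataOf_minors hσ, ← e, conjPrime_conjPrime, add_comm]
      unfold splitDataAt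
      congr 2
      funext i; fin_cases i <;> rfl
  | split_three P P' h hP =>
    have e := h.conjPrime_eq hσ
    refine ⟨P, hP, h.above, ?_⟩
    rw [dataOf_minors hσ, e]
    unfold splitDataAt
    congr 2
    funext i; fin_cases i <;> rfl

/-- The data of an atomic triple occur in the list, by the decomposition of the primes involved. -/
theorem listed_of_isAtomic [IsPrincipalIdealRing (𝓞 K)] (hσ : IsQuadraticConj σ)
    {t : Ideal (𝓞 Ω) × Ideal (𝓞 Ω) × Ideal (𝓞 K)} (h : IsAtomic t) : Listed K (dataOf σ t) := by
  cases h with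
  | entries P =>
    obtain ⟨p, hp⟩ := exists_above_prime (K := K) P
    rw [dataOf_entries hσ]
    rcases hp.trichotomy hσ with h | h | h
    · rw [h.conjPrime_eq, dataAt_add]
      refine Listed.inert p P h _ _ (Or.inr (Or.inr ?_))
      refine Prod.ext (funext fun i => ?_) rfl
      fin_cases i <;> rfl
    · rw [h.conjPrime_eq, dataAt_add]
      refine Listed.ramified p P h _ (Or.inl ?_)
      funext i; fin_cases i <;> rfl
    · have e : dataAt P ![1, 1, 1, 1] 1 + dataAt (conjPrime hσ P) ![0, 0, 0, 0] 1 =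
          splitDataAt P (conjPrime hσ P) ![1, 1, 1, 1] 1 := by
        unfold splitDataAt
        congr 2
        funext i; fin_cases i <;> rfl
      rw [e]
      by_cases hP : P.asIdeal.IsPrincipal
      · exact Listed.split_principal p P _ h hP _ (by simp)
      · exact Listed.split_nonprincipal p P _ h hP _ (by simp)
  | scalar p =>
    obtain ⟨P, hp⟩ := exists_prime_above hσ p
    rcases hp.trichotomy hσ with h | h | h
    · rw [dataOf_scalar_inert h]
      exact Listed.inert p P h _ _ (Or.inl rfl)
    · rw [dataOf_scalar (h.trans (pow_two _)), dataAt_add]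
      refine Listed.ramified p P h _ (Or.inr ?_)
      funext i; fin_cases i <;> rfl
    · have e : dataAt P ![0, 0, 1, 1] 1 + dataAt (conjPrime hσ P) ![0, 0, 1, 1] 1 =
          splitDataAt P (conjPrime hσ P) ![0, 0, 1, 1] 1 := by
        unfold splitDataAt
        congr 2
        funext i; fin_cases i <;> rfl
      rw [dataOf_scalar h.2, e]
      by_cases hP : P.asIdeal.IsPrincipal
      · exact Listed.split_principal p P _ h hP _ (by simp)
      · exact Listed.split_nonprincipal p P _ h hP _ (by simp)
  | minors P hP =>
    obtain ⟨p, hp⟩ := exists_above_prime (K := K) P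
    rw [dataOf_minors hσ]
    rcases hp.trichotomy hσ with h | h | h
    · rw [h.conjPrime_eq, dataAt_add]
      refine Listed.inert p P h _ _ (Or.inr (Or.inl ?_))
      refine Prod.ext (funext fun i => ?_) rfl
      fin_cases i <;> rfl
    · rw [h.conjPrime_eq, dataAt_add]
      convert Listed.ramified_principal p P h hP using 2
      funext i; fin_cases i <;> rfl
    · have e : dataAt P ![0, 1, 1, 1] 1 + dataAt (conjPrime hσ P) ![0, 0, 0, 1] 1 =
          splitDataAt P (conjPrime hσ P) ![0, 1, 1, 1] 1 := by
        unfold splitDataAt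
        congr 2
        funext i; fin_cases i <;> rfl
      rw [e]
      exact Listed.split_principal p P _ h hP _ (by simp)
  | minors_mul P Q hP hQ =>
    obtain ⟨p, hp⟩ := exists_above_prime (K := K) P
    obtain ⟨q, hq⟩ := exists_above_prime (K := K) Q
    rw [dataOf_minors_mul hσ]
    by_cases hpq : p = q
    · subst hpq
      rw [dataOf_minors hσ, dataOf_minors hσ]
      rcases hp.trichotomy hσ with h | h | h
      · exact absurd h.isPrincipal hP
      · have e := h.conjPrime_eq hσ
        obtain rfl : Q = P := by
          rcases hp.eq_or_eq hσ hq with h1 | h1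
          · exact h1
          · exact h1.trans e
        rw [e, dataAt_add, dataAt_add]
        convert Listed.ramified_nonprincipal p Q h hP using 2
        funext i; fin_cases i <;> rfl
      · rcases hp.eq_or_eq hσ hq with rfl | rfl
        · have e : dataAt Q ![0, 1, 1, 1] 1 + dataAt (conjPrime hσ Q) ![0, 0, 0, 1] 1 +
              (dataAt Q ![0, 1, 1, 1] 1 + dataAt (conjPrime hσ Q) ![0, 0, 0, 1] 1) =
              splitDataAt Q (conjPrime hσ Q) ![0, 2, 2, 2] 2 := by
            unfold splitDataAt
            rw [add_add_add_comm, dataAt_add, dataAt_add]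
            congr 2 <;> funext i <;> fin_cases i <;> rfl
          rw [e]
          exact Listed.split_nonprincipal_sq p Q _ h hP _ (by simp)
        · have e : dataAt P ![0, 1, 1, 1] 1 + dataAt (conjPrime hσ P) ![0, 0, 0, 1] 1 +
              (dataAt (conjPrime hσ P) ![0, 1, 1, 1] 1 +
                dataAt (conjPrime hσ (conjPrime hσ P)) ![0, 0, 0, 1] 1) =
              splitDataAt P (conjPrime hσ P) ![0, 1, 1, 2] 2 := by
            unfold splitDataAt
            rw [conjPrime_conjPrime, add_comm (dataAt (conjPrime hσ P) ![0, 1, 1, 1] 1),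
              add_add_add_comm, dataAt_add, dataAt_add]
            congr 2 <;> funext i <;> fin_cases i <;> rfl
          rw [e]
          exact Listed.split_nonprincipal_sq p P _ h hP _ (by simp)
    · exact Listed.product p q hpq _ _ (nonprincipalFactor_minors hσ hp hP)
        (nonprincipalFactor_minors hσ hq hQ)

/-- All data in the list come from atomic triples. -/
theorem Listed.exists_isAtomic [IsPrincipalIdealRing (𝓞 K)] (hσ : IsQuadraticConj σ)
    {d : DivisorData 2 Ω} (h : Listed K d) :
    ∃ t : Ideal (𝓞 Ω) × Ideal (𝓞 Ω) × Ideal (𝓞 K), IsAtomic t ∧ dataOf σ t = d := by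
  -- data at the two primes over a split prime
  have hsplit : ∀ (p : HeightOneSpectrum (𝓞 K)) (P P' : HeightOneSpectrum (𝓞 Ω)), IsSplit p P P' →
      dataOf σ (P'.asIdeal, 1, (1 : Ideal (𝓞 K))) = splitDataAt P P' ![0, 0, 0, 0] 1 ∧
      dataOf σ (1, 1, p.asIdeal) = splitDataAt P P' ![0, 0, 1, 1] 1 ∧
      dataOf σ (P.asIdeal, 1, (1 : Ideal (𝓞 K))) = splitDataAt P P' ![1, 1, 1, 1] 1 ∧
      dataOf σ (1, P'.asIdeal, (1 : Ideal (𝓞 K))) = splitDataAt P P' ![0, 0, 0, 1] 1 ∧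
      dataOf σ (1, P.asIdeal, (1 : Ideal (𝓞 K))) = splitDataAt P P' ![0, 1, 1, 1] 1 := by
    intro p P P' h
    have e := h.conjPrime_eq hσ
    have e' : conjPrime hσ P' = P := by rw [← e, conjPrime_conjPrime]
    unfold splitDataAt
    refine ⟨?_, ?_, ?_, ?_, ?_⟩
    · rw [dataOf_entries hσ, e', add_comm]
      congr 2; funext i; fin_cases i <;> rfl
    · rw [dataOf_scalar h.2]
      congr 2; funext i; fin_cases i <;> rfl
    · rw [dataOf_entries hσ, e]
      congr 2; funext i; fin_cases i <;> rfl
    · rw [dataOf_minors hσ, e', add_comm]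
      congr 2; funext i; fin_cases i <;> rfl
    · rw [dataOf_minors hσ, e]
      congr 2; funext i; fin_cases i <;> rfl
  cases h with
  | inert p P h a l ha =>
    rcases ha with ha | ha | ha <;> obtain ⟨rfl, rfl⟩ := Prod.ext_iff.1 ha
    · exact ⟨_, IsAtomic.scalar p, dataOf_scalar_inert h⟩
    · refine ⟨_, IsAtomic.minors P h.isPrincipal, ?_⟩
      rw [dataOf_minors hσ, h.conjPrime_eq, dataAt_add]
      congr 1; funext i; fin_cases i <;> rfl
    · refine ⟨_, IsAtomic.entries P, ?_⟩
      rw [dataOf_entries hσ, h.conjPrime_eq, dataAt_add]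
      congr 1; funext i; fin_cases i <;> rfl
  | ramified p P h a ha =>
    rcases ha with rfl | rfl
    · refine ⟨_, IsAtomic.entries P, ?_⟩
      rw [dataOf_entries hσ, h.conjPrime_eq, dataAt_add]
      congr 1; funext i; fin_cases i <;> rfl
    · refine ⟨_, IsAtomic.scalar p, ?_⟩
      rw [dataOf_scalar (h.trans (pow_two _)), dataAt_add]
      congr 1; funext i; fin_cases i <;> rfl
  | ramified_principal p P h hP =>
    refine ⟨_, IsAtomic.minors P hP, ?_⟩
    rw [dataOf_minors hσ, h.conjPrime_eq, dataAt_add]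
    congr 1; funext i; fin_cases i <;> rfl
  | ramified_nonprincipal p P h hP =>
    refine ⟨_, IsAtomic.minors_mul P P hP hP, ?_⟩
    rw [dataOf_minors_mul hσ, dataOf_minors hσ, h.conjPrime_eq, dataAt_add, dataAt_add]
    congr 1; funext i; fin_cases i <;> rfl
  | split_principal p P P' h hP a ha =>
    have hP' : P'.asIdeal.IsPrincipal := by
      rw [← h.conjPrime_eq hσ, conjPrime_isPrincipal_iff]; exact hP
    obtain ⟨h1, h2, h3, h4, h5⟩ := hsplit p P P' h
    rcases ha with rfl | rfl | rfl | rfl | rfl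
    · exact ⟨_, IsAtomic.entries P', h1⟩
    · exact ⟨_, IsAtomic.minors P' hP', h4⟩
    · exact ⟨_, IsAtomic.scalar p, h2⟩
    · exact ⟨_, IsAtomic.minors P hP, h5⟩
    · exact ⟨_, IsAtomic.entries P, h3⟩
  | split_nonprincipal p P P' h hP a ha =>
    obtain ⟨h1, h2, h3, -, -⟩ := hsplit p P P' h
    rcases ha with rfl | rfl | rfl
    · exact ⟨_, IsAtomic.entries P', h1⟩
    · exact ⟨_, IsAtomic.scalar p, h2⟩
    · exact ⟨_, IsAtomic.entries P, h3⟩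
  | split_nonprincipal_sq p P P' h hP a ha =>
    have hP' : ¬ P'.asIdeal.IsPrincipal := by
      rw [← h.conjPrime_eq hσ, conjPrime_isPrincipal_iff]; exact hP
    obtain ⟨-, -, -, h4, h5⟩ := hsplit p P P' h
    unfold splitDataAt at h4 h5
    rcases ha with rfl | rfl | rfl
    · refine ⟨_, IsAtomic.minors_mul P P' hP hP', ?_⟩
      unfold splitDataAt
      rw [dataOf_minors_mul hσ, h4, h5, add_add_add_comm, dataAt_add, dataAt_add]
      congr 2 <;> funext i <;> fin_cases i <;> rfl
    · refine ⟨_, IsAtomic.minors_mul P P hP hP, ?_⟩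
      unfold splitDataAt
      rw [dataOf_minors_mul hσ, h5, add_add_add_comm, dataAt_add, dataAt_add]
      congr 2 <;> funext i <;> fin_cases i <;> rfl
    · refine ⟨_, IsAtomic.minors_mul P' P' hP' hP', ?_⟩
      unfold splitDataAt
      rw [dataOf_minors_mul hσ, h4, add_add_add_comm, dataAt_add, dataAt_add]
      congr 2 <;> funext i <;> fin_cases i <;> rfl
  | product p₁ p₂ hp d₁ d₂ h₁ h₂ =>
    obtain ⟨P, hP, -, rfl⟩ := h₁.exists_prime hσ
    obtain ⟨Q, hQ, -, rfl⟩ := h₂.exists_prime hσ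
    exact ⟨_, IsAtomic.minors_mul P Q hP hQ, dataOf_minors_mul hσ P Q⟩

end Atoms

/-! ### Indecomposable double cosets -/

section Indecomposable

variable {K Ω : Type*} [Field K] [NumberField K] [Field Ω] [NumberField Ω] [Algebra K Ω]
  {σ : Ω ≃ₐ[K] Ω}

theorem exists_prime_dvd {F : Type*} [Field F] [NumberField F] {I : Ideal (𝓞 F)} (hI : I ≠ 0)
    (hI1 : I ≠ 1) : ∃ P : HeightOneSpectrum (𝓞 F), P.asIdeal ∣ I := by
  obtain ⟨p, hp, hd⟩ := WfDvdMonoid.exists_irreducible_factor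
    (fun h => hI1 (isUnit_iff_eq_one.1 h)) hI
  exact ⟨⟨p, Ideal.isPrime_of_prime hp.prime, hp.prime.ne_zero⟩, hd⟩

theorem eq_one_of_one_eq_mul {R : Type*} [CommRing R] {I J : Ideal R} (h : 1 = I * J) :
    I = 1 ∧ J = 1 :=
  ⟨isUnit_iff_eq_one.1 (IsUnit.of_mul_eq_one _ h.symm),
    isUnit_iff_eq_one.1 (IsUnit.of_mul_eq_one_right _ h.symm)⟩

theorem eq_one_or_eq_one_of_prime_eq_mul {F : Type*} [Field F] [NumberField F]
    {P : HeightOneSpectrum (𝓞 F)} {I J : Ideal (𝓞 F)} (h : P.asIdeal = I * J) : I = 1 ∨ J = 1 :=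
  (P.prime.irreducible.isUnit_or_isUnit h).imp isUnit_iff_eq_one.1 isUnit_iff_eq_one.1

theorem isPrincipal_one : (1 : Ideal (𝓞 Ω)).IsPrincipal := by
  rw [Ideal.one_eq_top]
  exact top_isPrincipal

theorem isPrincipal_of_mul_isPrincipal {I J : Ideal (𝓞 Ω)} (hI0 : I ≠ 0) (hI : I.IsPrincipal)
    (h : (I * J).IsPrincipal) : J.IsPrincipal := by
  obtain ⟨a, ha⟩ := hI.principal
  change I = Ideal.span {a} at ha
  refine isPrincipal_of_mul_span (δ := a) ?_ (ha ▸ h)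
  rintro rfl
  exact hI0 (ha.trans (Ideal.span_singleton_eq_bot.2 rfl))

theorem isPrincipal_mul {I J : Ideal (𝓞 Ω)} (hI : I.IsPrincipal) (hJ : J.IsPrincipal) :
    (I * J).IsPrincipal := by
  obtain ⟨a, rfl⟩ := hI
  obtain ⟨b, rfl⟩ := hJ
  exact ⟨a * b, Ideal.span_singleton_mul_span_singleton a b⟩

theorem exists_nonprincipal_prime_dvd {I : Ideal (𝓞 Ω)} (hI0 : I ≠ 0) (hI : ¬ I.IsPrincipal) :
    ∃ P : HeightOneSpectrum (𝓞 Ω), ¬ P.asIdeal.IsPrincipal ∧ P.asIdeal ∣ I := by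
  revert hI0 hI
  refine UniqueFactorizationMonoid.induction_on_prime I (fun h => absurd rfl h) ?_ ?_
  · intro U hU _ h
    rw [isUnit_iff_eq_one.1 hU] at h
    exact absurd isPrincipal_one h
  · intro J p hJ hp ih _ h
    by_cases h1 : p.IsPrincipal
    · obtain ⟨P, hP, hd⟩ := ih hJ fun h2 => h (isPrincipal_mul h1 h2)
      exact ⟨P, hP, hd.mul_left p⟩
    · exact ⟨⟨p, Ideal.isPrime_of_prime hp, hp.ne_zero⟩, h1, Dvd.intro _ rfl⟩

theorem IsAtomic.isValid (hΩ : NumberField.classNumber Ω = 2)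
    {t : Ideal (𝓞 Ω) × Ideal (𝓞 Ω) × Ideal (𝓞 K)} (h : IsAtomic t) : IsValid t := by
  cases h with
  | entries P => exact ⟨P.prime.ne_zero, one_ne_zero, one_ne_zero, isPrincipal_one⟩
  | scalar p => exact ⟨one_ne_zero, one_ne_zero, p.prime.ne_zero, isPrincipal_one⟩
  | minors P hP => exact ⟨one_ne_zero, P.prime.ne_zero, one_ne_zero, hP⟩
  | minors_mul P Q hP hQ =>
    exact ⟨one_ne_zero, mul_ne_zero P.prime.ne_zero Q.prime.ne_zero, one_ne_zero,
      isPrincipal_mul_of_not hΩ P.ne_bot Q.ne_bot hP hQ⟩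

/-- A nontrivial triple has an atomic factor. If only nonprincipal primes divide its second
component, then at least two of them do, and the product of two is principal. -/
theorem IsValid.eq_one_or_exists_isAtomic (hΩ : NumberField.classNumber Ω = 2)
    {t : Ideal (𝓞 Ω) × Ideal (𝓞 Ω) × Ideal (𝓞 K)} (h : IsValid t) :
    t = 1 ∨ ∃ a u, IsAtomic a ∧ IsValid u ∧ t = a * u := by
  obtain ⟨A, B, D⟩ := t
  obtain ⟨hA, hB, hD, hp⟩ := h
  dsimp only at hA hB hD hp
  by_cases hA1 : A = 1
  swap
  · obtain ⟨P, X, rfl⟩ := exists_prime_dvd hA hA1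
    exact Or.inr ⟨_, (X, B, D), IsAtomic.entries P, ⟨right_ne_zero_of_mul hA, hB, hD, hp⟩, by
      simp only [Prod.mk_mul_mk, one_mul]⟩
  by_cases hD1 : D = 1
  swap
  · obtain ⟨P, X, rfl⟩ := exists_prime_dvd hD hD1
    exact Or.inr ⟨_, (A, B, X), IsAtomic.scalar P, ⟨hA, hB, right_ne_zero_of_mul hD, hp⟩, by
      simp only [Prod.mk_mul_mk, one_mul]⟩
  by_cases hB1 : B = 1
  · left; rw [hA1, hB1, hD1]; rfl
  right
  have key : ∀ Q : HeightOneSpectrum (𝓞 Ω), Q.asIdeal.IsPrincipal → Q.asIdeal ∣ B →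
      ∃ a u, IsAtomic a ∧ IsValid u ∧ (A, B, D) = a * u := by
    rintro Q hQ ⟨X, rfl⟩
    exact ⟨_, (A, X, D), IsAtomic.minors Q hQ, ⟨hA, right_ne_zero_of_mul hB, hD,
      isPrincipal_of_mul_isPrincipal Q.prime.ne_zero hQ hp⟩, by
      simp only [Prod.mk_mul_mk, one_mul]⟩
  obtain ⟨P, hP⟩ := exists_prime_dvd hB hB1
  by_cases hPp : P.asIdeal.IsPrincipal
  · exact key P hPp hP
  obtain ⟨X, rfl⟩ := hP
  have hX := right_ne_zero_of_mul hB
  have hX' : ¬ X.IsPrincipal := fun h' =>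
    hPp (isPrincipal_of_mul_isPrincipal hX h' (mul_comm P.asIdeal X ▸ hp))
  obtain ⟨Q, hQ, Y, rfl⟩ := exists_nonprincipal_prime_dvd hX hX'
  rw [← mul_assoc] at hp
  refine ⟨_, (A, Y, D), IsAtomic.minors_mul P Q hPp hQ, ⟨hA, right_ne_zero_of_mul hX, hD,
    isPrincipal_of_mul_isPrincipal (mul_ne_zero P.prime.ne_zero Q.prime.ne_zero)
      (isPrincipal_mul_of_not hΩ P.ne_bot Q.ne_bot hPp hQ) hp⟩, ?_⟩
  simp only [Prod.mk_mul_mk, one_mul, mul_assoc]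

theorem IsAtomic.ne_one {t : Ideal (𝓞 Ω) × Ideal (𝓞 Ω) × Ideal (𝓞 K)} (h : IsAtomic t) :
    t ≠ 1 := by
  intro e
  obtain ⟨e1, e2⟩ := Prod.ext_iff.1 e
  obtain ⟨e2, e3⟩ := Prod.ext_iff.1 e2
  cases h with
  | entries P => exact P.prime.ne_one e1
  | scalar p => exact p.prime.ne_one e3
  | minors P hP => exact P.prime.ne_one e2
  | minors_mul P Q hP hQ =>
    exact P.prime.not_isUnit (IsUnit.of_mul_eq_one _ e2)

/-- An atomic triple is not a product of two nontrivial valid triples: a product `PQ` of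
nonprincipal primes is not a product of two proper principal ideals. -/
theorem IsAtomic.eq_one_or_eq_one {t u v : Ideal (𝓞 Ω) × Ideal (𝓞 Ω) × Ideal (𝓞 K)}
    (h : IsAtomic t) (hu : IsValid u) (hv : IsValid v) (e : t = u * v) : u = 1 ∨ v = 1 := by
  obtain ⟨A, B, D⟩ := u
  obtain ⟨A', B', D'⟩ := v
  rw [Prod.mk_mul_mk, Prod.mk_mul_mk] at e
  cases h with
  | entries P =>
    simp only [Prod.mk.injEq] at e
    obtain ⟨rfl, rfl⟩ := eq_one_of_one_eq_mul e.2.1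
    obtain ⟨rfl, rfl⟩ := eq_one_of_one_eq_mul e.2.2
    exact (eq_one_or_eq_one_of_prime_eq_mul e.1).imp (by rintro rfl; rfl) (by rintro rfl; rfl)
  | scalar p =>
    simp only [Prod.mk.injEq] at e
    obtain ⟨rfl, rfl⟩ := eq_one_of_one_eq_mul e.1
    obtain ⟨rfl, rfl⟩ := eq_one_of_one_eq_mul e.2.1
    exact (eq_one_or_eq_one_of_prime_eq_mul e.2.2).imp (by rintro rfl; rfl) (by rintro rfl; rfl)
  | minors P hP =>
    simp only [Prod.mk.injEq] at e
    obtain ⟨rfl, rfl⟩ := eq_one_of_one_eq_mul e.1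
    obtain ⟨rfl, rfl⟩ := eq_one_of_one_eq_mul e.2.2
    exact (eq_one_or_eq_one_of_prime_eq_mul e.2.1).imp (by rintro rfl; rfl) (by rintro rfl; rfl)
  | minors_mul P Q hP hQ =>
    simp only [Prod.mk.injEq] at e
    obtain ⟨rfl, rfl⟩ := eq_one_of_one_eq_mul e.1
    obtain ⟨rfl, rfl⟩ := eq_one_of_one_eq_mul e.2.2
    have key : ∀ {B B' : Ideal (𝓞 Ω)}, B.IsPrincipal → P.asIdeal * Q.asIdeal = B * B' →
        P.asIdeal ∣ B → B' = 1 := by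
      rintro _ B' hB e ⟨X, rfl⟩
      rw [mul_assoc] at e
      rcases eq_one_or_eq_one_of_prime_eq_mul (mul_left_cancel₀ P.prime.ne_zero e) with rfl | h3
      · rw [mul_one] at hB
        exact absurd hB hP
      · exact h3
    rcases P.prime.dvd_or_dvd (Dvd.intro _ e.2.1) with h3 | h3
    · obtain rfl := key hu.principal e.2.1 h3
      exact Or.inr rfl
    · obtain rfl := key hv.principal (e.2.1.trans (mul_comm _ _)) h3
      exact Or.inl rfl

/-- Adding data corresponds to multiplying triples, since the triple is determined by the data. -/
theorem divisorData_eq_add_iff [IsPrincipalIdealRing (𝓞 K)] (hσ : IsQuadraticConj σ)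
    (hΩ : NumberField.classNumber Ω = 2) (C N₁ N₂ : HermitianCoset 2 σ) :
    divisorData C = divisorData N₁ + divisorData N₂ ↔
      triple hσ C = triple hσ N₁ * triple hσ N₂ := by
  have hC := isTriple_triple hσ C
  have h1 := isTriple_triple hσ N₁
  have h2 := isTriple_triple hσ N₂
  have v1 := h1.isValid hσ hΩ
  have v2 := h2.isValid hσ hΩ
  rw [divisorData_eq hσ hΩ hC, divisorData_eq hσ hΩ h1, divisorData_eq hσ hΩ h2,
    ← dataOf_mul hσ v1.fst v1.snd v1.thd v2.fst v2.snd v2.thd]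
  exact ⟨dataOf_injective hσ (hC.isValid hσ hΩ) (v1.mul v2), congrArg _⟩

/-- The indecomposable double cosets are those whose triples are atoms. -/
theorem indecomposable_iff [IsPrincipalIdealRing (𝓞 K)] (hσ : IsQuadraticConj σ)
    (hΩ : NumberField.classNumber Ω = 2) (C : HermitianCoset 2 σ) :
    Indecomposable C ↔ IsAtomic (triple hσ C) := by
  constructor
  · rintro ⟨hC, h⟩
    rcases ((isTriple_triple hσ C).isValid hσ hΩ).eq_one_or_exists_isAtomic hΩ with
      h1 | ⟨a, u, ha, hu, e⟩
    · exact absurd ((triple_eq_one hσ).1 h1) hC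
    · obtain ⟨N₁, rfl⟩ := (ha.isValid hΩ).exists_triple_eq hσ hΩ
      obtain ⟨N₂, rfl⟩ := hu.exists_triple_eq hσ hΩ
      rcases h N₁ N₂ ((divisorData_eq_add_iff hσ hΩ _ _ _).2 e) with rfl | rfl
      · exact absurd (triple_one hσ) ha.ne_one
      · rw [e, triple_one hσ, mul_one]
        exact ha
  · intro h
    refine ⟨fun h1 => h.ne_one ((triple_eq_one hσ).2 h1), fun N₁ N₂ e => ?_⟩
    rw [divisorData_eq_add_iff hσ hΩ] at e
    exact (h.eq_one_or_eq_one ((isTriple_triple hσ N₁).isValid hσ hΩ)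
      ((isTriple_triple hσ N₂).isValid hσ hΩ) e).imp (triple_eq_one hσ).1 (triple_eq_one hσ).1

theorem divisorData_bijOn [IsPrincipalIdealRing (𝓞 K)] (hσ : IsQuadraticConj σ)
    (hΩ : NumberField.classNumber Ω = 2) :
    Set.BijOn divisorData {C : HermitianCoset 2 σ | Indecomposable C}
      {d : DivisorData 2 Ω | Listed K d} := by
  have hd : ∀ C : HermitianCoset 2 σ, divisorData C = dataOf σ (triple hσ C) := fun C =>
    divisorData_eq hσ hΩ (isTriple_triple hσ C)
  refine ⟨fun C hC => ?_, fun C _ D _ h => ?_, fun d h => ?_⟩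
  · have h := (indecomposable_iff hσ hΩ C).1 hC
    change Listed K (divisorData C)
    rw [hd]
    exact listed_of_isAtomic hσ h
  · rw [hd, hd] at h
    exact triple_injective hσ (dataOf_injective hσ ((isTriple_triple hσ C).isValid hσ hΩ)
      ((isTriple_triple hσ D).isValid hσ hΩ) h)
  · obtain ⟨t, ht, rfl⟩ := Listed.exists_isAtomic hσ h
    obtain ⟨C, rfl⟩ := (ht.isValid hΩ).exists_triple_eq hσ hΩ
    exact ⟨C, (indecomposable_iff hσ hΩ C).2 ht, hd C⟩

end Indecomposable

/-! ### Degrees -/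

section Degrees

variable {K Ω : Type*} [Field K] [NumberField K] [Field Ω] [NumberField Ω] [Algebra K Ω]
  {σ : Ω ≃ₐ[K] Ω}

/-- The similitude of the double coset with the given triple. -/
noncomputable def degree (t : Ideal (𝓞 Ω) × Ideal (𝓞 Ω) × Ideal (𝓞 K)) : Ideal (𝓞 K) :=
  t.2.2 * Ideal.relNorm (𝓞 K) (t.1 * t.2.1)

theorem cosetSimilitude_eq_degree (hσ : IsQuadraticConj σ) (C : HermitianCoset 2 σ) :
    cosetSimilitude C = degree (triple hσ C) := (isTriple_triple hσ C).similitude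

theorem degree_mul (t u : Ideal (𝓞 Ω) × Ideal (𝓞 Ω) × Ideal (𝓞 K)) :
    degree (t * u) = degree t * degree u := by
  change t.2.2 * u.2.2 * Ideal.relNorm (𝓞 K) (t.1 * u.1 * (t.2.1 * u.2.1)) =
    t.2.2 * Ideal.relNorm (𝓞 K) (t.1 * t.2.1) * (u.2.2 * Ideal.relNorm (𝓞 K) (u.1 * u.2.1))
  rw [mul_mul_mul_comm t.1, map_mul, mul_mul_mul_comm]

theorem eq_one_of_degree_eq_one {t : Ideal (𝓞 Ω) × Ideal (𝓞 Ω) × Ideal (𝓞 K)}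
    (h : degree t = 1) : t = 1 := by
  obtain ⟨A, B, D⟩ := t
  obtain ⟨h1, h2⟩ := eq_one_of_one_eq_mul h.symm
  obtain ⟨h3, h4⟩ := eq_one_of_one_eq_mul (eq_top_of_relNorm_eq_one h2).symm
  dsimp only at h1 h3 h4
  rw [h1, h3, h4]
  rfl

/-- A nontrivial factor, with nontrivial cofactor, of a divisor of a product of two primes is
prime. -/
theorem prime_of_mul_dvd_mul {R : Type*} [CommRing R] [IsDedekindDomain R] {a b p q : Ideal R}
    (hp : Prime p) (hq : Prime q) (h : a * b ∣ p * q) (ha : a ≠ 1) (hb : b ≠ 1) : Prime a := by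
  have h0 : a * b ≠ 0 := ne_zero_of_dvd_ne_zero (mul_ne_zero hp.ne_zero hq.ne_zero) h
  obtain ⟨r, hr, a', rfl⟩ := WfDvdMonoid.exists_irreducible_factor
    (fun h => ha (isUnit_iff_eq_one.1 h)) (left_ne_zero_of_mul h0)
  obtain ⟨x, hx⟩ := h
  have key : ∀ {p q : Ideal R}, Prime p → Prime q → p * q = r * a' * b * x → r ∣ p →
      Prime (r * a') := by
    intro p q hp hq hx hrp
    obtain rfl : r = p := associated_iff_eq.1 ((hr.prime.dvd_prime_iff_associated hp).1 hrp)
    rw [mul_assoc, mul_assoc] at hx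
    rcases hq.irreducible.isUnit_or_isUnit (mul_left_cancel₀ hr.ne_zero hx) with h1 | h1
    · rw [isUnit_iff_eq_one.1 h1, mul_one]
      exact hr.prime
    · exact absurd (isUnit_iff_eq_one.1 (isUnit_of_mul_isUnit_left h1)) hb
  rcases hr.prime.dvd_or_dvd (Dvd.intro (a' * b * x) (by rw [hx]; ring) : r ∣ p * q) with h1 | h1
  · exact key hp hq hx h1
  · exact key hq hp ((mul_comm q p).trans hx) h1

/-- Triples with one prime component and two trivial ones. -/
inductive IsPrimeTriple : Ideal (𝓞 Ω) × Ideal (𝓞 Ω) × Ideal (𝓞 K) → Prop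
  | entries {A : Ideal (𝓞 Ω)} (h : Prime A) : IsPrimeTriple (A, 1, 1)
  | minors {B : Ideal (𝓞 Ω)} (h : Prime B) : IsPrimeTriple (1, B, 1)
  | scalar {D : Ideal (𝓞 K)} (h : Prime D) : IsPrimeTriple (1, 1, D)

/-- The relative norm of an ideal is trivial only for the trivial ideal, so that a triple of prime
degree has a single nontrivial component, which is prime. -/
theorem isPrimeTriple_of_prime_degree {t : Ideal (𝓞 Ω) × Ideal (𝓞 Ω) × Ideal (𝓞 K)}
    (h : Prime (degree t)) : IsPrimeTriple t := by
  have hprime : ∀ {A : Ideal (𝓞 Ω)}, Prime (Ideal.relNorm (𝓞 K) A) → Prime A := by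
    intro A hA
    refine Irreducible.prime ⟨fun h1 => hA.ne_one ?_, fun X Y e => ?_⟩
    · rw [isUnit_iff_eq_one.1 h1, map_one]
    · rw [e, map_mul] at hA
      exact (hA.irreducible.isUnit_or_isUnit rfl).imp
        (fun h => isUnit_iff_eq_one.2 (eq_top_of_relNorm_eq_one (isUnit_iff_eq_one.1 h)))
        (fun h => isUnit_iff_eq_one.2 (eq_top_of_relNorm_eq_one (isUnit_iff_eq_one.1 h)))
  obtain ⟨A, B, D⟩ := t
  change Prime (D * Ideal.relNorm (𝓞 K) (A * B)) at h
  rcases h.irreducible.isUnit_or_isUnit rfl with h1 | h1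
  · obtain rfl := isUnit_iff_eq_one.1 h1
    rw [one_mul] at h
    have h2 := hprime h
    rcases h2.irreducible.isUnit_or_isUnit rfl with h3 | h3
    · obtain rfl := isUnit_iff_eq_one.1 h3
      rw [one_mul] at h2
      exact .minors h2
    · obtain rfl := isUnit_iff_eq_one.1 h3
      rw [mul_one] at h2
      exact .entries h2
  · have h2 := isUnit_iff_eq_one.1 h1
    rw [h2, mul_one] at h
    obtain ⟨rfl, rfl⟩ := eq_one_of_one_eq_mul (eq_top_of_relNorm_eq_one h2).symm
    exact .scalar h

/-- Divisibility is componentwise, so prime triples behave like primes. -/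
theorem IsPrimeTriple.eq_of_dvd {t u : Ideal (𝓞 Ω) × Ideal (𝓞 Ω) × Ideal (𝓞 K)}
    (ht : IsPrimeTriple t) (hu : IsPrimeTriple u) (h : t ∣ u) : t = u := by
  rw [prod_dvd_iff, prod_dvd_iff] at h
  obtain ⟨h1, h2, h3⟩ := h
  cases ht with
  | entries ht =>
    cases hu with
    | entries hu => rw [associated_iff_eq.1 ((ht.dvd_prime_iff_associated hu).1 h1)]
    | minors hu => exact absurd (isUnit_of_dvd_one h1) ht.not_isUnit
    | scalar hu => exact absurd (isUnit_of_dvd_one h1) ht.not_isUnit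
  | minors ht =>
    cases hu with
    | entries hu => exact absurd (isUnit_of_dvd_one h2) ht.not_isUnit
    | minors hu => rw [associated_iff_eq.1 ((ht.dvd_prime_iff_associated hu).1 h2)]
    | scalar hu => exact absurd (isUnit_of_dvd_one h2) ht.not_isUnit
  | scalar ht =>
    cases hu with
    | entries hu => exact absurd (isUnit_of_dvd_one h3) ht.not_isUnit
    | minors hu => exact absurd (isUnit_of_dvd_one h3) ht.not_isUnit
    | scalar hu => rw [associated_iff_eq.1 ((ht.dvd_prime_iff_associated hu).1 h3)]

theorem IsPrimeTriple.dvd_or_dvd {t u v : Ideal (𝓞 Ω) × Ideal (𝓞 Ω) × Ideal (𝓞 K)}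
    (ht : IsPrimeTriple t) (h : t ∣ u * v) : t ∣ u ∨ t ∣ v := by
  simp only [prod_dvd_iff] at h ⊢
  obtain ⟨h1, h2, h3⟩ := h
  cases ht with
  | entries ht =>
    exact (ht.dvd_or_dvd h1).imp (fun h => ⟨h, one_dvd _, one_dvd _⟩)
      (fun h => ⟨h, one_dvd _, one_dvd _⟩)
  | minors ht =>
    exact (ht.dvd_or_dvd h2).imp (fun h => ⟨one_dvd _, h, one_dvd _⟩)
      (fun h => ⟨one_dvd _, h, one_dvd _⟩)
  | scalar ht =>
    exact (ht.dvd_or_dvd h3).imp (fun h => ⟨one_dvd _, one_dvd _, h⟩)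
      (fun h => ⟨one_dvd _, one_dvd _, h⟩)

theorem IsValid.mul_left_cancel {t u v : Ideal (𝓞 Ω) × Ideal (𝓞 Ω) × Ideal (𝓞 K)}
    (ht : IsValid t) (h : t * u = t * v) : u = v := by
  obtain ⟨h1, h2⟩ := Prod.ext_iff.1 h
  obtain ⟨h2, h3⟩ := Prod.ext_iff.1 h2
  exact Prod.ext (mul_left_cancel₀ ht.fst h1)
    (Prod.ext (mul_left_cancel₀ ht.snd h2) (mul_left_cancel₀ ht.thd h3))

/-- A product of two prime triples determines its factors. -/
theorem IsPrimeTriple.mul_unique {t u t' u' : Ideal (𝓞 Ω) × Ideal (𝓞 Ω) × Ideal (𝓞 K)}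
    (ht : IsPrimeTriple t) (ht' : IsPrimeTriple t')
    (hu' : IsPrimeTriple u') (hv : IsValid t) (h : t * u = t' * u') :
    (t = t' ∧ u = u') ∨ (t = u' ∧ u = t') := by
  rcases ht.dvd_or_dvd (Dvd.intro _ h) with h1 | h1
  · obtain rfl := ht.eq_of_dvd ht' h1
    exact Or.inl ⟨rfl, hv.mul_left_cancel h⟩
  · obtain rfl := ht.eq_of_dvd hu' h1
    exact Or.inr ⟨rfl, hv.mul_left_cancel (h.trans (mul_comm _ _))⟩

theorem relNorm_eq_of_not_isPrincipal [IsPrincipalIdealRing (𝓞 K)] (hσ : IsQuadraticConj σ)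
    {P : HeightOneSpectrum (𝓞 Ω)} {p : HeightOneSpectrum (𝓞 K)} (h : Above P p)
    (hP : ¬ P.asIdeal.IsPrincipal) : Ideal.relNorm (𝓞 K) P.asIdeal = p.asIdeal := by
  rcases h.cases hσ with h1 | h1
  · exact absurd h1.isPrincipal hP
  · have h2 := congrArg (Ideal.relNorm (𝓞 K)) h1
    rw [relNorm_map_algebraMap hσ, map_mul] at h2
    change _ = _ * Ideal.relNorm (𝓞 K) (conjIdeal σ P.asIdeal) at h2
    rw [relNorm_conjIdeal, ← pow_two] at h2
    have h3 := fun {I J : Ideal (𝓞 K)} (h : I ^ 2 = J ^ 2) =>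
      (UniqueFactorizationMonoid.pow_dvd_pow_iff_dvd two_ne_zero).1 h.dvd
    exact associated_iff_eq.1 (associated_of_dvd_dvd (h3 h2.symm) (h3 h2))

/-- The degree of an atomic triple has at most two prime factors. -/
theorem IsAtomic.exists_degree_dvd [IsPrincipalIdealRing (𝓞 K)] (hσ : IsQuadraticConj σ)
    {t : Ideal (𝓞 Ω) × Ideal (𝓞 Ω) × Ideal (𝓞 K)} (h : IsAtomic t) :
    ∃ p q : Ideal (𝓞 K), Prime p ∧ Prime q ∧ degree t ∣ p * q := by
  have key : ∀ P : HeightOneSpectrum (𝓞 Ω), ∃ p q : Ideal (𝓞 K), Prime p ∧ Prime q ∧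
      Ideal.relNorm (𝓞 K) P.asIdeal ∣ p * q := by
    intro P
    obtain ⟨p, X, hX⟩ := exists_above_prime (K := K) P
    refine ⟨p.asIdeal, p.asIdeal, p.prime, p.prime, ?_⟩
    rw [← pow_two, ← relNorm_map_algebraMap hσ, hX, map_mul]
    exact Dvd.intro _ rfl
  unfold degree
  cases h with
  | entries P =>
    rw [mul_one, one_mul]
    exact key P
  | scalar p =>
    rw [mul_one, map_one, mul_one]
    exact ⟨p.asIdeal, p.asIdeal, p.prime, p.prime, Dvd.intro _ rfl⟩
  | minors P hP =>
    rw [one_mul, one_mul]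
    exact key P
  | minors_mul P Q hP hQ =>
    obtain ⟨p, hp⟩ := exists_above_prime (K := K) P
    obtain ⟨q, hq⟩ := exists_above_prime (K := K) Q
    refine ⟨p.asIdeal, q.asIdeal, p.prime, q.prime, ?_⟩
    rw [one_mul, one_mul, map_mul, relNorm_eq_of_not_isPrincipal hσ hp hP,
      relNorm_eq_of_not_isPrincipal hσ hq hQ]

/-- There are nonprincipal primes over two different primes: an ideal in the nontrivial class
can be chosen coprime to a given one. -/
theorem exists_nonprincipal_primes (hΩ : NumberField.classNumber Ω = 2) :
    ∃ (P Q : HeightOneSpectrum (𝓞 Ω)) (p q : HeightOneSpectrum (𝓞 K)),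
      ¬ P.asIdeal.IsPrincipal ∧ ¬ Q.asIdeal.IsPrincipal ∧ Above P p ∧ Above Q q ∧ p ≠ q := by
  have h1 : ∃ I : Ideal (𝓞 Ω), I ≠ 0 ∧ ¬ I.IsPrincipal := by
    by_contra! h
    have h2 : NumberField.classNumber Ω = 1 := NumberField.classNumber_eq_one_iff.2 ⟨fun I => by
      by_cases hI : I = 0
      · rw [hI]; exact bot_isPrincipal
      · exact h I hI⟩
    omega
  obtain ⟨I, hI0, hI⟩ := h1
  obtain ⟨P, hP, -⟩ := exists_nonprincipal_prime_dvd hI0 hI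
  obtain ⟨p, hp⟩ := exists_above_prime (K := K) P
  have hp0 := map_ne_zero' (Ω := Ω) p.prime.ne_zero
  -- `a` generates `P` modulo `P p`, so that `(a) = P J` with `J` coprime to `p`
  obtain ⟨a, ha⟩ := exists_sup_span_eq
    (Ideal.mul_le_left : P.asIdeal * p.asIdeal.map (algebraMap (𝓞 K) (𝓞 Ω)) ≤ P.asIdeal)
    (mul_ne_zero P.prime.ne_zero hp0)
  have haP : Ideal.span {a} ≤ P.asIdeal := ha ▸ le_sup_right
  obtain ⟨J, hJ⟩ := Ideal.dvd_iff_le.2 haP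
  rw [hJ, ← Ideal.mul_sup] at ha
  have hcop : p.asIdeal.map (algebraMap (𝓞 K) (𝓞 Ω)) ⊔ J = 1 :=
    mul_left_cancel₀ P.prime.ne_zero (ha.trans (mul_one _).symm)
  have hQp : ∀ Q : HeightOneSpectrum (𝓞 Ω), Q.asIdeal ∣ J → ¬ Above Q p := fun Q h1 h2 =>
    Q.prime.not_isUnit (isUnit_of_dvd_one (hcop ▸
      Ideal.dvd_iff_le.2 (sup_le (Ideal.le_of_dvd h2) (Ideal.le_of_dvd h1))))
  have hJ0 : J ≠ 0 := fun h0 => hQp P (h0 ▸ dvd_zero _) hp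
  obtain ⟨Q, hQ, hQJ⟩ := exists_nonprincipal_prime_dvd hJ0 fun h =>
    hP (isPrincipal_of_mul_isPrincipal hJ0 h ⟨a, by rw [mul_comm, ← hJ]⟩)
  obtain ⟨q, hq⟩ := exists_above_prime (K := K) Q
  exact ⟨P, Q, p, q, hP, hQ, hp, hq, fun h => hQp Q hQJ (h ▸ hq)⟩

end Degrees

/-! ### Generators of the Hecke algebra -/

section Generators

variable {K Ω : Type*} [Field K] [NumberField K] [Field Ω] [NumberField Ω] [Algebra K Ω]
  {σ : Ω ≃ₐ[K] Ω}

theorem absNorm_pos_of_ne_zero {F : Type*} [Field F] [NumberField F] {I : Ideal (𝓞 F)}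
    (hI : I ≠ 0) : 0 < Ideal.absNorm I :=
  Nat.pos_of_ne_zero fun h => hI (Ideal.absNorm_eq_zero_iff.1 h)

theorem absNorm_le_absNorm {F : Type*} [Field F] [NumberField F] {I J : Ideal (𝓞 F)} (hI : I ≠ 0)
    (h : I ≤ J) : Ideal.absNorm J ≤ Ideal.absNorm I :=
  Nat.le_of_dvd (absNorm_pos_of_ne_zero hI) (Ideal.absNorm_dvd_absNorm_of_le h)

theorem eq_of_le_of_absNorm_le {F : Type*} [Field F] [NumberField F] {I J : Ideal (𝓞 F)}
    (hI : I ≠ 0) (h : I ≤ J) (h' : Ideal.absNorm I ≤ Ideal.absNorm J) : I = J := by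
  obtain ⟨X, rfl⟩ := Ideal.dvd_iff_le.2 h
  rw [map_mul] at h'
  have h1 := absNorm_pos_of_ne_zero (left_ne_zero_of_mul hI)
  have h2 := absNorm_pos_of_ne_zero (right_ne_zero_of_mul hI)
  have h3 : Ideal.absNorm X = 1 := by nlinarith
  obtain rfl : X = 1 := (Ideal.absNorm_eq_one_iff.1 h3).trans Ideal.one_eq_top.symm
  exact mul_one _

/-- The size of a double coset: among the double cosets in a product the leading one is
the smallest. -/
noncomputable def cosetSize (C : HermitianCoset 2 σ) : ℕ :=
  Ideal.absNorm (cosetEntries C) * Ideal.absNorm (cosetMinors C)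

/-- The ideals of entries and of minors of the other double cosets in a product are contained in
those of the leading one, and not both can be equal. -/
theorem cosetSize_leading_lt [IsPrincipalIdealRing (𝓞 K)] (hσ : IsQuadraticConj σ)
    (hΩ : NumberField.classNumber Ω = 2) {C D E : HermitianCoset 2 σ}
    (h : structureConstant C D E ≠ 0) (hE : E ≠ leading hσ hΩ C D) :
    cosetSize (leading hσ hΩ C D) < cosetSize E := by
  have hC := isTriple_triple hσ C
  have hD := isTriple_triple hσ D
  have hL := isTriple_triple hσ (leading hσ hΩ C D)
  rw [triple_leading] at hL
  obtain ⟨h1, h2, h3⟩ := le_of_structureConstant_ne_zero h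
  have e1 : cosetEntries (leading hσ hΩ C D) = cosetEntries C * cosetEntries D := by
    rw [hL.entries, hC.entries, hD.entries]; rfl
  have e2 : cosetMinors (leading hσ hΩ C D) = cosetMinors C * cosetMinors D := by
    rw [hL.minors, hC.minors, hD.minors]
    change (_ * _) ^ 2 * (_ * _) = _
    ring
  have e3 : cosetSimilitude (leading hσ hΩ C D) = cosetSimilitude C * cosetSimilitude D := by
    rw [cosetSimilitude_eq_degree hσ, cosetSimilitude_eq_degree hσ, cosetSimilitude_eq_degree hσ,
      triple_leading, degree_mul]
  rw [← e1] at h1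
  rw [← e2] at h2
  rw [← e3] at h3
  have n1 := absNorm_le_absNorm (cosetEntries_ne_bot E) h1
  have n2 := absNorm_le_absNorm (cosetMinors_ne_bot E) h2
  have p1 := absNorm_pos_of_ne_zero (cosetEntries_ne_bot E)
  have p2 := absNorm_pos_of_ne_zero (cosetMinors_ne_bot (leading hσ hΩ C D))
  refine lt_of_le_of_ne (Nat.mul_le_mul n1 n2) fun he => hE ?_
  unfold cosetSize at he
  have m1 : Ideal.absNorm (cosetEntries E) ≤ Ideal.absNorm (cosetEntries (leading hσ hΩ C D)) := by
    by_contra! hlt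
    nlinarith
  have m2 : Ideal.absNorm (cosetMinors E) ≤ Ideal.absNorm (cosetMinors (leading hσ hΩ C D)) := by
    by_contra! hlt
    nlinarith
  exact coset_ext hσ (eq_of_le_of_absNorm_le (cosetEntries_ne_bot E) h1 m1)
    (eq_of_le_of_absNorm_le (cosetMinors_ne_bot E) h2 m2) h3

theorem cosetSimilitude_leading [IsPrincipalIdealRing (𝓞 K)] (hσ : IsQuadraticConj σ)
    (hΩ : NumberField.classNumber Ω = 2) (C D : HermitianCoset 2 σ) :
    cosetSimilitude (leading hσ hΩ C D) = cosetSimilitude C * cosetSimilitude D := by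
  rw [cosetSimilitude_eq_degree hσ, cosetSimilitude_eq_degree hσ, cosetSimilitude_eq_degree hσ,
    triple_leading, degree_mul]

theorem eq_one_of_cosetSimilitude_eq_one [IsPrincipalIdealRing (𝓞 K)] (hσ : IsQuadraticConj σ)
    {C : HermitianCoset 2 σ} (h : cosetSimilitude C = 1) : C = 1 :=
  (triple_eq_one hσ).1 (eq_one_of_degree_eq_one ((cosetSimilitude_eq_degree hσ C).symm.trans h))

/-- The size is bounded in terms of the similitude: the norms of the ideals are `a · a² b`, and the
similitude has norm `d a b`. -/
theorem cosetSize_le [IsPrincipalIdealRing (𝓞 K)] (hσ : IsQuadraticConj σ)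
    (hΩ : NumberField.classNumber Ω = 2) (C : HermitianCoset 2 σ) :
    cosetSize C ≤ Ideal.absNorm (cosetSimilitude C) ^ 3 := by
  have hC := isTriple_triple hσ C
  have hv := hC.isValid hσ hΩ
  unfold cosetSize
  rw [hC.entries, hC.minors, hC.similitude, map_mul, map_mul, map_pow, Ideal.absNorm_relNorm,
    map_mul]
  have p1 := absNorm_pos_of_ne_zero hv.fst
  have p2 := absNorm_pos_of_ne_zero hv.snd
  have p3 := absNorm_pos_of_ne_zero hv.thd
  generalize Ideal.absNorm (triple hσ C).1 = a at *
  generalize Ideal.absNorm (triple hσ C).2.1 = b at *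
  generalize Ideal.absNorm (triple hσ C).2.2 = d at *
  calc a * (a ^ 2 * b) = 1 * (a ^ 3 * b ^ 1) := by ring
    _ ≤ d ^ 3 * (a ^ 3 * b ^ 3) := Nat.mul_le_mul (Nat.one_le_pow _ _ p3)
      (Nat.mul_le_mul_left _ (Nat.pow_le_pow_right p2 (by norm_num)))
    _ = (d * (a * b)) ^ 3 := by ring

/-- A double coset which is neither trivial nor indecomposable is the leading term of a product of
two double cosets whose similitudes have smaller norm. -/
theorem adjoin_indecomposable_eq_top [IsPrincipalIdealRing (𝓞 K)] (hσ : IsQuadraticConj σ)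
    (hΩ : NumberField.classNumber Ω = 2) :
    Algebra.adjoin ℤ (basisElement '' {C : HermitianCoset 2 σ | Indecomposable C}) = ⊤ := by
  refine adjoin_eq_top_of_leading (leading hσ hΩ) (fun C => Ideal.absNorm (cosetSimilitude C))
    cosetSize (fun k => k ^ 3) _ (structureConstant_leading hσ hΩ) (fun C D E h => ?_)
    (fun C D E h hE => cosetSize_leading_lt hσ hΩ h hE) (cosetSize_le hσ hΩ) fun C => ?_
  · rw [cosetSimilitude_leading, (le_of_structureConstant_ne_zero h).2.2]
  · rcases ((isTriple_triple hσ C).isValid hσ hΩ).eq_one_or_exists_isAtomic hΩ with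
      h1 | ⟨a, u, ha, hu, e⟩
    · exact Or.inl ((triple_eq_one hσ).1 h1)
    right
    obtain ⟨N₁, rfl⟩ := (ha.isValid hΩ).exists_triple_eq hσ hΩ
    obtain ⟨N₂, rfl⟩ := hu.exists_triple_eq hσ hΩ
    obtain rfl : C = leading hσ hΩ N₁ N₂ :=
      triple_injective hσ (e.trans (triple_leading hσ hΩ _ _).symm)
    have hN₁ : N₁ ≠ 1 := fun h => ha.ne_one ((triple_eq_one hσ).2 h)
    by_cases hN₂ : N₂ = 1
    · left
      rw [Set.mem_ofPred_eq, indecomposable_iff hσ hΩ, e, hN₂, triple_one hσ, mul_one]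
      exact ha
    right
    refine ⟨N₁, N₂, rfl, ?_⟩
    have hlt : ∀ N : HermitianCoset 2 σ, N ≠ 1 → 1 < Ideal.absNorm (cosetSimilitude N) := by
      intro N hN
      refine lt_of_le_of_ne (absNorm_pos_of_ne_zero (cosetSimilitude_ne_bot N)) fun h => hN ?_
      exact eq_one_of_cosetSimilitude_eq_one hσ
        ((Ideal.absNorm_eq_one_iff.1 h.symm).trans Ideal.one_eq_top.symm)
    have h1 := hlt N₁ hN₁
    have h2 := hlt N₂ hN₂
    rw [cosetSimilitude_leading, map_mul]
    constructor <;> nlinarith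

/-- An indecomposable double coset is not generated by other ones, as long as those of the same
similitude are indecomposable. -/
theorem Indecomposable.notMem_adjoin [IsPrincipalIdealRing (𝓞 K)] (hσ : IsQuadraticConj σ)
    (hΩ : NumberField.classNumber Ω = 2) {C₀ : HermitianCoset 2 σ} (h₀ : Indecomposable C₀)
    {T : Set (HermitianCoset 2 σ)} (hT₀ : C₀ ∉ T)
    (hT : ∀ C ∈ T, cosetSimilitude C = cosetSimilitude C₀ → Indecomposable C) :
    basisElement C₀ ∉ Algebra.adjoin ℤ (basisElement '' T) := by
  have hind : ∀ C : HermitianCoset 2 σ, Indecomposable C → ∀ N₁ N₂, N₁ ≠ 1 → N₂ ≠ 1 →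
      C ≠ leading hσ hΩ N₁ N₂ := by
    rintro _ h N₁ N₂ h1 h2 rfl
    have hN := (divisorData_eq_add_iff hσ hΩ _ _ _).2 (triple_leading hσ hΩ N₁ N₂)
    rcases h.2 N₁ N₂ hN with h | h
    · exact h1 h
    · exact h2 h
  obtain ⟨p, q, hp, hq, hpq⟩ := ((indecomposable_iff hσ hΩ C₀).1 h₀).exists_degree_dvd hσ
  rw [← cosetSimilitude_eq_degree hσ] at hpq
  -- the factors in a nontrivial product of this degree have prime degree
  have hprime : ∀ C D : HermitianCoset 2 σ, C ≠ 1 → D ≠ 1 →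
      cosetSimilitude C * cosetSimilitude D = cosetSimilitude C₀ → IsPrimeTriple (triple hσ C) := by
    intro C D hC hD h
    refine isPrimeTriple_of_prime_degree ?_
    rw [← cosetSimilitude_eq_degree hσ]
    exact prime_of_mul_dvd_mul hp hq (h ▸ hpq)
      (fun h => hC (eq_one_of_cosetSimilitude_eq_one hσ h))
      (fun h => hD (eq_one_of_cosetSimilitude_eq_one hσ h))
  refine notMem_adjoin_of_leading (structureConstant_symm hσ) (leading hσ hΩ) cosetSimilitude
    cosetSize (fun C D => triple_injective hσ ?_) (structureConstant_leading hσ hΩ)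
    (fun C D E h => (le_of_structureConstant_ne_zero h).2.2)
    (fun C D E h hE => cosetSize_leading_lt hσ hΩ h hE) (fun C D h => ?_) (fun C D h => ?_)
    C₀ h₀.1 T hT₀ (fun C hC h => hind C (hT C hC h)) (hind C₀ h₀) ?_
  · rw [triple_leading, triple_leading, mul_comm]
  · have h1 := cosetSimilitude_leading hσ hΩ C D
    rw [h, cosetSimilitude_eq_degree hσ 1, triple_one] at h1
    refine eq_one_of_cosetSimilitude_eq_one hσ (eq_one_of_one_eq_mul (h1.symm.trans ?_).symm).1
    exact (one_mul _).trans ((congrArg _ (one_mul _)).trans (map_one _))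
  · have h1 := (le_of_structureConstant_ne_zero h).2.2
    rw [cosetSimilitude_eq_degree hσ 1, triple_one] at h1
    refine eq_one_of_cosetSimilitude_eq_one hσ (eq_one_of_one_eq_mul (h1.symm.trans ?_).symm).1
    exact (one_mul _).trans ((congrArg _ (one_mul _)).trans (map_one _))
  · intro C D C' D' hC hD hC' hD' h1 h2 h
    have e := congrArg (triple hσ) h
    rw [triple_leading, triple_leading] at e
    exact ((hprime C D hC hD h1).mul_unique (hprime C' D' hC' hD' h2)
      (hprime D' C' hD' hC' ((mul_comm _ _).trans h2))
      ((isTriple_triple hσ C).isValid hσ hΩ) e).imp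
      (fun h => ⟨triple_injective hσ h.1, triple_injective hσ h.2⟩)
      (fun h => ⟨triple_injective hσ h.1, triple_injective hσ h.2⟩)

theorem minimal_indecomposable [IsPrincipalIdealRing (𝓞 K)] (hσ : IsQuadraticConj σ)
    (hΩ : NumberField.classNumber Ω = 2) :
    Minimal (fun S : Set (HermitianHecke 2 σ) => Algebra.adjoin ℤ S = ⊤)
      (basisElement '' {C : HermitianCoset 2 σ | Indecomposable C}) := by
  refine ⟨adjoin_indecomposable_eq_top hσ hΩ, fun S hS hle => ?_⟩
  rintro _ ⟨C₀, h₀, rfl⟩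
  by_contra hC₀
  refine h₀.notMem_adjoin hσ hΩ (T := {C | Indecomposable C} \ {C₀}) (fun h => h.2 rfl)
    (fun C hC _ => hC.1) ?_
  have h1 : S ⊆ basisElement '' ({C : HermitianCoset 2 σ | Indecomposable C} \ {C₀}) := by
    intro x hx
    obtain ⟨C, hC, rfl⟩ := hle hx
    exact ⟨C, ⟨hC, fun h => hC₀ (by rwa [← Set.mem_singleton_iff.1 h])⟩, rfl⟩
  refine Algebra.adjoin_mono h1 ?_
  rw [hS]
  exact Algebra.mem_top

/-- The double coset attached to the product of two nonprincipal primes over different primes of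
`K` is not generated by double cosets whose similitude is a prime power. -/
theorem iSup_primaryComponent_ne_top [IsPrincipalIdealRing (𝓞 K)] (hσ : IsQuadraticConj σ)
    (hΩ : NumberField.classNumber Ω = 2) :
    (⨆ p : HeightOneSpectrum (𝓞 K), primaryComponent 2 σ p) ≠ ⊤ := by
  intro htop
  obtain ⟨P, Q, p, q, hP, hQ, hp, hq, hpq⟩ := exists_nonprincipal_primes (K := K) hΩ
  have ha : IsAtomic (1, P.asIdeal * Q.asIdeal, (1 : Ideal (𝓞 K))) := .minors_mul P Q hP hQ
  obtain ⟨C₀, h₀⟩ := (ha.isValid hΩ).exists_triple_eq hσ hΩ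
  have hdeg : cosetSimilitude C₀ = p.asIdeal * q.asIdeal := by
    rw [cosetSimilitude_eq_degree hσ, h₀]
    change 1 * Ideal.relNorm (𝓞 K) (1 * (P.asIdeal * Q.asIdeal)) = _
    rw [one_mul, one_mul, map_mul, relNorm_eq_of_not_isPrincipal hσ hp hP,
      relNorm_eq_of_not_isPrincipal hσ hq hQ]
  let T : Set (HermitianCoset 2 σ) := {C | ∃ (r : HeightOneSpectrum (𝓞 K)) (k : ℕ),
    cosetSimilitude C = r.asIdeal ^ k}
  have hne : ∀ C ∈ T, cosetSimilitude C ≠ cosetSimilitude C₀ := by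
    rintro C ⟨r, k, h⟩ h'
    rw [h', hdeg] at h
    have h1 : ∀ {s : HeightOneSpectrum (𝓞 K)}, s.asIdeal ∣ p.asIdeal * q.asIdeal → s = r :=
      fun {s} hs => HeightOneSpectrum.ext (associated_iff_eq.1
        ((s.prime.dvd_prime_iff_associated r.prime).1 (s.prime.dvd_of_dvd_pow (h ▸ hs))))
    exact hpq ((h1 (Dvd.intro _ rfl)).trans (h1 (Dvd.intro_left _ rfl)).symm)
  refine ((indecomposable_iff hσ hΩ C₀).2 (h₀ ▸ ha)).notMem_adjoin hσ hΩ (T := T)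
    (fun h => hne C₀ h rfl) (fun C hC h => absurd h (hne C hC)) ?_
  have h1 : (⨆ p : HeightOneSpectrum (𝓞 K), primaryComponent 2 σ p) ≤
      Algebra.adjoin ℤ (basisElement '' T) :=
    iSup_le fun r => Algebra.adjoin_mono (Set.image_mono fun C ⟨k, hk⟩ => ⟨r, k, hk⟩)
  refine h1 ?_
  rw [htop]
  exact Algebra.mem_top

end Generators

end HeckeAlgebra

theorem mainTheorem7 {K Ω : Type*} [Field K] [NumberField K] [Field Ω] [NumberField Ω]
    [Algebra K Ω] (hdeg : Module.finrank K Ω = 2)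
    (hK : NumberField.classNumber K = 1) (hΩ : NumberField.classNumber Ω = 2)
    (σ : Ω ≃ₐ[K] Ω) (hσ : σ ≠ 1) :
    Set.BijOn HeckeAlgebra.divisorData
      {C : HeckeAlgebra.HermitianCoset 2 σ | HeckeAlgebra.Indecomposable C}
      {d : HeckeAlgebra.DivisorData 2 Ω | HeckeAlgebra.Listed K d} ∧
    Minimal (fun S : Set (HeckeAlgebra.HermitianHecke 2 σ) => Algebra.adjoin ℤ S = ⊤)
      (HeckeAlgebra.basisElement ''
        {C : HeckeAlgebra.HermitianCoset 2 σ | HeckeAlgebra.Indecomposable C}) ∧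
    (⨆ p : IsDedekindDomain.HeightOneSpectrum (NumberField.RingOfIntegers K),
      HeckeAlgebra.primaryComponent 2 σ p) ≠ ⊤ := by
  have : IsPrincipalIdealRing (NumberField.RingOfIntegers K) :=
    NumberField.classNumber_eq_one_iff.1 hK
  have hσ' : HeckeAlgebra.IsQuadraticConj σ := ⟨hdeg, hσ⟩
  exact ⟨HeckeAlgebra.divisorData_bijOn hσ' hΩ, HeckeAlgebra.minimal_indecomposable hσ' hΩ,
    HeckeAlgebra.iSup_primaryComponent_ne_top hσ' hΩ⟩
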